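/- Let $n\ge 4$ and let $\lambda=\sum_{i=1}^n m_i\lambda_i$ ($m_i\in\mathbb Z_{\ge0}$) be a dominant integral weight of $D_n$. Put $l_j=m_j+\dots+m_{n-2}+\frac{m_{n-1}+m_n}{2}$ for $j<n$ and $l_n=\frac{m_n-m_{n-1}}2$. Write $\lambda=\omega_{i_1}+\dots+\omega_{i_t}$, plus one more $\lambda_n$ (if $l_n>0$) or $\lambda_{n-1}$ (if $l_n<0$) when $l_n\notin\mathbb Z$, where $\omega_i=\lambda_i$ ($i\le n-2$), $\omega_{n-1}=\lambda_{n-1}+\lambda_n$, $\omega_n=2\lambda_n$ and $\omega_{n+1}=2\lambda_{n-1}$; here $i_1\le\dots\le i_t$, and $\omega_n$ (resp. $\omega_{n+1}$) is used only if $l_n>0$ (resp. $l_n<0$). The height of $\omega_i$ is $\min(i,n)$. **Young walls.** Proper and reduced proper Young walls of type $D_n^{(1)}$ are built on the ground-state wall $Y_\Lambda$ of a level-one weight $\Lambda\in\{\Lambda_0,\Lambda_1,\Lambda_{n-1},\Lambda_n\}$, with rows coloured periodically $[0|1],2,\dots,n-2,[n-1|n],n-2,\dots,2$ (the brackets denote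 rows of two blocks of half-unit thickness, whose front colours alternate from column to column; all other blocks are of unit thickness). The ground-state wall has one front block in each column of the ground row, which is $[0|1]$ for $\Lambda_0,\Lambda_1$ and $[n-1|n]$ for $\Lambda_{n-1},\Lambda_n$; the right-most one has colour $1,0,n,n-1$ for $\Lambda_0,\Lambda_1,\Lambda_{n-1},\Lambda_n$ respectively. In a wall there is no free space to the right of a block (except in the right-most column). It is proper if no two full columns (columns with top of unit thickness) have equal height, and reduced if moreover no $\delta$-column ($2n-4$ units of height) can be removed from the top of a column leaving a proper wall. The operators $\tilde e_i,\tilde f_i$ are given by the $i$-signature: every $i$-removable column contributes $-$, every $i$-admissible column $+$, read from left to right; all $(+,-)$-pairs are cancelled; $\tilde e_i$ removes the $i$-block at the right-most $-$ and $\tilde f_i$ adds one at the left-most $+$; $\varepsilon_i,\varphi_i$ count the remaining $-$ and $+$, and $\mathrm{wt}(Y)=\Lambda-\sum_jk_j\alpha_j$ where $k_j$ is the number of added $j$-blocks, regarded as a weight of $D_n$ through its values on $h_1,\dots,h_n$. Reading from the right, the columns of a wall for $\lambda$ are divided into $t$ blocks of columns, as many in the $k$-th as the height of $\omega_{i_k}$,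 followed by $n$ columns if there is a half-spin summand. A column in a block represents a letter through its top: a single half-thickness block $0,1,n-1,n$ gives $1,\bar 1,n,\bar n$; $[0|1]$ gives $2$; a block $j-1$ on the increasing part of the pattern gives $j$ ($3\le j\le n-1$); $[n-1|n]$ gives $\overline{n-1}$; a block $j$ on the decreasing part gives $\bar j$ ($2\le j\le n-2$). The highest weight wall $H_\lambda$ is the one in which the columns of the $k$-th block represent, from right to left, $i_k,i_k-1,\dots,1$ (with $\bar n,n-1,\dots,1$ for $\omega_{n+1}$), the letter $1$ standing on $t-k$ times $\delta$ (and half a $\delta$ more if there is a half-spin summand), all other columns being those of $Y_\Lambda$. Here $\Lambda$ is the level-one weight whose ground colours fit: if there is a half-spin summand, the right-most of its $n$ columns has ground colour $n-1$ for $\lambda_n$ and $n$ for $\lambda_{n-1}$; otherwise the left-most column of the last block has ground colour $0$ (for $\lambda=0$, take $\Lambda=\Lambda_0$). Then $Y(\lambda)$ is the connected component of $H_\lambda$ in the crystal graph of reduced proper Young walls on $Y_\Lambda$ with the $0$-arrows removed. **Tableaux.** $T(\lambda)$ is the set of bottom-justified tableaux with full columns whose heights, from left to right, are those of $\omega_{i_1},\dots,\omega_{i_t}$,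 followed on the right by a half-column of height $n$ if there is a half-spin summand, with entries $a,\bar a$ ($1\le a\le n$), ordered by $1\prec\dots\prec n-1\prec n,\bar n\prec\overline{n-1}\prec\dots\prec\bar1$ ($n$ and $\bar n$ incomparable), such that (rows are numbered from bottom to top, starting with $1$): 1. entries weakly increase along rows; 2. entries strictly increase down columns, except that $\bar n$ may stand directly below $n$ and $n$ directly below $\bar n$; moreover, in a full or half column of height $n$, the entry $n$ occurs only in odd rows and $\bar n$ only in even rows if $l_n>0$, and the other way round if $l_n<0$; 3. a half-column does not contain both $a$ and $\bar a$; 4. (1CC) if $a$ and $\bar a$ lie in rows $p>q$ of a column of height $N$, then $p-q-1\ge N-a$; 5. for adjacent columns $C$ (left), $C'$ (right): (2CC-1) if $a$ lies in row $p$ of $C$ and $\bar a$ in row $q$ of $C'$ with $p>q$, then $p-q\le n-a$; for $a=n$ the same holds with $n$ and $\bar n$ exchanged (so neither $n,\bar n$ nor $\bar n,n$ can occur in this way); (2CC-2) if $a$ lies in row $p$ of $C$ and $\bar a$ in row $q$ of $C'$, and $b,\bar b$ lie in rows $r>s$ of one of $C,C'$ with $p\ge r>s\ge q$, then $(p-r)+(s-q)<b-a$;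 (2CC-3) if $1\le a<n$, $p\ge q>r\ge s$, $C$ has $a$ in row $p$ and $x$ in row $r$, $C'$ has $y$ in row $q$ and $\bar a$ in row $s$, and either $q-r+1$ is odd and $(y,x)\in\{(n,\bar n),(\bar n,n)\}$ ($a$-odd-configuration) or $q-r+1$ is even and $(y,x)\in\{(n,n),(\bar n,\bar n)\}$ ($a$-even-configuration), then $p-s<n-a$. The crystal structure on tableaux is given by the tensor product rule (the same signature rule), reading columns from right to left and each from top to bottom, a half-column being one element of a spin crystal and every other box an element of the crystal of the vector representation. **The map.** For $Y\in Y(\lambda)$ the $k$-th column of $T_Y$ consists, from bottom to top, of the letters represented by the columns of the $k$-th block of $Y$ from right to left. In the half-column, each of the last $n$ columns of $Y$ with added blocks gives its letter, the first of them (from the right) without added block gives $\bar n$ if its ground block has colour $n$, and for every $j$ such that $\bar j$ does not occur the entry $j$ occurs; the entries are put in increasing order. **Theorem.** The map $\varphi:Y(\lambda)\to T(\lambda)$, $Y\mapsto T_Y$, is an isomorphism of $U_q(D_n)$-crystals: $Y(\lambda)$ and $T(\lambda)$ are stable under $\tilde e_i,\tilde f_i$ ($1\le i\le n$), and $\varphi$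 is a bijection that preserves $\mathrm{wt}$, $\varepsilon_i$, $\varphi_i$ and commutes with all $\tilde e_i,\tilde f_i$ ($1\le i\le n$). -/

import Mathlib

/-!
Young walls and reverse-shape tableaux for type `D_n` (`n ≥ 4`).

Conventions: colours are natural numbers; the affine index set is `{0, 1, …, n}` and the classical
one is `{1, …, n}`.  Columns of a wall are numbered `0, 1, 2, …` from right to left, rows of a wall
are numbered `0, 1, 2, …` from bottom to top.  The columns of a tableau are listed from left to
right and the entries of a column are listed from bottom to top.
-/

namespace CrystalD

/-! ### Signatures and crystal data -/

/-- The two signs occurring in a signature. -/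
inductive Sign where
  | minus
  | plus
  deriving DecidableEq

/-- One step of the cancellation of `(+,-)`-pairs.  The list `st` is the part treated so far, last
sign first. -/
def cancelStep {α : Type} (st : List (Sign × α)) (s : Sign × α) : List (Sign × α) :=
  match s, st with
  | (Sign.minus, _), (Sign.plus, _) :: rest => rest
  | s, st => s :: st

/-- The signature: what remains of a sequence of signs (each tagged with a position) after all
`(+,-)`-pairs have been cancelled; it has the form `-,…,-,+,…,+`. -/
def signature {α : Type} (w : List (Sign × α)) : List (Sign × α) :=
  (w.foldl cancelStep []).reverse

/-- Position of the left-most `+` of the signature, if any. -/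
def leftmostPlus {α : Type} (w : List (Sign × α)) : Option α :=
  ((signature w).find? (fun s => decide (s.1 = Sign.plus))).map Prod.snd

/-- Position of the right-most `-` of the signature, if any. -/
def rightmostMinus {α : Type} (w : List (Sign × α)) : Option α :=
  ((signature w).reverse.find? (fun s => decide (s.1 = Sign.minus))).map Prod.snd

/-- Number of `-` in the signature. -/
def countMinus {α : Type} (w : List (Sign × α)) : ℕ :=
  (signature w).countP (fun s => decide (s.1 = Sign.minus))

/-- Number of `+` in the signature. -/
def countPlus {α : Type} (w : List (Sign × α)) : ℕ :=
  (signature w).countP (fun s => decide (s.1 = Sign.plus))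

/-- The data of a crystal: weight (`wt b i` is the value of the weight of `b` on the coroot `h_i`),
the functions `ε_i`, `φ_i` and the Kashiwara operators, `none` standing for `0`. -/
structure CrystalData (B : Type) where
  wt : B → ℕ → ℤ
  eps : ℕ → B → ℕ
  phi : ℕ → B → ℕ
  e : ℕ → B → Option B
  f : ℕ → B → Option B

/-- `S` is stable under the Kashiwara operators of colours `1, …, n`. -/
def CrystalData.IsStable {B : Type} (A : CrystalData B) (n : ℕ) (S : Set B) : Prop :=
  ∀ b ∈ S, ∀ i, 1 ≤ i → i ≤ n → ∀ b', (A.e i b = some b' ∨ A.f i b = some b') → b' ∈ S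

/-- `g` is an isomorphism of `U_q(D_n)`-crystals from `S` (with the crystal structure of `A`) onto
`S'` (with the crystal structure of `A'`): both sets are stable under the Kashiwara operators, `g`
is a bijection from `S` to `S'`, and it preserves `wt`, `ε_i`, `φ_i` and commutes with `ẽ_i`,
`f̃_i` for `i = 1, …, n` (the value `0` being sent to `0`). -/
def IsCrystalIso {B B' : Type} (n : ℕ) (A : CrystalData B) (S : Set B)
    (A' : CrystalData B') (S' : Set B') (g : B → B') : Prop :=
  A.IsStable n S ∧ A'.IsStable n S' ∧ Set.BijOn g S S' ∧
    ∀ b ∈ S, ∀ i, 1 ≤ i → i ≤ n →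
      A'.wt (g b) i = A.wt b i ∧ A'.eps i (g b) = A.eps i b ∧ A'.phi i (g b) = A.phi i b ∧
        A'.e i (g b) = (A.e i b).map g ∧ A'.f i (g b) = (A.f i b).map g

/-! ### Dominant integral weights of `D_n`

A dominant integral weight `λ = ∑ i ∈ {1,…,n}, m i • λ_i` is given by its coefficients `m`. In terms
of the orthonormal basis it is `∑ j, l j • ε_j` with `l j = m j + … + m (n-2) + (m (n-1) + m n) / 2`
for `j < n` and `l n = (m n - m (n-1)) / 2`. -/

/-- `|m n - m (n-1)|`, i.e. `2 |l n|`. -/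
def spinDiff (n : ℕ) (m : ℕ → ℕ) : ℕ := max (m (n - 1)) (m n) - min (m (n - 1)) (m n)

/-- Heights `i_1 ≤ … ≤ i_t` of the full columns of the diagram of `λ`. -/
def heights (n : ℕ) (m : ℕ → ℕ) : List ℕ :=
  (List.range' 1 (n - 2)).flatMap (fun i => List.replicate (m i) i) ++
    List.replicate (min (m (n - 1)) (m n)) (n - 1) ++
    List.replicate (spinDiff n m / 2) n

/-- Whether the diagram of `λ` has a half-column, i.e. whether `λ` contains one more `λ_{n-1}` or
`λ_n` beside the weights `ω_i`. -/
def HasSpin (n : ℕ) (m : ℕ → ℕ) : Prop := Odd (spinDiff n m)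

/-- `l n ≥ 0`.  If true, the columns of height `n` come from `ω_n = 2 λ_n` and `λ_n`; otherwise from
`ω_{n+1} = 2 λ_{n-1}` and `λ_{n-1}`. -/
def IsPlus (n : ℕ) (m : ℕ → ℕ) : Prop := m (n - 1) ≤ m n

/-- Number of columns preceding the block of index `k` (blocks are counted from `0`). -/
def blockStart (n : ℕ) (m : ℕ → ℕ) (k : ℕ) : ℕ := ((heights n m).take k).sum

/-! ### Young walls of type `D_n^{(1)}` -/

/-- The four fundamental weights `Λ_0, Λ_1, Λ_{n-1}, Λ_n` of level `1`. -/
inductive Level1 where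
  | L0
  | L1
  | Lpred
  | Ln
  deriving DecidableEq

/-- The index `i` of `Λ_i`. -/
def Level1.index (n : ℕ) : Level1 → ℕ
  | .L0 => 0
  | .L1 => 1
  | .Lpred => n - 1
  | .Ln => n

/-- Front and back half of a place of half-unit thickness. -/
inductive Side where
  | front
  | back
  deriving DecidableEq

/-- The other side. -/
def Side.opp : Side → Side
  | .front => .back
  | .back => .front

/-- The rows are coloured periodically, `[0|1], 2, 3, …, n-2, [n-1|n], n-2, …, 3, 2`, with
period `2n-4`.  `phase` is the position of a row in this cycle; the ground row is `[0|1]` for `Λ_0`,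
`Λ_1` and `[n-1|n]` for `Λ_{n-1}`, `Λ_n`. -/
def phase (n : ℕ) (L : Level1) (r : ℕ) : ℕ :=
  match L with
  | .L0 => r % (2 * n - 4)
  | .L1 => r % (2 * n - 4)
  | .Lpred => (r + (n - 2)) % (2 * n - 4)
  | .Ln => (r + (n - 2)) % (2 * n - 4)

/-- Rows consisting of two blocks of half-unit thickness, `[0|1]` or `[n-1|n]`. -/
def IsHalfRow (n : ℕ) (L : Level1) (r : ℕ) : Prop := phase n L r = 0 ∨ phase n L r = n - 2

instance (n : ℕ) (L : Level1) (r : ℕ) : Decidable (IsHalfRow n L r) := by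
  unfold IsHalfRow; infer_instance

/-- Colour of the block in column `k`, row `r` (on side `s`, for a row of half-thickness blocks).
In a row of half-thickness blocks the colours on the front side alternate from column to column. -/
def color (n : ℕ) (L : Level1) (k r : ℕ) (s : Side) : ℕ :=
  if phase n L r = 0 then
    if (k % 2 = 0 ↔ L ≠ .L1) ↔ s = .front then 1 else 0
  else if phase n L r = n - 2 then
    if (k % 2 = 0 ↔ L ≠ .Lpred) ↔ s = .front then n - 1 else n
  else if phase n L r < n - 2 then phase n L r + 1
  else 2 * n - 3 - phase n L r

/-- A column: `full` complete rows and possibly one block of half-unit thickness on top. -/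
structure Column where
  full : ℕ
  half : Option Side

/-- The blocks of a column: it has the block in row `r` on side `s`.  (A block of unit thickness
counts as occupying both sides.) -/
def Column.Has (c : Column) (r : ℕ) (s : Side) : Prop := r < c.full ∨ (r = c.full ∧ c.half = some s)

/-- A column of the ground-state wall: only the front block of the ground row. -/
def ground : Column := ⟨0, some .front⟩

/-- A configuration of columns, indexed from right to left. -/
abbrev Wall : Type := ℕ → Column

/-- Young walls on the ground-state wall of weight `L`. -/
structure IsYoungWall (n : ℕ) (L : Level1) (Y : Wall) : Prop where
  /-- half-thickness blocks stand only in the rows of half-thickness blocks -/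
  pattern : ∀ k s, (Y k).half = some s → IsHalfRow n L (Y k).full
  /-- the wall is built on the ground-state wall -/
  contains_ground : ∀ k, (Y k).Has 0 .front
  /-- there is no free space to the right of a block, except in the right-most column -/
  no_free_space : ∀ k r s, (Y (k + 1)).Has r s → (Y k).Has r s
  /-- finitely many blocks have been added -/
  finite : ∃ N, ∀ k, N ≤ k → Y k = ground

/-- Proper Young walls: no two full columns have the same height. -/
structure IsProper (n : ℕ) (L : Level1) (Y : Wall) : Prop extends IsYoungWall n L Y where
  proper : ∀ k l, (Y k).half = none → (Y l).half = none → (Y k).full = (Y l).full → k = l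

/-- Replace the column of index `k`. -/
def setColumn (Y : Wall) (k : ℕ) (c : Column) : Wall := fun l => if l = k then c else Y l

/-- The column obtained by adding an `i`-block on top of the column `c` of index `k`, if the pattern
allows it. -/
def addBlock (n : ℕ) (L : Level1) (k i : ℕ) (c : Column) : Option Column :=
  match c.half with
  | some s => if color n L k c.full s.opp = i then some ⟨c.full + 1, none⟩ else none
  | none =>
    if IsHalfRow n L c.full then
      if color n L k c.full .front = i then some ⟨c.full, some .front⟩
      else if color n L k c.full .back = i then some ⟨c.full, some .back⟩
      else none
    else if color n L k c.full .front = i then some ⟨c.full + 1, none⟩ else none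

/-- The column obtained by removing an `i`-block from the top of the column `c` of index `k`, if its
top contains such a block. -/
def removeBlock (n : ℕ) (L : Level1) (k i : ℕ) (c : Column) : Option Column :=
  match c.half with
  | some s => if color n L k c.full s = i then some ⟨c.full, none⟩ else none
  | none =>
    if c.full = 0 then none
    else if IsHalfRow n L (c.full - 1) then
      if color n L k (c.full - 1) .front = i then some ⟨c.full - 1, some .back⟩
      else if color n L k (c.full - 1) .back = i then some ⟨c.full - 1, some .front⟩
      else none
    else if color n L k (c.full - 1) .front = i then some ⟨c.full - 1, none⟩ else none

open Classical in
/-- Add an `i`-block to the column of index `k`, provided the result is a proper Young wall. -/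
noncomputable def addAt (n : ℕ) (L : Level1) (i : ℕ) (Y : Wall) (k : ℕ) : Option Wall :=
  (addBlock n L k i (Y k)).bind fun c =>
    if IsProper n L (setColumn Y k c) then some (setColumn Y k c) else none

open Classical in
/-- Remove an `i`-block from the column of index `k`, provided the result is a proper Young wall. -/
noncomputable def removeAt (n : ℕ) (L : Level1) (i : ℕ) (Y : Wall) (k : ℕ) : Option Wall :=
  (removeBlock n L k i (Y k)).bind fun c =>
    if IsProper n L (setColumn Y k c) then some (setColumn Y k c) else none

/-- All columns of index at least `width Y` are columns of the ground-state wall. -/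
noncomputable def width (Y : Wall) : ℕ := sInf {N | ∀ k, N ≤ k → Y k = ground}

/-- The signs contributed by column `k`: a `-` if it is `i`-removable, followed by a `+` if it is
`i`-admissible.  (For `D_n^{(1)}` no column is twice `i`-removable or twice `i`-admissible.) -/
noncomputable def columnSigns (n : ℕ) (L : Level1) (i : ℕ) (Y : Wall) (k : ℕ) : List (Sign × ℕ) :=
  (if (removeAt n L i Y k).isSome then [(Sign.minus, k)] else []) ++
    (if (addAt n L i Y k).isSome then [(Sign.plus, k)] else [])

/-- The signs of all columns, read from left to right.  The columns of index larger than `width Y`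
have no removable block and no admissible slot, so they contribute nothing. -/
noncomputable def wallSigns (n : ℕ) (L : Level1) (i : ℕ) (Y : Wall) : List (Sign × ℕ) :=
  (List.range (width Y + 1)).reverse.flatMap (columnSigns n L i Y)

/-- Number of `j`-blocks in row `r` of a column of index `k` filled there. -/
def rowCount (n : ℕ) (L : Level1) (k r j : ℕ) : ℕ :=
  if IsHalfRow n L r then
    (if color n L k r .front = j then 1 else 0) + (if color n L k r .back = j then 1 else 0)
  else if color n L k r .front = j then 1 else 0

/-- Number of `j`-blocks in the column `c` of index `k`. -/
def columnCount (n : ℕ) (L : Level1) (k j : ℕ) (c : Column) : ℕ :=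
  (∑ r ∈ Finset.range c.full, rowCount n L k r j) +
    match c.half with
    | some s => if color n L k c.full s = j then 1 else 0
    | none => 0

/-- Number `k_j` of `j`-blocks that have been added to the ground-state wall. -/
noncomputable def addedBlocks (n : ℕ) (L : Level1) (Y : Wall) (j : ℕ) : ℤ :=
  ∑ k ∈ Finset.range (width Y),
    ((columnCount n L k j (Y k) : ℤ) - (columnCount n L k j ground : ℤ))

/-- Edges `{i, j}`, `i < j`, of the Dynkin diagram of `D_n^{(1)}`. -/
def IsEdge (n i j : ℕ) : Prop :=
  (i = 0 ∧ j = 2) ∨ (1 ≤ i ∧ j = i + 1 ∧ j ≤ n - 1) ∨ (i = n - 2 ∧ j = n)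

instance (n i j : ℕ) : Decidable (IsEdge n i j) := by
  unfold IsEdge; infer_instance

/-- The Cartan matrix `a_{ij} = α_j(h_i)` of `D_n^{(1)}`. -/
def affineCartan (n i j : ℕ) : ℤ :=
  if i = j then 2 else if IsEdge n i j ∨ IsEdge n j i then -1 else 0

/-- The crystal structure on the proper Young walls on the ground-state wall of weight `L`; the
weight is `L - ∑ j, k_j α_j`. -/
noncomputable def wallCrystal (n : ℕ) (L : Level1) : CrystalData Wall where
  wt Y i := (if L.index n = i then 1 else 0) -
    ∑ j ∈ Finset.range (n + 1), addedBlocks n L Y j * affineCartan n i j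
  eps i Y := countMinus (wallSigns n L i Y)
  phi i Y := countPlus (wallSigns n L i Y)
  e i Y := (rightmostMinus (wallSigns n L i Y)).bind (removeAt n L i Y)
  f i Y := (leftmostPlus (wallSigns n L i Y)).bind (addAt n L i Y)

/-- Reduced proper Young walls: no column contains a removable `δ`.  A `δ`-column has `2n-4` units
of height. -/
def IsReduced (n : ℕ) (L : Level1) (Y : Wall) : Prop :=
  IsProper n L Y ∧
    ∀ k, 2 * n - 4 ≤ (Y k).full →
      ¬ IsProper n L (setColumn Y k ⟨(Y k).full - (2 * n - 4), (Y k).half⟩)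

/-! ### The highest weight wall and the Young wall realization -/

open Classical in
/-- The level-`1` weight `Λ` on whose ground-state wall the walls for `λ` are built: the colours of
the ground row must fit, that is, for `λ` with a half-column the right-most of its columns has
ground colour `n-1` for `λ_n` and `n` for `λ_{n-1}`, and without half-column the left-most column
of the last block has ground colour `0`. -/
noncomputable def levelOne (n : ℕ) (m : ℕ → ℕ) : Level1 :=
  if HasSpin n m then
    if (Even (heights n m).sum ↔ IsPlus n m) then .Ln else .Lpred
  else if Even (heights n m).sum then .L0 else .L1

open Classical in
/-- Number of complete rows below the window of block `k` (counted from `0`): `t-1-k` times `δ`, and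
half a `δ` more if there is a half-column. -/
noncomputable def baseRow (n : ℕ) (m : ℕ → ℕ) (k : ℕ) : ℕ :=
  ((heights n m).length - 1 - k) * (2 * n - 4) + if HasSpin n m then n - 2 else 0

/-- The column with `r` complete rows and one more half-thickness block of colour `c`. -/
def halfColumnOf (n : ℕ) (L : Level1) (k r c : ℕ) : Column :=
  ⟨r, some (if color n L k r .front = c then .front else .back)⟩

/-- The index of the block containing the column of index `k`: the number of blocks lying completely
to the right of it. -/
def blockIndex (n : ℕ) (m : ℕ → ℕ) (k : ℕ) : ℕ :=
  (List.range (heights n m).length).countP fun b => decide (blockStart n m (b + 1) ≤ k)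

open Classical in
/-- The highest weight wall `H_λ`.  A block of `i` columns lying above its base row `r` has, as
`a`-th column from the right (`a = 0, …, i-1`), the column ending with the blocks which represent the
entry `j = i - a`, or `n̄` when `j = n` and `λ` involves `ω_{n+1}`.  All columns to the left of
the blocks are columns of the ground-state wall. -/
noncomputable def highestWall (n : ℕ) (m : ℕ → ℕ) : Wall := fun k =>
  if k < (heights n m).sum then
    let b := blockIndex n m k
    let j := blockStart n m (b + 1) - k
    let r := baseRow n m b
    if j = 1 then halfColumnOf n (levelOne n m) k r 0
    else if j = n then
      halfColumnOf n (levelOne n m) k (r + (n - 2)) (if IsPlus n m then n - 1 else n)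
    else ⟨r + (j - 1), none⟩
  else ground

/-- The Young wall realization `Y(λ)`: the connected component of `H_λ` in the crystal graph of
reduced proper Young walls on `Λ` after the `0`-arrows have been removed. -/
def wallRealization (n : ℕ) (m : ℕ → ℕ) : Set Wall :=
  {Y | IsReduced n (levelOne n m) (highestWall n m) ∧
    Relation.ReflTransGen
      (fun Y₁ Y₂ => IsReduced n (levelOne n m) Y₂ ∧ ∃ i, 1 ≤ i ∧ i ≤ n ∧
        ((wallCrystal n (levelOne n m)).e i Y₁ = some Y₂ ∨
          (wallCrystal n (levelOne n m)).f i Y₁ = some Y₂))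
      (highestWall n m) Y}

/-! ### Letters and tableaux -/

/-- The entries `a` and `ā`. -/
inductive Letter where
  | pos (a : ℕ)
  | bar (a : ℕ)
  deriving DecidableEq

/-- The order `1 ≺ 2 ≺ … ≺ n-1 ≺ n, n̄ ≺ \overline{n-1} ≺ … ≺ 1̄` is defined through this rank; the
letters `n` and `n̄` have the same rank and are incomparable. -/
def Letter.rank (n : ℕ) : Letter → ℕ
  | .pos a => a
  | .bar a => 2 * n - a

/-- The strict order on letters. -/
def Letter.Lt (n : ℕ) (x y : Letter) : Prop := x.rank n < y.rank n

/-- The weak order on letters. -/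
def Letter.Le (n : ℕ) (x y : Letter) : Prop := x = y ∨ x.Lt n y

/-- Entries are `a` and `ā` with `1 ≤ a ≤ n`. -/
def Letter.Valid (n : ℕ) : Letter → Prop
  | .pos a => 1 ≤ a ∧ a ≤ n
  | .bar a => 1 ≤ a ∧ a ≤ n

/-- The operator `f̃_i` on the vector representation. -/
def Letter.f (n i : ℕ) : Letter → Option Letter
  | .pos a =>
    if i < n then if a = i then some (.pos (i + 1)) else none
    else if a = n - 1 then some (.bar n) else if a = n then some (.bar (n - 1)) else none
  | .bar a =>
    if i < n then if a = i + 1 then some (.bar i) else none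
    else none

/-- The operator `ẽ_i` on the vector representation. -/
def Letter.e (n i : ℕ) : Letter → Option Letter
  | .pos a =>
    if i < n then if a = i + 1 then some (.pos i) else none
    else none
  | .bar a =>
    if i < n then if a = i then some (.bar (i + 1)) else none
    else if a = n then some (.pos (n - 1)) else if a = n - 1 then some (.pos n) else none

/-- The value of `ε_a` on the coroot `h_i`. -/
def epsilonCoroot (n i a : ℕ) : ℤ :=
  if i < n then (if a = i then 1 else if a = i + 1 then -1 else 0)
  else if a = n - 1 ∨ a = n then 1 else 0

/-- The weight of a letter: `ε_a` for `a` and `-ε_a` for `ā`. -/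
def Letter.wt (n i : ℕ) : Letter → ℤ
  | .pos a => epsilonCoroot n i a
  | .bar a => - epsilonCoroot n i a

/-- `f̃_i` on a half-column (the spin crystals): for `i < n` it changes `i` into `i+1` and
`\overline{i+1}` into `ī` simultaneously, for `i = n` it changes `n-1, n` into
`n̄, \overline{n-1}`. -/
def spinF (n i : ℕ) (C : List Letter) : Option (List Letter) :=
  if (i < n ∧ Letter.pos i ∈ C ∧ Letter.bar (i + 1) ∈ C) ∨
      (i = n ∧ Letter.pos (n - 1) ∈ C ∧ Letter.pos n ∈ C) then
    some (C.map fun x => (x.f n i).getD x)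
  else none

/-- `ẽ_i` on a half-column. -/
def spinE (n i : ℕ) (C : List Letter) : Option (List Letter) :=
  if (i < n ∧ Letter.pos (i + 1) ∈ C ∧ Letter.bar i ∈ C) ∨
      (i = n ∧ Letter.bar n ∈ C ∧ Letter.bar (n - 1) ∈ C) then
    some (C.map fun x => (x.e n i).getD x)
  else none

/-- Tableaux of reverse shape: bottom-justified columns, listed from left to right, each given by
its entries from bottom to top, and possibly a half-column at the right end. -/
structure Tableau where
  cols : List (List Letter)
  half : Option (List Letter)

/-- All columns, from left to right, including the half-column. -/
def Tableau.allCols (T : Tableau) : List (List Letter) := T.cols ++ T.half.toList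

/-- Signs of the box in row `p` of column `c`. -/
def boxSigns (n i : ℕ) (c p : ℕ) (x : Letter) : List (Sign × Option (ℕ × ℕ)) :=
  (if (x.e n i).isSome then [(Sign.minus, some (c, p))] else []) ++
    (if (x.f n i).isSome then [(Sign.plus, some (c, p))] else [])

/-- Signs of a half-column, which is a single tensor factor (position `none`). -/
def spinSigns (n i : ℕ) (C : List Letter) : List (Sign × Option (ℕ × ℕ)) :=
  (if (spinE n i C).isSome then [(Sign.minus, none)] else []) ++
    (if (spinF n i C).isSome then [(Sign.plus, none)] else [])

/-- The signs of the tensor factors of a tableau, which is read from right to left and, in each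
column, from top to bottom. -/
def tableauSigns (n i : ℕ) (T : Tableau) : List (Sign × Option (ℕ × ℕ)) :=
  T.half.toList.flatMap (spinSigns n i) ++
    T.cols.zipIdx.reverse.flatMap fun C =>
      C.1.zipIdx.reverse.flatMap fun x => boxSigns n i C.2 x.2 x.1

/-- Apply the Kashiwara operator given by `g` on boxes and by `gs` on half-columns to the tensor
factor at a position. -/
def applyAt (g : Letter → Option Letter) (gs : List Letter → Option (List Letter)) (T : Tableau) :
    Option (ℕ × ℕ) → Tableau
  | some (c, p) => { T with cols := T.cols.modify c fun C => C.modify p fun x => (g x).getD x }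
  | none => { T with half := T.half.map fun C => (gs C).getD C }

/-- The crystal structure on tableaux, given by the tensor product rule. (The weight of a half-column
is half the sum of the weights of its entries.) -/
def tableauCrystal (n : ℕ) : CrystalData Tableau where
  wt T i := (T.cols.map fun C => (C.map (Letter.wt n i)).sum).sum +
    (T.half.toList.map fun C => (C.map (Letter.wt n i)).sum / 2).sum
  eps i T := countMinus (tableauSigns n i T)
  phi i T := countPlus (tableauSigns n i T)
  e i T := (rightmostMinus (tableauSigns n i T)).map (applyAt (Letter.e n i) (spinE n i) T)
  f i T := (leftmostPlus (tableauSigns n i T)).map (applyAt (Letter.f n i) (spinF n i) T)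

/-! ### The conditions defining `T(λ)` -/

/-- The entries of a column strictly increase from top to bottom, except that `n̄` may stand
directly below `n` and `n` directly below `n̄`. -/
def ColumnStrict (n : ℕ) (C : List Letter) : Prop :=
  ∀ (p : ℕ) (x y : Letter), C[p]? = some x → C[p + 1]? = some y →
    y.Lt n x ∨ (x = Letter.pos n ∧ y = Letter.bar n) ∨ (x = Letter.bar n ∧ y = Letter.pos n)

/-- The entries weakly increase from the column `C` to the column `C'` on its right. -/
def RowWeak (n : ℕ) (C C' : List Letter) : Prop :=
  ∀ (p : ℕ) (x y : Letter), C[p]? = some x → C'[p]? = some y → x.Le n y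

/-- (1CC): if `a` and `ā` are in rows `p > q` of a column of height `N`, then
`p - q - 1 ≥ N - a`. -/
def OneCC (C : List Letter) : Prop :=
  ∀ a p q : ℕ, q < p → C[p]? = some (Letter.pos a) → C[q]? = some (Letter.bar a) → C.length + q + 1 ≤ p + a

/-- (2CC-1): if `a` is in row `p` of `C` and `ā` in row `q` of `C'` with `p > q`, then
`p - q ≤ n - a`.  For `a = n` the roles of `n` and `n̄` may be exchanged. -/
def TwoCC1 (n : ℕ) (C C' : List Letter) : Prop :=
  ∀ a p q : ℕ, q < p →
    ((C[p]? = some (Letter.pos a) ∧ C'[q]? = some (Letter.bar a)) ∨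
      (a = n ∧ C[p]? = some (Letter.bar n) ∧ C'[q]? = some (Letter.pos n))) →
    p + a ≤ n + q

/-- (2CC-2): if `a` is in row `p` of `C` and `ā` in row `q` of `C'` with `p > q`, and if `b` and
`b̄` are in rows `r > s` of one of the two columns, between the rows `p` and `q`, then
`(p - r) + (s - q) < b - a`. -/
def TwoCC2 (C C' : List Letter) : Prop :=
  ∀ a b p q r s : ℕ, q ≤ s → s < r → r ≤ p →
    C[p]? = some (Letter.pos a) → C'[q]? = some (Letter.bar a) →
    ((C[r]? = some (Letter.pos b) ∧ C[s]? = some (Letter.bar b)) ∨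
      (C'[r]? = some (Letter.pos b) ∧ C'[s]? = some (Letter.bar b))) →
    p + s + a < r + q + b

/-- `C` and `C'` are in the `a`-odd-configuration in the rows `p ≥ q > r ≥ s`. -/
def OddConfig (n a : ℕ) (C C' : List Letter) (p q r s : ℕ) : Prop :=
  1 ≤ a ∧ a < n ∧ s ≤ r ∧ r < q ∧ q ≤ p ∧ Odd (q - r + 1) ∧
    C[p]? = some (Letter.pos a) ∧ C'[s]? = some (Letter.bar a) ∧
    ((C'[q]? = some (Letter.pos n) ∧ C[r]? = some (Letter.bar n)) ∨
      (C'[q]? = some (Letter.bar n) ∧ C[r]? = some (Letter.pos n)))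

/-- `C` and `C'` are in the `a`-even-configuration in the rows `p ≥ q > r ≥ s`. -/
def EvenConfig (n a : ℕ) (C C' : List Letter) (p q r s : ℕ) : Prop :=
  1 ≤ a ∧ a < n ∧ s ≤ r ∧ r < q ∧ q ≤ p ∧ Even (q - r + 1) ∧
    C[p]? = some (Letter.pos a) ∧ C'[s]? = some (Letter.bar a) ∧
    ((C'[q]? = some (Letter.pos n) ∧ C[r]? = some (Letter.pos n)) ∨
      (C'[q]? = some (Letter.bar n) ∧ C[r]? = some (Letter.bar n)))

/-- (2CC-3): `p - s < n - a` for every `a`-odd- and every `a`-even-configuration. -/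
def TwoCC3 (n : ℕ) (C C' : List Letter) : Prop :=
  ∀ a p q r s : ℕ, OddConfig n a C C' p q r s ∨ EvenConfig n a C C' p q r s → p + a < n + s

/-- A column of height `n` (full or half) has the sign of `l n`: for `l n > 0`, counting rows from
`1` at the bottom, the entry `n` occurs only in odd rows and `n̄` only in even rows; for `l n < 0` it
is the other way round.  (Below, rows are counted from `0`.) -/
def SignOK (n : ℕ) (plus : Prop) (C : List Letter) : Prop :=
  ∀ p : ℕ, (C[p]? = some (Letter.pos n) → (Even p ↔ plus)) ∧ (C[p]? = some (Letter.bar n) → (Odd p ↔ plus))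

/-- The set `T(λ)` of tableaux. -/
structure IsTableau (n : ℕ) (m : ℕ → ℕ) (T : Tableau) : Prop where
  shape : T.cols.map List.length = heights n m
  half_none : ¬ HasSpin n m → T.half = none
  half_some : HasSpin n m → ∃ C, T.half = some C ∧ C.length = n
  valid : ∀ C ∈ T.allCols, ∀ x ∈ C, x.Valid n
  rows : ∀ k C C', T.allCols[k]? = some C → T.allCols[k + 1]? = some C' → RowWeak n C C'
  columns : ∀ C ∈ T.allCols, ColumnStrict n C
  sign : ∀ C ∈ T.allCols, C.length = n → SignOK n (IsPlus n m) C
  half_column : ∀ C, T.half = some C → ∀ a, ¬ (Letter.pos a ∈ C ∧ Letter.bar a ∈ C)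
  oneCC : ∀ C ∈ T.allCols, OneCC C
  twoCC : ∀ k C C', T.allCols[k]? = some C → T.allCols[k + 1]? = some C' →
    TwoCC1 n C C' ∧ TwoCC2 C C' ∧ TwoCC3 n C C'

/-- `T(λ)`. -/
def tableauRealization (n : ℕ) (m : ℕ → ℕ) : Set Tableau := {T | IsTableau n m T}

/-! ### The map `Y ↦ T_Y` -/

/-- The entry of the box corresponding to the column `c` of index `k`, read off from the blocks on
its top:
a single half-thickness block `0`, `1`, `n-1`, `n` gives `1`, `1̄`, `n`, `n̄` respectively;
`[0|1]` gives `2`; `j-1` on the increasing part of the pattern gives `j` (`3 ≤ j ≤ n-1`);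
`[n-1|n]` gives `\overline{n-1}`; `j` on the decreasing part gives `j̄` (`2 ≤ j ≤ n-2`). -/
def letterOf (n : ℕ) (L : Level1) (k : ℕ) (c : Column) : Letter :=
  match c.half with
  | some s =>
    if phase n L c.full = 0 then
      if color n L k c.full s = 0 then .pos 1 else .bar 1
    else if color n L k c.full s = n - 1 then .pos n else .bar n
  | none =>
    if phase n L (c.full - 1) = 0 then .pos 2
    else if phase n L (c.full - 1) < n - 2 then
      .pos (color n L k (c.full - 1) .front + 1)
    else if phase n L (c.full - 1) = n - 2 then .bar (n - 1)
    else .bar (color n L k (c.full - 1) .front)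

/-- The column of `T_Y` corresponding to the block of index `b`: the `a`-th column of the block from
the right gives the `a`-th box from the bottom. -/
noncomputable def blockColumn (n : ℕ) (m : ℕ → ℕ) (Y : Wall) (b : ℕ) : List Letter :=
  (List.range ((heights n m)[b]?.getD 0)).map fun a =>
    letterOf n (levelOne n m) (blockStart n m b + a) (Y (blockStart n m b + a))

/-- The barred entries `j̄` of the half-column, read off from the `n` columns of the wall following
the blocks: those columns with added blocks give their letter; moreover, the first column (from the
right) without added block gives `n̄` if its block has colour `n`. -/
def IsBarred (n : ℕ) (m : ℕ → ℕ) (Y : Wall) (L : Level1) (j : ℕ) : Prop :=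
  ∃ a < n, (Y ((heights n m).sum + a) ≠ ground ∧
      letterOf n L ((heights n m).sum + a) (Y ((heights n m).sum + a)) = .bar j) ∨
    (j = n ∧ Y ((heights n m).sum + a) = ground ∧
      color n L ((heights n m).sum + a) 0 .front = n ∧
      ∀ a' < a, Y ((heights n m).sum + a') ≠ ground)

open Classical in
/-- The half-column of `T_Y`, from bottom to top: first the barred entries `1̄, 2̄, …`, then the
unbarred entries in decreasing order; for each `j` exactly one of `j`, `j̄` occurs. -/
noncomputable def spinColumn (n : ℕ) (m : ℕ → ℕ) (Y : Wall) : List Letter :=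
  ((List.range' 1 n).filter fun j => decide (IsBarred n m Y (levelOne n m) j)).map Letter.bar ++
    ((List.range' 1 n).reverse.filter fun j =>
      decide (¬ IsBarred n m Y (levelOne n m) j)).map Letter.pos

open Classical in
/-- The tableau `T_Y`. -/
noncomputable def tableauOf (n : ℕ) (m : ℕ → ℕ) (Y : Wall) : Tableau where
  cols := (List.range (heights n m).length).map (blockColumn n m Y)
  half := if HasSpin n m then some (spinColumn n m Y) else none

end CrystalD

set_option linter.unusedSimpArgs false
set_option linter.unnecessarySeqFocus false
set_option linter.unusedVariables false

namespace CrystalD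

section

/-! ### Sign words -/

/-! A column of a wall is read off from its top, and for a classical colour `i` adding or removing
an `i`-block on top acts on the represented letter exactly as `f̃_i` or `ẽ_i` act on the vector
representation (`addBlock_colOf`, `removeBlock_colOf`). Walls and tableaux therefore have almost the
same sign words. They differ only where two neighbouring columns obstruct each other: the left one
would receive, and the right one lose, a block of the same colour. In the word of letters these two
moves form an adjacent `(+,-)`-pair, which the signature rule cancels anyway
(`GoodCells.wordEquiv`).

The proof goes from tableaux to walls. `tableauWall` erects for each box the column representing its
entry, each block of columns being one `δ` higher than the next one on its left, and it intertwines
all crystal data. `Y(λ)` need not be described independently. `T(λ)` is stable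
(`tableauRealization_isStable`), it is generated by the `f̃_i` from one tableau
(`IsTableau.reachable`), and that tableau is sent to `H_λ` (`highestWall_eq`); hence `Y(λ)` is the
image of `T(λ)` (`wallRealization_eq`), and `Y ↦ T_Y` undoes `tableauWall`
(`IsTableau.tableauOf_wall`).

The combinatorial core is the stability of `T(λ)`. For a column `C` let `lowCount C a` and `barCount
C a` count the unbarred and the barred letters with index at most `a`. Counting rows from `0` at the
bottom, in a strict column of height `N` a letter `a < n` stands in row `N - lowCount C a`, and `ā`
stands in row `barCount C a - 1`. All conditions on positions thus become linear inequalities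
between counting functions: `lowCount C a + barCount C a ≤ a` for one column, and `GoodPair` for two
adjacent columns (`goodPair_iff`). Applying `f̃_i` or `ẽ_i` to a box changes one counting function
by `1` at one index `j`. The inequality at `j` could break only if those at `j - 1` and `j + 1`
leave no slack, and then the two columns show a pattern of letters whose signs contradict the choice
of the box by the signature rule.

For `i < n - 1` one has `j = i`. For `i = n - 1` and `i = n` one has `j = n - 1`, and the letters
`n`, `n̄` form an alternating run of which at most one `-` and one `+` survive cancellation.
Extending the counting functions to the index `n` by these two bits makes the same arithmetic
(`PairIneq`) valid for every colour. The bits depend on the parity of rows, which is how the sign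
condition and (2CC-3) enter (`GoodPair.pairIneq`).

A tableau with all `ε_i = 0` is forced column by column from the right (`GoodTableau.eq_highCol`),
and `ẽ_i` lowers the sum of the ranks of the entries, so every tableau is reached. Weights agree
because the roots of the blocks of a column plus the weight of its letter do not depend on the
height of the column (`colWt_add_letterWt`). -/

/-- One step of the computation of the numbers of uncancelled signs. -/
def signStep (s : ℕ × ℕ) : Sign → ℕ × ℕ
  | .minus => if s.2 = 0 then (s.1 + 1, 0) else (s.1, s.2 - 1)
  | .plus => (s.1, s.2 + 1)

/-- Number of uncancelled `-` of a sign word. -/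
def wordEps (w : List Sign) : ℕ := (w.foldl signStep (0, 0)).1

/-- Number of uncancelled `+` of a sign word. -/
def wordPhi (w : List Sign) : ℕ := (w.foldl signStep (0, 0)).2

@[simp] theorem wordEps_nil : wordEps [] = 0 := rfl
@[simp] theorem wordPhi_nil : wordPhi [] = 0 := rfl

theorem wordEps_concat (w : List Sign) (s : Sign) :
    wordEps (w ++ [s]) = match s with
      | .minus => if wordPhi w = 0 then wordEps w + 1 else wordEps w
      | .plus => wordEps w := by
  grind [wordEps, wordPhi, signStep]

theorem wordPhi_concat (w : List Sign) (s : Sign) :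
    wordPhi (w ++ [s]) = match s with
      | .minus => wordPhi w - 1
      | .plus => wordPhi w + 1 := by grind [wordPhi, signStep]

/-- A word reduces to `-^ε +^φ`. In a concatenation the `+` left over from `u` meet the `-` left
over from `v`, and the smaller number of them disappears in pairs; truncated subtraction records
this. Both formulas are proved together because each step of the induction needs both. -/
theorem wordEps_wordPhi_append (u v : List Sign) :
    wordEps (u ++ v) = wordEps u + (wordEps v - wordPhi u) ∧
      wordPhi (u ++ v) = wordPhi v + (wordPhi u - wordEps v) := by
  induction v using List.reverseRecOn with
  | nil => simp
  | append_singleton v s ih =>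
    rw [← List.append_assoc, wordEps_concat, wordPhi_concat, wordEps_concat, wordPhi_concat]
    cases s <;> simp only [ih.1, ih.2]
    · by_cases h : wordPhi v = 0
      · simp only [h, if_true]; constructor <;> (try split_ifs) <;> omega
      · simp only [h, if_false]; constructor <;> (try split_ifs) <;> omega
    grind

theorem wordEps_append (u v : List Sign) :
    wordEps (u ++ v) = wordEps u + (wordEps v - wordPhi u) := (wordEps_wordPhi_append u v).1

theorem wordPhi_append (u v : List Sign) :
    wordPhi (u ++ v) = wordPhi v + (wordPhi u - wordEps v) := (wordEps_wordPhi_append u v).2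

@[simp] theorem wordPhi_minus : wordPhi [.minus] = 0 := rfl

@[simp] theorem wordEps_plus : wordEps [.plus] = 0 := rfl

@[simp] theorem wordPhi_plus : wordPhi [.plus] = 1 := rfl

@[simp] theorem wordEps_minus_cons (v : List Sign) :
    wordEps (.minus :: v) = 1 + wordEps v := wordEps_append [.minus] v

@[simp] theorem wordPhi_minus_cons (v : List Sign) : wordPhi (.minus :: v) = wordPhi v := by
  have := wordPhi_append [.minus] v; simpa using this

@[simp] theorem wordEps_plus_cons (v : List Sign) :
    wordEps (.plus :: v) = wordEps v - 1 := by
  have := wordEps_append [.plus] v; simpa using this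

@[simp] theorem wordPhi_plus_cons (v : List Sign) :
    wordPhi (.plus :: v) = wordPhi v + (1 - wordEps v) := wordPhi_append [.plus] v

@[simp] theorem wordEps_replicate_minus (a : ℕ) : wordEps (List.replicate a .minus) = a := by
  induction a with
  | zero => rfl
  | succ a ih => rw [List.replicate_succ, wordEps_minus_cons, ih]; omega

@[simp] theorem wordPhi_replicate_minus (a : ℕ) : wordPhi (List.replicate a .minus) = 0 := by
  induction a with
  | zero => rfl
  | succ a ih => rw [List.replicate_succ, wordPhi_minus_cons, ih]

@[simp] theorem wordEps_replicate_plus (a : ℕ) : wordEps (List.replicate a .plus) = 0 := by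
  induction a with
  | zero => rfl
  | succ a ih => rw [List.replicate_succ, wordEps_plus_cons, ih]

@[simp] theorem wordPhi_replicate_plus (a : ℕ) : wordPhi (List.replicate a .plus) = a := by
  induction a with
  | zero => rfl
  | succ a ih => rw [List.replicate_succ, wordPhi_plus_cons, ih]; simp

/-! ### Tagged sign words -/

section Tagged

variable {α β : Type}

/-- The stack of signs after the cancellation consists of `+` on top of `-`. -/
theorem exists_stack (w : List (Sign × α)) :
    ∃ ps ms : List α,
      w.foldl cancelStep [] = ps.map (Prod.mk Sign.plus) ++ ms.map (Prod.mk Sign.minus) ∧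
      ps.length = wordPhi (w.map Prod.fst) ∧ ms.length = wordEps (w.map Prod.fst) := by
  induction w using List.reverseRecOn with
  | nil => simp_all
  | append_singleton w s ih =>
    obtain ⟨ps, ms, h, hp, hm⟩ := ih
    obtain ⟨s, x⟩ := s
    rw [List.foldl_append, h, List.map_append, List.map_singleton, wordPhi_concat, wordEps_concat]
    cases s with
    | plus => exact ⟨x :: ps, ms, by simp [cancelStep], by simp [hp], hm⟩
    | minus =>
      cases ps with
      | nil =>
        refine ⟨[], x :: ms, ?_, ?_, ?_⟩
        · cases ms <;> simp [cancelStep]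
        · simp at hp; simp [← hp]
        simp_all
      | cons p ps =>
        grind [cancelStep]

theorem find_plus (ps ms : List α) :
    (((ps.map (Prod.mk Sign.plus) ++ ms.map (Prod.mk Sign.minus)).reverse.find?
      (fun s => decide (s.1 = Sign.plus))).map Prod.snd) = ps.getLast? := by
  rw [List.reverse_append, List.find?_append]
  have h1 : ((ms.map (Prod.mk Sign.minus)).reverse.find?
      (fun s => decide (s.1 = Sign.plus))) = none := by simp
  rw [h1, Option.none_or]
  induction ps using List.reverseRecOn with
  | nil => simp
  | append_singleton ps p _ => simp

theorem find_minus (ps ms : List α) :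
    (((ps.map (Prod.mk Sign.plus) ++ ms.map (Prod.mk Sign.minus)).find?
      (fun s => decide (s.1 = Sign.minus))).map Prod.snd) = ms.head? := by
  rw [List.find?_append]
  have h1 : ((ps.map (Prod.mk Sign.plus)).find?
      (fun s => decide (s.1 = Sign.minus))) = none := by simp
  rw [h1, Option.none_or]
  cases ms <;> simp

/-- A new `-` cancels the most recent uncancelled `+`, so the left-most `+` survives until it is the
only one; hence the threshold `≤ 1`. A new `+` becomes the left-most only if no other is present. -/
theorem leftmostPlus_concat (w : List (Sign × α)) (s : Sign) (x : α) :
    leftmostPlus (w ++ [(s, x)]) = match s with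
      | .plus => if wordPhi (w.map Prod.fst) = 0 then some x else leftmostPlus w
      | .minus => if wordPhi (w.map Prod.fst) ≤ 1 then none else leftmostPlus w := by
  obtain ⟨ps, ms, h, hp, hm⟩ := exists_stack w
  have h0 : leftmostPlus w = ps.getLast? := by
    rw [← find_plus ps ms, ← h]; rfl
  rw [h0, ← hp]
  simp only [leftmostPlus, signature, List.foldl_append, h, List.foldl_cons, List.foldl_nil]
  cases s with
  | plus =>
    have : cancelStep (ps.map (Prod.mk Sign.plus) ++ ms.map (Prod.mk Sign.minus)) (Sign.plus, x) =
        (x :: ps).map (Prod.mk Sign.plus) ++ ms.map (Prod.mk Sign.minus) := by simp [cancelStep]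
    grind [find_plus]
  | minus =>
    cases ps with
    | nil =>
      have : cancelStep (([] : List α).map (Prod.mk Sign.plus) ++ ms.map (Prod.mk Sign.minus))
          (Sign.minus, x) = ([] : List α).map (Prod.mk Sign.plus) ++
            (x :: ms).map (Prod.mk Sign.minus) := by cases ms <;> simp [cancelStep]
      simp_all
    | cons p ps =>
      grind [cancelStep, find_plus]

/-- An uncancelled `-` can never be cancelled later, so the right-most one is only replaced, namely
when a new `-` finds no `+`. -/
theorem rightmostMinus_concat (w : List (Sign × α)) (s : Sign) (x : α) :
    rightmostMinus (w ++ [(s, x)]) = match s with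
      | .plus => rightmostMinus w
      | .minus => if wordPhi (w.map Prod.fst) = 0 then some x else rightmostMinus w := by
  obtain ⟨ps, ms, h, hp, hm⟩ := exists_stack w
  have h0 : rightmostMinus w = ms.head? := by grind [find_minus, rightmostMinus, signature]
  rw [h0, ← hp]
  simp only [rightmostMinus, signature, List.foldl_append, h, List.foldl_cons, List.foldl_nil,
    List.reverse_reverse]
  cases s with
  | plus =>
    grind [cancelStep, find_minus]
  | minus =>
    cases ps with
    | nil =>
      have : cancelStep (([] : List α).map (Prod.mk Sign.plus) ++ ms.map (Prod.mk Sign.minus))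
          (Sign.minus, x) = ([] : List α).map (Prod.mk Sign.plus) ++
            (x :: ms).map (Prod.mk Sign.minus) := by cases ms <;> simp [cancelStep]
      simp_all
    | cons p ps =>
      grind [cancelStep, find_minus]

/-- The left-most `+` of the signature is the `+` with no uncancelled `+` before and no uncancelled
`-` behind it. -/
theorem leftmostPlus_eq_some_iff (w : List (Sign × α)) (x : α) :
    leftmostPlus w = some x ↔ ∃ u v, w = u ++ (Sign.plus, x) :: v ∧
      wordPhi (u.map Prod.fst) = 0 ∧ wordEps (v.map Prod.fst) = 0 := by
  induction w using List.reverseRecOn with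
  | nil => simp [leftmostPlus, signature]
  | append_singleton w s ih =>
    obtain ⟨s, y⟩ := s
    rw [leftmostPlus_concat]
    constructor
    · intro h
      cases s with
      | plus =>
        simp only at h
        split_ifs at h with h0
        · cases h; exact ⟨w, [], by simp, h0, rfl⟩
        · obtain ⟨u, v, rfl, hu, hv⟩ := ih.1 h
          exact ⟨u, v ++ [(Sign.plus, y)], by simp, hu, by
            rw [List.map_append, List.map_singleton, wordEps_concat]; exact hv⟩
      | minus =>
        simp only at h
        split_ifs at h with h0
        obtain ⟨u, v, rfl, hu, hv⟩ := ih.1 h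
        refine ⟨u, v ++ [(Sign.minus, y)], by simp, hu, ?_⟩
        grind [wordPhi_append, wordPhi_plus_cons,
            wordEps_plus_cons, wordEps_minus_cons, wordEps_append, wordEps_nil]
    · rintro ⟨u, v, h, hu, hv⟩
      rcases List.eq_nil_or_concat v with rfl | ⟨v, t, rfl⟩
      · simp_all
      · rw [List.concat_eq_append] at h hv
        rw [← List.cons_append, ← List.append_assoc] at h
        obtain ⟨rfl, h2⟩ := List.append_inj' h rfl
        simp only [List.cons.injEq, and_true] at h2
        subst h2
        have hv' : wordEps (v.map Prod.fst) = 0 := by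
          rw [List.map_append, wordEps_append] at hv; omega
        have h3 := ih.2 ⟨u, v, rfl, hu, hv'⟩
        have h4 : wordPhi ((u ++ (Sign.plus, x) :: v).map Prod.fst) =
            wordPhi (v.map Prod.fst) + 1 := by
          grind [wordPhi_append, wordPhi_plus_cons, wordEps_plus_cons]
        rw [h3, h4]
        cases s with
        | plus => simp
        | minus =>
          rw [List.map_append, wordEps_append] at hv
          simp at hv
          grind

/-- The right-most `-` of the signature is the `-` with no uncancelled `+` before and no uncancelled
`-` behind it. -/
theorem rightmostMinus_eq_some_iff (w : List (Sign × α)) (x : α) :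
    rightmostMinus w = some x ↔ ∃ u v, w = u ++ (Sign.minus, x) :: v ∧
      wordPhi (u.map Prod.fst) = 0 ∧ wordEps (v.map Prod.fst) = 0 := by
  induction w using List.reverseRecOn with
  | nil => simp [rightmostMinus, signature]
  | append_singleton w s ih =>
    obtain ⟨s, y⟩ := s
    rw [rightmostMinus_concat]
    constructor
    · intro h
      cases s with
      | plus =>
        obtain ⟨u, v, rfl, hu, hv⟩ := ih.1 h
        grind [List.map_singleton, wordEps_concat]
      | minus =>
        simp only at h
        split_ifs at h with h0
        · cases h; exact ⟨w, [], by simp, h0, rfl⟩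
        obtain ⟨u, v, rfl, hu, hv⟩ := ih.1 h
        refine ⟨u, v ++ [(Sign.minus, y)], by simp, hu, ?_⟩
        grind [wordPhi_append, wordPhi_minus_cons, wordEps_minus_cons, wordEps_append, wordEps_nil]
    · rintro ⟨u, v, h, hu, hv⟩
      rcases List.eq_nil_or_concat v with rfl | ⟨v, t, rfl⟩
      · simp_all
      · rw [List.concat_eq_append] at h hv
        rw [← List.cons_append, ← List.append_assoc] at h
        obtain ⟨rfl, h2⟩ := List.append_inj' h rfl
        simp only [List.cons.injEq, and_true] at h2
        subst h2
        have hv' : wordEps (v.map Prod.fst) = 0 := by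
          rw [List.map_append, wordEps_append] at hv; omega
        have h3 := ih.2 ⟨u, v, rfl, hu, hv'⟩
        grind [wordPhi, wordPhi_append, wordPhi_minus_cons, wordEps_minus_cons, wordEps_append]

theorem rightmostMinus_isSome (w : List (Sign × α)) :
    (rightmostMinus w).isSome ↔ wordEps (w.map Prod.fst) ≠ 0 := by
  obtain ⟨ps, ms, h, hp, hm⟩ := exists_stack w
  have h0 : rightmostMinus w = ms.head? := by grind [find_minus, rightmostMinus, signature]
  rw [h0, ← hm]
  cases ms <;> simp

/-- Two tagged words are equivalent if they act in the same way on every stack. -/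
def WordEquiv (w w' : List (Sign × α)) : Prop :=
  ∀ st, w.foldl cancelStep st = w'.foldl cancelStep st

theorem WordEquiv.refl (w : List (Sign × α)) : WordEquiv w w := fun _ => rfl

theorem WordEquiv.trans {w w' w'' : List (Sign × α)} (h : WordEquiv w w') (h' : WordEquiv w' w'') :
    WordEquiv w w'' := fun st => (h st).trans (h' st)

theorem WordEquiv.append {u u' v v' : List (Sign × α)} (h : WordEquiv u u') (h' : WordEquiv v v') :
    WordEquiv (u ++ v) (u' ++ v') := fun st => by
  rw [List.foldl_append, List.foldl_append, h st, h' _]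

theorem wordEquiv_cancel (x y : α) (w : List (Sign × α)) :
    WordEquiv ((Sign.plus, x) :: (Sign.minus, y) :: w) w := fun st => by
  simp [cancelStep]

theorem WordEquiv.signature_eq {w w' : List (Sign × α)} (h : WordEquiv w w') :
    signature w = signature w' := by
  simp only [signature, h []]

/-- Cancellation never looks at the tags. This lets the selected position be carried from boxes of a
tableau to columns of its wall. -/
theorem foldl_cancelStep_map (g : α → β) (w st : List (Sign × α)) :
    (w.map (Prod.map id g)).foldl cancelStep (st.map (Prod.map id g)) =
      (w.foldl cancelStep st).map (Prod.map id g) := by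
  induction w generalizing st with
  | nil => rfl
  | cons s w ih =>
    rw [List.map_cons, List.foldl_cons, List.foldl_cons, ← ih]
    congr 1
    obtain ⟨s, x⟩ := s
    rcases s with _ | _ <;> rcases st with _ | ⟨⟨_ | _, y⟩, st⟩ <;> simp [cancelStep]

theorem signature_map (g : α → β) (w : List (Sign × α)) :
    signature (w.map (Prod.map id g)) = (signature w).map (Prod.map id g) := by
  have := foldl_cancelStep_map g w []
  grind [signature, List.map_reverse]

theorem leftmostPlus_map (g : α → β) (w : List (Sign × α)) :
    leftmostPlus (w.map (Prod.map id g)) = (leftmostPlus w).map g := by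
  simp only [leftmostPlus, signature_map, List.find?_map]
  rw [Option.map_map, Option.map_map]
  rfl

theorem rightmostMinus_map (g : α → β) (w : List (Sign × α)) :
    rightmostMinus (w.map (Prod.map id g)) = (rightmostMinus w).map g := by
  simp only [rightmostMinus, signature_map, ← List.map_reverse, List.find?_map]
  rw [Option.map_map, Option.map_map]
  rfl

/-- Splitting a concatenation at a sign. -/
theorem flatMap_eq_append_cons {γ : Type} {L : List γ} {g : γ → List β} {u v : List β} {s : β}
    (h : L.flatMap g = u ++ s :: v) :
    ∃ L₁ a L₂ u' v', L = L₁ ++ a :: L₂ ∧ g a = u' ++ s :: v' ∧ u = L₁.flatMap g ++ u' ∧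
      v = v' ++ L₂.flatMap g := by
  induction L generalizing u with
  | nil => simp at h
  | cons a L ih =>
    rw [List.flatMap_cons] at h
    rcases List.append_eq_append_iff.1 h with ⟨w, hw1, hw2⟩ | ⟨w, hw1, hw2⟩
    · grind
    · cases w with
      | nil =>
        obtain ⟨L₁, b, L₂, u', v', rfl, hb, h0, rfl⟩ := ih (u := []) (by simpa using hw2.symm)
        refine ⟨a :: L₁, b, L₂, u', v', rfl, hb, ?_, rfl⟩
        grind
      | cons t w =>
        simp only [List.cons_append, List.cons.injEq] at hw2
        obtain ⟨rfl, rfl⟩ := hw2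
        exact ⟨[], a, L, u, w, rfl, hw1, by simp, rfl⟩

end Tagged

end

section

/-! ### Columns and their counting functions -/

/-- The number of unbarred letters `j` with `j ≤ a` in a column. -/
def lowCount (C : List Letter) (a : ℕ) : ℕ :=
  C.countP fun x => match x with
    | .pos j => decide (j ≤ a)
    | .bar _ => false

/-- The number of barred letters `j̄` with `j ≤ a` in a column. -/
def barCount (C : List Letter) (a : ℕ) : ℕ :=
  C.countP fun x => match x with
    | .pos _ => false
    | .bar j => decide (j ≤ a)

@[simp] theorem lowCount_nil (a : ℕ) : lowCount [] a = 0 := rfl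

@[simp] theorem barCount_nil (a : ℕ) : barCount [] a = 0 := rfl

@[simp] theorem lowCount_append (C D : List Letter) (a : ℕ) :
    lowCount (C ++ D) a = lowCount C a + lowCount D a := List.countP_append ..

@[simp] theorem barCount_append (C D : List Letter) (a : ℕ) :
    barCount (C ++ D) a = barCount C a + barCount D a := List.countP_append ..

@[simp] theorem lowCount_pos_cons (j : ℕ) (C : List Letter) (a : ℕ) :
    lowCount (.pos j :: C) a = lowCount C a + if j ≤ a then 1 else 0 := by
  simp [lowCount, List.countP_cons]

@[simp] theorem lowCount_bar_cons (j : ℕ) (C : List Letter) (a : ℕ) :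
    lowCount (.bar j :: C) a = lowCount C a := by
  simp [lowCount]

@[simp] theorem barCount_pos_cons (j : ℕ) (C : List Letter) (a : ℕ) :
    barCount (.pos j :: C) a = barCount C a := by
  simp [barCount]

@[simp] theorem barCount_bar_cons (j : ℕ) (C : List Letter) (a : ℕ) :
    barCount (.bar j :: C) a = barCount C a + if j ≤ a then 1 else 0 := by
  simp [barCount, List.countP_cons]

theorem lowCount_mono (C : List Letter) {a b : ℕ} (h : a ≤ b) : lowCount C a ≤ lowCount C b := by
  refine List.countP_mono_left fun x _ hx => ?_
  grind

theorem barCount_mono (C : List Letter) {a b : ℕ} (h : a ≤ b) : barCount C a ≤ barCount C b := by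
  refine List.countP_mono_left fun x _ hx => ?_
  grind

theorem lowCount_add_barCount_le (C : List Letter) (a : ℕ) :
    lowCount C a + barCount C a ≤ C.length := by
  induction C with
  | nil => simp
  | cons x C ih => cases x <;> simp <;> split_ifs <;> omega

theorem lowCount_le_length (C : List Letter) (a : ℕ) : lowCount C a ≤ C.length := by
  have := lowCount_add_barCount_le C a; omega

theorem lowCount_eq_zero {C : List Letter} {a : ℕ} (h : ∀ j, Letter.pos j ∈ C → a < j) :
    lowCount C a = 0 := by grind [lowCount, List.countP_eq_zero]

theorem barCount_eq_zero {C : List Letter} {a : ℕ} (h : ∀ j, Letter.bar j ∈ C → a < j) :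
    barCount C a = 0 := by grind [barCount, List.countP_eq_zero]

theorem lowCount_eq_length {C : List Letter} {a : ℕ} (h : ∀ x ∈ C, ∃ j ≤ a, x = Letter.pos j) :
    lowCount C a = C.length := by grind [lowCount, List.countP_eq_length]

theorem barCount_eq_length {C : List Letter} {a : ℕ} (h : ∀ x ∈ C, ∃ j ≤ a, x = Letter.bar j) :
    barCount C a = C.length := by grind [barCount, List.countP_eq_length]

@[simp] theorem Letter.rank_pos (n a : ℕ) : (Letter.pos a).rank n = a := rfl
@[simp] theorem Letter.rank_bar (n a : ℕ) : (Letter.bar a).rank n = 2 * n - a := rfl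

/-- `y` may stand directly above `x` in a column. -/
def Letter.Above (n : ℕ) (x y : Letter) : Prop :=
  y.Lt n x ∨ (x = Letter.pos n ∧ y = Letter.bar n) ∨ (x = Letter.bar n ∧ y = Letter.pos n)

/-- `y` may stand somewhere above `x` in a column. -/
def Letter.WeakAbove (n : ℕ) (x y : Letter) : Prop :=
  y.rank n < x.rank n ∨ (x.rank n = n ∧ y.rank n = n)

theorem Letter.WeakAbove.trans {n : ℕ} {x y z : Letter} (h : x.WeakAbove n y)
    (h' : y.WeakAbove n z) : x.WeakAbove n z := by
  unfold WeakAbove at *; omega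

theorem Letter.Above.weakAbove {n : ℕ} {x y : Letter} (h : x.Above n y) : x.WeakAbove n y := by
  rcases h with h | ⟨rfl, rfl⟩ | ⟨rfl, rfl⟩
  · exact Or.inl h
  · right; simp; omega
  · right; simp; omega

theorem columnStrict_iff_isChain {n : ℕ} {C : List Letter} :
    ColumnStrict n C ↔ C.IsChain (Letter.Above n) := by
  rw [List.isChain_iff_getElem]
  constructor
  · intro h p hp
    exact h p _ _ (List.getElem?_eq_getElem _) (List.getElem?_eq_getElem _)
  · intro h p x y hx hy
    obtain ⟨hp, rfl⟩ := List.getElem?_eq_some_iff.1 hx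
    obtain ⟨hp', rfl⟩ := List.getElem?_eq_some_iff.1 hy
    exact h p hp'

/-- `Letter.Above` is not transitive, since `n` and `n̄` may alternate in a column;
`Letter.WeakAbove` is the transitive relation that forgets the difference between these two letters.
-/
theorem ColumnStrict.pairwise {n : ℕ} {C : List Letter} (h : ColumnStrict n C) :
    C.Pairwise (Letter.WeakAbove n) := by
  have : IsTrans Letter (Letter.WeakAbove n) := ⟨fun _ _ _ => Letter.WeakAbove.trans⟩
  grind [List.isChain_iff_pairwise, columnStrict_iff_isChain, Letter.Above.weakAbove]

/-- The conditions on a single column. -/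
structure GoodColumn (n : ℕ) (C : List Letter) : Prop where
  valid : ∀ x ∈ C, x.Valid n
  strict : ColumnStrict n C
  length_le : C.length ≤ n
  cc : ∀ a < n, lowCount C a + barCount C a ≤ a

/-- A column with valid and strictly increasing entries. -/
structure StrictColumn (n : ℕ) (C : List Letter) : Prop where
  valid : ∀ x ∈ C, x.Valid n
  strict : ColumnStrict n C

theorem GoodColumn.toStrict {n : ℕ} {C : List Letter} (h : GoodColumn n C) : StrictColumn n C :=
  ⟨h.valid, h.strict⟩

namespace StrictColumn

variable {n : ℕ} {C : List Letter}

theorem split_above (h : StrictColumn n C) {lo hi : List Letter} {x : Letter}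
    (hC : C = lo ++ x :: hi) :
    (∀ y ∈ lo, y.WeakAbove n x) ∧ ∀ y ∈ hi, x.WeakAbove n y := by
  have := h.strict.pairwise
  grind [List.pairwise_cons]

/-- Above an unbarred `a < n` there are only smaller unbarred letters, and below it none of them. So
the row of `a` is read off from `lowCount`, which is what turns conditions on positions into
inequalities. -/
theorem index_pos (h : StrictColumn n C) {lo hi : List Letter} {a : ℕ} (ha : a < n)
    (hC : C = lo ++ .pos a :: hi) :
    lowCount lo a = 0 ∧ lowCount hi a = hi.length ∧ lo.length + lowCount C a = C.length := by
  obtain ⟨h1, h2⟩ := h.split_above hC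
  have e1 : lowCount lo a = 0 := lowCount_eq_zero fun j hj => by
    have := h1 _ hj
    simp only [Letter.WeakAbove, Letter.rank_pos, Letter.rank_bar] at this
    omega
  have e2 : lowCount hi a = hi.length := lowCount_eq_length fun x hx => by
    have := h2 _ hx
    have hv := h.valid x (by simp [hC, hx])
    cases x with
    | pos j =>
      simp only [Letter.WeakAbove, Letter.rank_pos, Letter.rank_bar] at this
      exact ⟨j, by omega, rfl⟩
    | bar j =>
      simp only [Letter.WeakAbove, Letter.rank_pos, Letter.rank_bar, Letter.Valid] at this hv
      omega
  simp_all

theorem index_bar (h : StrictColumn n C) {lo hi : List Letter} {a : ℕ} (ha : a < n)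
    (hC : C = lo ++ .bar a :: hi) :
    barCount lo a = lo.length ∧ barCount hi a = 0 ∧ lo.length + 1 = barCount C a := by
  obtain ⟨h1, h2⟩ := h.split_above hC
  have hva := h.valid (.bar a) (by simp [hC])
  have e1 : barCount lo a = lo.length := barCount_eq_length fun x hx => by
    have := h1 _ hx
    have hv := h.valid x (by simp [hC, hx])
    cases x with
    | pos j =>
      simp only [Letter.WeakAbove, Letter.rank_pos, Letter.rank_bar, Letter.Valid] at this hv
      omega
    | bar j =>
      simp only [Letter.WeakAbove, Letter.rank_pos, Letter.rank_bar, Letter.Valid] at this hv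
      exact ⟨j, by omega, rfl⟩
  grind [barCount, barCount_eq_zero, Letter.WeakAbove, Letter.rank_pos, Letter.rank_bar]

theorem exists_split {p : ℕ} {x : Letter} (hp : C[p]? = some x) :
    ∃ lo hi, C = lo ++ x :: hi ∧ lo.length = p := by
  obtain ⟨hl, hx⟩ := List.getElem?_eq_some_iff.1 hp
  refine ⟨C.take p, C.drop (p + 1), ?_, by simp; omega⟩
  rw [← hx, ← List.drop_eq_getElem_cons hl, List.take_append_drop]

theorem getElem?_pos (h : StrictColumn n C) {p a : ℕ} (ha : a < n)
    (hp : C[p]? = some (.pos a)) : p + lowCount C a = C.length := by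
  obtain ⟨lo, hi, hC, rfl⟩ := exists_split hp
  exact (h.index_pos ha hC).2.2

theorem getElem?_bar (h : StrictColumn n C) {p a : ℕ} (ha : a < n)
    (hp : C[p]? = some (.bar a)) : p + 1 = barCount C a := by
  obtain ⟨lo, hi, hC, rfl⟩ := exists_split hp
  exact (h.index_bar ha hC).2.2

theorem lowCount_zero (h : StrictColumn n C) : lowCount C 0 = 0 :=
  lowCount_eq_zero fun j hj => by have := h.valid _ hj; grind [Letter.Valid]

theorem barCount_zero (h : StrictColumn n C) : barCount C 0 = 0 :=
  barCount_eq_zero fun j hj => by have := h.valid _ hj; grind [Letter.Valid]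

theorem _root_.CrystalD.lowCount_succ (C : List Letter) (a : ℕ) :
    lowCount C (a + 1) = lowCount C a + C.count (.pos (a + 1)) := by
  induction C with
  | nil => simp
  | cons x C ih =>
    cases x with
    | pos j => grind [lowCount_pos_cons]
    | bar j => simp [ih]

theorem _root_.CrystalD.barCount_succ (C : List Letter) (a : ℕ) :
    barCount C (a + 1) = barCount C a + C.count (.bar (a + 1)) := by
  induction C with
  | nil => simp
  | cons x C ih =>
    cases x with
    | pos j => simp [ih]
    | bar j => grind [barCount_bar_cons]

theorem count_le_one (h : StrictColumn n C) {x : Letter} (hx : x.rank n ≠ n) : C.count x ≤ 1 := by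
  by_contra hc
  have hsub : List.Sublist (List.replicate 2 x) C :=
    List.replicate_sublist_iff.2 (by omega)
  have := h.strict.pairwise.sublist hsub
  simp [Letter.WeakAbove, hx] at this

theorem count_eq (h : StrictColumn n C) {x : Letter} (hx : x.rank n ≠ n) :
    C.count x = if x ∈ C then 1 else 0 := by
  have := h.count_le_one hx
  grind

theorem lowCount_step (h : StrictColumn n C) {a : ℕ} (h1 : 1 ≤ a) (ha : a < n) :
    lowCount C a = lowCount C (a - 1) + if Letter.pos a ∈ C then 1 else 0 := by
  obtain ⟨a, rfl⟩ : ∃ b, a = b + 1 := ⟨a - 1, by omega⟩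
  rw [lowCount_succ, h.count_eq (by simp [Letter.rank]; omega)]; rfl

theorem barCount_step (h : StrictColumn n C) {a : ℕ} (h1 : 1 ≤ a) (ha : a < n) :
    barCount C a = barCount C (a - 1) + if Letter.bar a ∈ C then 1 else 0 := by
  obtain ⟨a, rfl⟩ : ∃ b, a = b + 1 := ⟨a - 1, by omega⟩
  rw [barCount_succ, h.count_eq (by simp [Letter.rank]; omega)]; rfl

theorem lowCount_lip (h : StrictColumn n C) {a b : ℕ} (hab : a ≤ b) (hb : b < n) :
    lowCount C b + a ≤ lowCount C a + b := by
  induction b, hab using Nat.le_induction with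
  | base => omega
  | succ b hab ih =>
    have := h.lowCount_step (a := b + 1) (by omega) hb
    grind

theorem barCount_lip (h : StrictColumn n C) {a b : ℕ} (hab : a ≤ b) (hb : b < n) :
    barCount C b + a ≤ barCount C a + b := by
  induction b, hab using Nat.le_induction with
  | base => omega
  | succ b hab ih =>
    have := h.barCount_step (a := b + 1) (by omega) hb
    grind

/-- The letters `n` and `n̄` fill exactly the rows left between the barred letters below and the
unbarred letters above; `exists_index_n` is the converse. -/
theorem index_n (h : StrictColumn n C) {p : ℕ} {x : Letter}
    (hp : C[p]? = some x) (hx : x.rank n = n) :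
    barCount C (n - 1) ≤ p ∧ p + lowCount C (n - 1) < C.length := by
  obtain ⟨lo, hi, hC, rfl⟩ := exists_split hp
  obtain ⟨h1, h2⟩ := h.split_above hC
  have hvx := h.valid x (by simp [hC])
  have e1 : lowCount lo (n - 1) = 0 := lowCount_eq_zero fun j hj => by
    have := h1 _ hj
    simp only [Letter.WeakAbove, Letter.rank_pos, Letter.rank_bar, hx] at this
    have := h.valid (.pos j) (by simp [hC, hj])
    grind [Letter.Valid]
  have e2 : barCount hi (n - 1) = 0 := barCount_eq_zero fun j hj => by
    have := h2 _ hj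
    simp only [Letter.WeakAbove, Letter.rank_pos, Letter.rank_bar, hx] at this
    have := h.valid (.bar j) (by simp [hC, hj])
    grind [Letter.Valid]
  have e3 := lowCount_add_barCount_le lo (n - 1)
  have e4 := lowCount_add_barCount_le hi (n - 1)
  cases x with
  | pos j =>
    grind [Letter.Valid, Letter.rank_pos, Letter.rank_bar, lowCount_append, barCount_append,
        lowCount_pos_cons, barCount_pos_cons, List.length_append, List.length_cons]
  | bar j =>
    grind [Letter.Valid, Letter.rank_pos, Letter.rank_bar, lowCount_append, barCount_append,
        lowCount_bar_cons, barCount_bar_cons, List.length_append, List.length_cons]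

theorem exists_index_n (h : StrictColumn n C) {p : ℕ} (h1 : barCount C (n - 1) ≤ p)
    (h2 : p + lowCount C (n - 1) < C.length) :
    C[p]? = some (.pos n) ∨ C[p]? = some (.bar n) := by
  obtain ⟨x, hx⟩ : ∃ x, C[p]? = some x := ⟨_, List.getElem?_eq_getElem (by omega)⟩
  have hv := h.valid x (List.mem_of_getElem? hx)
  cases x with
  | pos a =>
    simp only [Letter.Valid] at hv
    rcases eq_or_lt_of_le hv.2 with rfl | ha
    · exact Or.inl hx
    · have := h.getElem?_pos ha hx
      have := lowCount_mono C (a := a) (b := n - 1) (by omega)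
      omega
  | bar a =>
    simp only [Letter.Valid] at hv
    rcases eq_or_lt_of_le hv.2 with rfl | ha
    · exact Or.inr hx
    · have := h.getElem?_bar ha hx
      have := barCount_mono C (a := a) (b := n - 1) (by omega)
      omega

theorem exists_pos (h : StrictColumn n C) {p a : ℕ} (ha : a < n) (hp : p < C.length)
    (h1 : C.length ≤ p + lowCount C a) : ∃ j ≤ a, C[p]? = some (.pos j) := by
  obtain ⟨x, hx⟩ : ∃ x, C[p]? = some x := ⟨_, List.getElem?_eq_getElem hp⟩
  have hv := h.valid x (List.mem_of_getElem? hx)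
  have hm := lowCount_mono C (a := a) (b := n - 1) (by omega)
  by_cases hr : x.rank n = n
  · have := h.index_n hx hr; omega
  cases x with
  | pos j =>
    simp only [Letter.Valid, Letter.rank_pos, Letter.rank_bar] at hv hr
    refine ⟨j, ?_, hx⟩
    by_contra hj
    have e1 := h.getElem?_pos (by omega) hx
    have e2 := h.lowCount_step (a := j) (by omega) (by omega)
    rw [if_pos (List.mem_of_getElem? hx)] at e2
    have := lowCount_mono C (a := a) (b := j - 1) (by omega)
    omega
  | bar j =>
    simp only [Letter.Valid, Letter.rank_pos, Letter.rank_bar] at hv hr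
    have e1 := h.getElem?_bar (by omega) hx
    have := barCount_mono C (a := j) (b := n - 1) (by omega)
    have := lowCount_add_barCount_le C (n - 1)
    omega

theorem exists_bar (h : StrictColumn n C) {p a : ℕ} (ha : a < n) (h1 : p < barCount C a) :
    ∃ j ≤ a, C[p]? = some (.bar j) := by
  have h0 := lowCount_add_barCount_le C (n - 1)
  have hm := barCount_mono C (a := a) (b := n - 1) (by omega)
  obtain ⟨x, hx⟩ : ∃ x, C[p]? = some x := ⟨_, List.getElem?_eq_getElem (by omega)⟩
  have hv := h.valid x (List.mem_of_getElem? hx)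
  by_cases hr : x.rank n = n
  · have := h.index_n hx hr; omega
  cases x with
  | bar j =>
    simp only [Letter.Valid, Letter.rank_pos, Letter.rank_bar] at hv hr
    refine ⟨j, ?_, hx⟩
    by_contra hj
    have e1 := h.getElem?_bar (by omega) hx
    have e2 := h.barCount_step (a := j) (by omega) (by omega)
    rw [if_pos (List.mem_of_getElem? hx)] at e2
    have := barCount_mono C (a := a) (b := j - 1) (by omega)
    omega
  | pos j =>
    simp only [Letter.Valid, Letter.rank_pos, Letter.rank_bar] at hv hr
    have e1 := h.getElem?_pos (by omega) hx
    have := lowCount_mono C (a := j) (b := n - 1) (by omega)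
    omega

/-- The letters `n` and `n̄` alternate in consecutive rows, so the parity of the row of one of them
fixes all the others. Without such letters the condition is empty and any sign, here `True`, will
do. -/
theorem exists_signOK (h : StrictColumn n C) (hn : 1 ≤ n) : ∃ s : Prop, SignOK n s C := by
  by_cases hM : barCount C (n - 1) + lowCount C (n - 1) < C.length
  swap
  · refine ⟨True, fun p => ⟨fun hp => ?_, fun hp => ?_⟩⟩
    · have := h.index_n hp (by simp [Letter.rank]); omega
    · have := h.index_n hp (by simp [Letter.rank]; omega); omega
  have key : ∀ k, barCount C (n - 1) + k + lowCount C (n - 1) < C.length →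
      (C[barCount C (n - 1) + k]? = some (.pos n) ↔
        (C[barCount C (n - 1)]? = some (.pos n) ↔ Even k)) := by
    intro k
    induction k with
    | zero => simp
    | succ k ih =>
      intro hk
      have ih := ih (by omega)
      have e1 := h.exists_index_n (p := barCount C (n - 1) + k) (by omega) (by omega)
      have e2 := h.exists_index_n (p := barCount C (n - 1) + (k + 1)) (by omega) (by omega)
      have e3 := h.strict (barCount C (n - 1) + k)
      grind [Nat.even_add_one, add_assoc, Letter.Lt, lt_irrefl, Letter.pos.injEq,
          Letter.bar.injEq, reduceCtorEq, Option.some.injEq]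
  have e0 := h.exists_index_n (p := barCount C (n - 1)) le_rfl hM
  refine ⟨(C[barCount C (n - 1)]? = some (.pos n) ↔ Even (barCount C (n - 1))), fun p => ?_⟩
  constructor
  · intro hp
    have hi := h.index_n hp (by simp [Letter.rank])
    grind [Nat.exists_eq_add_of_le]
  · intro hp
    have hi := h.index_n hp (by simp [Letter.rank]; omega)
    grind [Nat.exists_eq_add_of_le, Nat.not_even_iff_odd]

end StrictColumn

end

/-! ### The conditions on columns as inequalities between counting functions -/

section

/-- Passing from `a` to `a + 1` increases the sum by at most `1` unless both `a + 1` and its barred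
partner occur. In that case (1CC), with the two rows expressed through the counts, is the inequality
at `a + 1` itself. For the letter `n`, (1CC) is automatic because the height is at most `n`. -/
theorem StrictColumn.oneCC_iff {n : ℕ} {C : List Letter} (h : StrictColumn n C) (hn : 1 ≤ n)
    (hl : C.length ≤ n) : OneCC C ↔ ∀ a < n, lowCount C a + barCount C a ≤ a := by
  constructor
  · intro h1 a
    induction a with
    | zero => intro _; rw [h.lowCount_zero, h.barCount_zero]
    | succ a ih =>
      intro ha
      have ih := ih (by omega)
      have e1 := h.lowCount_step (a := a + 1) (by omega) ha
      have e2 := h.barCount_step (a := a + 1) (by omega) ha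
      simp only [Nat.add_sub_cancel] at e1 e2
      by_cases hp : Letter.pos (a + 1) ∈ C
      · by_cases hq : Letter.bar (a + 1) ∈ C
        · obtain ⟨p, hp'⟩ := List.mem_iff_getElem?.1 hp
          obtain ⟨q, hq'⟩ := List.mem_iff_getElem?.1 hq
          have e3 := h.getElem?_pos ha hp'
          have e4 := h.getElem?_bar ha hq'
          have e5 := lowCount_add_barCount_le C (a + 1)
          have := h1 (a + 1) p q (by omega) hp' hq'
          omega
        · rw [if_neg hq] at e2; split_ifs at e1 <;> omega
      grind
  · intro h1 a p q hqp hp hq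
    have hv := h.valid _ (List.mem_of_getElem? hp)
    simp only [Letter.Valid] at hv
    rcases eq_or_lt_of_le hv.2 with rfl | ha
    · omega
    · have e3 := h.getElem?_pos ha hp
      have e4 := h.getElem?_bar ha hq
      grind

/-- The conditions on two adjacent columns, in terms of the counting functions. -/
structure GoodPair (n : ℕ) (C C' : List Letter) : Prop where
  left : ∀ a b, a ≤ b → b < n → lowCount C b + barCount C b + a ≤ lowCount C a + barCount C' a + b
  right : ∀ a b, a ≤ b → b < n → lowCount C' b + barCount C' b + a + C.length ≤
    barCount C' a + lowCount C a + C'.length + b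
  mid : ∀ a < n, C.length + a ≤ n + lowCount C a + barCount C' a
  sign : (∃ s : Prop, SignOK n s C ∧ SignOK n s C') ∨
    ∀ a < n, C.length + a < n + lowCount C a + barCount C' a

/-- Unbarred entries of the right column are compared through `right` with `a = b`, barred entries
of the left column through `left` with `a = b`. Two letters of rank `n` in the same row agree if the
columns have a common sign; the strict form of `mid` at `n - 1` excludes such a row. -/
theorem GoodPair.rowWeak {n : ℕ} {C C' : List Letter} (hC : StrictColumn n C)
    (hC' : StrictColumn n C') (hn : 1 ≤ n) (h : GoodPair n C C') : RowWeak n C C' := by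
  intro p x y hx hy
  have hvx := hC.valid _ (List.mem_of_getElem? hx)
  have hvy := hC'.valid _ (List.mem_of_getElem? hy)
  have hpC := (List.getElem?_eq_some_iff.1 hx).1
  have hpC' := (List.getElem?_eq_some_iff.1 hy).1
  by_cases hry : y.rank n < n
  · cases y with
    | bar a => simp [Letter.Valid] at hry hvy; omega
    | pos a =>
      simp only [Letter.rank_pos, Letter.Valid] at hry hvy
      have e1 := hC'.getElem?_pos hry hy
      have e2 := h.right a a le_rfl hry
      obtain ⟨j, hj, hj'⟩ := hC.exists_pos hry hpC (by omega)
      rw [hx] at hj'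
      cases hj'
      rcases eq_or_lt_of_le hj with rfl | hj
      · exact Or.inl rfl
      · exact Or.inr hj
  by_cases hrx : n < x.rank n
  · cases x with
    | pos a => simp [Letter.Valid] at hrx hvx; omega
    | bar a =>
      simp only [Letter.rank_bar, Letter.Valid] at hrx hvx
      have e1 := hC.getElem?_bar (by omega) hx
      have e2 := h.left a a le_rfl (by omega)
      obtain ⟨j, hj, hj'⟩ := hC'.exists_bar (p := p) (a := a) (by omega) (by omega)
      rw [hy] at hj'
      cases hj'
      rcases eq_or_lt_of_le hj with rfl | hj
      · exact Or.inl rfl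
      · right; simp only [Letter.Lt, Letter.rank_bar]; omega
  rcases lt_or_ge (x.rank n) (y.rank n) with hlt | hge
  · exact Or.inr hlt
  have e1 := hC.index_n hx (by omega)
  have e2 := hC'.index_n hy (by omega)
  rcases h.sign with ⟨s, h1, h2⟩ | h1
  · left
    have f1 := hC.exists_index_n e1.1 e1.2
    have f2 := hC'.exists_index_n e2.1 e2.2
    have g1 := h1 p
    have g2 := h2 p
    rw [hx] at f1 g1
    rw [hy] at f2 g2
    simp only [Option.some.injEq] at f1 f2 g1 g2
    have hpar := Nat.not_even_iff_odd (n := p)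
    rcases f1 with rfl | rfl <;> rcases f2 with rfl | rfl <;>
      first | rfl | (exfalso; simp at g1 g2; tauto)
  grind

/-- This is `mid` at `a - 1` rather than at `a`: both counting functions jump at `a`, which sharpens
the bound. For letters of rank `n`, `mid` at `n - 1` leaves no room for one in `C` strictly above
one in `C'`. -/
theorem GoodPair.twoCC1 {n : ℕ} {C C' : List Letter} (hC : StrictColumn n C)
    (hC' : StrictColumn n C') (hn : 1 ≤ n) (h : GoodPair n C C') : TwoCC1 n C C' := by
  have key : ∀ (p q : ℕ) (x y : Letter), q < p → C[p]? = some x → C'[q]? = some y → x.rank n = n → y.rank n = n →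
      False := by
    intro p q x y hqp hx hy hrx hry
    have e1 := hC.index_n hx hrx
    have e2 := hC'.index_n hy hry
    have := h.mid (n - 1) (by omega)
    omega
  rintro a p q hqp (⟨hp, hq⟩ | ⟨rfl, hp, hq⟩)
  · have hv := hC.valid _ (List.mem_of_getElem? hp)
    simp only [Letter.Valid] at hv
    rcases eq_or_lt_of_le hv.2 with rfl | ha
    · exact (key p q _ _ hqp hp hq (by simp) (by simp; omega)).elim
    · have e1 := hC.getElem?_pos ha hp
      have e2 := hC'.getElem?_bar ha hq
      have e3 := hC.lowCount_step hv.1 ha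
      have e4 := hC'.barCount_step hv.1 ha
      rw [if_pos (List.mem_of_getElem? hp)] at e3
      rw [if_pos (List.mem_of_getElem? hq)] at e4
      have := h.mid (a - 1) (by omega)
      omega
  · exact (key p q _ _ hqp hp hq (by simp; omega) (by simp)).elim

/-- The inequality `left` or `right` at `(a - 1, b)`, according to the column that contains `b` and
`b̄`. If `a` or `b` equals `n`, the bound already follows from (2CC-1). -/
theorem GoodPair.twoCC2 {n : ℕ} {C C' : List Letter} (hC : StrictColumn n C)
    (hC' : StrictColumn n C') (hn : 1 ≤ n) (h : GoodPair n C C') : TwoCC2 C C' := by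
  have h1cc := h.twoCC1 hC hC' hn
  intro a b p q r s hqs hsr hrp hp hq hb
  have hv := hC.valid _ (List.mem_of_getElem? hp)
  simp only [Letter.Valid] at hv
  have hbn : b ≤ n := by
    rcases hb with ⟨hb, _⟩ | ⟨hb, _⟩
    · exact (hC.valid _ (List.mem_of_getElem? hb)).2
    · exact (hC'.valid _ (List.mem_of_getElem? hb)).2
  rcases eq_or_lt_of_le hv.2 with rfl | ha
  · have := h1cc a p q (by omega) (Or.inl ⟨hp, hq⟩)
    omega
  rcases eq_or_lt_of_le hbn with rfl | hbn
  · have := h1cc a p q (by omega) (Or.inl ⟨hp, hq⟩)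
    omega
  have e1 := hC.getElem?_pos ha hp
  have e2 := hC'.getElem?_bar ha hq
  have e3 := hC.lowCount_step hv.1 ha
  have e4 := hC'.barCount_step hv.1 ha
  rw [if_pos (List.mem_of_getElem? hp)] at e3
  rw [if_pos (List.mem_of_getElem? hq)] at e4
  rcases hb with ⟨hr, hs⟩ | ⟨hr, hs⟩
  · have e5 := hC.getElem?_pos hbn hr
    have e6 := hC.getElem?_bar hbn hs
    have hab : a - 1 ≤ b := by
      by_contra hc
      have := lowCount_mono C (a := b) (b := a - 1) (by omega)
      omega
    have := h.left (a - 1) b hab hbn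
    omega
  · have e5 := hC'.getElem?_pos hbn hr
    have e6 := hC'.getElem?_bar hbn hs
    have hab : a - 1 ≤ b := by
      by_contra hc
      have := barCount_mono C' (a := b) (b := a - 1) (by omega)
      omega
    have := h.right (a - 1) b hab hbn
    omega

/-- The odd and even configurations say precisely that the two alternating runs of `n`, `n̄`
disagree. So they are impossible for a common sign, and by `SignOK.config_of_ne` they are
unavoidable for opposite signs. -/
theorem SignOK.config {n : ℕ} {s : Prop} {C C' : List Letter} (h : SignOK n s C) (h' : SignOK n s C')
    {q r : ℕ} (hr : r < q) (hc : (Odd (q - r + 1) ∧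
      ((C'[q]? = some (Letter.pos n) ∧ C[r]? = some (Letter.bar n)) ∨
      (C'[q]? = some (Letter.bar n) ∧ C[r]? = some (Letter.pos n)))) ∨
      (Even (q - r + 1) ∧ ((C'[q]? = some (Letter.pos n) ∧ C[r]? = some (Letter.pos n)) ∨
      (C'[q]? = some (Letter.bar n) ∧ C[r]? = some (Letter.bar n))))) : False := by
  have h1 := h r
  have h2 := h' q
  grind

theorem SignOK.config_of_ne {n : ℕ} {s s' : Prop} {C C' : List Letter} (h : SignOK n s C)
    (h' : SignOK n s' C') (hs : ¬ (s ↔ s')) {q r : ℕ} (hr : r < q)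
    (t1 : C[r]? = some (.pos n) ∨ C[r]? = some (.bar n))
    (t2 : C'[q]? = some (.pos n) ∨ C'[q]? = some (.bar n)) : (Odd (q - r + 1) ∧
      ((C'[q]? = some (Letter.pos n) ∧ C[r]? = some (Letter.bar n)) ∨
      (C'[q]? = some (Letter.bar n) ∧ C[r]? = some (Letter.pos n)))) ∨
      (Even (q - r + 1) ∧ ((C'[q]? = some (Letter.pos n) ∧ C[r]? = some (Letter.pos n)) ∨
      (C'[q]? = some (Letter.bar n) ∧ C[r]? = some (Letter.bar n)))) := by
  have h1 := h r
  have h2 := h' q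
  grind

theorem GoodPair.twoCC3 {n : ℕ} {C C' : List Letter} (hC : StrictColumn n C)
    (hC' : StrictColumn n C') (h : GoodPair n C C') : TwoCC3 n C C' := by
  intro a p q r s hc
  rcases h.sign with ⟨t, h1, h2⟩ | h1
  · exfalso
    rcases hc with ⟨_, _, _, hrq, _, e, _, _, h3⟩ | ⟨_, _, _, hrq, _, e, _, _, h3⟩
    · exact h1.config h2 hrq (Or.inl ⟨e, h3⟩)
    · exact h1.config h2 hrq (Or.inr ⟨e, h3⟩)
  · obtain ⟨ha1, ha, hp, hq⟩ : 1 ≤ a ∧ a < n ∧ C[p]? = some (.pos a) ∧ C'[s]? = some (.bar a) := by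
      rcases hc with ⟨ha1, ha, _, _, _, _, hp, hq, _⟩ | ⟨ha1, ha, _, _, _, _, hp, hq, _⟩ <;>
        exact ⟨ha1, ha, hp, hq⟩
    have e1 := hC.getElem?_pos ha hp
    have e2 := hC'.getElem?_bar ha hq
    have e3 := hC.lowCount_step ha1 ha
    have e4 := hC'.barCount_step ha1 ha
    grind

section Converse

variable {n : ℕ} {C C' : List Letter}

/-- If `C` had more barred letters up to `a`, the row just above those of `C'` would hold some `j̄`
with `j ≤ a` in `C`. Its right neighbour would then be another such letter of `C'`, in a row beyond
the last one available. -/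
theorem RowWeak.barCount_le (hC : StrictColumn n C)
    (hC' : StrictColumn n C') (hl : C.length ≤ C'.length) (h : RowWeak n C C') {a : ℕ}
    (ha : a < n) : barCount C a ≤ barCount C' a := by
  by_contra hc
  obtain ⟨j, hj, hx⟩ := hC.exists_bar (p := barCount C' a) ha (by omega)
  have hp := (List.getElem?_eq_some_iff.1 hx).1
  have hp' : barCount C' a < C'.length := by omega
  have hy := List.getElem?_eq_getElem hp'
  have hr := h _ _ _ hx hy
  have hvx := hC.valid _ (List.mem_of_getElem? hx)
  have hvy := hC'.valid _ (List.mem_of_getElem? hy)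
  have hk : ∃ k ≤ a, C'[barCount C' a] = Letter.bar k := by
    grind [barCount, Letter.Le, Letter.Lt, Letter.Valid, Letter.rank_pos, Letter.rank_bar,
        reduceCtorEq, Letter.bar.injEq]
  obtain ⟨k, hk, hk'⟩ := hk
  rw [hk'] at hy
  have := hC'.getElem?_bar (by omega) hy
  have := barCount_mono C' hk
  omega

theorem RowWeak.lowCount_le (hC : StrictColumn n C)
    (hC' : StrictColumn n C') (hl : C.length ≤ C'.length) (h : RowWeak n C C') {a : ℕ}
    (ha : a < n) : lowCount C' a + C.length ≤ lowCount C a + C'.length := by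
  by_contra hc
  have := lowCount_le_length C' a
  have := lowCount_le_length C a
  have hp : C.length - lowCount C a - 1 < C.length := by omega
  obtain ⟨j, hj, hy⟩ := hC'.exists_pos (p := C.length - lowCount C a - 1) ha (by omega) (by omega)
  have hx := List.getElem?_eq_getElem hp
  have hr := h _ _ _ hx hy
  have hvx := hC.valid _ (List.mem_of_getElem? hx)
  have hvy := hC'.valid _ (List.mem_of_getElem? hy)
  have hk : ∃ k ≤ a, C[C.length - lowCount C a - 1] = Letter.pos k := by
    grind [lowCount, Letter.Le, Letter.Lt, Letter.Valid, Letter.rank_pos, Letter.rank_bar,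
        reduceCtorEq, Letter.pos.injEq]
  obtain ⟨k, hk, hk'⟩ := hk
  rw [hk'] at hx
  have := hC.getElem?_pos (by omega) hx
  have := lowCount_mono C hk
  omega

/-- Induction on the length of the interval from `a` to `b`. The inequality follows from the one for
`(a, b - 1)` unless `b` and `b̄` both occur in `C`, and from the one for `(a + 1, b)` unless `a + 1`
occurs in `C` and its barred partner in `C'`. With all four letters present it is (2CC-2). -/
theorem goodPair_left (hC : StrictColumn n C)
    (hC' : StrictColumn n C') (hl : C.length ≤ C'.length) (h : RowWeak n C C')
    (h2 : TwoCC2 C C') : ∀ k a b, b - a ≤ k → a ≤ b → b < n →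
      lowCount C b + barCount C b + a ≤ lowCount C a + barCount C' a + b := by
  intro k
  induction k with
  | zero =>
    intro a b hk hab hb
    obtain rfl : a = b := by omega
    have := h.barCount_le hC hC' hl hb
    omega
  | succ k ih =>
    intro a b hk hab hb
    rcases eq_or_lt_of_le hab with rfl | hlt
    · simp_all
    have e1 := ih a (b - 1) (by omega) (by omega) (by omega)
    have e2 := ih (a + 1) b (by omega) (by omega) hb
    have s1 := hC.lowCount_step (a := b) (by omega) hb
    have s2 := hC.barCount_step (a := b) (by omega) hb
    have s3 := hC.lowCount_step (a := a + 1) (by omega) (by omega)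
    have s4 := hC'.barCount_step (a := a + 1) (by omega) (by omega)
    simp only [Nat.add_sub_cancel] at s3 s4
    by_cases hb1 : Letter.pos b ∈ C
    swap
    · rw [if_neg hb1] at s1; split_ifs at s2 <;> omega
    by_cases hb2 : Letter.bar b ∈ C
    swap
    · rw [if_neg hb2] at s2; split_ifs at s1 <;> omega
    by_cases ha1 : Letter.pos (a + 1) ∈ C
    swap
    · rw [if_neg ha1] at s3; split_ifs at s4 <;> omega
    by_cases ha2 : Letter.bar (a + 1) ∈ C'
    swap
    · grind
    rw [if_pos ha1] at s3
    rw [if_pos ha2] at s4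
    obtain ⟨r, hr⟩ := List.mem_iff_getElem?.1 hb1
    obtain ⟨s, hs⟩ := List.mem_iff_getElem?.1 hb2
    obtain ⟨p, hp⟩ := List.mem_iff_getElem?.1 ha1
    obtain ⟨q, hq⟩ := List.mem_iff_getElem?.1 ha2
    have f1 := hC.getElem?_pos hb hr
    have f2 := hC.getElem?_bar hb hs
    have f3 := hC.getElem?_pos (by omega) hp
    have f4 := hC'.getElem?_bar (by omega) hq
    have m1 := lowCount_mono C (a := a + 1) (b := b) (by omega)
    have m2 := lowCount_add_barCount_le C b
    have m3 := hC.lowCount_lip hab hb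
    -- If the pair of `b` does not lie between the rows of the outer pair, then `barCount C b ≤
    -- barCount C' a`, and it suffices that `lowCount` grows by at most one per step.
    by_cases hqs : q ≤ s
    · have := h2 (a + 1) b p q r s hqs (by omega) (by omega) hp hq (Or.inl ⟨hr, hs⟩)
      omega
    · omega

theorem goodPair_right (hC : StrictColumn n C)
    (hC' : StrictColumn n C') (hl : C.length ≤ C'.length) (h : RowWeak n C C')
    (h2 : TwoCC2 C C') : ∀ k a b, b - a ≤ k → a ≤ b → b < n →
      lowCount C' b + barCount C' b + a + C.length ≤
        barCount C' a + lowCount C a + C'.length + b := by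
  intro k
  induction k with
  | zero =>
    intro a b hk hab hb
    obtain rfl : a = b := by omega
    have := h.lowCount_le hC hC' hl hb
    omega
  | succ k ih =>
    intro a b hk hab hb
    rcases eq_or_lt_of_le hab with rfl | hlt
    · simp_all
    have e1 := ih a (b - 1) (by omega) (by omega) (by omega)
    have e2 := ih (a + 1) b (by omega) (by omega) hb
    have s1 := hC'.lowCount_step (a := b) (by omega) hb
    have s2 := hC'.barCount_step (a := b) (by omega) hb
    have s3 := hC.lowCount_step (a := a + 1) (by omega) (by omega)
    have s4 := hC'.barCount_step (a := a + 1) (by omega) (by omega)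
    simp only [Nat.add_sub_cancel] at s3 s4
    by_cases hb1 : Letter.pos b ∈ C'
    swap
    · rw [if_neg hb1] at s1; split_ifs at s2 <;> omega
    by_cases hb2 : Letter.bar b ∈ C'
    swap
    · rw [if_neg hb2] at s2; split_ifs at s1 <;> omega
    by_cases ha1 : Letter.pos (a + 1) ∈ C
    swap
    · rw [if_neg ha1] at s3; split_ifs at s4 <;> omega
    by_cases ha2 : Letter.bar (a + 1) ∈ C'
    swap
    · grind
    rw [if_pos ha1] at s3
    rw [if_pos ha2] at s4
    obtain ⟨r, hr⟩ := List.mem_iff_getElem?.1 hb1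
    obtain ⟨s, hs⟩ := List.mem_iff_getElem?.1 hb2
    obtain ⟨p, hp⟩ := List.mem_iff_getElem?.1 ha1
    obtain ⟨q, hq⟩ := List.mem_iff_getElem?.1 ha2
    have f1 := hC'.getElem?_pos hb hr
    have f2 := hC'.getElem?_bar hb hs
    have f3 := hC.getElem?_pos (by omega) hp
    have f4 := hC'.getElem?_bar (by omega) hq
    have m1 := barCount_mono C' (a := a + 1) (b := b) (by omega)
    have m2 := lowCount_add_barCount_le C' b
    have m3 := hC'.barCount_lip hab hb
    by_cases hrp : r ≤ p
    · have := h2 (a + 1) b p q r s (by omega) (by omega) hrp hp hq (Or.inr ⟨hr, hs⟩)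
      omega
    · omega

/-- Descending induction from `n - 1`: a step can only fail when `a + 1` occurs in `C` and its
barred partner in `C'`, and then (2CC-1) gives the bound. -/
theorem goodPair_mid (hC : StrictColumn n C)
    (hC' : StrictColumn n C') (hl : C.length ≤ C'.length) (hn : 1 ≤ n) (h : RowWeak n C C')
    (h1 : TwoCC1 n C C') : ∀ k, ∀ a < n, n - 1 - a ≤ k →
      C.length + a ≤ n + lowCount C a + barCount C' a := by
  -- If this failed, two consecutive rows of `C` would hold letters of rank `n`, with another one to
  -- the right of the lower row. That one equals its left neighbour, hence differs from the upper
  -- letter of `C`, and (2CC-1) for `n` and `n̄` is violated.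
  have base : C.length + (n - 1) ≤ n + lowCount C (n - 1) + barCount C' (n - 1) := by
    by_contra hc
    have r1 := h.barCount_le hC hC' hl (a := n - 1) (by omega)
    have r2 := h.lowCount_le hC hC' hl (a := n - 1) (by omega)
    have e1 := hC.exists_index_n (p := barCount C' (n - 1)) (by omega) (by omega)
    have e2 := hC.exists_index_n (p := barCount C' (n - 1) + 1) (by omega) (by omega)
    have e3 := hC'.exists_index_n (p := barCount C' (n - 1)) (by omega) (by omega)
    have e4 := hC.strict (barCount C' (n - 1))
    have e5 := h (barCount C' (n - 1))
    have e6 := h1 n (barCount C' (n - 1) + 1) (barCount C' (n - 1)) (by omega)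
    grind [Letter.Lt, Letter.Le, lt_irrefl, reduceCtorEq, Letter.rank_pos, Letter.rank_bar]
  intro k
  induction k with
  | zero => grind
  | succ k ih =>
    intro a ha hk
    rcases eq_or_lt_of_le (show a ≤ n - 1 by omega) with rfl | hlt
    · exact base
    have e1 := ih (a + 1) (by omega) (by omega)
    have s3 := hC.lowCount_step (a := a + 1) (by omega) (by omega)
    have s4 := hC'.barCount_step (a := a + 1) (by omega) (by omega)
    simp only [Nat.add_sub_cancel] at s3 s4
    by_cases ha1 : Letter.pos (a + 1) ∈ C
    swap
    · grind
    by_cases ha2 : Letter.bar (a + 1) ∈ C'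
    swap
    · grind
    rw [if_pos ha1] at s3
    rw [if_pos ha2] at s4
    obtain ⟨p, hp⟩ := List.mem_iff_getElem?.1 ha1
    obtain ⟨q, hq⟩ := List.mem_iff_getElem?.1 ha2
    have f3 := hC.getElem?_pos (by omega) hp
    have f4 := hC'.getElem?_bar (by omega) hq
    by_cases hqp : q < p
    · have := h1 (a + 1) p q hqp (Or.inl ⟨hp, hq⟩)
      omega
    · omega

/-- If one of the columns has no letter of rank `n`, then `left` or `right` with `b = n - 1` is
already the strict inequality. Otherwise both signs are determined, and if they differ, (2CC-3)
improves `mid` by one. -/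
theorem goodPair_sign (hC : StrictColumn n C)
    (hC' : StrictColumn n C') (hn : 1 ≤ n) (h : RowWeak n C C')
    (hleft : ∀ a b, a ≤ b → b < n →
      lowCount C b + barCount C b + a ≤ lowCount C a + barCount C' a + b)
    (hright : ∀ a b, a ≤ b → b < n → lowCount C' b + barCount C' b + a + C.length ≤
      barCount C' a + lowCount C a + C'.length + b)
    (hmid : ∀ a < n, C.length + a ≤ n + lowCount C a + barCount C' a)
    (h3 : TwoCC3 n C C') : (∃ s : Prop, SignOK n s C ∧ SignOK n s C') ∨
    ∀ a < n, C.length + a < n + lowCount C a + barCount C' a := by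
  by_cases hM : lowCount C (n - 1) + barCount C (n - 1) < C.length
  swap
  · right; intro a ha
    have := hleft a (n - 1) (by omega) (by omega)
    omega
  by_cases hM' : lowCount C' (n - 1) + barCount C' (n - 1) < C'.length
  swap
  · right; intro a ha
    have := hright a (n - 1) (by omega) (by omega)
    omega
  obtain ⟨s, hs⟩ := hC.exists_signOK hn
  obtain ⟨s', hs'⟩ := hC'.exists_signOK hn
  by_cases hss : s ↔ s'
  · grind
  right
  -- Equality in `mid` at `n - 1` would place letters of rank `n` side by side in one row; being
  -- equal, they would give the columns the same sign.
  have base : C.length + (n - 1) < n + lowCount C (n - 1) + barCount C' (n - 1) := by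
    by_contra hc
    have m1 := hmid (n - 1) (by omega)
    have m2 := hright (n - 1) (n - 1) le_rfl (by omega)
    have m3 := hleft (n - 1) (n - 1) le_rfl (by omega)
    have e1 := hC.exists_index_n (p := barCount C' (n - 1)) (by omega) (by omega)
    have e3 := hC'.exists_index_n (p := barCount C' (n - 1)) (by omega) (by omega)
    have e5 := h (barCount C' (n - 1))
    have g1 := hs (barCount C' (n - 1))
    have g2 := hs' (barCount C' (n - 1))
    rw [← Nat.not_even_iff_odd] at g1 g2
    rcases e1 with e1 | e1 <;> rcases e3 with e3 | e3 <;> have e5 := e5 _ _ e1 e3 <;>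
      simp only [Letter.Lt, Letter.Le, lt_irrefl, reduceCtorEq, Letter.rank_pos, Letter.rank_bar,
        false_or, or_false] at e5 <;>
      simp only [e1, e3, true_implies, Option.some.injEq, reduceCtorEq, false_implies, and_true,
        true_and] at g1 g2 <;> first | omega | tauto
  have key : ∀ k, ∀ a < n, n - 1 - a ≤ k → C.length + a < n + lowCount C a + barCount C' a := by
    intro k
    induction k with
    | zero => intro a ha hk; obtain rfl : a = n - 1 := by omega
              exact base
    | succ k ih =>
      intro a ha hk
      rcases eq_or_lt_of_le (show a ≤ n - 1 by omega) with rfl | hlt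
      · exact base
      have e1 := ih (a + 1) (by omega) (by omega)
      have s3 := hC.lowCount_step (a := a + 1) (by omega) (by omega)
      have s4 := hC'.barCount_step (a := a + 1) (by omega) (by omega)
      simp only [Nat.add_sub_cancel] at s3 s4
      by_cases ha1 : Letter.pos (a + 1) ∈ C
      swap
      · rw [if_neg ha1] at s3; split_ifs at s4 <;> omega
      by_cases ha2 : Letter.bar (a + 1) ∈ C'
      swap
      · grind
      rw [if_pos ha1] at s3
      rw [if_pos ha2] at s4
      obtain ⟨p, hp⟩ := List.mem_iff_getElem?.1 ha1
      obtain ⟨q, hq⟩ := List.mem_iff_getElem?.1 ha2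
      have f3 := hC.getElem?_pos (by omega) hp
      have f4 := hC'.getElem?_bar (by omega) hq
      have m1 := hC.lowCount_lip (a := a + 1) (b := n - 1) (by omega) (by omega)
      have m2 := hC'.barCount_lip (a := a + 1) (b := n - 1) (by omega) (by omega)
      have m3 := lowCount_add_barCount_le C (n - 1)
      -- `r` is the highest row of `C`, and `q'` the lowest row of `C'`, with a letter of rank `n`.
      -- The strict inequality at `n - 1` says that `r < q'`, so opposite signs produce a
      -- configuration in these rows.
      obtain ⟨r, hr⟩ : ∃ r, r = C.length - lowCount C (n - 1) - 1 := ⟨_, rfl⟩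
      obtain ⟨q', hq'⟩ : ∃ q', q' = barCount C' (n - 1) := ⟨_, rfl⟩
      by_cases hsr : q ≤ r
      swap
      · omega
      by_cases hqp : q' ≤ p
      swap
      · omega
      have hrq : r < q' := by omega
      have t1 := hC.exists_index_n (p := r) (by omega) (by omega)
      have t2 := hC'.exists_index_n (p := q') (by omega) (by omega)
      have hcf := hs.config_of_ne hs' hss hrq t1 t2
      have := h3 (a + 1) p q' r q (by grind [OddConfig, EvenConfig])
      omega
  exact fun a ha => key _ a ha le_rfl

theorem goodPair_iff (hC : StrictColumn n C) (hC' : StrictColumn n C') (hl : C.length ≤ C'.length)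
    (hn : 1 ≤ n) : GoodPair n C C' ↔
      RowWeak n C C' ∧ TwoCC1 n C C' ∧ TwoCC2 C C' ∧ TwoCC3 n C C' := by
  constructor
  · intro h
    exact ⟨h.rowWeak hC hC' hn, h.twoCC1 hC hC' hn, h.twoCC2 hC hC' hn, h.twoCC3 hC hC'⟩
  · rintro ⟨h, h1, h2, h3⟩
    have hleft := fun a b => goodPair_left hC hC' hl h h2 _ a b le_rfl
    have hright := fun a b => goodPair_right hC hC' hl h h2 _ a b le_rfl
    have hmid := fun a ha => goodPair_mid hC hC' hl hn h h1 _ a ha le_rfl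
    exact ⟨hleft, hright, hmid, goodPair_sign hC hC' hn h hleft hright hmid h3⟩

end Converse

end

section

/-! ### Arithmetic of the Kashiwara operators -/

/-- The inequalities on the counting functions of two adjacent columns. -/
structure PairIneq (K N N' c : ℕ) (A B A' B' : ℕ → ℕ) : Prop where
  left : ∀ a b, a ≤ b → b ≤ K → A b + B b + a ≤ A a + B' a + b
  right : ∀ a b, a ≤ b → b ≤ K → A' b + B' b + a + N ≤ B' a + A a + N' + b
  mid : ∀ a ≤ K, N + a ≤ c + A a + B' a

/-- The increments at `j` and `j + 1`. -/
structure Increments (A B : ℕ → ℕ) (j x₁ x₂ x₃ x₄ : ℕ) : Prop where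
  le₁ : x₁ ≤ 1
  le₂ : x₂ ≤ 1
  le₃ : x₃ ≤ 1
  le₄ : x₄ ≤ 1
  low : A j = A (j - 1) + x₁
  low_succ : A (j + 1) = A j + x₂
  bar_succ : B (j + 1) = B j + x₃
  bar : B j = B (j - 1) + x₄

/-- `φ` of the word `+^{x₁} -^{x₂} +^{x₃} -^{x₄}`. -/
def phi4 (x₁ x₂ x₃ x₄ : ℕ) : ℕ := x₃ + (x₁ - x₂) - x₄

/-- `ε` of the word `+^{x₁} -^{x₂} +^{x₃} -^{x₄}`. -/
def eps4 (x₁ x₂ x₃ x₄ : ℕ) : ℕ := (x₂ - x₁) + (x₄ - (x₃ + (x₁ - x₂)))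

section

variable {j K N N' c : ℕ} {A B A' B' D : ℕ → ℕ} {x₁ x₂ x₃ x₄ y₁ y₂ y₃ y₄ : ℕ}

/-- `f` turns `j` into `j + 1` in the left column. -/
theorem PairIneq.left_f_low (h : PairIneq K N N' c A B A' B') (hj : 1 ≤ j) (hK : j < K)
    (hx : Increments A B j x₁ x₂ x₃ x₄) (hy : Increments A' B' j y₁ y₂ y₃ y₄)
    (hD : ∀ a, a ≠ j → D a = A a) (hDj : D j + 1 = A j)
    (h1 : x₁ = 1) (h2 : x₂ = 0) (h3 : x₄ ≤ x₃) (h4 : phi4 y₁ y₂ y₃ y₄ = 0) :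
    PairIneq K N N' c D B A' B' := by
  obtain ⟨_, _, _, _, _, _, _, _⟩ := hx
  obtain ⟨_, _, _, _, _, _, _, _⟩ := hy
  unfold phi4 at h4
  constructor
  · intro a b hab hb
    have e0 := h.left a b hab hb
    rcases eq_or_ne b j with rfl | hbj
    · grind
    · rw [hD b hbj]
      rcases eq_or_ne a j with rfl | haj
      -- Pattern of all these proofs: the inequality at `j - 1` supplies the missing unit if `y₄ =
      -- 1`, the one at `j + 1` supplies it if `y₃ = 0`. In the remaining case `y₃ = 1`, `y₄ = 0`
      -- the value of `phi4` would be positive.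
      · have e1 := h.left (a - 1) b (by omega) hb
        have e2 := h.left (a + 1) b (by omega) hb
        omega
      · rw [hD a haj]; omega
  · intro a b hab hb
    have e0 := h.right a b hab hb
    rcases eq_or_ne a j with rfl | haj
    · have e1 := h.right (a - 1) b (by omega) hb
      rcases eq_or_lt_of_le hab with rfl | hlt
      · have e2 := h.right (a + 1) (a + 1) le_rfl hK
        have e3 := h.right (a - 1) (a - 1) le_rfl (by omega)
        omega
      · have e2 := h.right (a + 1) b (by omega) hb
        omega
    · rw [hD a haj]; omega
  · intro a ha
    have e0 := h.mid a ha
    rcases eq_or_ne a j with rfl | haj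
    · have e1 := h.mid (a - 1) (by omega)
      have e2 := h.mid (a + 1) (by omega)
      omega
    · rw [hD a haj]; omega

/-- `f` turns `\overline{j+1}` into `j̄` in the left column. -/
theorem PairIneq.left_f_bar (h : PairIneq K N N' c A B A' B') (hj : 1 ≤ j) (hK : j < K)
    (hx : Increments A B j x₁ x₂ x₃ x₄) (hy : Increments A' B' j y₁ y₂ y₃ y₄)
    (hD : ∀ a, a ≠ j → D a = B a) (hDj : D j = B j + 1)
    (h1 : x₃ = 1) (h2 : x₄ = 0) (h3 : x₁ ≤ x₂)
    (h4 : phi4 y₁ y₂ y₃ y₄ + x₁ - x₂ = 0) :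
    PairIneq K N N' c A D A' B' := by
  obtain ⟨_, _, _, _, _, _, _, _⟩ := hx
  obtain ⟨_, _, _, _, _, _, _, _⟩ := hy
  unfold phi4 at h4
  constructor
  · intro a b hab hb
    have e0 := h.left a b hab hb
    rcases eq_or_ne b j with rfl | hbj
    · have e1 := h.left a (b + 1) (by omega) hK
      rcases eq_or_ne a b with rfl | haj
      -- On the diagonal only `y₃ = 1`, `y₄ = 0` is critical. Then `h4` forces `x₁ = 0` and `x₂ =
      -- 1`, and the inequality at `(j, j + 1)` gives the missing unit.
      · have e2 := h.left (a - 1) (a - 1) (by omega) (by omega)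
        have e3 := h.left (a + 1) (a + 1) (by omega) (by omega)
        omega
      · have e2 := h.left a (b - 1) (by omega) (by omega)
        omega
    simp_all
  · exact h.right
  · exact h.mid

/-- `f` turns `j` into `j + 1` in the right column. -/
theorem PairIneq.right_f_low (h : PairIneq K N N' c A B A' B')
    (hD : ∀ a, a ≠ j → D a = A' a) (hDj : D j + 1 = A' j) :
    PairIneq K N N' c A B D B' := by
  refine ⟨h.left, fun a b hab hb => ?_, h.mid⟩
  have e0 := h.right a b hab hb
  grind

/-- `f` turns `\overline{j+1}` into `j̄` in the right column. -/
theorem PairIneq.right_f_bar (h : PairIneq K N N' c A B A' B') (hj : 1 ≤ j) (hK : j < K)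
    (hy : Increments A' B' j y₁ y₂ y₃ y₄)
    (hD : ∀ a, a ≠ j → D a = B' a) (hDj : D j = B' j + 1)
    (h1 : y₃ = 1) (h2 : y₄ = 0) (h3 : y₁ ≤ y₂) :
    PairIneq K N N' c A B A' D := by
  obtain ⟨_, _, _, _, _, _, _, _⟩ := hy
  constructor
  · intro a b hab hb
    have e0 := h.left a b hab hb
    grind
  · intro a b hab hb
    have e0 := h.right a b hab hb
    rcases eq_or_ne b j with rfl | hbj
    · rcases eq_or_ne a b with rfl | haj
      · omega
      · have e1 := h.right a (b + 1) (by omega) hK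
        have e2 := h.right a (b - 1) (by omega) (by omega)
        rw [hD a haj]; omega
    grind
  · intro a ha
    have e0 := h.mid a ha
    grind

/-- `e` turns `j + 1` into `j` in the left column. -/
theorem PairIneq.left_e_low (h : PairIneq K N N' c A B A' B') (hj : 1 ≤ j) (hK : j < K)
    (hx : Increments A B j x₁ x₂ x₃ x₄)
    (hD : ∀ a, a ≠ j → D a = A a) (hDj : D j = A j + 1)
    (h1 : x₂ = 1) (h2 : x₁ = 0) (h3 : x₄ ≤ x₃) :
    PairIneq K N N' c D B A' B' := by
  obtain ⟨_, _, _, _, _, _, _, _⟩ := hx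
  constructor
  · intro a b hab hb
    have e0 := h.left a b hab hb
    rcases eq_or_ne b j with rfl | hbj
    · rcases eq_or_ne a b with rfl | haj
      · omega
      · have e1 := h.left a (b + 1) (by omega) hK
        have e2 := h.left a (b - 1) (by omega) (by omega)
        rw [hD a haj]; omega
    grind
  · intro a b hab hb
    have e0 := h.right a b hab hb
    grind
  · intro a ha
    have e0 := h.mid a ha
    grind

/-- `e` turns `j̄` into `\overline{j+1}` in the left column. -/
theorem PairIneq.left_e_bar (h : PairIneq K N N' c A B A' B')
    (hD : ∀ a, a ≠ j → D a = B a) (hDj : D j + 1 = B j) :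
    PairIneq K N N' c A D A' B' := by
  refine ⟨fun a b hab hb => ?_, h.right, h.mid⟩
  have e0 := h.left a b hab hb
  grind

/-- `e` turns `j + 1` into `j` in the right column. -/
theorem PairIneq.right_e_low (h : PairIneq K N N' c A B A' B') (hj : 1 ≤ j) (hK : j < K)
    (hx : Increments A B j x₁ x₂ x₃ x₄) (hy : Increments A' B' j y₁ y₂ y₃ y₄)
    (hD : ∀ a, a ≠ j → D a = A' a) (hDj : D j = A' j + 1)
    (h1 : y₂ = 1) (h2 : y₁ = 0) (h3 : y₄ ≤ y₃)
    (h4 : eps4 x₁ x₂ x₃ x₄ - (y₃ - y₄) = 0) :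
    PairIneq K N N' c A B D B' := by
  obtain ⟨_, _, _, _, _, _, _, _⟩ := hx
  obtain ⟨_, _, _, _, _, _, _, _⟩ := hy
  unfold eps4 at h4
  refine ⟨h.left, fun a b hab hb => ?_, h.mid⟩
  have e0 := h.right a b hab hb
  rcases eq_or_ne b j with rfl | hbj
  · have e1 := h.right a (b + 1) (by omega) hK
    rcases eq_or_ne a b with rfl | haj
    · have e2 := h.right (a - 1) (a - 1) (by omega) (by omega)
      have e3 := h.right (a + 1) (a + 1) (by omega) (by omega)
      omega
    · have e2 := h.right a (b - 1) (by omega) (by omega)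
      omega
  · rw [hD b hbj]; omega

/-- `e` turns `j̄` into `\overline{j+1}` in the right column. -/
theorem PairIneq.right_e_bar (h : PairIneq K N N' c A B A' B') (hj : 1 ≤ j) (hK : j < K)
    (hx : Increments A B j x₁ x₂ x₃ x₄) (hy : Increments A' B' j y₁ y₂ y₃ y₄)
    (hD : ∀ a, a ≠ j → D a = B' a) (hDj : D j + 1 = B' j)
    (h1 : y₄ = 1) (h2 : y₃ = 0) (h3 : y₁ ≤ y₂) (h4 : eps4 x₁ x₂ x₃ x₄ = 0) :
    PairIneq K N N' c A B A' D := by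
  obtain ⟨_, _, _, _, _, _, _, _⟩ := hx
  obtain ⟨_, _, _, _, _, _, _, _⟩ := hy
  unfold eps4 at h4
  constructor
  · intro a b hab hb
    have e0 := h.left a b hab hb
    rcases eq_or_ne a j with rfl | haj
    · have e1 := h.left (a - 1) b (by omega) hb
      rcases eq_or_lt_of_le hab with rfl | hlt
      · have e2 := h.left (a + 1) (a + 1) le_rfl hK
        have e3 := h.left (a - 1) (a - 1) le_rfl (by omega)
        omega
      · have e2 := h.left (a + 1) b (by omega) hb
        omega
    · rw [hD a haj]; omega
  · intro a b hab hb
    have e0 := h.right a b hab hb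
    rcases eq_or_ne b j with rfl | hbj
    · grind
    · rw [hD b hbj]
      rcases eq_or_ne a j with rfl | haj
      · have e1 := h.right (a - 1) b (by omega) hb
        have e2 := h.right (a + 1) b (by omega) hb
        omega
      · rw [hD a haj]; omega
  · intro a ha
    have e0 := h.mid a ha
    rcases eq_or_ne a j with rfl | haj
    · have e1 := h.mid (a - 1) (by omega)
      have e2 := h.mid (a + 1) (by omega)
      omega
    · rw [hD a haj]; omega

/-! #### The right column is a half-column -/

theorem PairIneq.left_f_bar_half (h : PairIneq K N N' c A B A' B') (hj : 1 ≤ j) (hK : j < K)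
    (hx : Increments A B j x₁ x₂ x₃ x₄) (hy : Increments A' B' j y₁ y₂ y₃ y₄)
    (hH : ∀ a ≤ K, A' a + B' a = a)
    (hD : ∀ a, a ≠ j → D a = B a) (hDj : D j = B j + 1)
    (h1 : x₃ = 1) (h2 : x₄ = 0) (h3 : x₁ ≤ x₂)
    (h4 : (y₁ = 1 ∧ y₃ = 1) → x₁ < x₂) :
    PairIneq K N N' c A D A' B' := by
  obtain ⟨_, _, _, _, _, _, _, _⟩ := hx
  obtain ⟨_, _, _, _, _, _, _, _⟩ := hy
  refine ⟨fun a b hab hb => ?_, h.right, h.mid⟩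
  have e0 := h.left a b hab hb
  -- Evaluated at `j - 1`, `j` and `j + 1`, `hH` gives `y₁ + y₄ = 1` and `y₂ + y₃ = 1`. So the
  -- critical pattern `y₃ = 1`, `y₄ = 0` is the one with `y₁ = y₃ = 1`, which `h4` treats.
  have := hH (j - 1) (by omega)
  have := hH j (by omega)
  have := hH (j + 1) (by omega)
  rcases eq_or_ne b j with rfl | hbj
  · have e1 := h.left a (b + 1) (by omega) hK
    rcases eq_or_ne a b with rfl | haj
    · have e2 := h.left (a - 1) (a - 1) (by omega) (by omega)
      have e3 := h.left (a + 1) (a + 1) (by omega) (by omega)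
      omega
    · have e2 := h.left a (b - 1) (by omega) (by omega)
      omega
  simp_all

theorem PairIneq.right_f_half (h : PairIneq K N N' c A B A' B') {E : ℕ → ℕ}
    (hD : ∀ a, a ≠ j → D a = A' a) (hDj : D j + 1 = A' j)
    (hE : ∀ a, a ≠ j → E a = B' a) (hEj : E j = B' j + 1)
    (hH : ∀ a ≤ K, A' a + B' a = a) :
    PairIneq K N N' c A B D E := by
  constructor
  · intro a b hab hb
    have e0 := h.left a b hab hb
    grind
  · intro a b hab hb
    have e0 := h.right a b hab hb
    grind
  · intro a ha
    have e0 := h.mid a ha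
    grind

theorem PairIneq.right_e_half (h : PairIneq K N N' c A B A' B') (hj : 1 ≤ j) (hK : j < K)
    (hx : Increments A B j x₁ x₂ x₃ x₄) (hy : Increments A' B' j y₁ y₂ y₃ y₄) {E : ℕ → ℕ}
    (hD : ∀ a, a ≠ j → D a = A' a) (hDj : D j = A' j + 1)
    (hE : ∀ a, a ≠ j → E a = B' a) (hEj : E j + 1 = B' j)
    (hH : ∀ a ≤ K, A' a + B' a = a) (h1 : y₂ = 1) (h2 : y₄ = 1)
    (h4 : eps4 x₁ x₂ x₃ x₄ = 0) :
    PairIneq K N N' c A B D E := by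
  obtain ⟨_, _, _, _, _, _, _, _⟩ := hx
  obtain ⟨_, _, _, _, _, _, _, _⟩ := hy
  unfold eps4 at h4
  have g0 := hH (j - 1) (by omega)
  have g1 := hH j (by omega)
  have g2 := hH (j + 1) (by omega)
  constructor
  · intro a b hab hb
    have e0 := h.left a b hab hb
    rcases eq_or_ne a j with rfl | haj
    · have e1 := h.left (a - 1) b (by omega) hb
      rcases eq_or_lt_of_le hab with rfl | hlt
      · have e2 := h.left (a + 1) (a + 1) le_rfl hK
        have e3 := h.left (a - 1) (a - 1) le_rfl (by omega)
        omega
      · have e2 := h.left (a + 1) b (by omega) hb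
        omega
    · rw [hE a haj]; omega
  · intro a b hab hb
    have e0 := h.right a b hab hb
    have e1 := h.right a a le_rfl (by omega)
    have := hH a (by omega)
    have := hH b (by omega)
    have e2 := h.right (j - 1) (j - 1) le_rfl (by omega)
    have e3 := h.right (j + 1) (j + 1) le_rfl (by omega)
    grind
  · intro a ha
    have e0 := h.mid a ha
    rcases eq_or_ne a j with rfl | haj
    · have e1 := h.mid (a - 1) (by omega)
      have e2 := h.mid (a + 1) (by omega)
      omega
    · rw [hE a haj]; omega

end

end

section

/-! ### The operators on letters -/

/-- The index of the counting functions changed by the operators of colour `i`. -/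
def lowIdx (n i : ℕ) : ℕ := if i < n then i else n - 1

/-- The letter obtained from `lowIdx n i` by `f̃_i`. -/
def upLetter (n i : ℕ) : Letter := if i < n then .pos (i + 1) else .bar n

/-- The letter which `f̃_i` turns into the barred letter of `lowIdx n i`. -/
def downLetter (n i : ℕ) : Letter := if i < n then .bar (i + 1) else .pos n

section Letters

variable {n i : ℕ}

/-- Every colour has exactly two arrows in the vector representation, `j` to `upLetter` and
`downLetter` to `j̄` with `j = lowIdx n i`. This common shape allows the colours `n - 1` and `n` to
be treated together with the others. -/
theorem letter_f_eq_some (hn : 2 ≤ n) (h1 : 1 ≤ i) (hi : i ≤ n) {x y : Letter} :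
    x.f n i = some y ↔ (x = .pos (lowIdx n i) ∧ y = upLetter n i) ∨
      (x = downLetter n i ∧ y = .bar (lowIdx n i)) := by
  unfold lowIdx upLetter downLetter
  rcases eq_or_lt_of_le hi with rfl | hi
  · cases x with
    | pos a =>
      grind [Letter.f, lt_irrefl, Letter.pos.injEq, Option.some.injEq]
    | bar a => simp [Letter.f]
  · cases x with
    | pos a =>
      grind [Letter.f, Letter.pos.injEq, reduceCtorEq]
    | bar a =>
      grind [Letter.f, Letter.bar.injEq, reduceCtorEq]

theorem letter_e_eq_some (hn : 2 ≤ n) (h1 : 1 ≤ i) (hi : i ≤ n) {x y : Letter} :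
    x.e n i = some y ↔ (x = upLetter n i ∧ y = .pos (lowIdx n i)) ∨
      (x = .bar (lowIdx n i) ∧ y = downLetter n i) := by
  unfold lowIdx upLetter downLetter
  rcases eq_or_lt_of_le hi with rfl | hi
  · cases x with
    | bar a =>
      grind [Letter.e, lt_irrefl, Letter.bar.injEq, Option.some.injEq]
    | pos a => simp [Letter.e]
  · cases x with
    | bar a =>
      grind [Letter.e, Letter.bar.injEq, reduceCtorEq]
    | pos a =>
      grind [Letter.e, Letter.pos.injEq, reduceCtorEq]

theorem letter_f_isSome (hn : 2 ≤ n) (h1 : 1 ≤ i) (hi : i ≤ n) {x : Letter} :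
    (x.f n i).isSome ↔ x = .pos (lowIdx n i) ∨ x = downLetter n i := by
  rw [Option.isSome_iff_exists]
  simp [letter_f_eq_some hn h1 hi, exists_or]

theorem letter_e_isSome (hn : 2 ≤ n) (h1 : 1 ≤ i) (hi : i ≤ n) {x : Letter} :
    (x.e n i).isSome ↔ x = upLetter n i ∨ x = .bar (lowIdx n i) := by
  rw [Option.isSome_iff_exists]
  simp [letter_e_eq_some hn h1 hi, exists_or]

theorem lowIdx_pos (hn : 2 ≤ n) (h1 : 1 ≤ i) : 1 ≤ lowIdx n i := by grind [lowIdx]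

theorem lowIdx_lt (hn : 2 ≤ n) : lowIdx n i < n := by grind [lowIdx]

theorem lowIdx_eq (hn : 2 ≤ n) (hi : i ≤ n) :
    (i < n - 1 ∧ lowIdx n i = i) ∨ (n - 1 ≤ i ∧ lowIdx n i = n - 1) := by grind [lowIdx]

theorem rank_upLetter (hn : 2 ≤ n) (hi : i ≤ n) : (upLetter n i).rank n = lowIdx n i + 1 := by
  unfold upLetter lowIdx; split_ifs <;> simp <;> omega

theorem rank_downLetter (hn : 2 ≤ n) (hi : i ≤ n) :
    (downLetter n i).rank n + (lowIdx n i + 1) = 2 * n := by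
  unfold downLetter lowIdx; split_ifs <;> simp <;> omega

theorem upLetter_ne_downLetter : upLetter n i ≠ downLetter n i := by grind [upLetter, downLetter]

/-- The signs of a letter. -/
def letterSigns (n i : ℕ) (x : Letter) : List Sign :=
  (if (x.e n i).isSome then [.minus] else []) ++ (if (x.f n i).isSome then [.plus] else [])

theorem letterSigns_low (hn : 2 ≤ n) (h1 : 1 ≤ i) (hi : i ≤ n) :
    letterSigns n i (.pos (lowIdx n i)) = [.plus] := by
  have e1 : ¬ ((Letter.pos (lowIdx n i)).e n i).isSome := by
    rw [letter_e_isSome hn h1 hi]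
    have := rank_upLetter hn hi
    rintro (h | h)
    · rw [← h] at this; simp at this
    · cases h
  grind [lowIdx, letter_f_isSome, letterSigns]

theorem letterSigns_down (hn : 2 ≤ n) (h1 : 1 ≤ i) (hi : i ≤ n) :
    letterSigns n i (downLetter n i) = [.plus] := by
  have hj := lowIdx_lt (i := i) hn
  have e1 : ¬ ((downLetter n i).e n i).isSome := by
    rw [letter_e_isSome hn h1 hi]
    have := rank_downLetter hn hi
    rintro (h | h)
    · exact upLetter_ne_downLetter h.symm
    · rw [h] at this; simp at this; omega
  grind [downLetter, letter_f_isSome, letterSigns]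

theorem letterSigns_up (hn : 2 ≤ n) (h1 : 1 ≤ i) (hi : i ≤ n) :
    letterSigns n i (upLetter n i) = [.minus] := by
  have e1 : ¬ ((upLetter n i).f n i).isSome := by
    rw [letter_f_isSome hn h1 hi]
    have := rank_upLetter hn hi
    rintro (h | h)
    · rw [h] at this; simp at this
    · exact upLetter_ne_downLetter h
  grind [upLetter, letter_e_isSome, letterSigns]

theorem letterSigns_bar (hn : 2 ≤ n) (h1 : 1 ≤ i) (hi : i ≤ n) :
    letterSigns n i (.bar (lowIdx n i)) = [.minus] := by
  have hj := lowIdx_lt (i := i) hn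
  have e1 : ¬ ((Letter.bar (lowIdx n i)).f n i).isSome := by
    rw [letter_f_isSome hn h1 hi]
    have := rank_downLetter hn hi
    rintro (h | h)
    · cases h
    · rw [← h] at this; simp at this; omega
  grind [lowIdx, letter_e_isSome, letterSigns]

theorem letterSigns_eq_nil (hn : 2 ≤ n) (h1 : 1 ≤ i) (hi : i ≤ n) {x : Letter}
    (hx₁ : x ≠ .pos (lowIdx n i)) (hx₂ : x ≠ upLetter n i) (hx₃ : x ≠ downLetter n i)
    (hx₄ : x ≠ .bar (lowIdx n i)) : letterSigns n i x = [] := by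
  grind [letter_e_isSome, letter_f_isSome, letterSigns]

theorem letterSigns_cases (hn : 2 ≤ n) (h1 : 1 ≤ i) (hi : i ≤ n) (x : Letter) :
    (x.e n i = none ∧ x.f n i = none) ∨ ((x.e n i).isSome ∧ x.f n i = none) ∨
      (x.e n i = none ∧ (x.f n i).isSome) := by
  rcases he : x.e n i with _ | y
  · rcases hf : x.f n i with _ | y <;> simp
  · rcases hf : x.f n i with _ | z
    · simp
    grind [letterSigns_low, letterSigns_down, letter_f_eq_some, letterSigns]

end Letters

/-! ### Sign words of columns -/

/-- The sign word of a column, read from top to bottom. -/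
def columnWord (n i : ℕ) (C : List Letter) : List Sign := C.reverse.flatMap (letterSigns n i)

@[simp] theorem columnWord_nil (n i : ℕ) : columnWord n i [] = [] := rfl

theorem columnWord_append (n i : ℕ) (C D : List Letter) :
    columnWord n i (C ++ D) = columnWord n i D ++ columnWord n i C := by
  simp [columnWord]

theorem columnWord_cons (n i : ℕ) (x : Letter) (D : List Letter) :
    columnWord n i (x :: D) = columnWord n i D ++ letterSigns n i x := by
  simp [columnWord]

theorem columnWord_split (n i : ℕ) (lo : List Letter) (x : Letter) (hi : List Letter) :
    columnWord n i (lo ++ x :: hi) = columnWord n i hi ++ (letterSigns n i x ++ columnWord n i lo) := by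
  rw [columnWord_append, columnWord_cons, List.append_assoc]

theorem columnWord_of_single {n i : ℕ} {D : List Letter} {x : Letter} {s : Sign}
    (h : ∀ y ∈ D, y ≠ x → letterSigns n i y = []) (hx : letterSigns n i x = [s]) :
    columnWord n i D = List.replicate (D.count x) s := by
  induction D with
  | nil => rfl
  | cons y D ih =>
    grind [columnWord_cons, List.mem_cons_of_mem, List.count_cons_self, List.replicate_succ',
        List.count_cons_of_ne]

theorem sorted_split {n k : ℕ} {D : List Letter}
    (h : D.Pairwise (Letter.WeakAbove n)) :
    D = D.filter (fun x => decide (k ≤ x.rank n)) ++ D.filter (fun x => decide (x.rank n < k)) := by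
  induction D with
  | nil => rfl
  | cons x D ih =>
    rw [List.pairwise_cons] at h
    by_cases hx : k ≤ x.rank n
    · grind
    · have h0 : (x :: D).filter (fun x => decide (k ≤ x.rank n)) = [] := by
        rw [List.filter_eq_nil_iff]
        intro y hy
        rcases List.mem_cons.1 hy with rfl | hy
        · simpa using hx
        · have := h.1 y hy
          simp only [Letter.WeakAbove] at this
          simp; omega
      grind

/-- The part of a column strictly between `j` and `j̄`, for `j = lowIdx n i`. -/
def midPart (n i : ℕ) (D : List Letter) : List Letter :=
  D.filter fun x => decide (lowIdx n i < x.rank n) && decide (x.rank n < 2 * n - lowIdx n i)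

theorem midPart_append (n i : ℕ) (C D : List Letter) :
    midPart n i (C ++ D) = midPart n i C ++ midPart n i D := List.filter_append ..

theorem StrictColumn.infix {n : ℕ} {C D : List Letter} (h : StrictColumn n C) (hD : D <:+: C) :
    StrictColumn n D :=
  ⟨fun x hx => h.valid x (hD.subset hx),
    columnStrict_iff_isChain.2 ((columnStrict_iff_isChain.1 h.strict).infix hD)⟩

theorem StrictColumn.left_of_split {n : ℕ} {lo hi : List Letter} {x : Letter}
    (h : StrictColumn n (lo ++ x :: hi)) : StrictColumn n lo :=
  h.infix (List.prefix_append _ _).isInfix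

theorem StrictColumn.right_of_split {n : ℕ} {lo hi : List Letter} {x : Letter}
    (h : StrictColumn n (lo ++ x :: hi)) : StrictColumn n hi :=
  h.infix ⟨lo ++ [x], [], by simp⟩

theorem valid_rank_le {n j : ℕ} {y : Letter} (h : y.Valid n) (hj : j < n) (hr : y.rank n ≤ j) :
    y = .pos (y.rank n) := by
  cases y with
  | pos a => rfl
  | bar a => simp [Letter.Valid] at *; omega

theorem valid_le_rank {n j : ℕ} {y : Letter} (h : y.Valid n) (hj : j < n)
    (hr : 2 * n - j ≤ y.rank n) : y = .bar (2 * n - y.rank n) := by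
  cases y with
  | pos a => simp [Letter.Valid] at *; omega
  | bar a => simp [Letter.Valid] at *; omega

theorem rank_injOn {n : ℕ} {x y : Letter} (hx : x.Valid n) (hy : y.Valid n)
    (h : x.rank n = y.rank n) (hn : x.rank n ≠ n) : x = y := by
  cases x <;> cases y <;> simp [Letter.Valid] at * <;> omega

section Words

variable {n i : ℕ} {C D : List Letter}

theorem StrictColumn.eq_parts (h : StrictColumn n D) (hn : 2 ≤ n) :
    D = D.filter (fun x => decide (2 * n - lowIdx n i ≤ x.rank n)) ++
      (midPart n i D ++ D.filter (fun x => decide (x.rank n ≤ lowIdx n i))) := by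
  have hj := lowIdx_lt (i := i) hn
  have h1 := sorted_split (k := 2 * n - lowIdx n i) h.strict.pairwise
  have h2 := sorted_split (k := lowIdx n i + 1)
    (h.strict.pairwise.filter (fun x => decide (x.rank n < 2 * n - lowIdx n i)))
  rw [List.filter_filter, List.filter_filter] at h2
  conv_lhs => rw [h1, h2]
  congr 2
  grind

/-- Read from top to bottom, the letters of rank at most `j` come first and only `j` has a sign;
those from `j̄` on come last and only `j̄` has a sign. Everything else with a sign lies in the
middle part. -/
theorem StrictColumn.columnWord_eq (h : StrictColumn n D) (hn : 2 ≤ n) (h1 : 1 ≤ i) (hi : i ≤ n) :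
    columnWord n i D = List.replicate (D.count (.pos (lowIdx n i))) .plus ++
      (columnWord n i (midPart n i D) ++ List.replicate (D.count (.bar (lowIdx n i))) .minus) := by
  have hj := lowIdx_lt (i := i) hn
  have hu := rank_upLetter hn hi
  have hd := rank_downLetter hn hi
  conv_lhs => rw [h.eq_parts (i := i) hn, columnWord_append, columnWord_append, List.append_assoc]
  congr 1
  · rw [columnWord_of_single (x := .pos (lowIdx n i)) (s := .plus) _ (letterSigns_low hn h1 hi),
      List.count_filter (by simp)]
    intro y hy hne
    simp only [List.mem_filter, decide_eq_true_eq] at hy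
    have hv := valid_rank_le (h.valid y hy.1) hj hy.2
    refine letterSigns_eq_nil hn h1 hi hne ?_ ?_ ?_
    · rintro rfl; omega
    · rintro rfl; omega
    · rw [hv]; simp
  · congr 1
    rw [columnWord_of_single (x := .bar (lowIdx n i)) (s := .minus) _ (letterSigns_bar hn h1 hi),
      List.count_filter (by simp)]
    intro y hy hne
    simp only [List.mem_filter, decide_eq_true_eq] at hy
    have hv := valid_le_rank (h.valid y hy.1) hj hy.2
    refine letterSigns_eq_nil hn h1 hi ?_ ?_ ?_ hne
    · rw [hv]; simp
    · rintro rfl; omega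
    · rintro rfl; omega

/-- The middle part for `i ≤ n - 2`. -/
theorem StrictColumn.columnWord_midPart (h : StrictColumn n D) (hn : 2 ≤ n) (h1 : 1 ≤ i)
    (hi : i < n - 1) :
    columnWord n i (midPart n i D) = List.replicate (D.count (upLetter n i)) .minus ++
      List.replicate (D.count (downLetter n i)) .plus := by
  have hj := lowIdx_lt (i := i) hn
  have hin : i ≤ n := by omega
  have hu := rank_upLetter hn hin
  have hd := rank_downLetter hn hin
  have hji : lowIdx n i = i := by grind [lowIdx]
  have hs := sorted_split (k := n) (h.strict.pairwise.filter
    (fun x => decide (lowIdx n i < x.rank n) && decide (x.rank n < 2 * n - lowIdx n i)))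
  have key : ∀ y ∈ midPart n i D, y ≠ upLetter n i → y ≠ downLetter n i →
      letterSigns n i y = [] := by
    intro y hy h2 h3
    simp only [midPart, List.mem_filter, Bool.and_eq_true, decide_eq_true_eq] at hy
    refine letterSigns_eq_nil hn h1 hin ?_ h2 h3 ?_
    · rintro rfl; simp at hy
    · rintro rfl; simp at hy
  have cu : (midPart n i D).count (upLetter n i) = D.count (upLetter n i) :=
    List.count_filter (by grind)
  have cd : (midPart n i D).count (downLetter n i) = D.count (downLetter n i) :=
    List.count_filter (by simp only [Bool.and_eq_true, decide_eq_true_eq]; omega)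
  change midPart n i D = _ at hs
  rw [← cu, ← cd]
  conv_lhs => rw [hs, columnWord_append]
  congr 1
  · rw [columnWord_of_single (x := upLetter n i) (s := .minus) _ (letterSigns_up hn h1 hin),
      ← midPart, List.count_filter (by simp only [decide_eq_true_eq]; omega)]
    grind
  · rw [columnWord_of_single (x := downLetter n i) (s := .plus) _ (letterSigns_down hn h1 hin),
      ← midPart, List.count_filter (by simp only [decide_eq_true_eq]; omega)]
    grind

/-- The letters of a middle part for `i ≥ n - 1` alternate. -/
theorem StrictColumn.midPart_alternating (h : StrictColumn n D) (hn : 2 ≤ n)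
    (hi : n - 1 ≤ i) (hin : i ≤ n) :
    (∀ x ∈ midPart n i D, x = upLetter n i ∨ x = downLetter n i) ∧
      (midPart n i D).IsChain (· ≠ ·) := by
  have hji : lowIdx n i = n - 1 := by grind [lowIdx]
  have h0 : ∀ x ∈ midPart n i D, x = .pos n ∨ x = .bar n := by
    intro x hx
    simp only [midPart, List.mem_filter, Bool.and_eq_true, decide_eq_true_eq, hji] at hx
    have hv := h.valid x hx.1
    cases x <;> simp [Letter.Valid] at * <;> omega
  constructor
  · grind [upLetter, downLetter, eq_or_lt_of_le, Nat.sub_add_cancel]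
  · have hm : StrictColumn n (midPart n i D) :=
      h.infix ⟨_, _, by rw [List.append_assoc]; exact (h.eq_parts (i := i) hn).symm⟩
    refine List.IsChain.imp_of_mem_imp (R := Letter.Above n) ?_ (columnStrict_iff_isChain.1 hm.strict)
    rintro x y hx hy hxy rfl
    rcases hxy with hxy | ⟨rfl, hxy⟩ | ⟨rfl, hxy⟩
    · exact lt_irrefl _ hxy
    · cases hxy
    · cases hxy

/-- In an alternating run every `+` is cancelled by the `-` read next. Only a `-` at the very
beginning (the top, that is the last entry of `M`) and a `+` at the very end (the bottom, its first
entry) survive. -/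
theorem alternating_word (hn : 2 ≤ n) (h1 : 1 ≤ i) (hi : i ≤ n) {M : List Letter}
    (hM : ∀ x ∈ M, x = upLetter n i ∨ x = downLetter n i) (hc : M.IsChain (· ≠ ·)) :
    wordEps (columnWord n i M) = (if M.getLast? = some (upLetter n i) then 1 else 0) ∧
      wordPhi (columnWord n i M) = (if M.head? = some (downLetter n i) then 1 else 0) := by
  have hne := upLetter_ne_downLetter (n := n) (i := i)
  induction M with
  | nil => simp
  | cons x M ih =>
    have ih := ih (fun y hy => hM y (by simp [hy])) hc.tail
    rw [columnWord_cons, wordEps_append, wordPhi_append, ih.1, ih.2]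
    cases M with
    | nil =>
      rcases hM x (by simp) with rfl | rfl
      · rw [letterSigns_up hn h1 hi]; simp [hne]
      · rw [letterSigns_down hn h1 hi]; simp [hne.symm]
    | cons y M =>
      have hxy : x ≠ y := (List.isChain_cons_cons.1 hc).1
      rw [List.getLast?_cons_cons]
      rcases hM x (by simp) with rfl | rfl
      · obtain rfl : y = downLetter n i := by
          rcases hM y (by simp) with rfl | rfl
          · exact absurd rfl hxy
          · rfl
        rw [letterSigns_up hn h1 hi]; simp [hne]
      · obtain rfl : y = upLetter n i := by
          rcases hM y (by simp) with rfl | rfl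
          · rfl
          · exact absurd rfl hxy
        rw [letterSigns_down hn h1 hi]; simp [hne]

end Words

end

section

/-! ### Columns under the operators -/

theorem StrictColumn.replace {n : ℕ} {lo hi : List Letter} {x y : Letter}
    (h : StrictColumn n (lo ++ x :: hi)) (hv : y.Valid n) (h1 : ∀ a ∈ lo.getLast?, a.Above n y)
    (h2 : ∀ b ∈ hi.head?, y.Above n b) : StrictColumn n (lo ++ y :: hi) := by
  constructor
  · intro z hz
    rw [List.mem_append, List.mem_cons] at hz
    rcases hz with hz | rfl | hz
    · exact h.valid z (by simp [hz])
    · exact hv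
    · exact h.valid z (by simp [hz])
  · have hc := columnStrict_iff_isChain.1 h.strict
    grind [List.isChain_append, List.isChain_cons, columnStrict_iff_isChain, List.head?_cons,
        Option.mem_def, Option.some.injEq]

/-- The increment of the unbarred counting function at `lowIdx n i`. -/
def bitLow (n i : ℕ) (C : List Letter) : ℕ := C.count (.pos (lowIdx n i))

/-- The increment of the barred counting function at `lowIdx n i`. -/
def bitBar (n i : ℕ) (C : List Letter) : ℕ := C.count (.bar (lowIdx n i))

/-- The increment of the (extended) unbarred counting function at `lowIdx n i + 1`. -/
def bitUp (n i : ℕ) (C : List Letter) : ℕ :=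
  if i < n - 1 then C.count (upLetter n i)
  else if (midPart n i C).getLast? = some (upLetter n i) then 1 else 0

/-- The increment of the (extended) barred counting function at `lowIdx n i + 1`. -/
def bitDown (n i : ℕ) (C : List Letter) : ℕ :=
  if i < n - 1 then C.count (downLetter n i)
  else if (midPart n i C).head? = some (downLetter n i) then 1 else 0

/-- The unbarred counting function, extended to `n`. -/
def extLow (n i : ℕ) (C : List Letter) (a : ℕ) : ℕ :=
  if a < n then lowCount C a else lowCount C (n - 1) + if i < n - 1 then 0 else bitUp n i C

/-- The barred counting function, extended to `n`. -/
def extBar (n i : ℕ) (C : List Letter) (a : ℕ) : ℕ :=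
  if a < n then barCount C a else barCount C (n - 1) + if i < n - 1 then 0 else bitDown n i C

section

variable {n i : ℕ} {C : List Letter}

theorem upLetter_valid (hn : 2 ≤ n) (h1 : 1 ≤ i) (hi : i ≤ n) : (upLetter n i).Valid n := by
  grind [upLetter, Letter.Valid]

theorem downLetter_valid (hn : 2 ≤ n) (h1 : 1 ≤ i) (hi : i ≤ n) : (downLetter n i).Valid n := by
  grind [downLetter, Letter.Valid]

theorem upLetter_of_lt (hi : i < n - 1) : upLetter n i = .pos (lowIdx n i + 1) := by
  grind [upLetter, lowIdx]

theorem downLetter_of_lt (hi : i < n - 1) : downLetter n i = .bar (lowIdx n i + 1) := by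
  grind [downLetter, lowIdx]

/-- For `i < n - 1` these are the ordinary increments of the counting functions. For the two highest
colours the values at `n` are defined so that the surviving bits of the run of `n`, `n̄` become
increments from `n - 1` to `n`. -/
theorem StrictColumn.increments (h : StrictColumn n C) (hn : 2 ≤ n) (h1 : 1 ≤ i) (hi : i ≤ n) :
    Increments (extLow n i C) (extBar n i C) (lowIdx n i) (bitLow n i C) (bitUp n i C)
      (bitDown n i C) (bitBar n i C) := by
  have hj := lowIdx_lt (i := i) hn
  have hj1 := lowIdx_pos hn h1
  have hu := rank_upLetter hn hi
  have hd := rank_downLetter hn hi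
  have c1 : bitLow n i C ≤ 1 := h.count_le_one (by simp; omega)
  have c4 : bitBar n i C ≤ 1 := h.count_le_one (by simp; omega)
  obtain ⟨k, hk⟩ : ∃ k, lowIdx n i = k + 1 := ⟨lowIdx n i - 1, by omega⟩
  have hlow : extLow n i C (lowIdx n i) = extLow n i C (lowIdx n i - 1) + bitLow n i C := by
    grind [extLow, bitLow, lowCount_succ]
  have hbar : extBar n i C (lowIdx n i) = extBar n i C (lowIdx n i - 1) + bitBar n i C := by
    grind [extBar, bitBar, barCount_succ]
  rcases lowIdx_eq hn hi with ⟨hi', hj'⟩ | ⟨hi', hj'⟩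
  · refine ⟨c1, ?_, ?_, c4, hlow, ?_, ?_, hbar⟩
    · unfold bitUp; rw [if_pos hi']; exact h.count_le_one (by omega)
    · unfold bitDown; rw [if_pos hi']; exact h.count_le_one (by omega)
    · unfold extLow bitUp
      rw [if_pos hj, if_pos (by omega), if_pos hi', lowCount_succ, upLetter_of_lt hi']
    grind [extBar, bitDown, barCount_succ, downLetter_of_lt]
  · refine ⟨c1, ?_, ?_, c4, hlow, ?_, ?_, hbar⟩
    · unfold bitUp; rw [if_neg (by omega)]; split_ifs <;> omega
    · unfold bitDown; rw [if_neg (by omega)]; split_ifs <;> omega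
    · unfold extLow
      rw [if_pos hj, if_neg (by omega), hj', if_neg (by omega)]
    grind [extBar]

theorem StrictColumn.midPart_word (h : StrictColumn n C) (hn : 2 ≤ n) (h1 : 1 ≤ i) (hi : i ≤ n) :
    wordEps (columnWord n i (midPart n i C)) = bitUp n i C ∧
      wordPhi (columnWord n i (midPart n i C)) = bitDown n i C := by
  rcases lowIdx_eq hn hi with ⟨hi', hj'⟩ | ⟨hi', hj'⟩
  · rw [h.columnWord_midPart hn h1 hi', wordEps_append, wordPhi_append]
    simp [bitUp, bitDown, hi']
  · obtain ⟨m1, m2⟩ := h.midPart_alternating hn hi' hi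
    grind [alternating_word, bitUp, bitDown]

/-- For every colour a column may thus be replaced by the word `+^{x₁} -^{x₂} +^{x₃} -^{x₄}` of its
four increments, so signature conditions become conditions in the arithmetic of `PairIneq`. -/
theorem StrictColumn.columnWord_eps_phi (h : StrictColumn n C) (hn : 2 ≤ n) (h1 : 1 ≤ i)
    (hi : i ≤ n) :
    wordEps (columnWord n i C) =
        eps4 (bitLow n i C) (bitUp n i C) (bitDown n i C) (bitBar n i C) ∧
      wordPhi (columnWord n i C) =
        phi4 (bitLow n i C) (bitUp n i C) (bitDown n i C) (bitBar n i C) := by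
  have hm := h.midPart_word hn h1 hi
  rw [h.columnWord_eq hn h1 hi, wordEps_append, wordPhi_append, wordEps_append, wordPhi_append,
    hm.1, hm.2]
  grind [wordEps_replicate_plus, wordPhi_replicate_plus, wordEps_replicate_minus,
      wordPhi_replicate_minus, eps4, phi4, bitLow, bitBar]

variable {lo hi : List Letter}

theorem count_eq_zero_of_rank {D : List Letter} {x : Letter} (h : ∀ y ∈ D, y.rank n ≠ x.rank n) :
    D.count x = 0 :=
  List.count_eq_zero.2 fun hx => h x hx rfl

theorem midPart_eq_nil {D : List Letter}
    (h : ∀ y ∈ D, y.rank n ≤ lowIdx n i ∨ 2 * n - lowIdx n i ≤ y.rank n) : midPart n i D = [] := by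
  grind [midPart, List.filter_eq_nil_iff]

theorem columnWord_eq_nil_of_rank {D : List Letter} (hn : 2 ≤ n) (h1 : 1 ≤ i) (hin : i ≤ n)
    (h : ∀ y ∈ D, y.rank n < lowIdx n i ∨ 2 * n - lowIdx n i < y.rank n) :
    columnWord n i D = [] := by
  have hj := lowIdx_lt (i := i) hn
  have hu := rank_upLetter hn hin
  have hd := rank_downLetter hn hin
  simp only [columnWord, List.flatMap_eq_nil_iff, List.mem_reverse]
  intro y hy
  have := h y hy
  refine letterSigns_eq_nil hn h1 hin ?_ ?_ ?_ ?_ <;> rintro rfl <;>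
    (try simp only [Letter.rank_pos, Letter.rank_bar] at this) <;> omega

/-- A column split at the letter `lowIdx n i`. -/
theorem StrictColumn.split_low (h : StrictColumn n (lo ++ .pos (lowIdx n i) :: hi)) (hn : 2 ≤ n)
    (h1 : 1 ≤ i) (hin : i ≤ n) : columnWord n i hi = [] ∧
      bitLow n i (lo ++ .pos (lowIdx n i) :: hi) = 1 ∧
      wordEps (columnWord n i lo) = bitUp n i (lo ++ .pos (lowIdx n i) :: hi) +
        (bitBar n i (lo ++ .pos (lowIdx n i) :: hi) - bitDown n i (lo ++ .pos (lowIdx n i) :: hi)) ∧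
      wordPhi (columnWord n i lo) = bitDown n i (lo ++ .pos (lowIdx n i) :: hi) -
        bitBar n i (lo ++ .pos (lowIdx n i) :: hi) := by
  have hj := lowIdx_lt (i := i) hn
  obtain ⟨a1, a2⟩ := h.split_above rfl
  have w1 : columnWord n i hi = [] := columnWord_eq_nil_of_rank hn h1 hin fun y hy => by
    grind [Letter.WeakAbove, Letter.rank_pos]
  have c1 : bitLow n i (lo ++ .pos (lowIdx n i) :: hi) = 1 := by
    have e1 : lo.count (.pos (lowIdx n i)) = 0 := count_eq_zero_of_rank (n := n) fun y hy => by
      grind [Letter.WeakAbove, Letter.rank_pos]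
    have e2 : hi.count (.pos (lowIdx n i)) = 0 := count_eq_zero_of_rank (n := n) fun y hy => by
      grind [Letter.WeakAbove, Letter.rank_pos]
    rw [bitLow, List.count_append, List.count_cons_self, e1, e2]
  have hm := h.midPart_word hn h1 hin
  have e := h.columnWord_eq hn h1 hin
  rw [columnWord_split, w1, letterSigns_low hn h1 hin, ← bitLow, c1, ← bitBar] at e
  simp only [List.replicate_one, List.nil_append, List.singleton_append, List.cons.injEq,
    true_and] at e
  refine ⟨w1, c1, ?_, ?_⟩
  · rw [e, wordEps_append, hm.1, hm.2]; simp
  · rw [e, wordPhi_append, hm.2]; simp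

/-- A column split at the barred letter of `lowIdx n i`. -/
theorem StrictColumn.split_bar (h : StrictColumn n (lo ++ .bar (lowIdx n i) :: hi)) (hn : 2 ≤ n)
    (h1 : 1 ≤ i) (hin : i ≤ n) : columnWord n i lo = [] ∧
      bitBar n i (lo ++ .bar (lowIdx n i) :: hi) = 1 ∧
      wordEps (columnWord n i hi) = bitUp n i (lo ++ .bar (lowIdx n i) :: hi) -
        bitLow n i (lo ++ .bar (lowIdx n i) :: hi) ∧
      wordPhi (columnWord n i hi) = bitDown n i (lo ++ .bar (lowIdx n i) :: hi) +
        (bitLow n i (lo ++ .bar (lowIdx n i) :: hi) -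
          bitUp n i (lo ++ .bar (lowIdx n i) :: hi)) := by
  have hj := lowIdx_lt (i := i) hn
  obtain ⟨a1, a2⟩ := h.split_above rfl
  have w1 : columnWord n i lo = [] := columnWord_eq_nil_of_rank hn h1 hin fun y hy => by
    grind [Letter.WeakAbove, Letter.rank_bar]
  have c1 : bitBar n i (lo ++ .bar (lowIdx n i) :: hi) = 1 := by
    have e1 : lo.count (.bar (lowIdx n i)) = 0 := count_eq_zero_of_rank (n := n) fun y hy => by
      grind [Letter.WeakAbove, Letter.rank_bar]
    have e2 : hi.count (.bar (lowIdx n i)) = 0 := count_eq_zero_of_rank (n := n) fun y hy => by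
      grind [Letter.WeakAbove, Letter.rank_bar]
    rw [bitBar, List.count_append, List.count_cons_self, e1, e2]
  have hm := h.midPart_word hn h1 hin
  have e := h.columnWord_eq hn h1 hin
  rw [columnWord_split, w1, letterSigns_bar hn h1 hin, ← bitLow, ← bitBar, c1, List.append_nil,
    List.replicate_one, ← List.append_assoc] at e
  have e := List.append_cancel_right e
  refine ⟨w1, c1, ?_, ?_⟩
  · rw [e, wordEps_append, hm.1]; simp
  · rw [e, wordPhi_append, hm.2, hm.1]; simp

/-- The part below is read later, so `ε = 0` there means that it contributes no uncancelled `-`. A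
`j̄` below would contribute one; for the two highest colours so would the letter of rank `n`
directly below, which by alternation can only be `upLetter`. -/
theorem StrictColumn.split_down_lo (h : StrictColumn n (lo ++ downLetter n i :: hi)) (hn : 2 ≤ n)
    (h1 : 1 ≤ i) (hin : i ≤ n) (he : wordEps (columnWord n i lo) = 0) :
    ∀ x ∈ lo, 2 * n - lowIdx n i < x.rank n := by
  have hj := lowIdx_lt (i := i) hn
  have hd := rank_downLetter hn hin
  have hu := rank_upLetter hn hin
  obtain ⟨a1, a2⟩ := h.split_above rfl
  have hlo := h.left_of_split
  have hmid : midPart n i lo = [] := by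
    rcases lowIdx_eq hn hin with ⟨hi', hj'⟩ | ⟨hi', hj'⟩
    · refine midPart_eq_nil fun y hy => ?_
      have := a1 y hy
      simp only [Letter.WeakAbove] at this; omega
    · obtain ⟨m1, m2⟩ := hlo.midPart_alternating hn hi' hin
      have hw := alternating_word hn h1 hin m1 m2
      by_contra hne
      rw [hlo.columnWord_eq hn h1 hin, wordEps_append, wordEps_append, hw.1] at he
      have e1 : lo.count (.pos (lowIdx n i)) = 0 := count_eq_zero_of_rank (n := n) fun y hy => by
        have := a1 y hy
        simp only [Letter.WeakAbove, Letter.rank_pos] at this ⊢; omega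
      rw [e1] at he
      have e2 : (midPart n i lo).getLast? ≠ some (upLetter n i) := by
        intro e; rw [if_pos e] at he; simp at he
      have e3 : (midPart n i lo).getLast? = some (downLetter n i) := by
        have := m1 _ (List.getLast_mem hne)
        rw [List.getLast?_eq_some_getLast hne] at e2 ⊢
        rcases this with e | e
        · rw [e] at e2; exact absurd rfl e2
        · rw [e]
      obtain ⟨mc1, mc2⟩ := h.midPart_alternating hn hi' hin
      have e4 : midPart n i (downLetter n i :: hi) = downLetter n i :: midPart n i hi := by
        rw [midPart, List.filter_cons_of_pos]; · rfl
        simp only [Bool.and_eq_true, decide_eq_true_eq]; omega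
      rw [midPart_append, e4, List.isChain_append] at mc2
      exact mc2.2.2 _ e3 _ (by simp) rfl
  have hc : lo.count (.bar (lowIdx n i)) = 0 := by
    have e1 : lo.count (.pos (lowIdx n i)) = 0 := count_eq_zero_of_rank (n := n) fun y hy => by
      have := a1 y hy
      simp only [Letter.WeakAbove, Letter.rank_pos] at this ⊢; omega
    rw [hlo.columnWord_eq hn h1 hin, hmid, e1] at he
    simpa using he
  intro x hx
  have hw := a1 x hx
  have h2 : ¬ (lowIdx n i < x.rank n ∧ x.rank n < 2 * n - lowIdx n i) := by
    intro h2
    have : x ∈ midPart n i lo := by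
      simp only [midPart, List.mem_filter, Bool.and_eq_true, decide_eq_true_eq]; exact ⟨hx, h2⟩
    rw [hmid] at this; cases this
  have h3 : x.rank n ≠ 2 * n - lowIdx n i := by
    intro h3
    have := rank_injOn (hlo.valid x hx) (y := .bar (lowIdx n i))
      (by simp [Letter.Valid]; have := lowIdx_pos hn h1; omega) (by rw [h3]; rfl) (by omega)
    rw [this] at hx
    exact List.count_eq_zero.1 hc hx
  grind [Letter.WeakAbove]

theorem StrictColumn.split_up_hi (h : StrictColumn n (lo ++ upLetter n i :: hi)) (hn : 2 ≤ n)
    (h1 : 1 ≤ i) (hin : i ≤ n) (he : wordPhi (columnWord n i hi) = 0) :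
    ∀ x ∈ hi, x.rank n < lowIdx n i := by
  have hj := lowIdx_lt (i := i) hn
  have hd := rank_downLetter hn hin
  have hu := rank_upLetter hn hin
  obtain ⟨a1, a2⟩ := h.split_above rfl
  have hhi := h.right_of_split
  have hmid : midPart n i hi = [] := by
    rcases lowIdx_eq hn hin with ⟨hi', hj'⟩ | ⟨hi', hj'⟩
    · refine midPart_eq_nil fun y hy => ?_
      have := a2 y hy
      simp only [Letter.WeakAbove] at this; omega
    · obtain ⟨m1, m2⟩ := hhi.midPart_alternating hn hi' hin
      have hw := alternating_word hn h1 hin m1 m2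
      by_contra hne
      have e1 : hi.count (.bar (lowIdx n i)) = 0 := count_eq_zero_of_rank (n := n) fun y hy => by
        have := a2 y hy
        simp only [Letter.WeakAbove, Letter.rank_bar] at this ⊢; omega
      rw [hhi.columnWord_eq hn h1 hin, e1, List.replicate_zero, List.append_nil, wordPhi_append,
        hw.2] at he
      have e2 : (midPart n i hi).head? ≠ some (downLetter n i) := by
        intro e; rw [if_pos e] at he; omega
      have e3 : (midPart n i hi).head? = some (upLetter n i) := by
        have := m1 _ (List.head_mem hne)
        rw [List.head?_eq_some_head hne] at e2 ⊢
        rcases this with e | e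
        · rw [e]
        · rw [e] at e2; exact absurd rfl e2
      obtain ⟨mc1, mc2⟩ := h.midPart_alternating hn hi' hin
      have e4 : midPart n i (upLetter n i :: hi) = upLetter n i :: midPart n i hi := by
        rw [midPart, List.filter_cons_of_pos]; · rfl
        simp only [Bool.and_eq_true, decide_eq_true_eq]; omega
      rw [midPart_append, e4, List.isChain_append, List.isChain_cons] at mc2
      exact mc2.2.1.1 _ e3 rfl
  have hc : hi.count (.pos (lowIdx n i)) = 0 := by
    have e1 : hi.count (.bar (lowIdx n i)) = 0 := count_eq_zero_of_rank (n := n) fun y hy => by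
      have := a2 y hy
      simp only [Letter.WeakAbove, Letter.rank_bar] at this ⊢; omega
    rw [hhi.columnWord_eq hn h1 hin, hmid, e1] at he
    simpa using he
  intro x hx
  have hw := a2 x hx
  have h2 : ¬ (lowIdx n i < x.rank n ∧ x.rank n < 2 * n - lowIdx n i) := by
    intro h2
    have : x ∈ midPart n i hi := by
      simp only [midPart, List.mem_filter, Bool.and_eq_true, decide_eq_true_eq]; exact ⟨hx, h2⟩
    rw [hmid] at this; cases this
  have h3 : x.rank n ≠ lowIdx n i := by
    intro h3
    have := rank_injOn (hhi.valid x hx) (y := .pos (lowIdx n i))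
      (by simp [Letter.Valid]; have := lowIdx_pos hn h1; omega) (by rw [h3]; rfl) (by omega)
    rw [this] at hx
    exact List.count_eq_zero.1 hc hx
  grind [Letter.WeakAbove]

/-- A column split at the letter which `f̃_i` turns into the barred letter of `lowIdx n i`. -/
theorem StrictColumn.split_down (h : StrictColumn n (lo ++ downLetter n i :: hi)) (hn : 2 ≤ n)
    (h1 : 1 ≤ i) (hin : i ≤ n) (he : wordEps (columnWord n i lo) = 0) :
    columnWord n i lo = [] ∧ bitDown n i (lo ++ downLetter n i :: hi) = 1 ∧
      bitBar n i (lo ++ downLetter n i :: hi) = 0 ∧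
      wordEps (columnWord n i hi) =
        bitUp n i (lo ++ downLetter n i :: hi) - bitLow n i (lo ++ downLetter n i :: hi) ∧
      bitLow n i (lo ++ downLetter n i :: hi) - bitUp n i (lo ++ downLetter n i :: hi) ≤
        wordPhi (columnWord n i hi) := by
  have hj := lowIdx_lt (i := i) hn
  have hd := rank_downLetter hn hin
  have hu := rank_upLetter hn hin
  have hne := upLetter_ne_downLetter (n := n) (i := i)
  obtain ⟨a1, a2⟩ := h.split_above rfl
  have hlo := h.split_down_lo hn h1 hin he
  have w1 : columnWord n i lo = [] :=
    columnWord_eq_nil_of_rank hn h1 hin fun y hy => Or.inr (hlo y hy)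
  have cz : ∀ x : Letter, x.rank n ≤ 2 * n - lowIdx n i → lo.count x = 0 := fun x hx =>
    count_eq_zero_of_rank (n := n) fun y hy => by have := hlo y hy; omega
  have hr2 : ∀ y ∈ hi, y.rank n < 2 * n - lowIdx n i := fun y hy => by grind [Letter.WeakAbove]
  have cb : hi.count (.bar (lowIdx n i)) = 0 := count_eq_zero_of_rank (n := n) fun y hy => by
    grind [Letter.rank_bar]
  have ml : midPart n i lo = [] := midPart_eq_nil fun y hy => Or.inr (hlo y hy).le
  have mc : midPart n i (lo ++ downLetter n i :: hi) = downLetter n i :: midPart n i hi := by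
    grind [midPart_append, midPart, List.filter_cons_of_pos]
  have b1 : bitLow n i (lo ++ downLetter n i :: hi) = hi.count (.pos (lowIdx n i)) := by
    grind [bitLow, Letter.rank_pos, List.count_cons_of_ne, zero_add]
  have b2 : bitUp n i (lo ++ downLetter n i :: hi) = bitUp n i hi := by
    unfold bitUp
    grind
  have hw := h.right_of_split.midPart_word hn h1 hin
  have e := h.right_of_split.columnWord_eq hn h1 hin
  rw [cb, List.replicate_zero, List.append_nil] at e
  refine ⟨w1, ?_, ?_, ?_, ?_⟩
  · unfold bitDown
    split_ifs with h3 h4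
    · have := h.count_le_one (x := downLetter n i) (by have := lowIdx_eq hn hin; omega)
      have : 0 < (lo ++ downLetter n i :: hi).count (downLetter n i) :=
        List.count_pos_iff.2 (by simp)
      omega
    · rfl
    simp_all
  · grind [bitBar, Letter.rank_bar, List.count_cons_of_ne]
  · rw [e, wordEps_append, hw.1, b1, b2]; simp
  · rw [e, wordPhi_append, hw.1, b1, b2]; simp

/-- A column split at the letter obtained from `lowIdx n i` by `f̃_i`. -/
theorem StrictColumn.split_up (h : StrictColumn n (lo ++ upLetter n i :: hi)) (hn : 2 ≤ n)
    (h1 : 1 ≤ i) (hin : i ≤ n) (he : wordPhi (columnWord n i hi) = 0) :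
    columnWord n i hi = [] ∧ bitUp n i (lo ++ upLetter n i :: hi) = 1 ∧
      bitLow n i (lo ++ upLetter n i :: hi) = 0 ∧
      wordPhi (columnWord n i lo) =
        bitDown n i (lo ++ upLetter n i :: hi) - bitBar n i (lo ++ upLetter n i :: hi) ∧
      bitBar n i (lo ++ upLetter n i :: hi) - bitDown n i (lo ++ upLetter n i :: hi) ≤
        wordEps (columnWord n i lo) := by
  have hj := lowIdx_lt (i := i) hn
  have hd := rank_downLetter hn hin
  have hu := rank_upLetter hn hin
  have hne := upLetter_ne_downLetter (n := n) (i := i)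
  obtain ⟨a1, a2⟩ := h.split_above rfl
  have hlo := h.split_up_hi hn h1 hin he
  have w1 : columnWord n i hi = [] :=
    columnWord_eq_nil_of_rank hn h1 hin fun y hy => Or.inl (hlo y hy)
  have cz : ∀ x : Letter, lowIdx n i ≤ x.rank n → hi.count x = 0 := fun x hx =>
    count_eq_zero_of_rank (n := n) fun y hy => by have := hlo y hy; omega
  have hr2 : ∀ y ∈ lo, lowIdx n i < y.rank n := fun y hy => by grind [Letter.WeakAbove]
  have cb : lo.count (.pos (lowIdx n i)) = 0 := count_eq_zero_of_rank (n := n) fun y hy => by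
    grind [Letter.rank_pos]
  have ml : midPart n i hi = [] := midPart_eq_nil fun y hy => Or.inl (hlo y hy).le
  have mc : midPart n i (lo ++ upLetter n i :: hi) = midPart n i lo ++ [upLetter n i] := by
    grind [midPart_append, midPart, List.filter_cons_of_pos]
  have b1 : bitBar n i (lo ++ upLetter n i :: hi) = lo.count (.bar (lowIdx n i)) := by
    grind [bitBar, List.count_cons_of_ne, Letter.rank_bar, add_zero]
  have b2 : bitDown n i (lo ++ upLetter n i :: hi) = bitDown n i lo := by
    unfold bitDown
    split_ifs with h3 h4 h5 h5
    · grind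
    · rfl
    · exfalso
      rw [mc, List.head?_append] at h4
      cases hh : (midPart n i lo).head? with
      | none => simp_all
      | some z => simp_all
    · simp_all
    · rfl
  have hw := h.left_of_split.midPart_word hn h1 hin
  have e := h.left_of_split.columnWord_eq hn h1 hin
  rw [cb, List.replicate_zero, List.nil_append] at e
  refine ⟨w1, ?_, ?_, ?_, ?_⟩
  · unfold bitUp
    split_ifs with h3 h4
    · have := h.count_le_one (x := upLetter n i) (by have := lowIdx_eq hn hin; omega)
      have : 0 < (lo ++ upLetter n i :: hi).count (upLetter n i) :=
        List.count_pos_iff.2 (by simp)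
      omega
    · rfl
    simp_all
  · grind [bitLow, List.count_cons_of_ne, Letter.rank_pos]
  · rw [e, wordPhi_append, hw.2, b1, b2]; simp
  · rw [e, wordEps_append, hw.2, b1, b2]; simp

end

end

section

/-! ### Replacing one entry of a column -/

section

variable {n i : ℕ} {lo hi : List Letter}

theorem up_above {a : Letter} (hn : 2 ≤ n) (hin : i ≤ n) (hv : a.Valid n)
    (ha : lowIdx n i < a.rank n) (hne : a ≠ upLetter n i) : a.Above n (upLetter n i) := by
  have hu := rank_upLetter hn hin
  have hj := lowIdx_lt (i := i) hn
  by_cases h : a.rank n = lowIdx n i + 1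
  · by_cases h2 : a.rank n = n
    · unfold upLetter at *
      rcases lowIdx_eq hn hin with ⟨h3, h4⟩ | ⟨h3, h4⟩
      · omega
      · cases a with
        | pos b =>
          simp only [Letter.rank_pos] at h2; subst h2
          split_ifs at hne ⊢ with h5
          · grind
          · right; left; simp
        | bar b =>
          simp only [Letter.rank_bar] at h2
          simp only [Letter.Valid] at hv
          obtain rfl : b = n := by omega
          split_ifs at hne ⊢ with h5
          · right; simp_all
          · exact absurd rfl hne
    · exact absurd (rank_injOn hv (by grind [upLetter, Letter.Valid])
        (by omega) h2) hne
  · left; unfold Letter.Lt; omega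

theorem above_down {b : Letter} (hn : 2 ≤ n) (h1 : 1 ≤ i) (hin : i ≤ n) (hv : b.Valid n)
    (hb : b.rank n + lowIdx n i < 2 * n) (hne : b ≠ downLetter n i) :
    (downLetter n i).Above n b := by
  have hu := rank_downLetter hn hin
  have hj := lowIdx_lt (i := i) hn
  by_cases h : b.rank n + (lowIdx n i + 1) = 2 * n
  · by_cases h2 : b.rank n = n
    · unfold downLetter at *
      rcases lowIdx_eq hn hin with ⟨h3, h4⟩ | ⟨h3, h4⟩
      · omega
      · cases b with
        | pos a =>
          simp only [Letter.rank_pos] at h2; subst h2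
          split_ifs at hne ⊢ with h5
          · right; right; rw [show i + 1 = a by omega]; simp
          · exact absurd rfl hne
        | bar a =>
          simp only [Letter.rank_bar] at h2
          simp only [Letter.Valid] at hv
          obtain rfl : a = n := by omega
          split_ifs at hne ⊢ with h5
          · exfalso; apply hne; rw [show i + 1 = a by omega]
          · right; left; simp
    grind [absurd, rank_injOn, downLetter_valid]
  · left; unfold Letter.Lt; omega

theorem midPart_eq_self_of_getLast {a : Letter} (ha : a ∈ lo.getLast?)
    (h : lowIdx n i < a.rank n ∧ a.rank n < 2 * n - lowIdx n i) :
    (midPart n i lo).getLast? = some a := by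
  grind [List.getLast?_eq_some_iff, midPart, List.filter_cons_of_pos, midPart_append]

theorem midPart_eq_self_of_head {a : Letter} (ha : a ∈ hi.head?)
    (h : lowIdx n i < a.rank n ∧ a.rank n < 2 * n - lowIdx n i) :
    (midPart n i hi).head? = some a := by
  obtain ⟨l, rfl⟩ := List.head?_eq_some_iff.1 ha
  grind [midPart, List.filter_cons_of_pos]

theorem midPart_cons_of_not {x : Letter} {C : List Letter}
    (h : ¬ (lowIdx n i < x.rank n ∧ x.rank n < 2 * n - lowIdx n i)) :
    midPart n i (x :: C) = midPart n i C := by grind [midPart, List.filter_cons_of_neg]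

theorem midPart_cons_of {x : Letter} {C : List Letter}
    (h : lowIdx n i < x.rank n ∧ x.rank n < 2 * n - lowIdx n i) :
    midPart n i (x :: C) = x :: midPart n i C := by grind [midPart, List.filter_cons_of_pos]

theorem StrictColumn.midPart_hi (h : StrictColumn n (lo ++ .pos (lowIdx n i) :: hi)) (hn : 2 ≤ n) :
    midPart n i hi = [] := by
  have hj := lowIdx_lt (i := i) hn
  refine midPart_eq_nil fun y hy => ?_
  have := (h.split_above rfl).2 y hy
  grind [Letter.WeakAbove, Letter.rank_pos]

theorem StrictColumn.midPart_lo (h : StrictColumn n (lo ++ .bar (lowIdx n i) :: hi)) (hn : 2 ≤ n) :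
    midPart n i lo = [] := by
  have hj := lowIdx_lt (i := i) hn
  refine midPart_eq_nil fun y hy => ?_
  have := (h.split_above rfl).1 y hy
  grind [Letter.WeakAbove, Letter.rank_bar]

/-- The only entry that could get in the way is an `upLetter` directly below; it would be the top of
the middle part (or counted by `bitUp` directly), contrary to `bitUp = 0`. -/
theorem StrictColumn.low_to_up (h : StrictColumn n (lo ++ .pos (lowIdx n i) :: hi)) (hn : 2 ≤ n)
    (h1 : 1 ≤ i) (hin : i ≤ n) (hb : bitUp n i (lo ++ .pos (lowIdx n i) :: hi) = 0) :
    StrictColumn n (lo ++ upLetter n i :: hi) := by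
  have hj := lowIdx_lt (i := i) hn
  have hu := rank_upLetter hn hin
  obtain ⟨a1, a2⟩ := h.split_above rfl
  refine h.replace (upLetter_valid hn h1 hin) (fun a ha => ?_) fun b hb => ?_
  · have hal : a ∈ lo := List.mem_of_getLast? ha
    have hr := a1 a hal
    simp only [Letter.WeakAbove, Letter.rank_pos] at hr
    refine up_above hn hin (h.valid _ (by simp [hal])) (by omega) ?_
    rintro rfl
    unfold bitUp at hb
    split_ifs at hb with h2 h3
    · grind
    · apply h3
      rw [midPart_append, midPart_cons_of_not (by simp), h.midPart_hi hn, List.append_nil]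
      exact midPart_eq_self_of_getLast ha (by omega)
  · left
    grind [List.mem_of_head?, Letter.WeakAbove, Letter.rank_pos, Letter.Lt]

theorem StrictColumn.up_to_low (h : StrictColumn n (lo ++ upLetter n i :: hi)) (hn : 2 ≤ n)
    (h1 : 1 ≤ i) (hin : i ≤ n) (he : wordPhi (columnWord n i hi) = 0) :
    StrictColumn n (lo ++ .pos (lowIdx n i) :: hi) := by
  have hj := lowIdx_lt (i := i) hn
  have hj1 := lowIdx_pos hn h1
  have hu := rank_upLetter hn hin
  have hr := h.split_up_hi hn h1 hin he
  obtain ⟨a1, a2⟩ := h.split_above rfl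
  refine h.replace ⟨hj1, hj.le⟩ (fun a ha => ?_) fun b hb => ?_
  · left
    have hr := a1 a (List.mem_of_getLast? ha)
    grind [Letter.WeakAbove, Letter.Lt, Letter.rank_pos]
  · left
    grind [List.mem_of_head?, Letter.Lt, Letter.rank_pos]

theorem StrictColumn.down_to_bar (h : StrictColumn n (lo ++ downLetter n i :: hi)) (hn : 2 ≤ n)
    (h1 : 1 ≤ i) (hin : i ≤ n) (he : wordEps (columnWord n i lo) = 0) :
    StrictColumn n (lo ++ .bar (lowIdx n i) :: hi) := by
  have hj := lowIdx_lt (i := i) hn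
  have hj1 := lowIdx_pos hn h1
  have hu := rank_downLetter hn hin
  have hr := h.split_down_lo hn h1 hin he
  obtain ⟨a1, a2⟩ := h.split_above rfl
  refine h.replace ⟨hj1, hj.le⟩ (fun a ha => ?_) fun b hb => ?_
  · left
    grind [List.mem_of_getLast?, Letter.Lt, Letter.rank_bar]
  · left
    grind [List.mem_of_head?, Letter.WeakAbove, Letter.Lt, Letter.rank_bar]

theorem StrictColumn.bar_to_down (h : StrictColumn n (lo ++ .bar (lowIdx n i) :: hi)) (hn : 2 ≤ n)
    (h1 : 1 ≤ i) (hin : i ≤ n) (hb : bitDown n i (lo ++ .bar (lowIdx n i) :: hi) = 0) :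
    StrictColumn n (lo ++ downLetter n i :: hi) := by
  have hj := lowIdx_lt (i := i) hn
  have hu := rank_downLetter hn hin
  obtain ⟨a1, a2⟩ := h.split_above rfl
  refine h.replace (downLetter_valid hn h1 hin) (fun a ha => ?_) fun b hb' => ?_
  · left
    have hr := a1 a (List.mem_of_getLast? ha)
    grind [Letter.WeakAbove, Letter.rank_bar, Letter.Lt]
  · have hbl : b ∈ hi := List.mem_of_head? hb'
    have hr := a2 b hbl
    simp only [Letter.WeakAbove, Letter.rank_bar] at hr
    refine above_down hn h1 hin (h.valid _ (by simp [hbl])) (by omega) ?_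
    rintro rfl
    unfold bitDown at hb
    split_ifs at hb with h2 h3
    · grind
    · apply h3
      rw [midPart_append, h.midPart_lo hn, List.nil_append, midPart_cons_of_not (by simp)]
      exact midPart_eq_self_of_head hb' (by omega)

/-- The effect on the counting functions of `lowIdx n i ↔ upLetter n i`. -/
theorem ext_low_up (h : StrictColumn n (lo ++ .pos (lowIdx n i) :: hi))
    (h' : StrictColumn n (lo ++ upLetter n i :: hi)) (hn : 2 ≤ n) (h1 : 1 ≤ i) (hin : i ≤ n) :
    bitUp n i (lo ++ .pos (lowIdx n i) :: hi) = 0 ∧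
    (∀ a, a ≠ lowIdx n i → extLow n i (lo ++ upLetter n i :: hi) a =
      extLow n i (lo ++ .pos (lowIdx n i) :: hi) a) ∧
    extLow n i (lo ++ upLetter n i :: hi) (lowIdx n i) + 1 =
      extLow n i (lo ++ .pos (lowIdx n i) :: hi) (lowIdx n i) ∧
    extBar n i (lo ++ upLetter n i :: hi) = extBar n i (lo ++ .pos (lowIdx n i) :: hi) := by
  have hj := lowIdx_lt (i := i) hn
  have hu := rank_upLetter hn hin
  have hd := rank_downLetter hn hin
  have hne := upLetter_ne_downLetter (n := n) (i := i)
  have e0 : upLetter n i ≠ .pos (lowIdx n i) := by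
    intro e; rw [e, Letter.rank_pos] at hu; omega
  have hw : wordPhi (columnWord n i hi) = 0 := by rw [(h.split_low hn h1 hin).1]; rfl
  obtain ⟨-, b1, -⟩ := h'.split_up hn h1 hin hw
  have mo : midPart n i (lo ++ .pos (lowIdx n i) :: hi) = midPart n i lo := by
    rw [midPart_append, midPart_cons_of_not (by simp), h.midPart_hi hn, List.append_nil]
  have mn : midPart n i (lo ++ upLetter n i :: hi) = midPart n i lo ++ [upLetter n i] := by
    rw [midPart_append, midPart_cons_of (by omega), h.midPart_hi hn]
  have b2 : bitUp n i (lo ++ .pos (lowIdx n i) :: hi) = 0 := by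
    unfold bitUp at b1 ⊢
    split_ifs with h2 h3
    · rw [if_pos h2, List.count_append, List.count_cons_self] at b1
      rw [List.count_append, List.count_cons_of_ne e0.symm]; omega
    · exfalso
      have := (h'.midPart_alternating hn (by omega) hin).2
      rw [mn, List.isChain_append] at this
      rw [mo] at h3
      exact this.2.2 _ h3 (upLetter n i) (by simp) rfl
    · rfl
  have b3 : n - 1 ≤ i → bitDown n i (lo ++ upLetter n i :: hi) =
      bitDown n i (lo ++ .pos (lowIdx n i) :: hi) := by
    intro h2
    unfold bitDown
    have h3 : ¬ i < n - 1 := by omega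
    simp only [h3, if_false, mo, mn]
    cases midPart n i lo with
    | nil => simp [hne]
    | cons y l => simp
  have cl : ∀ a < n, lowCount (lo ++ upLetter n i :: hi) a + (if a = lowIdx n i then 1 else 0) =
      lowCount (lo ++ .pos (lowIdx n i) :: hi) a := by
    intro a ha
    unfold upLetter lowIdx at *
    by_cases h2 : i < n
    · simp only [h2, if_true, lowCount_append, lowCount_pos_cons]
      split_ifs <;> omega
    · simp only [h2, if_false, lowCount_append, lowCount_pos_cons, lowCount_bar_cons]
      split_ifs <;> omega
  grind [barCount, upLetter, lowIdx, barCount_append, barCount_pos_cons, barCount_bar_cons,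
      extLow, lowIdx_eq, extBar]

/-- The effect on the counting functions of `downLetter n i ↔ \overline{lowIdx n i}`. -/
theorem ext_down_bar (h : StrictColumn n (lo ++ downLetter n i :: hi))
    (h' : StrictColumn n (lo ++ .bar (lowIdx n i) :: hi)) (hn : 2 ≤ n) (h1 : 1 ≤ i) (hin : i ≤ n) :
    bitDown n i (lo ++ .bar (lowIdx n i) :: hi) = 0 ∧
    (∀ a, a ≠ lowIdx n i → extBar n i (lo ++ .bar (lowIdx n i) :: hi) a =
      extBar n i (lo ++ downLetter n i :: hi) a) ∧
    extBar n i (lo ++ .bar (lowIdx n i) :: hi) (lowIdx n i) =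
      extBar n i (lo ++ downLetter n i :: hi) (lowIdx n i) + 1 ∧
    extLow n i (lo ++ .bar (lowIdx n i) :: hi) = extLow n i (lo ++ downLetter n i :: hi) := by
  have hj := lowIdx_lt (i := i) hn
  have hu := rank_upLetter hn hin
  have hd := rank_downLetter hn hin
  have hne := upLetter_ne_downLetter (n := n) (i := i)
  have e0 : downLetter n i ≠ .bar (lowIdx n i) := by
    intro e; rw [e, Letter.rank_bar] at hd; omega
  have hw : wordEps (columnWord n i lo) = 0 := by rw [(h'.split_bar hn h1 hin).1]; rfl
  obtain ⟨-, b1, -⟩ := h.split_down hn h1 hin hw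
  have mo : midPart n i (lo ++ .bar (lowIdx n i) :: hi) = midPart n i hi := by
    rw [midPart_append, midPart_cons_of_not (by simp), h'.midPart_lo hn, List.nil_append]
  have mn : midPart n i (lo ++ downLetter n i :: hi) = downLetter n i :: midPart n i hi := by
    rw [midPart_append, midPart_cons_of (by omega), h'.midPart_lo hn, List.nil_append]
  have b2 : bitDown n i (lo ++ .bar (lowIdx n i) :: hi) = 0 := by
    unfold bitDown at b1 ⊢
    split_ifs with h2 h3
    · rw [if_pos h2, List.count_append, List.count_cons_self] at b1
      rw [List.count_append, List.count_cons_of_ne e0.symm]; omega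
    · exfalso
      have := (h.midPart_alternating hn (by omega) hin).2
      rw [mn, List.isChain_cons] at this
      rw [mo] at h3
      exact this.1 _ h3 rfl
    · rfl
  have b3 : n - 1 ≤ i → bitUp n i (lo ++ .bar (lowIdx n i) :: hi) =
      bitUp n i (lo ++ downLetter n i :: hi) := by
    intro h2
    unfold bitUp
    have h3 : ¬ i < n - 1 := by omega
    simp only [h3, if_false, mo, mn, List.getLast?_cons]
    cases (midPart n i hi).getLast? with
    | none => simp [hne.symm]
    | some y => simp
  have cb : ∀ a < n, barCount (lo ++ .bar (lowIdx n i) :: hi) a =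
      barCount (lo ++ downLetter n i :: hi) a + (if a = lowIdx n i then 1 else 0) := by
    intro a ha
    unfold downLetter lowIdx at *
    by_cases h2 : i < n
    · simp only [h2, if_true, barCount_append, barCount_bar_cons]
      split_ifs <;> omega
    · simp only [h2, if_false, barCount_append, barCount_pos_cons, barCount_bar_cons]
      split_ifs <;> omega
  grind [lowCount, lowIdx, downLetter, lowCount_append, lowCount_bar_cons, lowCount_pos_cons,
      extBar, lowIdx_eq, extLow]

theorem SignOK.replace {s : Prop} {x y : Letter} (h : SignOK n s (lo ++ x :: hi))
    (hy : y.rank n ≠ n) : SignOK n s (lo ++ y :: hi) := by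
  intro p
  by_cases hp : p = lo.length
  · subst hp
    simp only [List.getElem?_append_right le_rfl, Nat.sub_self, List.getElem?_cons_zero,
      Option.some.injEq]
    constructor
    · rintro rfl; simp at hy
    · rintro rfl; simp at hy; omega
  · have : (lo ++ y :: hi)[p]? = (lo ++ x :: hi)[p]? := by grind
    rw [this]; exact h p

end

end

section

/-! ### Adjacent columns under the operators -/

section

variable {n i : ℕ} {C C' D D' : List Letter}

theorem extLow_of_lt {a : ℕ} (ha : a < n) : extLow n i C a = lowCount C a := if_pos ha

theorem extBar_of_lt {a : ℕ} (ha : a < n) : extBar n i C a = barCount C a := if_pos ha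

theorem extLow_self (h : n - 1 ≤ i) : extLow n i C n = lowCount C (n - 1) + bitUp n i C := by
  grind [extLow, lt_irrefl]

theorem extBar_self (h : n - 1 ≤ i) : extBar n i C n = barCount C (n - 1) + bitDown n i C := by
  grind [extBar, lt_irrefl]

theorem StrictColumn.midPart_getElem? (h : StrictColumn n C) (hn : 2 ≤ n) (h2 : n - 1 ≤ i)
    (hin : i ≤ n) : lowCount C (n - 1) + barCount C (n - 1) + (midPart n i C).length = C.length ∧
      ∀ p < (midPart n i C).length, (midPart n i C)[p]? = C[barCount C (n - 1) + p]? := by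
  have hj : lowIdx n i = n - 1 := by have := lowIdx_eq hn hin; omega
  have e := h.eq_parts (i := i) hn
  rw [hj] at e
  have l1 : (C.filter fun x => decide (2 * n - (n - 1) ≤ x.rank n)).length = barCount C (n - 1) := by
    rw [barCount, List.countP_eq_length_filter.symm]
    refine List.countP_congr fun x hx => ?_
    have := h.valid x hx
    cases x <;> simp [Letter.Valid] at this ⊢ <;> omega
  have l2 : (C.filter fun x => decide (x.rank n ≤ n - 1)).length = lowCount C (n - 1) := by
    rw [lowCount, List.countP_eq_length_filter.symm]
    refine List.countP_congr fun x hx => ?_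
    have := h.valid x hx
    cases x with
    | pos a => exact Iff.rfl
    | bar a =>
      simp only [Letter.Valid] at this
      refine ⟨fun h => ?_, fun h => absurd h (by simp)⟩
      change decide (2 * n - a ≤ n - 1) = true at h
      rw [decide_eq_true_eq] at h
      omega
  constructor
  · grind
  · intro p hp
    have : ∀ q : ℕ, C[q]? = (C.filter (fun x => decide (2 * n - (n - 1) ≤ x.rank n)) ++
      (midPart n i C ++ C.filter (fun x => decide (x.rank n ≤ n - 1))))[q]? := fun q => by
      rw [← e]
    rw [this, List.getElem?_append_right (by omega), l1, Nat.add_sub_cancel_left,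
      List.getElem?_append_left hp]

theorem upLetter_high (h2 : n - 1 ≤ i) (hn : 2 ≤ n) (hin : i ≤ n) :
    (i = n - 1 ∧ upLetter n i = .pos n ∧ downLetter n i = .bar n) ∨
      (i = n ∧ upLetter n i = .bar n ∧ downLetter n i = .pos n) := by
  grind [upLetter, downLetter, Nat.sub_add_cancel]

/-- The number `z` encodes the sign relative to the colour: a row `p` with a letter of rank `n`
holds `upLetter` if and only if `p + z` is even. The two bits concern the highest and the lowest of
these rows. -/
theorem StrictColumn.bit_sign (h : StrictColumn n C) (hn : 2 ≤ n) (h2 : n - 1 ≤ i)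
    (hin : i ≤ n) {z : ℕ} (hz : z < 2) (hs : SignOK n (z = 0 ↔ i < n) C) :
    (bitUp n i C = 1 ↔ lowCount C (n - 1) + barCount C (n - 1) < C.length ∧
        (C.length - lowCount C (n - 1) - 1 + z) % 2 = 0) ∧
      (bitDown n i C = 1 ↔ lowCount C (n - 1) + barCount C (n - 1) < C.length ∧
        (barCount C (n - 1) + z) % 2 = 1) := by
  obtain ⟨hl, hg⟩ := h.midPart_getElem? hn h2 hin
  have key : ∀ p, lowCount C (n - 1) + barCount C (n - 1) + p < C.length →
      ((midPart n i C)[p]? = some (upLetter n i) ↔ (barCount C (n - 1) + p + z) % 2 = 0) ∧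
      ((midPart n i C)[p]? = some (downLetter n i) ↔ (barCount C (n - 1) + p + z) % 2 = 1) := by
    intro p hp
    rw [hg p (by omega)]
    have h0 := h.exists_index_n (p := barCount C (n - 1) + p) (by omega) (by omega)
    obtain ⟨s1, s2⟩ := hs (barCount C (n - 1) + p)
    rcases upLetter_high h2 hn hin with ⟨hi, e1, e2⟩ | ⟨hi, e1, e2⟩ <;> rw [e1, e2] <;>
    rcases h0 with h0 | h0 <;> rw [h0] at s1 s2 ⊢ <;>
      simp [Nat.even_iff, Nat.odd_iff, hi] at s1 s2 ⊢
    · have : 0 < n := by omega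
      simp only [this, iff_true] at s1; omega
    · have : 0 < n := by omega
      simp only [this, iff_true] at s2; omega
    · omega
    · omega
  have hu : bitUp n i C = if (midPart n i C).getLast? = some (upLetter n i) then 1 else 0 := by
    unfold bitUp; rw [if_neg (by omega)]
  have hd : bitDown n i C = if (midPart n i C).head? = some (downLetter n i) then 1 else 0 := by
    unfold bitDown; rw [if_neg (by omega)]
  rw [hu, hd, List.getLast?_eq_getElem?, List.head?_eq_getElem?]
  grind

/-- The increments at `n` in terms of the number of letters `n`, `n̄` and their positions. -/
def SignBits (N A B x₂ x₃ z : ℕ) : Prop :=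
  (A + B = N ∧ x₂ = 0 ∧ x₃ = 0) ∨
    (A + B < N ∧ x₂ + (N - A - 1 + z) % 2 = 1 ∧ x₃ = (B + z) % 2)

theorem StrictColumn.signBits (h : StrictColumn n C) (hn : 2 ≤ n) (h2 : n - 1 ≤ i)
    (hin : i ≤ n) {z : ℕ} (hz : z < 2) (hs : SignOK n (z = 0 ↔ i < n) C) :
    SignBits C.length (lowCount C (n - 1)) (barCount C (n - 1)) (bitUp n i C) (bitDown n i C)
      z := by
  obtain ⟨e1, e2⟩ := h.bit_sign hn h2 hin hz hs
  have c0 := lowCount_add_barCount_le C (n - 1)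
  have hb1 : bitUp n i C ≤ 1 := by grind [bitUp]
  have hb2 : bitDown n i C ≤ 1 := by grind [bitDown]
  by_cases hM : lowCount C (n - 1) + barCount C (n - 1) < C.length
  · simp only [hM, true_and] at e1 e2
    exact Or.inr ⟨hM, by omega, by omega⟩
  · simp only [hM, false_and, iff_false] at e1 e2
    exact Or.inl ⟨by omega, by omega, by omega⟩

section Arithmetic

variable {N A B x₂ x₃ z N' A' B' x₂' x₃' z' : ℕ}

/-- The bits are at most `1`, so only `B = B'` is critical. Then the lowest rows with a letter of
rank `n` coincide, and equal signs give equal bits; for different signs `N ≤ A + B'` leaves `C` no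
such letter. The next lemmas follow the same scheme. -/
theorem SignBits.left_self (b : SignBits N A B x₂ x₃ z) (b' : SignBits N' A' B' x₂' x₃' z')
    (l : B ≤ B') (r : A' + N ≤ A + N') (s : z = z' ∨ N ≤ A + B') : B + x₃ ≤ B' + x₃' := by
  rcases b with ⟨_, _, _⟩ | ⟨_, _, _⟩ <;> rcases b' with ⟨_, _, _⟩ | ⟨_, _, _⟩ <;> omega

theorem SignBits.right_self (b : SignBits N A B x₂ x₃ z) (b' : SignBits N' A' B' x₂' x₃' z')
    (l : B ≤ B') (r : A' + N ≤ A + N') (s : z = z' ∨ N ≤ A + B') :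
    A' + x₂' + N ≤ A + x₂ + N' := by
  rcases b with ⟨_, _, _⟩ | ⟨_, _, _⟩ <;> rcases b' with ⟨_, _, _⟩ | ⟨_, _, _⟩ <;> omega

theorem SignBits.mid_self (b : SignBits N A B x₂ x₃ z) (b' : SignBits N' A' B' x₂' x₃' z')
    (l : B ≤ B') (r : A' + N ≤ A + N') (m : N ≤ A + B' + 1) (s : z = z' ∨ N ≤ A + B') :
    N ≤ A + x₂ + (B' + x₃') := by
  rcases b with ⟨_, _, _⟩ | ⟨_, _, _⟩ <;> rcases b' with ⟨_, _, _⟩ | ⟨_, _, _⟩ <;> omega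

theorem SignBits.mid_strict (b : SignBits N A B x₂ x₃ z) (b' : SignBits N' A' B' x₂' x₃' z')
    (hM : A + B < N) (hM' : A' + B' < N') (hz : z < 2) (hz' : z' < 2) (hne : z ≠ z')
    (m : N ≤ A + B') : N + 1 ≤ A + x₂ + (B' + x₃') := by
  rcases b with ⟨_, _, _⟩ | ⟨_, _, _⟩ <;> rcases b' with ⟨_, _, _⟩ | ⟨_, _, _⟩ <;> omega

theorem SignBits.le_length (b : SignBits N A B x₂ x₃ z) : A + B + x₂ + x₃ ≤ N := by
  rcases b with ⟨_, _, _⟩ | ⟨_, _, _⟩ <;> omega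

end Arithmetic

theorem StrictColumn.exists_sign (h : StrictColumn n C) (hn : 2 ≤ n) :
    ∃ z < 2, SignOK n (z = 0 ↔ i < n) C := by
  obtain ⟨s, hs⟩ := h.exists_signOK (by omega)
  have : ∃ z < 2, ((z = 0 ↔ i < n) ↔ s) := by
    by_cases h1 : s <;> by_cases h2 : i < n
    · simp_all
    · exact ⟨1, by omega, by simp [*]⟩
    · exact ⟨1, by omega, by simp [*]⟩
    · exact ⟨0, by omega, by simp [*]⟩
  obtain ⟨z, hz, e⟩ := this
  exact ⟨z, hz, by rw [e]; exact hs⟩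

theorem StrictColumn.signOK_of_full (h : StrictColumn n C)
    (hM : ¬ lowCount C (n - 1) + barCount C (n - 1) < C.length) (s : Prop) : SignOK n s C := by
  intro p
  refine ⟨fun hp => ?_, fun hp => ?_⟩
  · have := h.index_n hp (by simp [Letter.rank]); omega
  · have := h.index_n hp (by simp [Letter.rank]; omega); omega

theorem StrictColumn.signOK_unique (h : StrictColumn n C) {s t : Prop} (hs : SignOK n s C)
    (ht : SignOK n t C) (hM : lowCount C (n - 1) + barCount C (n - 1) < C.length) : s ↔ t := by
  have s1 := hs (barCount C (n - 1))
  have t1 := ht (barCount C (n - 1))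
  rcases h.exists_index_n (p := barCount C (n - 1)) le_rfl (by omega) with e | e
  · exact (s1.1 e).symm.trans (t1.1 e)
  simp_all

/-- The last index of the (extended) counting functions. -/
def topIdx (n i : ℕ) : ℕ := if i < n - 1 then n - 1 else n

theorem lowIdx_lt_topIdx (hn : 2 ≤ n) (hin : i ≤ n) : lowIdx n i < topIdx n i := by
  grind [topIdx, lowIdx_eq]

/-- The inequalities involving the index `n` follow from those at `n - 1` by the parity of the rows
of `n`, `n̄`. The strict alternative in `sign` is the same system of inequalities with the constant
`n` replaced by `n - 1`. -/
theorem GoodPair.pairIneq (h : GoodPair n C C') (hC : StrictColumn n C) (hC' : StrictColumn n C')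
    (hn : 2 ≤ n) (hin : i ≤ n) :
    PairIneq (topIdx n i) C.length C'.length n (extLow n i C) (extBar n i C) (extLow n i C')
        (extBar n i C') ∧
      ((∃ s : Prop, SignOK n s C ∧ SignOK n s C') ∨
        PairIneq (topIdx n i) C.length C'.length (n - 1) (extLow n i C) (extBar n i C)
          (extLow n i C') (extBar n i C')) := by
  unfold topIdx
  split_ifs with hi
  · constructor
    · refine ⟨fun a b hab hb => ?_, fun a b hab hb => ?_, fun a ha => ?_⟩ <;>
        simp only [extLow_of_lt (show a < n by omega), extBar_of_lt (show a < n by omega)]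
      · simp only [extLow_of_lt (show b < n by omega), extBar_of_lt (show b < n by omega)]
        exact h.left a b hab (by omega)
      · simp only [extLow_of_lt (show b < n by omega), extBar_of_lt (show b < n by omega)]
        exact h.right a b hab (by omega)
      · exact h.mid a (by omega)
    · rcases h.sign with hs | hs
      · exact Or.inl hs
      · right
        refine ⟨fun a b hab hb => ?_, fun a b hab hb => ?_, fun a ha => ?_⟩ <;>
          simp only [extLow_of_lt (show a < n by omega), extBar_of_lt (show a < n by omega)]
        · simp only [extLow_of_lt (show b < n by omega), extBar_of_lt (show b < n by omega)]
          exact h.left a b hab (by omega)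
        · simp only [extLow_of_lt (show b < n by omega), extBar_of_lt (show b < n by omega)]
          exact h.right a b hab (by omega)
        · have := hs a (by omega)
          omega
  have h2 : n - 1 ≤ i := by omega
  have l0 := h.left (n - 1) (n - 1) le_rfl (by omega)
  have r0 := h.right (n - 1) (n - 1) le_rfl (by omega)
  have m0 := h.mid (n - 1) (by omega)
  have c0 := lowCount_add_barCount_le C (n - 1)
  have c0' := lowCount_add_barCount_le C' (n - 1)
  obtain ⟨z, hz, sz⟩ := hC.exists_sign (i := i) hn
  obtain ⟨z', hz', sz'⟩ := hC'.exists_sign (i := i) hn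
  have bs := hC.signBits hn h2 hin hz sz
  have bs' := hC'.signBits hn h2 hin hz' sz'
  have t := bs.le_length
  have t' := bs'.le_length
  -- The signs can differ only where `mid` is strict: by `sign`, or because one column has no letter
  -- of rank `n` and then `left` or `right` with `b = n - 1` is strict enough.
  have hzz : z = z' ∨ ∀ a < n, C.length + a < n + lowCount C a + barCount C' a := by
    by_cases hM : lowCount C (n - 1) + barCount C (n - 1) < C.length ∧
      lowCount C' (n - 1) + barCount C' (n - 1) < C'.length
    · rcases h.sign with ⟨s, hs, hs'⟩ | hs
      · left
        have e1 := hC.signOK_unique sz hs hM.1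
        have e2 := hC'.signOK_unique sz' hs' hM.2
        have := e1.trans e2.symm
        by_cases hi' : i < n
        · simp only [hi', iff_true] at this; omega
        · simp only [hi', iff_false] at this; omega
      · exact Or.inr hs
    · right
      intro a ha
      have := h.left a (n - 1) (by omega) (by omega)
      have := h.right a (n - 1) (by omega) (by omega)
      omega
  have main : PairIneq n C.length C'.length n (extLow n i C) (extBar n i C) (extLow n i C')
        (extBar n i C') := by
    have s0 : z = z' ∨ C.length ≤ lowCount C (n - 1) + barCount C' (n - 1) :=
      hzz.imp id fun hs => by have := hs (n - 1) (by omega); omega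
    have l1 := bs.left_self bs' (by omega) (by omega) s0
    have r1 := bs.right_self bs' (by omega) (by omega) s0
    have m1 := bs.mid_self bs' (by omega) (by omega) (by omega) s0
    refine ⟨fun a b hab hb => ?_, fun a b hab hb => ?_, fun a ha => ?_⟩
    · rcases eq_or_lt_of_le hb with rfl | hb
      · rcases eq_or_lt_of_le hab with rfl | hab
        · simp only [extLow_self h2, extBar_self h2]
          omega
        · have := h.left a (b - 1) (by omega) (by omega)
          have := h.mid a hab
          simp only [extLow_self h2, extBar_self h2, extLow_of_lt hab, extBar_of_lt hab]
          omega
      · have := h.left a b hab hb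
        have ha : a < n := by omega
        simpa only [extLow_of_lt hb, extBar_of_lt hb, extLow_of_lt ha, extBar_of_lt ha] using this
    · rcases eq_or_lt_of_le hb with rfl | hb
      · rcases eq_or_lt_of_le hab with rfl | hab
        · simp only [extLow_self h2, extBar_self h2]
          omega
        · have := h.right a (b - 1) (by omega) (by omega)
          have := h.mid a hab
          simp only [extLow_self h2, extBar_self h2, extLow_of_lt hab, extBar_of_lt hab]
          omega
      · have := h.right a b hab hb
        have ha : a < n := by omega
        simpa only [extLow_of_lt hb, extBar_of_lt hb, extLow_of_lt ha, extBar_of_lt ha] using this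
    · rcases eq_or_lt_of_le ha with rfl | ha
      · simp only [extLow_self h2, extBar_self h2]
        omega
      · have := h.mid a ha
        simpa only [extLow_of_lt ha, extBar_of_lt ha] using this
  refine ⟨main, ?_⟩
  by_cases hcom : ∃ s : Prop, SignOK n s C ∧ SignOK n s C'
  · exact Or.inl hcom
  right
  have hs := h.sign.resolve_left hcom
  -- A column without letters of rank `n` satisfies every sign condition, so it would share a sign
  -- with the other column.
  have hM : lowCount C (n - 1) + barCount C (n - 1) < C.length := by
    by_contra hM
    exact hcom ⟨_, hC.signOK_of_full hM _, sz'⟩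
  have hM' : lowCount C' (n - 1) + barCount C' (n - 1) < C'.length := by
    by_contra hM
    exact hcom ⟨_, sz, hC'.signOK_of_full hM _⟩
  have hne : z ≠ z' := fun e => hcom ⟨_, sz, e ▸ sz'⟩
  refine ⟨main.left, main.right, fun a ha => ?_⟩
  rcases eq_or_lt_of_le ha with rfl | ha
  · have := hs (a - 1) (by omega)
    have := bs.mid_strict bs' hM hM' hz hz' hne (by omega)
    simp only [extLow_self h2, extBar_self h2]
    omega
  grind [extLow_of_lt, extBar_of_lt]

theorem GoodPair.of_pairIneq (hn : 2 ≤ n) {c : ℕ}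
    (h : PairIneq (topIdx n i) C.length C'.length c (extLow n i C) (extBar n i C) (extLow n i C')
        (extBar n i C')) (hc : c ≤ n)
    (hs : (∃ s : Prop, SignOK n s C ∧ SignOK n s C') ∨
      ∀ a < n, C.length + a < n + lowCount C a + barCount C' a) : GoodPair n C C' := by
  have hk : n - 1 ≤ topIdx n i := by grind [topIdx]
  refine ⟨fun a b hab hb => ?_, fun a b hab hb => ?_, fun a ha => ?_, hs⟩
  · have := h.left a b hab (by omega)
    grind [extLow_of_lt, extBar_of_lt]
  · have := h.right a b hab (by omega)
    grind [extLow_of_lt, extBar_of_lt]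
  · have := h.mid a (by omega)
    grind [extLow_of_lt, extBar_of_lt]

/-- `T` is required for every constant `c` because it is used twice: with `c = n` for `mid` itself
and, if the columns have no common sign, with `c = n - 1` for its strict form. Only the loss of a
common sign has to be treated by hand. -/
theorem GoodPair.transport (hg : GoodPair n C C') (hC : StrictColumn n C) (hC' : StrictColumn n C')
    (hn : 2 ≤ n) (hin : i ≤ n)
    (T : ∀ c, PairIneq (topIdx n i) C.length C'.length c (extLow n i C) (extBar n i C)
        (extLow n i C') (extBar n i C') →
      PairIneq (topIdx n i) D.length D'.length c (extLow n i D) (extBar n i D)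
        (extLow n i D') (extBar n i D'))
    (hs : ∀ s, SignOK n s C → SignOK n s C' → (∃ s : Prop, SignOK n s D ∧ SignOK n s D') ∨
      ∀ a < n, D.length + a < n + lowCount D a + barCount D' a) : GoodPair n D D' := by
  obtain ⟨h1, h2⟩ := hg.pairIneq hC hC' hn hin
  refine GoodPair.of_pairIneq hn (T n h1) le_rfl ?_
  rcases h2 with ⟨s, s1, s2⟩ | h2
  · exact hs s s1 s2
  · right
    intro a ha
    have := (T _ h2).mid a (by unfold topIdx; split_ifs <;> omega)
    grind [extLow_of_lt, extBar_of_lt]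

end

end

/-! ### Good columns and good pairs after the replacement of one entry -/

section

section

variable {n i : ℕ} {C C' lo hi : List Letter}

theorem length_replace (lo hi : List Letter) (x y : Letter) :
    (lo ++ x :: hi).length = (lo ++ y :: hi).length := by simp

/-- At the additional index `n` the bound comes from the height: the surviving bits never count more
letters than the column has. -/
theorem StrictColumn.ext_cc (h : GoodColumn n C) (hn : 2 ≤ n) (h1 : 1 ≤ i) (hin : i ≤ n) :
    ∀ a ≤ topIdx n i, extLow n i C a + extBar n i C a ≤ a := by
  intro a ha
  unfold topIdx at ha
  by_cases han : a < n
  · rw [extLow_of_lt han, extBar_of_lt han]; exact h.cc a han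
  · have h2 : ¬ i < n - 1 := by intro h2; rw [if_pos h2] at ha; omega
    rw [if_neg h2] at ha
    obtain rfl : a = n := by omega
    obtain ⟨z, hz, sz⟩ := h.toStrict.exists_sign (i := i) hn
    have := (h.toStrict.signBits hn (by omega) hin hz sz).le_length
    have := h.length_le
    grind [extLow_self, extBar_self]

theorem GoodColumn.of_ext {D : List Letter} (hD : StrictColumn n D) (hl : D.length ≤ n)
    (h : ∀ a ≤ topIdx n i, extLow n i D a + extBar n i D a ≤ a) : GoodColumn n D := by
  refine ⟨hD.valid, hD.strict, hl, fun a ha => ?_⟩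
  have := h a (by unfold topIdx; split_ifs <;> omega)
  rwa [extLow_of_lt ha, extBar_of_lt ha] at this

theorem GoodColumn.low_to_up (h : GoodColumn n (lo ++ .pos (lowIdx n i) :: hi)) (hn : 2 ≤ n)
    (h1 : 1 ≤ i) (hin : i ≤ n) (hb : bitUp n i (lo ++ .pos (lowIdx n i) :: hi) = 0) :
    GoodColumn n (lo ++ upLetter n i :: hi) := by
  have hD := h.toStrict.low_to_up hn h1 hin hb
  obtain ⟨-, e1, e2, e3⟩ := ext_low_up h.toStrict hD hn h1 hin
  refine GoodColumn.of_ext (i := i) hD (by have := h.length_le; simpa using this) fun a ha => ?_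
  have := StrictColumn.ext_cc h hn h1 hin a ha
  rw [e3]
  grind

theorem GoodColumn.bar_to_down (h : GoodColumn n (lo ++ .bar (lowIdx n i) :: hi)) (hn : 2 ≤ n)
    (h1 : 1 ≤ i) (hin : i ≤ n) (hb : bitDown n i (lo ++ .bar (lowIdx n i) :: hi) = 0) :
    GoodColumn n (lo ++ downLetter n i :: hi) := by
  have hD := h.toStrict.bar_to_down hn h1 hin hb
  obtain ⟨-, e1, e2, e3⟩ := ext_down_bar hD h.toStrict hn h1 hin
  refine GoodColumn.of_ext (i := i) hD (by have := h.length_le; simpa using this) fun a ha => ?_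
  have := StrictColumn.ext_cc h hn h1 hin a ha
  rw [← e3]
  grind

theorem GoodColumn.down_to_bar (h : GoodColumn n (lo ++ downLetter n i :: hi)) (hn : 2 ≤ n)
    (h1 : 1 ≤ i) (hin : i ≤ n) (he : wordEps (columnWord n i lo) = 0)
    (hp : wordPhi (columnWord n i hi) = 0) :
    GoodColumn n (lo ++ .bar (lowIdx n i) :: hi) := by
  have hD := h.toStrict.down_to_bar hn h1 hin he
  obtain ⟨-, e1, e2, e3⟩ := ext_down_bar h.toStrict hD hn h1 hin
  have hk := lowIdx_lt_topIdx hn hin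
  have hj := lowIdx_pos hn h1
  obtain ⟨-, b1, b2, b3, b4⟩ := h.toStrict.split_down hn h1 hin he
  obtain ⟨_, _, _, _, _, _, _, _⟩ := h.toStrict.increments hn h1 hin
  refine GoodColumn.of_ext (i := i) hD (by have := h.length_le; simpa using this) fun a ha => ?_
  have c0 := StrictColumn.ext_cc h hn h1 hin a ha
  rw [e3]
  by_cases haj : a = lowIdx n i
  · subst haj
    -- The count at `j` grows by one. If `bitLow = 0`, the bound at `j - 1` leaves room for this;
    -- otherwise `hp` forces `bitUp = 1` and the bound at `j + 1` does.
    have := StrictColumn.ext_cc h hn h1 hin (lowIdx n i + 1) (by omega)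
    have := StrictColumn.ext_cc h hn h1 hin (lowIdx n i - 1) (by omega)
    omega
  simp_all

theorem GoodColumn.up_to_low (h : GoodColumn n (lo ++ upLetter n i :: hi)) (hn : 2 ≤ n)
    (h1 : 1 ≤ i) (hin : i ≤ n) (he : wordEps (columnWord n i lo) = 0)
    (hp : wordPhi (columnWord n i hi) = 0) :
    GoodColumn n (lo ++ .pos (lowIdx n i) :: hi) := by
  have hD := h.toStrict.up_to_low hn h1 hin hp
  obtain ⟨-, e1, e2, e3⟩ := ext_low_up hD h.toStrict hn h1 hin
  have hk := lowIdx_lt_topIdx hn hin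
  have hj := lowIdx_pos hn h1
  obtain ⟨-, b1, b2, b3, b4⟩ := h.toStrict.split_up hn h1 hin hp
  obtain ⟨_, _, _, _, _, _, _, _⟩ := h.toStrict.increments hn h1 hin
  refine GoodColumn.of_ext (i := i) hD (by have := h.length_le; simpa using this) fun a ha => ?_
  have c0 := StrictColumn.ext_cc h hn h1 hin a ha
  rw [← e3]
  by_cases haj : a = lowIdx n i
  · subst haj
    have := StrictColumn.ext_cc h hn h1 hin (lowIdx n i + 1) (by omega)
    have := StrictColumn.ext_cc h hn h1 hin (lowIdx n i - 1) (by omega)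
    omega
  simp_all

theorem SignOK.lift {D : List Letter} (hC : StrictColumn n C) (hD : StrictColumn n D) (hn : 1 ≤ n)
    (hle : ∀ s, SignOK n s D → SignOK n s C)
    (hM : lowCount C (n - 1) + barCount C (n - 1) < C.length) {s : Prop} (hs : SignOK n s C) :
    SignOK n s D := by
  obtain ⟨t, ht⟩ := hD.exists_signOK hn
  have := hC.signOK_unique hs (hle t ht) hM
  rwa [propext this]

/-- Replacing an entry in the column on the left keeps the sign condition. -/
theorem signOK_replace_or {x y : Letter} (hC : StrictColumn n (lo ++ x :: hi))
    (hD : StrictColumn n (lo ++ y :: hi)) (hn : 1 ≤ n) (hx : x.rank n ≠ n) {s : Prop}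
    (hs : SignOK n s (lo ++ x :: hi)) : SignOK n s (lo ++ y :: hi) ∨ (y.rank n = n ∧
      ¬ lowCount (lo ++ x :: hi) (n - 1) + barCount (lo ++ x :: hi) (n - 1) <
        (lo ++ x :: hi).length) := by
  by_cases hy : y.rank n = n
  · by_cases hM : lowCount (lo ++ x :: hi) (n - 1) + barCount (lo ++ x :: hi) (n - 1) <
        (lo ++ x :: hi).length
    · exact Or.inl (SignOK.lift hC hD hn (fun t ht => ht.replace hx) hM hs)
    omega
  · exact Or.inl (hs.replace hy)

theorem rank_up_eq (hn : 2 ≤ n) (hin : i ≤ n) (h : (upLetter n i).rank n = n) :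
    n - 1 ≤ i ∧ lowIdx n i = n - 1 := by grind [rank_upLetter, lowIdx_eq]

theorem rank_down_eq (hn : 2 ≤ n) (hin : i ≤ n) (h : (downLetter n i).rank n = n) :
    n - 1 ≤ i ∧ lowIdx n i = n - 1 := by grind [rank_downLetter, lowIdx_eq]

theorem low_rank_ne (hn : 2 ≤ n) : (Letter.pos (lowIdx n i)).rank n ≠ n := by
  have := lowIdx_lt (i := i) hn; rw [Letter.rank_pos]; omega

theorem bar_rank_ne (hn : 2 ≤ n) : (Letter.bar (lowIdx n i)).rank n ≠ n := by
  have := lowIdx_lt (i := i) hn; rw [Letter.rank_bar]; omega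

theorem ext_low_up_count (h : StrictColumn n (lo ++ .pos (lowIdx n i) :: hi))
    (h' : StrictColumn n (lo ++ upLetter n i :: hi)) (hn : 2 ≤ n) (h1 : 1 ≤ i) (hin : i ≤ n) :
    (∀ a < n, a ≠ lowIdx n i → lowCount (lo ++ upLetter n i :: hi) a =
      lowCount (lo ++ .pos (lowIdx n i) :: hi) a) ∧
    lowCount (lo ++ upLetter n i :: hi) (lowIdx n i) + 1 =
      lowCount (lo ++ .pos (lowIdx n i) :: hi) (lowIdx n i) ∧
    ∀ a < n, barCount (lo ++ upLetter n i :: hi) a =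
      barCount (lo ++ .pos (lowIdx n i) :: hi) a := by
  obtain ⟨-, e1, e2, e3⟩ := ext_low_up h h' hn h1 hin
  refine ⟨fun a ha haj => ?_, ?_, fun a ha => ?_⟩
  · simpa only [extLow_of_lt ha] using e1 a haj
  · grind [extLow_of_lt, lowIdx_lt]
  · simpa only [extBar_of_lt ha] using congrFun e3 a

theorem ext_down_bar_count (h : StrictColumn n (lo ++ downLetter n i :: hi))
    (h' : StrictColumn n (lo ++ .bar (lowIdx n i) :: hi)) (hn : 2 ≤ n) (h1 : 1 ≤ i) (hin : i ≤ n) :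
    (∀ a < n, a ≠ lowIdx n i → barCount (lo ++ .bar (lowIdx n i) :: hi) a =
      barCount (lo ++ downLetter n i :: hi) a) ∧
    barCount (lo ++ .bar (lowIdx n i) :: hi) (lowIdx n i) =
      barCount (lo ++ downLetter n i :: hi) (lowIdx n i) + 1 ∧
    ∀ a < n, lowCount (lo ++ .bar (lowIdx n i) :: hi) a =
      lowCount (lo ++ downLetter n i :: hi) a := by
  obtain ⟨-, e1, e2, e3⟩ := ext_down_bar h h' hn h1 hin
  refine ⟨fun a ha haj => ?_, ?_, fun a ha => ?_⟩
  · simpa only [extBar_of_lt ha] using e1 a haj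
  · grind [extBar_of_lt, lowIdx_lt]
  · simpa only [extLow_of_lt ha] using congrFun e3 a

variable (hn : 2 ≤ n) (h1 : 1 ≤ i) (hin : i ≤ n)
include hn h1 hin

/-- Besides the inequalities, the sign needs care: the new entry may be the first letter of rank `n`
in the left column, which thereby acquires a sign. If this sign differs from that of the right
column, the strict form of `mid` must hold. -/
theorem GoodPair.low_to_up_left (hg : GoodPair n (lo ++ .pos (lowIdx n i) :: hi) C')
    (hC : StrictColumn n (lo ++ .pos (lowIdx n i) :: hi))
    (hD : StrictColumn n (lo ++ upLetter n i :: hi)) (hC' : StrictColumn n C')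
    (h3 : bitBar n i (lo ++ .pos (lowIdx n i) :: hi) ≤
      bitDown n i (lo ++ .pos (lowIdx n i) :: hi))
    (h4 : phi4 (bitLow n i C') (bitUp n i C') (bitDown n i C') (bitBar n i C') = 0) :
    GoodPair n (lo ++ upLetter n i :: hi) C' := by
  have hk := lowIdx_lt_topIdx hn hin
  have hj := lowIdx_pos hn h1
  obtain ⟨b0, e1, e2, e3⟩ := ext_low_up hC hD hn h1 hin
  have x1 := (hC.split_low hn h1 hin).2.1
  have hx := hC.increments hn h1 hin
  have hy := hC'.increments hn h1 hin
  refine hg.transport hC hC' hn hin (fun c P => ?_) fun s hs hs' => ?_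
  · rw [e3, length_replace lo hi _ (.pos (lowIdx n i))]
    exact P.left_f_low hj hk hx hy e1 e2 x1 b0 h3 h4
  · rcases signOK_replace_or hC hD (by omega) (low_rank_ne hn) hs with h | ⟨hr, hM⟩
    · exact Or.inl ⟨s, h, hs'⟩
    obtain ⟨hi2, hj2⟩ := rank_up_eq hn hin hr
    obtain ⟨z, hz, sz⟩ := hD.exists_sign (i := i) hn
    obtain ⟨z', hz', sz'⟩ := hC'.exists_sign (i := i) hn
    obtain ⟨c1, c2, c3⟩ := ext_low_up_count hC hD hn h1 hin
    by_cases hM' : lowCount C' (n - 1) + barCount C' (n - 1) < C'.length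
    swap
    · exact Or.inl ⟨_, sz, hC'.signOK_of_full hM' _⟩
    by_cases hzz : z = z'
    · exact Or.inl ⟨_, sz, hzz ▸ sz'⟩
    right
    have bs := hD.signBits hn hi2 hin hz sz
    have bs' := hC'.signBits hn hi2 hin hz' sz'
    have bo := hC.signBits hn hi2 hin hz ((hC.signOK_of_full hM _))
    have hlen := length_replace lo hi (upLetter n i) (.pos (lowIdx n i))
    intro a ha
    rw [hlen]
    have q0 := hg.left a (n - 1) (by omega) (by omega)
    have q1 := hg.left (n - 1) (n - 1) (by omega) (by omega)
    have q2 := hg.left (n - 1 - 1) (n - 1 - 1) (by omega) (by omega)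
    have c0 := lowCount_add_barCount_le (lo ++ .pos (lowIdx n i) :: hi) (n - 1)
    by_cases haj : a = lowIdx n i
    · have hbu : bitUp n i (lo ++ upLetter n i :: hi) = 1 :=
        (hD.split_up hn h1 hin (by rw [(hC.split_low hn h1 hin).1]; rfl)).2.1
      obtain ⟨_, _, _, _, i1, -, -, i2⟩ := hx
      obtain ⟨_, _, _, _, i1', -, -, i2'⟩ := hy
      rw [extLow_of_lt (by omega), extLow_of_lt (by omega)] at i1 i1'
      rw [extBar_of_lt (by omega), extBar_of_lt (by omega)] at i2 i2'
      unfold phi4 at h4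
      have c3' := c3 (n - 1) (by omega)
      rw [hlen] at bs
      rw [haj]
      rw [hbu, c3'] at bs
      rw [← hj2] at bs bs' bo q0 q1 q2 c0 hM hM'
      rcases bs with ⟨_, _, _⟩ | ⟨_, _, _⟩
      · omega
      rcases bs' with ⟨_, _, _⟩ | ⟨_, _, _⟩
      · omega
      rcases bo with ⟨_, _, _⟩ | ⟨_, _, _⟩
      swap
      · omega
      -- Failure gives equal bar counts of the old left column and of `C'` at `n - 1`, and then the
      -- barred letter of `n - 1` is absent from `C'`. Now `φ = 0` forces `bitDown C' = 0`, while
      -- opposite signs make it `1`.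
      by_contra hcon
      have : bitDown n i C' = 0 := by omega
      omega
    grind

/-- The alternative in `h4` serves the two kinds of right neighbours, a full column and a
half-column. The replacement only removes a letter of rank `n`, or none, so signs cause no trouble.
-/
theorem GoodPair.down_to_bar_left (hg : GoodPair n (lo ++ downLetter n i :: hi) C')
    (hC : StrictColumn n (lo ++ downLetter n i :: hi))
    (hD : StrictColumn n (lo ++ .bar (lowIdx n i) :: hi)) (hC' : StrictColumn n C')
    (h3 : bitLow n i (lo ++ downLetter n i :: hi) ≤ bitUp n i (lo ++ downLetter n i :: hi))
    (h4 : phi4 (bitLow n i C') (bitUp n i C') (bitDown n i C') (bitBar n i C') +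
      bitLow n i (lo ++ downLetter n i :: hi) - bitUp n i (lo ++ downLetter n i :: hi) = 0 ∨
      ((∀ a ≤ topIdx n i, extLow n i C' a + extBar n i C' a = a) ∧
        (bitLow n i C' = 1 ∧ bitDown n i C' = 1 →
          bitLow n i (lo ++ downLetter n i :: hi) < bitUp n i (lo ++ downLetter n i :: hi)))) :
    GoodPair n (lo ++ .bar (lowIdx n i) :: hi) C' := by
  have hk := lowIdx_lt_topIdx hn hin
  have hj := lowIdx_pos hn h1
  obtain ⟨b0, e1, e2, e3⟩ := ext_down_bar hC hD hn h1 hin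
  obtain ⟨-, x3, x4, -⟩ := hC.split_down hn h1 hin
    (by rw [(hD.split_bar hn h1 hin).1]; rfl)
  have hx := hC.increments hn h1 hin
  have hy := hC'.increments hn h1 hin
  refine hg.transport hC hC' hn hin (fun c P => ?_) fun s hs hs' => ?_
  · rw [e3, length_replace lo hi _ (downLetter n i)]
    rcases h4 with h4 | ⟨h4, h5⟩
    · exact P.left_f_bar hj hk hx hy e1 e2 x3 x4 h3 h4
    · exact P.left_f_bar_half hj hk hx hy h4 e1 e2 x3 x4 h3 h5
  · exact Or.inl ⟨s, hs.replace (bar_rank_ne hn), hs'⟩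

theorem GoodPair.up_to_low_left (hg : GoodPair n (lo ++ upLetter n i :: hi) C')
    (hC : StrictColumn n (lo ++ upLetter n i :: hi))
    (hD : StrictColumn n (lo ++ .pos (lowIdx n i) :: hi)) (hC' : StrictColumn n C')
    (h3 : bitBar n i (lo ++ upLetter n i :: hi) ≤ bitDown n i (lo ++ upLetter n i :: hi)) :
    GoodPair n (lo ++ .pos (lowIdx n i) :: hi) C' := by
  have hk := lowIdx_lt_topIdx hn hin
  have hj := lowIdx_pos hn h1
  obtain ⟨b0, e1, e2, e3⟩ := ext_low_up hD hC hn h1 hin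
  obtain ⟨-, x2, x1, -⟩ := hC.split_up hn h1 hin
    (by rw [(hD.split_low hn h1 hin).1]; rfl)
  have hx := hC.increments hn h1 hin
  refine hg.transport hC hC' hn hin (fun c P => ?_) fun s hs hs' => ?_
  · rw [← e3, length_replace lo hi _ (upLetter n i)]
    exact P.left_e_low hj hk hx (fun a ha => (e1 a ha).symm) e2.symm x2 x1 h3
  · exact Or.inl ⟨s, hs.replace (low_rank_ne hn), hs'⟩

theorem GoodPair.bar_to_down_left (hg : GoodPair n (lo ++ .bar (lowIdx n i) :: hi) C')
    (hC : StrictColumn n (lo ++ .bar (lowIdx n i) :: hi))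
    (hD : StrictColumn n (lo ++ downLetter n i :: hi)) (hC' : StrictColumn n C') :
    GoodPair n (lo ++ downLetter n i :: hi) C' := by
  obtain ⟨b0, e1, e2, e3⟩ := ext_down_bar hD hC hn h1 hin
  refine hg.transport hC hC' hn hin (fun c P => ?_) fun s hs hs' => ?_
  · rw [← e3, length_replace lo hi _ (.bar (lowIdx n i))]
    exact P.left_e_bar (fun a ha => (e1 a ha).symm) e2.symm
  · rcases signOK_replace_or hC hD (by omega) (bar_rank_ne hn) hs with h | ⟨hr, hM⟩
    · exact Or.inl ⟨s, h, hs'⟩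
    right
    intro a ha
    obtain ⟨c1, c2, c3⟩ := ext_down_bar_count hD hC hn h1 hin
    have q0 := hg.left a (n - 1) (by omega) (by omega)
    grind

theorem GoodPair.low_to_up_right (hg : GoodPair n C (lo ++ .pos (lowIdx n i) :: hi))
    (hC : StrictColumn n C) (hC' : StrictColumn n (lo ++ .pos (lowIdx n i) :: hi))
    (hD : StrictColumn n (lo ++ upLetter n i :: hi)) :
    GoodPair n C (lo ++ upLetter n i :: hi) := by
  obtain ⟨b0, e1, e2, e3⟩ := ext_low_up hC' hD hn h1 hin
  refine hg.transport hC hC' hn hin (fun c P => ?_) fun s hs hs' => ?_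
  · rw [e3, length_replace lo hi _ (.pos (lowIdx n i))]
    exact P.right_f_low e1 e2
  · rcases signOK_replace_or hC' hD (by omega) (low_rank_ne hn) hs' with h | ⟨hr, hM⟩
    · grind
    right
    intro a ha
    obtain ⟨c1, c2, c3⟩ := ext_low_up_count hC' hD hn h1 hin
    have q0 := hg.right a (n - 1) (by omega) (by omega)
    rw [c3 a ha]
    omega

theorem GoodPair.down_to_bar_right (hg : GoodPair n C (lo ++ downLetter n i :: hi))
    (hC : StrictColumn n C) (hC' : StrictColumn n (lo ++ downLetter n i :: hi))
    (hD : StrictColumn n (lo ++ .bar (lowIdx n i) :: hi))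
    (h3 : bitLow n i (lo ++ downLetter n i :: hi) ≤ bitUp n i (lo ++ downLetter n i :: hi)) :
    GoodPair n C (lo ++ .bar (lowIdx n i) :: hi) := by
  have hk := lowIdx_lt_topIdx hn hin
  have hj := lowIdx_pos hn h1
  obtain ⟨b0, e1, e2, e3⟩ := ext_down_bar hC' hD hn h1 hin
  obtain ⟨-, x3, x4, -⟩ := hC'.split_down hn h1 hin
    (by rw [(hD.split_bar hn h1 hin).1]; rfl)
  refine hg.transport hC hC' hn hin (fun c P => ?_) fun s hs hs' => ?_
  · rw [e3, length_replace lo hi _ (downLetter n i)]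
    exact P.right_f_bar hj hk (hC'.increments hn h1 hin) e1 e2 x3 x4 h3
  · exact Or.inl ⟨s, hs, hs'.replace (bar_rank_ne hn)⟩

theorem GoodPair.up_to_low_right (hg : GoodPair n C (lo ++ upLetter n i :: hi))
    (hC : StrictColumn n C) (hC' : StrictColumn n (lo ++ upLetter n i :: hi))
    (hD : StrictColumn n (lo ++ .pos (lowIdx n i) :: hi))
    (h3 : bitBar n i (lo ++ upLetter n i :: hi) ≤ bitDown n i (lo ++ upLetter n i :: hi))
    (h4 : eps4 (bitLow n i C) (bitUp n i C) (bitDown n i C) (bitBar n i C) -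
      (bitDown n i (lo ++ upLetter n i :: hi) - bitBar n i (lo ++ upLetter n i :: hi)) = 0) :
    GoodPair n C (lo ++ .pos (lowIdx n i) :: hi) := by
  have hk := lowIdx_lt_topIdx hn hin
  have hj := lowIdx_pos hn h1
  obtain ⟨b0, e1, e2, e3⟩ := ext_low_up hD hC' hn h1 hin
  obtain ⟨-, x2, x1, -⟩ := hC'.split_up hn h1 hin
    (by rw [(hD.split_low hn h1 hin).1]; rfl)
  refine hg.transport hC hC' hn hin (fun c P => ?_) fun s hs hs' => ?_
  · rw [← e3, length_replace lo hi _ (upLetter n i)]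
    exact P.right_e_low hj hk (hC.increments hn h1 hin) (hC'.increments hn h1 hin)
      (fun a ha => (e1 a ha).symm) e2.symm x2 x1 h3 h4
  · exact Or.inl ⟨s, hs, hs'.replace (low_rank_ne hn)⟩

/-- Mirror image of `GoodPair.low_to_up_left`: now the right column may acquire its first letter of
rank `n`, and `ε = 0` for the left column excludes the bad parity. -/
theorem GoodPair.bar_to_down_right (hg : GoodPair n C (lo ++ .bar (lowIdx n i) :: hi))
    (hC : StrictColumn n C) (hC' : StrictColumn n (lo ++ .bar (lowIdx n i) :: hi))
    (hD : StrictColumn n (lo ++ downLetter n i :: hi))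
    (h3 : bitLow n i (lo ++ .bar (lowIdx n i) :: hi) ≤ bitUp n i (lo ++ .bar (lowIdx n i) :: hi))
    (h4 : eps4 (bitLow n i C) (bitUp n i C) (bitDown n i C) (bitBar n i C) = 0) :
    GoodPair n C (lo ++ downLetter n i :: hi) := by
  have hk := lowIdx_lt_topIdx hn hin
  have hj := lowIdx_pos hn h1
  obtain ⟨b0, e1, e2, e3⟩ := ext_down_bar hD hC' hn h1 hin
  have x4 := (hC'.split_bar hn h1 hin).2.1
  have hx := hC.increments hn h1 hin
  have hy := hC'.increments hn h1 hin
  refine hg.transport hC hC' hn hin (fun c P => ?_) fun s hs hs' => ?_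
  · rw [← e3, length_replace lo hi _ (.bar (lowIdx n i))]
    exact P.right_e_bar hj hk hx hy (fun a ha => (e1 a ha).symm) e2.symm x4 b0 h3 h4
  · rcases signOK_replace_or hC' hD (by omega) (bar_rank_ne hn) hs' with h | ⟨hr, hM⟩
    · exact Or.inl ⟨s, hs, h⟩
    obtain ⟨hi2, hj2⟩ := rank_down_eq hn hin hr
    obtain ⟨z, hz, sz⟩ := hC.exists_sign (i := i) hn
    obtain ⟨z', hz', sz'⟩ := hD.exists_sign (i := i) hn
    obtain ⟨c1, c2, c3⟩ := ext_down_bar_count hD hC' hn h1 hin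
    by_cases hM' : lowCount C (n - 1) + barCount C (n - 1) < C.length
    swap
    · exact Or.inl ⟨_, hC.signOK_of_full hM' _, sz'⟩
    by_cases hzz : z = z'
    · exact Or.inl ⟨_, sz, hzz ▸ sz'⟩
    right
    have bs := hC.signBits hn hi2 hin hz sz
    have bs' := hD.signBits hn hi2 hin hz' sz'
    have bo := hC'.signBits hn hi2 hin hz (hC'.signOK_of_full hM _)
    have hlen := length_replace lo hi (downLetter n i) (.bar (lowIdx n i))
    intro a ha
    have q0 := hg.right a (n - 1) (by omega) (by omega)
    have q1 := hg.right (n - 1) (n - 1) (by omega) (by omega)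
    have q2 := hg.right (n - 1 - 1) (n - 1 - 1) (by omega) (by omega)
    have c0 := lowCount_add_barCount_le (lo ++ .bar (lowIdx n i) :: hi) (n - 1)
    by_cases haj : a = lowIdx n i
    · have hbd : bitDown n i (lo ++ downLetter n i :: hi) = 1 :=
        (hD.split_down hn h1 hin (by rw [(hC'.split_bar hn h1 hin).1]; rfl)).2.1
      obtain ⟨_, _, _, _, i1, -, -, i2⟩ := hx
      obtain ⟨_, _, _, _, i1', -, -, i2'⟩ := hy
      rw [extLow_of_lt (by omega), extLow_of_lt (by omega)] at i1 i1'
      rw [extBar_of_lt (by omega), extBar_of_lt (by omega)] at i2 i2'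
      unfold eps4 at h4
      have c3' := c3 (n - 1) (by omega)
      rw [hlen] at bs'
      rw [haj]
      rw [hbd, ← c3'] at bs'
      rw [← hj2] at bs bs' bo q0 q1 q2 c0 hM hM'
      rcases bs' with ⟨_, _, _⟩ | ⟨_, _, _⟩
      · omega
      rcases bs with ⟨_, _, _⟩ | ⟨_, _, _⟩
      · omega
      rcases bo with ⟨_, _, _⟩ | ⟨_, _, _⟩
      swap
      · omega
      by_contra hcon
      have : bitUp n i C = 0 := by omega
      omega
    grind

end

end

/-! ### Replacements at the position selected by the signature -/

section

section

variable {n i : ℕ} {C C' lo hi : List Letter} {x y : Letter}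

theorem GoodColumn.f_replace (h : GoodColumn n (lo ++ x :: hi)) (hn : 2 ≤ n) (h1 : 1 ≤ i)
    (hin : i ≤ n) (hxy : x.f n i = some y) (he : wordEps (columnWord n i lo) = 0)
    (hp : wordPhi (columnWord n i hi) = 0) : GoodColumn n (lo ++ y :: hi) := by
  rcases (letter_f_eq_some hn h1 hin).1 hxy with ⟨rfl, rfl⟩ | ⟨rfl, rfl⟩
  · obtain ⟨-, -, b, -⟩ := h.toStrict.split_low hn h1 hin
    exact h.low_to_up hn h1 hin (by omega)
  · exact h.down_to_bar hn h1 hin he hp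

theorem GoodColumn.e_replace (h : GoodColumn n (lo ++ x :: hi)) (hn : 2 ≤ n) (h1 : 1 ≤ i)
    (hin : i ≤ n) (hxy : x.e n i = some y) (he : wordEps (columnWord n i lo) = 0)
    (hp : wordPhi (columnWord n i hi) = 0) : GoodColumn n (lo ++ y :: hi) := by
  rcases (letter_e_eq_some hn h1 hin).1 hxy with ⟨rfl, rfl⟩ | ⟨rfl, rfl⟩
  · exact h.up_to_low hn h1 hin he hp
  · obtain ⟨-, -, -, b⟩ := h.toStrict.split_bar hn h1 hin
    exact h.bar_to_down hn h1 hin (by omega)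

/-- By (1CC) at `n - 1`, a column of height `n` always contains a letter of rank `n`, so its sign is
unique. The replacement keeps at least one witness of it, or only removes letters of rank `n`. -/
theorem GoodColumn.signOK_replace (h : GoodColumn n (lo ++ x :: hi))
    (h' : GoodColumn n (lo ++ y :: hi)) (hn : 2 ≤ n) (h1 : 1 ≤ i) (hin : i ≤ n)
    (hxy : x.f n i = some y ∨ x.e n i = some y) (hl : (lo ++ x :: hi).length = n) {s : Prop}
    (hs : SignOK n s (lo ++ x :: hi)) : SignOK n s (lo ++ y :: hi) := by
  have key : x.rank n ≠ n → SignOK n s (lo ++ y :: hi) := by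
    intro hx
    refine (signOK_replace_or h.toStrict h'.toStrict (by omega) hx hs).resolve_right ?_
    rintro ⟨-, hM⟩
    have := h.cc (n - 1) (by omega)
    omega
  rw [letter_f_eq_some hn h1 hin, letter_e_eq_some hn h1 hin] at hxy
  rcases hxy with (⟨rfl, rfl⟩ | ⟨rfl, rfl⟩) | (⟨rfl, rfl⟩ | ⟨rfl, rfl⟩)
  · exact key (low_rank_ne hn)
  · exact hs.replace (bar_rank_ne hn)
  · exact hs.replace (low_rank_ne hn)
  · exact key (bar_rank_ne hn)

/-- The right column is read before `hi`, and `hi` before `x`. `hout` says that the `+` of the right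
column are used up by the `-` of `hi`, as is necessary for the `+` of `x` to be the left-most one.
-/
theorem GoodPair.f_left (hg : GoodPair n (lo ++ x :: hi) C')
    (hC : GoodColumn n (lo ++ x :: hi)) (hC' : StrictColumn n C') (hn : 2 ≤ n) (h1 : 1 ≤ i)
    (hin : i ≤ n) (hxy : x.f n i = some y) (he : wordEps (columnWord n i lo) = 0)
    (hp : wordPhi (columnWord n i hi) = 0)
    (hout : wordPhi (columnWord n i C') ≤ wordEps (columnWord n i hi)) :
    GoodPair n (lo ++ y :: hi) C' := by
  have hD := hC.f_replace hn h1 hin hxy he hp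
  have hw := (hC'.columnWord_eps_phi hn h1 hin).2
  rcases (letter_f_eq_some hn h1 hin).1 hxy with ⟨rfl, rfl⟩ | ⟨rfl, rfl⟩
  · obtain ⟨b0, -, b, -⟩ := hC.toStrict.split_low hn h1 hin
    have h0 : wordEps (columnWord n i hi) = 0 := by rw [b0]; rfl
    exact hg.low_to_up_left hn h1 hin hC.toStrict hD.toStrict hC' (by omega) (by omega)
  · obtain ⟨-, -, -, b1, b2⟩ := hC.toStrict.split_down hn h1 hin he
    exact hg.down_to_bar_left hn h1 hin hC.toStrict hD.toStrict hC' (by omega)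
      (Or.inl (by omega))

/-- A half-column is a single tensor factor, with a `+` exactly if `bitLow` and `bitDown` are `1`.
Combined with the identity `hH`, the weaker condition `hout` still provides what
`GoodPair.low_to_up_left` and `GoodPair.down_to_bar_left` require. -/
theorem GoodPair.f_left_half (hg : GoodPair n (lo ++ x :: hi) C')
    (hC : GoodColumn n (lo ++ x :: hi)) (hC' : StrictColumn n C') (hn : 2 ≤ n) (h1 : 1 ≤ i)
    (hin : i ≤ n) (hxy : x.f n i = some y) (he : wordEps (columnWord n i lo) = 0)
    (hp : wordPhi (columnWord n i hi) = 0)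
    (hH : ∀ a ≤ topIdx n i, extLow n i C' a + extBar n i C' a = a)
    (hout : bitLow n i C' = 1 ∧ bitDown n i C' = 1 → 1 ≤ wordEps (columnWord n i hi)) :
    GoodPair n (lo ++ y :: hi) C' := by
  have hD := hC.f_replace hn h1 hin hxy he hp
  rcases (letter_f_eq_some hn h1 hin).1 hxy with ⟨rfl, rfl⟩ | ⟨rfl, rfl⟩
  · obtain ⟨b0, -, b, -⟩ := hC.toStrict.split_low hn h1 hin
    have h0 : wordEps (columnWord n i hi) = 0 := by rw [b0]; rfl
    refine hg.low_to_up_left hn h1 hin hC.toStrict hD.toStrict hC' (by omega) ?_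
    obtain ⟨_, _, _, _, _, _, _, _⟩ := hC'.increments hn h1 hin
    grind [lowIdx_lt_topIdx, lowIdx, lowIdx_pos, phi4]
  · obtain ⟨-, -, -, b1, b2⟩ := hC.toStrict.split_down hn h1 hin he
    exact hg.down_to_bar_left hn h1 hin hC.toStrict hD.toStrict hC' (by omega)
      (Or.inr ⟨hH, fun h => by have := hout h; omega⟩)

theorem GoodPair.f_right (hg : GoodPair n C (lo ++ x :: hi)) (hC : StrictColumn n C)
    (hC' : GoodColumn n (lo ++ x :: hi)) (hn : 2 ≤ n) (h1 : 1 ≤ i)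
    (hin : i ≤ n) (hxy : x.f n i = some y) (he : wordEps (columnWord n i lo) = 0)
    (hp : wordPhi (columnWord n i hi) = 0) : GoodPair n C (lo ++ y :: hi) := by
  have hD := hC'.f_replace hn h1 hin hxy he hp
  rcases (letter_f_eq_some hn h1 hin).1 hxy with ⟨rfl, rfl⟩ | ⟨rfl, rfl⟩
  · exact hg.low_to_up_right hn h1 hin hC hC'.toStrict hD.toStrict
  · obtain ⟨-, -, -, b1, b2⟩ := hC'.toStrict.split_down hn h1 hin he
    exact hg.down_to_bar_right hn h1 hin hC hC'.toStrict hD.toStrict (by omega)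

theorem GoodPair.e_left (hg : GoodPair n (lo ++ x :: hi) C')
    (hC : GoodColumn n (lo ++ x :: hi)) (hC' : StrictColumn n C') (hn : 2 ≤ n) (h1 : 1 ≤ i)
    (hin : i ≤ n) (hxy : x.e n i = some y) (he : wordEps (columnWord n i lo) = 0)
    (hp : wordPhi (columnWord n i hi) = 0) : GoodPair n (lo ++ y :: hi) C' := by
  have hD := hC.e_replace hn h1 hin hxy he hp
  rcases (letter_e_eq_some hn h1 hin).1 hxy with ⟨rfl, rfl⟩ | ⟨rfl, rfl⟩
  · obtain ⟨-, -, -, b1, b2⟩ := hC.toStrict.split_up hn h1 hin hp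
    exact hg.up_to_low_left hn h1 hin hC.toStrict hD.toStrict hC' (by omega)
  · exact hg.bar_to_down_left hn h1 hin hC.toStrict hD.toStrict hC'

/-- The left column is read after `lo`. `hout` says that its `-` are cancelled by the `+` of `lo`,
as is necessary for the `-` of `x` to be the right-most one. -/
theorem GoodPair.e_right (hg : GoodPair n C (lo ++ x :: hi)) (hC : StrictColumn n C)
    (hC' : GoodColumn n (lo ++ x :: hi)) (hn : 2 ≤ n) (h1 : 1 ≤ i)
    (hin : i ≤ n) (hxy : x.e n i = some y) (he : wordEps (columnWord n i lo) = 0)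
    (hp : wordPhi (columnWord n i hi) = 0)
    (hout : wordEps (columnWord n i C) ≤ wordPhi (columnWord n i lo)) :
    GoodPair n C (lo ++ y :: hi) := by
  have hD := hC'.e_replace hn h1 hin hxy he hp
  have hw := (hC.columnWord_eps_phi hn h1 hin).1
  rcases (letter_e_eq_some hn h1 hin).1 hxy with ⟨rfl, rfl⟩ | ⟨rfl, rfl⟩
  · obtain ⟨-, -, -, b1, b2⟩ := hC'.toStrict.split_up hn h1 hin hp
    exact hg.up_to_low_right hn h1 hin hC hC'.toStrict hD.toStrict (by omega) (by omega)
  · obtain ⟨b0, -, -, b⟩ := hC'.toStrict.split_bar hn h1 hin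
    have h0 : wordPhi (columnWord n i lo) = 0 := by rw [b0]; rfl
    exact hg.bar_to_down_right hn h1 hin hC hC'.toStrict hD.toStrict (by omega) (by omega)

end

/-! ### Half-columns -/

/-- A half-column: a good column of height `n` with exactly one of `a`, `ā` for all `a`. -/
structure HalfColumn (n : ℕ) (H : List Letter) : Prop extends GoodColumn n H where
  length_eq : H.length = n
  cover : ∀ a < n, lowCount H a + barCount H a = a

section

variable {n i : ℕ} {C H : List Letter}

theorem HalfColumn.nodup (h : HalfColumn n H) (hn : 2 ≤ n) : H.Nodup := by
  rw [List.nodup_iff_getElem?_ne_getElem?]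
  intro p q hpq hq e
  have hx := List.getElem?_eq_getElem hq
  rw [hx] at e
  have hv := h.valid _ (List.getElem_mem hq)
  have hc := h.cover (n - 1) (by omega)
  have hl := h.length_eq
  by_cases hr : (H[q]).rank n = n
  · have := h.toStrict.index_n e hr
    have := h.toStrict.index_n hx hr
    omega
  · generalize H[q] = x at *
    cases x with
    | pos a =>
      simp only [Letter.rank_pos, Letter.Valid] at hr hv
      have := h.toStrict.getElem?_pos (by omega) e
      have := h.toStrict.getElem?_pos (by omega) hx
      omega
    | bar a =>
      simp only [Letter.rank_bar, Letter.Valid] at hr hv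
      have := h.toStrict.getElem?_bar (by omega) e
      have := h.toStrict.getElem?_bar (by omega) hx
      omega

theorem HalfColumn.not_both (h : HalfColumn n H) (hn : 2 ≤ n) (a : ℕ) :
    ¬ (Letter.pos a ∈ H ∧ Letter.bar a ∈ H) := by
  rintro ⟨h1, h2⟩
  have hv := h.valid _ h1
  simp only [Letter.Valid] at hv
  rcases eq_or_lt_of_le hv.2 with rfl | han
  · obtain ⟨p, hp⟩ := List.mem_iff_getElem?.1 h1
    obtain ⟨q, hq⟩ := List.mem_iff_getElem?.1 h2
    have := h.toStrict.index_n hp (by simp)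
    have := h.toStrict.index_n hq (by simp; omega)
    have := h.cover (a - 1) (by omega)
    have := h.length_eq
    grind
  · have e1 := h.toStrict.lowCount_step hv.1 han
    have e2 := h.toStrict.barCount_step hv.1 han
    rw [if_pos h1] at e1
    rw [if_pos h2] at e2
    have := h.cover a han
    have := h.cover (a - 1) (by omega)
    omega

/-- Each index below `n` contributes at most one letter, and there is at most one letter of rank
`n`, since two adjacent ones would be `n` and `n̄`. With `n` rows to fill, every index contributes
exactly one. -/
theorem HalfColumn.of_not_both (h : StrictColumn n H) (hl : H.length = n) (hn : 2 ≤ n)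
    (hb : ∀ a, ¬ (Letter.pos a ∈ H ∧ Letter.bar a ∈ H)) : HalfColumn n H := by
  have step : ∀ a, 1 ≤ a → a < n → lowCount H a + barCount H a ≤
      lowCount H (a - 1) + barCount H (a - 1) + 1 := by
    intro a h1 ha
    have e1 := h.lowCount_step h1 ha
    have e2 := h.barCount_step h1 ha
    grind
  have last : n - 1 ≤ lowCount H (n - 1) + barCount H (n - 1) := by
    by_contra hc
    have e1 := h.exists_index_n (p := barCount H (n - 1)) le_rfl (by omega)
    have e2 := h.exists_index_n (p := barCount H (n - 1) + 1) (by omega) (by omega)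
    have hs := h.strict (barCount H (n - 1))
    grind [Letter.Lt, List.mem_of_getElem?]
  have up : ∀ a, a < n → lowCount H a + barCount H a ≤ a := by
    intro a
    induction a with
    | zero => intro _; rw [h.lowCount_zero, h.barCount_zero]
    | succ a ih =>
      grind
  have down : ∀ k a, a + k = n - 1 → a ≤ lowCount H a + barCount H a := by
    intro k
    induction k with
    | zero => simp_all
    | succ k ih =>
      intro a ha
      have := ih (a + 1) (by omega)
      grind
  exact ⟨⟨h.valid, h.strict, hl.le, up⟩, hl, fun a ha =>
    le_antisymm (up a ha) (down (n - 1 - a) a (by omega))⟩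

theorem HalfColumn.ext_cover (h : HalfColumn n H) (hn : 2 ≤ n) (h1 : 1 ≤ i) (hin : i ≤ n) :
    ∀ a ≤ topIdx n i, extLow n i H a + extBar n i H a = a := by
  intro a ha
  by_cases han : a < n
  · rw [extLow_of_lt han, extBar_of_lt han]; exact h.cover a han
  · unfold topIdx at ha
    have h2 : ¬ i < n - 1 := by grind
    rw [if_neg h2] at ha
    obtain rfl : a = n := by omega
    obtain ⟨z, hz, sz⟩ := h.toStrict.exists_sign (i := i) hn
    have bs := h.toStrict.signBits hn (by omega) hin hz sz
    have := h.length_eq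
    have := h.cover (a - 1) (by omega)
    rw [extLow_self (by omega), extBar_self (by omega)]
    rcases bs with ⟨_, _, _⟩ | ⟨_, _, _⟩ <;> omega

theorem HalfColumn.of_ext (h : StrictColumn n H) (hl : H.length = n)
    (hc : ∀ a ≤ topIdx n i, extLow n i H a + extBar n i H a = a) : HalfColumn n H := by
  have : ∀ a < n, lowCount H a + barCount H a = a := fun a ha => by
    have := hc a (by unfold topIdx; split_ifs <;> omega)
    rwa [extLow_of_lt ha, extBar_of_lt ha] at this
  exact ⟨⟨h.valid, h.strict, hl.le, fun a ha => (this a ha).le⟩, hl, this⟩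

/-- The increments of a half-column. -/
theorem HalfColumn.bits (h : HalfColumn n H) (hn : 2 ≤ n) (h1 : 1 ≤ i) (hin : i ≤ n) :
    bitLow n i H + bitBar n i H = 1 ∧ bitUp n i H + bitDown n i H = 1 := by
  have hk := lowIdx_lt_topIdx hn hin
  have := h.ext_cover hn h1 hin (lowIdx n i - 1) (by omega)
  have := h.ext_cover hn h1 hin (lowIdx n i) (by omega)
  have := h.ext_cover hn h1 hin (lowIdx n i + 1) (by omega)
  have := lowIdx_pos hn h1
  obtain ⟨_, _, _, _, _, _, _, _⟩ := h.toStrict.increments hn h1 hin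
  omega

theorem HalfColumn.count_le_one (h : HalfColumn n H) (hn : 2 ≤ n) (x : Letter) : H.count x ≤ 1 :=
  List.nodup_iff_count_le_one.1 (h.nodup hn) x

theorem HalfColumn.bit_mem (h : HalfColumn n H) (hn : 2 ≤ n) (h1 : 1 ≤ i) (hin : i ≤ n) :
    (bitLow n i H = 1 ↔ Letter.pos (lowIdx n i) ∈ H) ∧
    (bitBar n i H = 1 ↔ Letter.bar (lowIdx n i) ∈ H) ∧
    (bitUp n i H = 1 ↔ upLetter n i ∈ H) ∧ (bitDown n i H = 1 ↔ downLetter n i ∈ H) := by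
  have key : ∀ x : Letter, H.count x = 1 ↔ x ∈ H := fun x => by
    have := h.count_le_one hn x
    grind
  refine ⟨key _, key _, ?_⟩
  unfold bitUp bitDown
  by_cases h2 : i < n - 1
  · simp_all
  · rw [if_neg h2, if_neg h2]
    have hl := (h.toStrict.midPart_getElem? hn (by omega) hin).1
    have := h.cover (n - 1) (by omega)
    have := h.length_eq
    obtain ⟨w, hw⟩ : ∃ w, midPart n i H = [w] := List.length_eq_one_iff.1 (by omega)
    have hu := rank_upLetter hn hin
    have hd := rank_downLetter hn hin
    have hj : lowIdx n i = n - 1 := by have := lowIdx_eq hn hin; omega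
    have key : ∀ x : Letter, x.rank n = n → (x ∈ H ↔ w = x) := by
      intro x hx
      have : x ∈ midPart n i H ↔ x ∈ H := by
        simp only [midPart, List.mem_filter, Bool.and_eq_true, decide_eq_true_eq]
        constructor
        · exact fun h => h.1
        · intro h; exact ⟨h, by omega, by omega⟩
      rw [← this, hw, List.mem_singleton, eq_comm]
    grind

theorem HalfColumn.spinF_isSome (h : HalfColumn n H) (hn : 2 ≤ n) (h1 : 1 ≤ i) (hin : i ≤ n) :
    (spinF n i H).isSome ↔ Letter.pos (lowIdx n i) ∈ H ∧ downLetter n i ∈ H := by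
  grind [spinF, lowIdx, downLetter, eq_or_lt_of_le]

theorem HalfColumn.spinE_isSome (h : HalfColumn n H) (hn : 2 ≤ n) (h1 : 1 ≤ i) (hin : i ≤ n) :
    (spinE n i H).isSome ↔ upLetter n i ∈ H ∧ Letter.bar (lowIdx n i) ∈ H := by
  grind [spinE, lowIdx, upLetter, eq_or_lt_of_le]

theorem map_getD_eq_self {g : Letter → Option Letter} {D : List Letter}
    (h : ∀ x ∈ D, g x = none) : D.map (fun x => (g x).getD x) = D := by
  conv_rhs => rw [← List.map_id D]
  grind [List.map_congr_left]

theorem HalfColumn.exists_split_down (h : HalfColumn n H) (hn : 2 ≤ n) (h1 : 1 ≤ i) (hin : i ≤ n)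
    (hs : (spinF n i H).isSome) : ∃ lo mid hi,
      H = lo ++ downLetter n i :: (mid ++ .pos (lowIdx n i) :: hi) := by
  obtain ⟨m1, m2⟩ := (h.spinF_isSome hn h1 hin).1 hs
  have hj := lowIdx_lt (i := i) hn
  have hd := rank_downLetter hn hin
  obtain ⟨l, hi, e⟩ := List.append_of_mem m1
  have hne : downLetter n i ≠ .pos (lowIdx n i) := by
    intro e; rw [e, Letter.rank_pos] at hd; omega
  have m3 : downLetter n i ∈ l := by
    rw [e, List.mem_append, List.mem_cons] at m2
    rcases m2 with m2 | m2 | m2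
    · exact m2
    · exact absurd m2 hne
    · have := (h.toStrict.split_above e).2 _ m2
      simp only [Letter.WeakAbove, Letter.rank_pos] at this; omega
  obtain ⟨lo, mid, rfl⟩ := List.append_of_mem m3
  grind

theorem HalfColumn.exists_split_up (h : HalfColumn n H) (hn : 2 ≤ n) (h1 : 1 ≤ i) (hin : i ≤ n)
    (hs : (spinE n i H).isSome) : ∃ lo mid hi,
      H = lo ++ .bar (lowIdx n i) :: (mid ++ upLetter n i :: hi) := by
  obtain ⟨m2, m1⟩ := (h.spinE_isSome hn h1 hin).1 hs
  have hj := lowIdx_lt (i := i) hn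
  have hu := rank_upLetter hn hin
  obtain ⟨lo, l, e⟩ := List.append_of_mem m1
  have hne : upLetter n i ≠ .bar (lowIdx n i) := by
    intro e; rw [e, Letter.rank_bar] at hu; omega
  have m3 : upLetter n i ∈ l := by
    rw [e, List.mem_append, List.mem_cons] at m2
    rcases m2 with m2 | m2 | m2
    · have := (h.toStrict.split_above e).1 _ m2
      simp only [Letter.WeakAbove, Letter.rank_bar] at this; omega
    · exact absurd m2 hne
    · exact m2
  obtain ⟨mid, hi, rfl⟩ := List.append_of_mem m3
  grind

variable {lo mid hi : List Letter}

theorem HalfColumn.spinF_eq (hn : 2 ≤ n) (h1 : 1 ≤ i) (hin : i ≤ n)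
    (h : HalfColumn n (lo ++ downLetter n i :: (mid ++ .pos (lowIdx n i) :: hi))) :
    spinF n i (lo ++ downLetter n i :: (mid ++ .pos (lowIdx n i) :: hi)) =
      some (lo ++ .bar (lowIdx n i) :: (mid ++ upLetter n i :: hi)) := by
  have hs := (h.spinF_isSome hn h1 hin).2 ⟨by simp, by simp⟩
  have hs2 : ∀ H, (spinF n i H).isSome → spinF n i H = some (H.map fun x => (x.f n i).getD x) := by
    grind [spinF]
  have hnd := h.nodup hn
  have fx : ∀ x : Letter, x ≠ .pos (lowIdx n i) → x ≠ downLetter n i → x.f n i = none := by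
    grind [Option.not_isSome_iff_eq_none, letter_f_isSome]
  have f1 := (letter_f_eq_some hn h1 hin).2 (Or.inl ⟨rfl, rfl⟩)
  have f2 := (letter_f_eq_some hn h1 hin).2 (Or.inr ⟨rfl, rfl⟩)
  rw [hs2 _ hs]
  simp only [List.nodup_append, List.nodup_cons, List.mem_append, List.mem_cons, not_or] at hnd
  simp only [List.map_append, List.map_cons, f1, f2, Option.getD_some]
  rw [map_getD_eq_self fun x hx => fx x (fun e => hnd.2.2 _ (e ▸ hx) _ (by simp) rfl)
    (fun e => hnd.2.2 _ (e ▸ hx) _ (by simp) rfl),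
    map_getD_eq_self fun x hx => fx x (fun e => hnd.2.1.2.2.2 _ (e ▸ hx) _ (by simp) rfl)
    (fun e => hnd.2.1.1.1 (e ▸ hx)),
    map_getD_eq_self fun x hx => fx x (fun e => hnd.2.1.2.2.1.1 (e ▸ hx))
    (fun e => hnd.2.1.1.2.2 (e ▸ hx))]

theorem HalfColumn.spinE_eq (hn : 2 ≤ n) (h1 : 1 ≤ i) (hin : i ≤ n)
    (h : HalfColumn n (lo ++ .bar (lowIdx n i) :: (mid ++ upLetter n i :: hi))) :
    spinE n i (lo ++ .bar (lowIdx n i) :: (mid ++ upLetter n i :: hi)) =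
      some (lo ++ downLetter n i :: (mid ++ .pos (lowIdx n i) :: hi)) := by
  have hs := (h.spinE_isSome hn h1 hin).2 ⟨by simp, by simp⟩
  have hs2 : ∀ H, (spinE n i H).isSome → spinE n i H = some (H.map fun x => (x.e n i).getD x) := by
    grind [spinE]
  have hnd := h.nodup hn
  have fx : ∀ x : Letter, x ≠ upLetter n i → x ≠ .bar (lowIdx n i) → x.e n i = none := by
    grind [Option.not_isSome_iff_eq_none, letter_e_isSome]
  have f1 := (letter_e_eq_some hn h1 hin).2 (Or.inl ⟨rfl, rfl⟩)
  have f2 := (letter_e_eq_some hn h1 hin).2 (Or.inr ⟨rfl, rfl⟩)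
  rw [hs2 _ hs]
  simp only [List.nodup_append, List.nodup_cons, List.mem_append, List.mem_cons, not_or] at hnd
  simp only [List.map_append, List.map_cons, f1, f2, Option.getD_some]
  rw [map_getD_eq_self fun x hx => fx x (fun e => hnd.2.2 _ (e ▸ hx) _ (by simp) rfl)
    (fun e => hnd.2.2 _ (e ▸ hx) _ (by simp) rfl),
    map_getD_eq_self fun x hx => fx x (fun e => hnd.2.1.2.2.2 _ (e ▸ hx) _ (by simp) rfl)
    (fun e => hnd.2.1.1.1 (e ▸ hx)),
    map_getD_eq_self fun x hx => fx x (fun e => hnd.2.1.2.2.1.1 (e ▸ hx))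
    (fun e => hnd.2.1.1.2.2 (e ▸ hx))]

/-- The two half-columns related by the operators of colour `i`. -/
theorem HalfColumn.spin_step (hn : 2 ≤ n) (h1 : 1 ≤ i) (hin : i ≤ n)
    (h : StrictColumn n (lo ++ downLetter n i :: (mid ++ .pos (lowIdx n i) :: hi)))
    (h' : StrictColumn n (lo ++ .bar (lowIdx n i) :: (mid ++ upLetter n i :: hi)))
    (hm : StrictColumn n (lo ++ .bar (lowIdx n i) :: (mid ++ .pos (lowIdx n i) :: hi)))  :
    (∀ a ≠ lowIdx n i,
      extLow n i (lo ++ .bar (lowIdx n i) :: (mid ++ upLetter n i :: hi)) a =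
        extLow n i (lo ++ downLetter n i :: (mid ++ .pos (lowIdx n i) :: hi)) a) ∧
    extLow n i (lo ++ .bar (lowIdx n i) :: (mid ++ upLetter n i :: hi)) (lowIdx n i) + 1 =
        extLow n i (lo ++ downLetter n i :: (mid ++ .pos (lowIdx n i) :: hi)) (lowIdx n i) ∧
    (∀ a ≠ lowIdx n i,
      extBar n i (lo ++ .bar (lowIdx n i) :: (mid ++ upLetter n i :: hi)) a =
        extBar n i (lo ++ downLetter n i :: (mid ++ .pos (lowIdx n i) :: hi)) a) ∧
    extBar n i (lo ++ .bar (lowIdx n i) :: (mid ++ upLetter n i :: hi)) (lowIdx n i) =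
        extBar n i (lo ++ downLetter n i :: (mid ++ .pos (lowIdx n i) :: hi)) (lowIdx n i) + 1 := by
  obtain ⟨-, d1, d2, d3⟩ := ext_down_bar h hm hn h1 hin
  have ea : ∀ y : Letter, lo ++ .bar (lowIdx n i) :: (mid ++ y :: hi) =
    (lo ++ .bar (lowIdx n i) :: mid) ++ y :: hi := fun y => by simp
  have hm' := hm
  have h'' := h'
  rw [ea] at hm' h''
  obtain ⟨-, u1, u2, u3⟩ := ext_low_up hm' h'' hn h1 hin
  rw [← ea, ← ea] at u1 u2 u3
  rw [u3, ← d3]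
  grind

/-- The two letters are changed one after the other, so the results for single replacements apply.
The intermediate column contains both `j` and `j̄`; it is strict but not a half-column. -/
theorem HalfColumn.f_step (hn : 2 ≤ n) (h1 : 1 ≤ i) (hin : i ≤ n)
    (h : HalfColumn n (lo ++ downLetter n i :: (mid ++ .pos (lowIdx n i) :: hi))) :
    StrictColumn n (lo ++ .bar (lowIdx n i) :: (mid ++ .pos (lowIdx n i) :: hi)) ∧
    HalfColumn n (lo ++ .bar (lowIdx n i) :: (mid ++ upLetter n i :: hi)) := by
  have hj := lowIdx_lt (i := i) hn
  have hd := rank_downLetter hn hin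
  have hmem := h.bit_mem hn h1 hin
  have b1 := hmem.1.2 (by simp)
  have b3 := hmem.2.2.2.2 (by simp)
  obtain ⟨b4, b2⟩ := h.bits hn h1 hin
  have ea : ∀ y : Letter, lo ++ .bar (lowIdx n i) :: (mid ++ y :: hi) =
    (lo ++ .bar (lowIdx n i) :: mid) ++ y :: hi := fun y => by simp
  have hm : StrictColumn n (lo ++ .bar (lowIdx n i) :: (mid ++ .pos (lowIdx n i) :: hi)) := by
    refine h.toStrict.down_to_bar hn h1 hin ?_
    rw [columnWord_eq_nil_of_rank hn h1 hin]
    · rfl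
    intro y hy
    right
    have hr := (h.toStrict.split_above rfl).1 y hy
    simp only [Letter.WeakAbove] at hr
    have n1 : y.rank n ≠ 2 * n - lowIdx n i := by
      intro hr2
      have : y = .bar (lowIdx n i) := rank_injOn (h.valid y (by simp [hy]))
        ⟨lowIdx_pos hn h1, hj.le⟩ (by rw [hr2]; rfl) (by omega)
      subst this
      have := hmem.2.1.2 (by simp [hy])
      omega
    have n2 : ¬ (y.rank n = n ∧ (downLetter n i).rank n = n) := by
      rintro ⟨hr1, hr2⟩
      obtain ⟨p, hp⟩ := List.mem_iff_getElem?.1 hy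
      have hpl := (List.getElem?_eq_some_iff.1 hp).1
      have i1 := h.toStrict.index_n (p := p) (x := y) (by rw [List.getElem?_append_left hpl, hp]) hr1
      have i2 := h.toStrict.index_n (p := lo.length) (x := downLetter n i) (by simp) hr2
      have := h.length_eq
      have := h.cover (n - 1) (by omega)
      omega
    omega
  have hb : bitUp n i (lo ++ .bar (lowIdx n i) :: (mid ++ .pos (lowIdx n i) :: hi)) = 0 := by
    obtain ⟨-, -, -, d3⟩ := ext_down_bar h.toStrict hm hn h1 hin
    have i1 := (hm.increments hn h1 hin).low_succ
    have i2 := (h.toStrict.increments hn h1 hin).low_succ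
    rw [d3] at i1
    omega
  have h' : StrictColumn n (lo ++ .bar (lowIdx n i) :: (mid ++ upLetter n i :: hi)) := by
    rw [ea] at hm hb ⊢
    exact hm.low_to_up hn h1 hin hb
  refine ⟨hm, HalfColumn.of_ext (i := i) h' (by rw [← h.length_eq]; simp) fun a ha => ?_⟩
  obtain ⟨s1, s2, s3, s4⟩ := HalfColumn.spin_step hn h1 hin h.toStrict h' hm
  have := h.ext_cover hn h1 hin a ha
  grind

theorem HalfColumn.e_step (hn : 2 ≤ n) (h1 : 1 ≤ i) (hin : i ≤ n)
    (h : HalfColumn n (lo ++ .bar (lowIdx n i) :: (mid ++ upLetter n i :: hi))) :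
    StrictColumn n (lo ++ .bar (lowIdx n i) :: (mid ++ .pos (lowIdx n i) :: hi)) ∧
    HalfColumn n (lo ++ downLetter n i :: (mid ++ .pos (lowIdx n i) :: hi)) := by
  have hj := lowIdx_lt (i := i) hn
  have hu := rank_upLetter hn hin
  have hmem := h.bit_mem hn h1 hin
  have b4 := hmem.2.1.2 (by simp)
  have b2 := hmem.2.2.1.2 (by simp)
  obtain ⟨b1, b3⟩ := h.bits hn h1 hin
  have ea : ∀ y : Letter, lo ++ .bar (lowIdx n i) :: (mid ++ y :: hi) =
    (lo ++ .bar (lowIdx n i) :: mid) ++ y :: hi := fun y => by simp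
  have hm : StrictColumn n (lo ++ .bar (lowIdx n i) :: (mid ++ .pos (lowIdx n i) :: hi)) := by
    have h0 := h.toStrict
    rw [ea] at h0 ⊢
    refine h0.up_to_low hn h1 hin ?_
    rw [columnWord_eq_nil_of_rank hn h1 hin]
    · rfl
    intro y hy
    left
    have hr := (h.toStrict.split_above (ea _)).2 y hy
    simp only [Letter.WeakAbove] at hr
    have n1 : y.rank n ≠ lowIdx n i := by
      intro hr2
      have : y = .pos (lowIdx n i) := rank_injOn (h.valid y (by simp [hy]))
        ⟨lowIdx_pos hn h1, hj.le⟩ (by rw [hr2]; rfl) (by omega)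
      subst this
      have := hmem.1.2 (by simp [hy])
      omega
    have n2 : ¬ (y.rank n = n ∧ (upLetter n i).rank n = n) := by
      rintro ⟨hr1, hr2⟩
      obtain ⟨p, hp⟩ := List.mem_iff_getElem?.1 hy
      have i1 := h0.index_n (p := (lo ++ .bar (lowIdx n i) :: mid).length + (p + 1)) (x := y)
        (by rw [List.getElem?_append_right (by omega)]; simpa using hp) hr1
      have i2 := h0.index_n (p := (lo ++ .bar (lowIdx n i) :: mid).length) (x := upLetter n i)
        (by simp) hr2
      have := h.length_eq
      have := h.cover (n - 1) (by omega)
      rw [ea] at *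
      omega
    omega
  have hb : bitDown n i (lo ++ .bar (lowIdx n i) :: (mid ++ .pos (lowIdx n i) :: hi)) = 0 := by
    have hm' := hm
    have h0 := h.toStrict
    rw [ea] at hm' h0
    obtain ⟨-, -, -, d3⟩ := ext_low_up hm' h0 hn h1 hin
    have i1 := (hm'.increments hn h1 hin).bar_succ
    have i2 := (h0.increments hn h1 hin).bar_succ
    rw [d3] at i2
    rw [ea] at b3 b2 ⊢
    omega
  have h' : StrictColumn n (lo ++ downLetter n i :: (mid ++ .pos (lowIdx n i) :: hi)) :=
    hm.bar_to_down hn h1 hin hb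
  refine ⟨hm, HalfColumn.of_ext (i := i) h' (by rw [← h.length_eq]; simp) fun a ha => ?_⟩
  obtain ⟨s1, s2, s3, s4⟩ := HalfColumn.spin_step hn h1 hin h' h.toStrict hm
  have := h.ext_cover hn h1 hin a ha
  grind

/-- For the two highest colours the number of barred letters below the letter of rank `n` changes by
one, which moves that letter by one row, and at the same time `n` and `n̄` are exchanged. The two
effects on the sign compensate each other. -/
theorem HalfColumn.signOK_iff_of_step (hn : 2 ≤ n) (h1 : 1 ≤ i) (hin : i ≤ n)
    (h : HalfColumn n (lo ++ downLetter n i :: (mid ++ .pos (lowIdx n i) :: hi)))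
    (h' : HalfColumn n (lo ++ .bar (lowIdx n i) :: (mid ++ upLetter n i :: hi)))
    (hm : StrictColumn n (lo ++ .bar (lowIdx n i) :: (mid ++ .pos (lowIdx n i) :: hi)))
    {s : Prop} :
    SignOK n s (lo ++ downLetter n i :: (mid ++ .pos (lowIdx n i) :: hi)) ↔
      SignOK n s (lo ++ .bar (lowIdx n i) :: (mid ++ upLetter n i :: hi)) := by
  have ea : ∀ y : Letter, lo ++ .bar (lowIdx n i) :: (mid ++ y :: hi) =
    (lo ++ .bar (lowIdx n i) :: mid) ++ y :: hi := fun y => by simp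
  by_cases h2 : i < n - 1
  · have hu : (upLetter n i).rank n ≠ n := by grind [rank_upLetter, lowIdx_eq]
    have hd : (downLetter n i).rank n ≠ n := by grind [rank_downLetter, lowIdx_eq]
    constructor
    · intro hs
      have := hs.replace (bar_rank_ne hn (i := i))
      rw [ea] at this ⊢
      exact this.replace hu
    · intro hs
      rw [ea] at hs
      have := hs.replace (low_rank_ne hn (i := i))
      rw [← ea] at this
      exact this.replace hd
  · obtain ⟨z, hz, sz⟩ := h.toStrict.exists_sign (i := i) hn
    obtain ⟨z', hz', sz'⟩ := h'.toStrict.exists_sign (i := i) hn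
    have bs := h.toStrict.signBits hn (by omega) hin hz sz
    have bs' := h'.toStrict.signBits hn (by omega) hin hz' sz'
    have b3 := (h.bit_mem hn h1 hin).2.2.2.2 (by simp)
    have b2 := (h'.bit_mem hn h1 hin).2.2.1.2 (by simp)
    obtain ⟨s1, s2, s3, s4⟩ := HalfColumn.spin_step hn h1 hin h.toStrict h'.toStrict hm
    have hj : lowIdx n i = n - 1 := by have := lowIdx_eq hn hin; omega
    have hjn := lowIdx_lt (i := i) hn
    rw [extLow_of_lt hjn, extLow_of_lt hjn] at s2
    rw [extBar_of_lt hjn, extBar_of_lt hjn] at s4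
    have c := h.cover _ hjn
    have c' := h'.cover _ hjn
    have l := h.length_eq
    have l' := h'.length_eq
    rw [← hj] at bs bs'
    have hzz : z = z' := by
      rcases bs with ⟨_, _, _⟩ | ⟨_, _, _⟩ <;> rcases bs' with ⟨_, _, _⟩ | ⟨_, _, _⟩ <;> omega
    have d := h.cover (n - 1) (by omega)
    have d' := h'.cover (n - 1) (by omega)
    constructor
    · intro hs
      have := h.toStrict.signOK_unique hs sz (by rw [d]; omega)
      simp_all
    · intro hs
      have := h'.toStrict.signOK_unique hs sz' (by rw [d']; omega)
      simp_all

end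

end

/-! ### Pairs consisting of a column and a half-column -/

section

section

variable {n i : ℕ} {C lo mid hi : List Letter}

theorem GoodPair.half_f (hn : 2 ≤ n) (h1 : 1 ≤ i) (hin : i ≤ n)
    (hg : GoodPair n C (lo ++ downLetter n i :: (mid ++ .pos (lowIdx n i) :: hi)))
    (hC : StrictColumn n C)
    (h : HalfColumn n (lo ++ downLetter n i :: (mid ++ .pos (lowIdx n i) :: hi))) :
    GoodPair n C (lo ++ .bar (lowIdx n i) :: (mid ++ upLetter n i :: hi)) := by
  obtain ⟨hm, h'⟩ := h.f_step hn h1 hin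
  obtain ⟨s1, s2, s3, s4⟩ := HalfColumn.spin_step hn h1 hin h.toStrict h'.toStrict hm
  refine hg.transport hC h.toStrict hn hin (fun c P => ?_) fun s hs hs' => ?_
  · rw [h.length_eq] at P
    rw [h'.length_eq]
    exact P.right_f_half s1 s2 s3 s4 (h.ext_cover hn h1 hin)
  grind [HalfColumn.signOK_iff_of_step]

/-- The columns are read after the half-column, so `ẽ_i` acts on the half-column only if they leave
no `-`; this is the source of `he`. -/
theorem GoodPair.half_e (hn : 2 ≤ n) (h1 : 1 ≤ i) (hin : i ≤ n)
    (hg : GoodPair n C (lo ++ .bar (lowIdx n i) :: (mid ++ upLetter n i :: hi)))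
    (hC : StrictColumn n C)
    (h : HalfColumn n (lo ++ .bar (lowIdx n i) :: (mid ++ upLetter n i :: hi)))
    (he : wordEps (columnWord n i C) = 0) :
    GoodPair n C (lo ++ downLetter n i :: (mid ++ .pos (lowIdx n i) :: hi)) := by
  obtain ⟨hm, h'⟩ := h.e_step hn h1 hin
  obtain ⟨s1, s2, s3, s4⟩ := HalfColumn.spin_step hn h1 hin h'.toStrict h.toStrict hm
  have hmem := h.bit_mem hn h1 hin
  refine hg.transport hC h.toStrict hn hin (fun c P => ?_) fun s hs hs' => ?_
  · rw [h.length_eq] at P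
    rw [h'.length_eq]
    refine P.right_e_half (lowIdx_pos hn h1) (lowIdx_lt_topIdx hn hin)
      (hC.increments hn h1 hin) (h.toStrict.increments hn h1 hin) (fun a ha => (s1 a ha).symm)
      s2.symm (fun a ha => (s3 a ha).symm) s4.symm (h.ext_cover hn h1 hin)
      (hmem.2.2.1.2 (by simp)) (hmem.2.1.2 (by simp)) ?_
    rw [← (hC.columnWord_eps_phi hn h1 hin).1, he]
  grind [HalfColumn.signOK_iff_of_step]

end

/-! ### The operators on tableaux -/

/-- The signs of a half-column. -/
def spinWord (n i : ℕ) (H : List Letter) : List Sign :=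
  (if (spinE n i H).isSome then [.minus] else []) ++ (if (spinF n i H).isSome then [.plus] else [])

/-- The signs of an optional half-column. -/
def halfWord (n i : ℕ) (H : Option (List Letter)) : List Sign := H.toList.flatMap (spinWord n i)

/-- The signs of a list of columns, read from right to left. -/
def colsWord (n i : ℕ) (L : List (List Letter)) : List Sign := L.reverse.flatMap (columnWord n i)

@[simp] theorem colsWord_nil (n i : ℕ) : colsWord n i [] = [] := rfl

theorem colsWord_append (n i : ℕ) (L M : List (List Letter)) :
    colsWord n i (L ++ M) = colsWord n i M ++ colsWord n i L := by
  simp [colsWord]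

theorem colsWord_cons (n i : ℕ) (C : List Letter) (M : List (List Letter)) :
    colsWord n i (C :: M) = colsWord n i M ++ columnWord n i C := by
  simp [colsWord]

/-- The signs of a tableau. -/
def tableauWord (n i : ℕ) (T : Tableau) : List Sign := halfWord n i T.half ++ colsWord n i T.cols

section

variable {n i : ℕ}

theorem boxSigns_map_fst (c p : ℕ) (x : Letter) :
    (boxSigns n i c p x).map Prod.fst = letterSigns n i x := by grind [boxSigns, letterSigns]

theorem spinSigns_map_fst (H : List Letter) :
    (spinSigns n i H).map Prod.fst = spinWord n i H := by grind [spinSigns, spinWord]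

/-- The tagged signs of a column. -/
def columnSignsAt (n i : ℕ) (C : List Letter × ℕ) : List (Sign × Option (ℕ × ℕ)) :=
  C.1.zipIdx.reverse.flatMap fun x => boxSigns n i C.2 x.2 x.1

theorem columnSignsAt_map_fst (C : List Letter × ℕ) :
    (columnSignsAt n i C).map Prod.fst = columnWord n i C.1 := by
  unfold columnSignsAt columnWord
  rw [List.map_flatMap]
  simp only [boxSigns_map_fst]
  conv_rhs => rw [← List.zipIdx_map_fst 0 C.1]
  rw [← List.map_reverse, List.flatMap_map]

theorem colsSigns_map_fst (L : List (List Letter × ℕ)) :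
    (L.reverse.flatMap (columnSignsAt n i)).map Prod.fst = colsWord n i (L.map Prod.fst) := by
  grind [colsWord, List.map_flatMap, List.map_reverse, List.flatMap_map, columnSignsAt_map_fst]

theorem tableauSigns_eq (T : Tableau) : tableauSigns n i T =
    T.half.toList.flatMap (spinSigns n i) ++
      T.cols.zipIdx.reverse.flatMap (columnSignsAt n i) := rfl

theorem tableauSigns_map_fst (T : Tableau) :
    (tableauSigns n i T).map Prod.fst = tableauWord n i T := by
  rw [tableauSigns_eq, List.map_append, colsSigns_map_fst, List.zipIdx_map_fst, tableauWord,
    halfWord, List.map_flatMap]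
  simp only [spinSigns_map_fst]

theorem zipIdx_eq_append_cons {α : Type} {l : List α} {L M : List (α × ℕ)} {x : α × ℕ} {k : ℕ}
    (h : l.zipIdx k = L ++ x :: M) :
    l = L.map Prod.fst ++ x.1 :: M.map Prod.fst ∧ x.2 = k + L.length := by
  induction L generalizing l k with
  | nil =>
    cases l with
    | nil => simp at h
    | cons a l =>
      simp only [List.zipIdx_cons, List.nil_append, List.cons.injEq] at h
      obtain ⟨rfl, rfl⟩ := h
      simp
  | cons y L ih =>
    cases l with
    | nil => simp at h
    | cons a l =>
      grind

theorem append_eq_append_cons {α : Type} {A B u v : List α} {s : α} (h : A ++ B = u ++ s :: v) :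
    (∃ v', A = u ++ s :: v' ∧ v = v' ++ B) ∨ ∃ u', u = A ++ u' ∧ B = u' ++ s :: v := by
  rcases List.append_eq_append_iff.1 h with ⟨w, hw1, hw2⟩ | ⟨w, hw1, hw2⟩
  · simp_all
  · cases w with
    | nil => simp_all
    | cons a w =>
      simp_all

theorem append_cons_of_eq_singleton {α β : Type} {L u v : List (α × β)} {s t : α} {x : β}
    (h : L = u ++ (s, x) :: v) (h' : L.map Prod.fst = [t]) : u = [] ∧ v = [] ∧ s = t := by
  grind [List.append_eq_singleton_iff, List.map_eq_nil_iff, List.cons.injEq]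

theorem letterSigns_length (hn : 2 ≤ n) (h1 : 1 ≤ i) (hi : i ≤ n) (x : Letter) :
    letterSigns n i x = [] ∨ ∃ t, letterSigns n i x = [t] := by
  grind [letterSigns, letterSigns_cases]

theorem tableauSigns_split (hn : 2 ≤ n) (h1 : 1 ≤ i) (hi : i ≤ n) {T : Tableau} {s : Sign}
    {x : Option (ℕ × ℕ)} {u v : List (Sign × Option (ℕ × ℕ))}
    (h : tableauSigns n i T = u ++ (s, x) :: v) :
    (∃ H v', T.half = some H ∧ spinSigns n i H = u ++ (s, x) :: v' ∧
      v.map Prod.fst = v'.map Prod.fst ++ colsWord n i T.cols) ∨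
    (∃ l lo a hi r, T.cols = l ++ (lo ++ a :: hi) :: r ∧ x = some (l.length, lo.length) ∧
      letterSigns n i a = [s] ∧
      u.map Prod.fst = halfWord n i T.half ++ (colsWord n i r ++ columnWord n i hi) ∧
      v.map Prod.fst = columnWord n i lo ++ colsWord n i l) := by
  rw [tableauSigns_eq] at h
  rcases append_eq_append_cons h with ⟨v', e1, e2⟩ | ⟨u', e1, e2⟩
  · left
    obtain ⟨L₁, H, L₂, u', v'', hH, g, rfl, rfl⟩ := flatMap_eq_append_cons e1
    cases hT : T.half with
    | none => simp_all
    | some H' =>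
      grind [Option.toList_some, colsSigns_map_fst, List.zipIdx_map_fst]
  · right
    obtain ⟨L₁, ⟨C, c⟩, L₂, u'', v'', hH, g, rfl, rfl⟩ := flatMap_eq_append_cons e2
    unfold columnSignsAt at g
    obtain ⟨M₁, ⟨a, p⟩, M₂, u₃, v₃, hM, g', rfl, rfl⟩ := flatMap_eq_append_cons g
    have hH' : T.cols.zipIdx = L₂.reverse ++ (C, c) :: L₁.reverse := by simp_all
    have hM' : C.zipIdx = M₂.reverse ++ (a, p) :: M₁.reverse := by simp_all
    obtain ⟨z1, z2⟩ := zipIdx_eq_append_cons hH'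
    obtain ⟨z3, z4⟩ := zipIdx_eq_append_cons hM'
    simp only at z1 z2 z3 z4
    have hls : ∃ t, letterSigns n i a = [t] := by
      refine (letterSigns_length hn h1 hi a).resolve_left fun h0 => ?_
      have := congrArg (List.map Prod.fst) g'
      rw [boxSigns_map_fst, h0] at this
      simp at this
    obtain ⟨t, ht⟩ := hls
    obtain ⟨rfl, rfl, rfl⟩ := append_cons_of_eq_singleton g' (by rw [boxSigns_map_fst, ht])
    refine ⟨_, _, a, _, _, z1.trans (by rw [z3]), ?_, ht, ?_, ?_⟩
    · have : (s, x) ∈ boxSigns n i c p a := by rw [g']; simp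
      unfold boxSigns at this
      have hx : x = some (c, p) := by
        split_ifs at this <;> simp at this
        · grind
        · exact this.2
        · exact this.2
      rw [hx, z2, z4]; simp
    · rw [e1]
      simp only [List.map_append, List.append_nil, List.map_nil]
      congr 1
      · rw [halfWord, List.map_flatMap]; simp only [spinSigns_map_fst]
      · congr 1
        · rw [← colsSigns_map_fst]; simp
        · have := columnSignsAt_map_fst (n := n) (i := i) ((M₁.reverse.map Prod.fst), c)
          rw [columnWord, List.map_flatMap, ← List.map_reverse, List.flatMap_map]
          simp [boxSigns_map_fst]
    · simp only [List.map_append, List.nil_append]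
      congr 1
      · rw [columnWord, List.map_flatMap, ← List.map_reverse, List.flatMap_map]
        simp [boxSigns_map_fst]
      · rw [← colsSigns_map_fst]; simp

theorem tableauSigns_of_cols (hn : 2 ≤ n) (h1 : 1 ≤ i) (hi : i ≤ n) {l r : List (List Letter)}
    {lo hi' : List Letter} {a : Letter} {s : Sign} {H : Option (List Letter)}
    (ha : letterSigns n i a = [s]) :
    ∃ u v, tableauSigns n i ⟨l ++ (lo ++ a :: hi') :: r, H⟩ =
        u ++ (s, some (l.length, lo.length)) :: v ∧
      u.map Prod.fst = halfWord n i H ++ (colsWord n i r ++ columnWord n i hi') ∧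
      v.map Prod.fst = columnWord n i lo ++ colsWord n i l := by
  have hb : boxSigns n i l.length lo.length a = [(s, some (l.length, lo.length))] := by
    grind [letterSigns, boxSigns]
  refine ⟨H.toList.flatMap (spinSigns n i) ++
      ((r.zipIdx (l.length + 1)).reverse.flatMap (columnSignsAt n i) ++
        (hi'.zipIdx (lo.length + 1)).reverse.flatMap fun x => boxSigns n i l.length x.2 x.1),
    (lo.zipIdx.reverse.flatMap fun x => boxSigns n i l.length x.2 x.1) ++
      l.zipIdx.reverse.flatMap (columnSignsAt n i), ?_, ?_, ?_⟩
  · rw [tableauSigns_eq]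
    simp only [List.zipIdx_append, List.zipIdx_cons, List.reverse_append, List.reverse_cons,
      List.flatMap_append, List.flatMap_cons, List.flatMap_nil, List.append_nil, zero_add,
      List.append_assoc]
    congr 2
    conv_lhs => rw [columnSignsAt]
    grind
  · rw [List.map_append, List.map_append, colsSigns_map_fst, List.zipIdx_map_fst]
    congr 1
    · rw [halfWord, List.map_flatMap]; simp only [spinSigns_map_fst]
    · congr 1
      rw [columnWord, List.map_flatMap]
      simp only [boxSigns_map_fst]
      conv_rhs => rw [← List.zipIdx_map_fst (lo.length + 1) hi']
      rw [← List.map_reverse, List.flatMap_map]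
  · rw [List.map_append, colsSigns_map_fst, List.zipIdx_map_fst]
    congr 1
    rw [columnWord, List.map_flatMap]
    simp only [boxSigns_map_fst]
    conv_rhs => rw [← List.zipIdx_map_fst 0 lo]
    rw [← List.map_reverse, List.flatMap_map]

theorem modify_append_cons {α : Type} (l r : List α) (a : α) (f : α → α) :
    (l ++ a :: r).modify l.length f = l ++ f a :: r := by
  induction l with
  | nil => simp
  | cons b l ih => simpa using ih

theorem letterSigns_eq_plus (hn : 2 ≤ n) (h1 : 1 ≤ i) (hi : i ≤ n) {x : Letter} :
    letterSigns n i x = [.plus] ↔ (x.f n i).isSome := by grind [letterSigns, letterSigns_cases]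

theorem letterSigns_eq_minus (hn : 2 ≤ n) (h1 : 1 ≤ i) (hi : i ≤ n) {x : Letter} :
    letterSigns n i x = [.minus] ↔ (x.e n i).isSome := by grind [letterSigns, letterSigns_cases]

/-- The chosen position is translated into a splitting of the tableau around the changed factor: no
`+` is left before it and no `-` behind it. In this form the tags are no longer needed. -/
theorem tableau_f_iff (hn : 2 ≤ n) (h1 : 1 ≤ i) (hi : i ≤ n) {T T' : Tableau} :
    (tableauCrystal n).f i T = some T' ↔
      (∃ H H', T.half = some H ∧ spinF n i H = some H' ∧ T' = ⟨T.cols, some H'⟩ ∧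
        wordEps (colsWord n i T.cols) = 0) ∨
      ∃ l lo x hi r y, T.cols = l ++ (lo ++ x :: hi) :: r ∧ x.f n i = some y ∧
        T' = ⟨l ++ (lo ++ y :: hi) :: r, T.half⟩ ∧
        wordPhi (halfWord n i T.half ++ (colsWord n i r ++ columnWord n i hi)) = 0 ∧
        wordEps (columnWord n i lo ++ colsWord n i l) = 0 := by
  simp only [tableauCrystal, Option.map_eq_some_iff, leftmostPlus_eq_some_iff]
  constructor
  · rintro ⟨x, ⟨u, v, e, hu, hv⟩, rfl⟩
    rcases tableauSigns_split hn h1 hi e with ⟨H, v', hH, e1, e2⟩ | ⟨l, lo, a, hi', r, e1, rfl, e2, e3, e4⟩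
    · left
      have hp : (Sign.plus, x) ∈ spinSigns n i H := by rw [e1]; simp
      unfold spinSigns at hp
      have hs : (spinF n i H).isSome ∧ x = none := by split_ifs at hp <;> simp_all
      obtain ⟨hs, rfl⟩ := hs
      obtain ⟨H', hH'⟩ := Option.isSome_iff_exists.1 hs
      refine ⟨H, H', hH, hH', by simp [applyAt, hH, hH'], ?_⟩
      unfold spinSigns at e1
      rw [if_pos hs] at e1
      -- In `spinSigns` the `+` comes last, so nothing of the half-column is read behind it.
      have : v' = [] := by
        have h2 : u ++ (Sign.plus, none) :: v' = (u ++ [(Sign.plus, none)]) ++ v' := by simp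
        rw [h2] at e1
        have h3 := congrArg List.length e1
        split_ifs at e1 h3
        · rcases v' with _ | ⟨w, v'⟩
          · rfl
          · rcases u with _ | ⟨w', u⟩
            · simp at e1
            · simp at h3; omega
        · rcases v' with _ | ⟨w, v'⟩
          · rfl
          · simp at h3; omega
      rw [e2, this] at hv
      simpa using hv
    grind [Option.isSome_iff_exists, letterSigns_eq_plus, applyAt, modify_append_cons]
  · rintro (⟨H, H', hH, hs, rfl, he⟩ | ⟨l, lo, x, hi', r, y, e, hxy, rfl, hp, he⟩)
    · refine ⟨none, ⟨if (spinE n i H).isSome then [(.minus, none)] else [],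
        T.cols.zipIdx.reverse.flatMap (columnSignsAt n i), ?_, ?_, ?_⟩, ?_⟩
      · grind [tableauSigns_eq, spinSigns]
      · split_ifs <;> simp
      · rw [colsSigns_map_fst, List.zipIdx_map_fst]; exact he
      · simp [applyAt, hH, hs]
    · obtain ⟨cols, half⟩ := T
      subst e
      obtain ⟨u, v, e1, e2, e3⟩ := tableauSigns_of_cols (l := l) (lo := lo) (hi' := hi') (r := r)
        (H := half) hn h1 hi ((letterSigns_eq_plus hn h1 hi (x := x)).2 (by simp [hxy]))
      grind [applyAt, modify_append_cons]

/-- Here `hT` matters: if the half-column also had a `+`, that `+` would stand behind its `-` and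
could absorb a `-` of the columns, so the first alternative would be wrong. Genuine half-columns
never have both signs. -/
theorem tableau_e_iff (hn : 2 ≤ n) (h1 : 1 ≤ i) (hi : i ≤ n) {T T' : Tableau}
    (hT : ∀ H ∈ T.half, ¬ ((spinE n i H).isSome ∧ (spinF n i H).isSome)) :
    (tableauCrystal n).e i T = some T' ↔
      (∃ H H', T.half = some H ∧ spinE n i H = some H' ∧ T' = ⟨T.cols, some H'⟩ ∧
        wordEps (colsWord n i T.cols) = 0) ∨
      ∃ l lo x hi r y, T.cols = l ++ (lo ++ x :: hi) :: r ∧ x.e n i = some y ∧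
        T' = ⟨l ++ (lo ++ y :: hi) :: r, T.half⟩ ∧
        wordPhi (halfWord n i T.half ++ (colsWord n i r ++ columnWord n i hi)) = 0 ∧
        wordEps (columnWord n i lo ++ colsWord n i l) = 0 := by
  simp only [tableauCrystal, Option.map_eq_some_iff, rightmostMinus_eq_some_iff]
  constructor
  · rintro ⟨x, ⟨u, v, e, hu, hv⟩, rfl⟩
    rcases tableauSigns_split hn h1 hi e with ⟨H, v', hH, e1, e2⟩ | ⟨l, lo, a, hi', r, e1, rfl, e2, e3, e4⟩
    · left
      have hp : (Sign.minus, x) ∈ spinSigns n i H := by rw [e1]; simp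
      unfold spinSigns at hp
      have hs : (spinE n i H).isSome ∧ x = none := by split_ifs at hp <;> simp_all
      obtain ⟨hs, rfl⟩ := hs
      obtain ⟨H', hH'⟩ := Option.isSome_iff_exists.1 hs
      refine ⟨H, H', hH, hH', by simp [applyAt, hH, hH'], ?_⟩
      have hF := fun h => hT H hH ⟨hs, h⟩
      unfold spinSigns at e1
      rw [if_pos hs, if_neg hF] at e1
      have : v' = [] := by
        have h3 := congrArg List.length e1
        rcases v' with _ | ⟨w, v'⟩
        · rfl
        · simp at h3; omega
      rw [e2, this] at hv
      simpa using hv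
    grind [Option.isSome_iff_exists, letterSigns_eq_minus, applyAt, modify_append_cons]
  · rintro (⟨H, H', hH, hs, rfl, he⟩ | ⟨l, lo, x, hi', r, y, e, hxy, rfl, hp, he⟩)
    · have hF := fun h => hT H hH ⟨by simp [hs], h⟩
      refine ⟨none, ⟨[], T.cols.zipIdx.reverse.flatMap (columnSignsAt n i), ?_, ?_, ?_⟩, ?_⟩
      · grind [tableauSigns_eq, Option.toList_some, spinSigns]
      · simp
      · rw [colsSigns_map_fst, List.zipIdx_map_fst]; exact he
      · simp [applyAt, hH, hs]
    · obtain ⟨cols, half⟩ := T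
      subst e
      obtain ⟨u, v, e1, e2, e3⟩ := tableauSigns_of_cols (l := l) (lo := lo) (hi' := hi') (r := r)
        (H := half) hn h1 hi ((letterSigns_eq_minus hn h1 hi (x := x)).2 (by simp [hxy]))
      grind [applyAt, modify_append_cons]

end

end

section

/-! ### The set of tableaux is stable -/

/-- The conditions on a tableau in terms of the counting functions of its columns; the columns of
height `n` have the sign given by `s`. -/
structure GoodTableau (n : ℕ) (s : Prop) (T : Tableau) : Prop where
  cols : ∀ C ∈ T.cols, GoodColumn n C
  half : ∀ H ∈ T.half, HalfColumn n H
  sign : ∀ C ∈ T.allCols, C.length = n → SignOK n s C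
  chain : T.allCols.IsChain (GoodPair n)

section

variable {n i : ℕ} {s : Prop} {T T' : Tableau}

theorem GoodTableau.strict (h : GoodTableau n s T) {C : List Letter} (hC : C ∈ T.allCols) :
    StrictColumn n C := by
  rw [Tableau.allCols, List.mem_append] at hC
  rcases hC with hC | hC
  · exact (h.cols C hC).toStrict
  · exact (h.half C (by simpa using hC)).toStrict

theorem isChain_replace {α : Type} {R : α → α → Prop} {l r : List α} {a b : α}
    (h : (l ++ a :: r).IsChain R) (h1 : ∀ c ∈ l.getLast?, R c a → R c b)
    (h2 : ∀ c ∈ r.head?, R a c → R b c) : (l ++ b :: r).IsChain R := by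
  grind [List.isChain_append, List.isChain_cons, List.head?_cons, Option.mem_def, Option.some.injEq]

theorem colsWord_getLast {l : List (List Letter)} {c : List Letter} (h : c ∈ l.getLast?) :
    ∃ w, colsWord n i l = columnWord n i c ++ w := by
  obtain ⟨l', rfl⟩ := List.getLast?_eq_some_iff.1 h
  exact ⟨colsWord n i l', by rw [colsWord_append, colsWord_cons]; simp⟩

theorem wordPhi_spinWord (n i : ℕ) (H : List Letter) :
    wordPhi (spinWord n i H) = if (spinF n i H).isSome then 1 else 0 := by
  unfold spinWord; split_ifs <;> simp

theorem bitLow_bitDown_spinF {H : List Letter} (hH : HalfColumn n H) (hn : 2 ≤ n) (h1 : 1 ≤ i)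
    (hin : i ≤ n) (h : bitLow n i H = 1 ∧ bitDown n i H = 1) : (spinF n i H).isSome := by
  have hm := hH.bit_mem hn h1 hin
  exact (hH.spinF_isSome hn h1 hin).2 ⟨hm.1.1 h.1, hm.2.2.2.1 h.2⟩

theorem HalfColumn.not_both_spin {H : List Letter} (hH : HalfColumn n H) (hn : 2 ≤ n) (h1 : 1 ≤ i)
    (hin : i ≤ n) : ¬ ((spinE n i H).isSome ∧ (spinF n i H).isSome) := by
  rw [hH.spinE_isSome hn h1 hin, hH.spinF_isSome hn h1 hin]
  have hm := hH.bit_mem hn h1 hin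
  rw [← hm.1, ← hm.2.1, ← hm.2.2.1, ← hm.2.2.2]
  have := hH.bits hn h1 hin
  omega

theorem GoodTableau.replace_column {l r : List (List Letter)} {C D : List Letter}
    {H : Option (List Letter)} (h : GoodTableau n s ⟨l ++ C :: r, H⟩) (hD : GoodColumn n D)
    (hl : D.length = C.length) (hs : C.length = n → SignOK n s C → SignOK n s D)
    (h1 : ∀ c ∈ l.getLast?, GoodPair n c C → GoodPair n c D)
    (h2 : ∀ c ∈ (r ++ H.toList).head?, GoodPair n C c → GoodPair n D c) :
    GoodTableau n s ⟨l ++ D :: r, H⟩ := by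
  refine ⟨?_, h.half, ?_, ?_⟩
  · intro E hE
    simp only [List.mem_append, List.mem_cons] at hE
    rcases hE with hE | rfl | hE
    · exact h.cols E (by simp [hE])
    · exact hD
    · exact h.cols E (by simp [hE])
  · intro E hE hEn
    simp only [Tableau.allCols, List.mem_append, List.mem_cons, List.append_assoc,
      List.cons_append] at hE
    rcases hE with hE | rfl | hE
    · exact h.sign E (by simp [Tableau.allCols, hE]) hEn
    · exact hs (by omega) (h.sign C (by simp [Tableau.allCols]) (by omega))
    · refine h.sign E ?_ hEn
      grind [Tableau.allCols, List.append_assoc]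
  · have hc := h.chain
    grind [Tableau.allCols, List.append_assoc, isChain_replace]

theorem GoodTableau.replace_half {L : List (List Letter)} {H H' : List Letter}
    (h : GoodTableau n s ⟨L, some H⟩) (hH' : HalfColumn n H')
    (hs : SignOK n s H → SignOK n s H')
    (h1 : ∀ c ∈ L.getLast?, GoodPair n c H → GoodPair n c H') :
    GoodTableau n s ⟨L, some H'⟩ := by
  refine ⟨h.cols, fun E hE => ?_, ?_, ?_⟩
  · simp_all
  · intro E hE hEn
    simp only [Tableau.allCols, List.mem_append, Option.toList_some, List.mem_singleton] at hE
    rcases hE with hE | rfl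
    · exact h.sign E (by simp [Tableau.allCols, hE]) hEn
    · exact hs (h.sign H (by simp [Tableau.allCols]) (h.half H rfl).length_eq)
  · have hc := h.chain
    grind [Tableau.allCols, Option.toList_some, isChain_replace]

/-- Only the changed column and its two neighbours have to be examined. Under `f̃_i` the delicate
neighbour is the right one, which is read earlier and must leave no `+`; under `ẽ_i` it is the left
one, which is read later and must leave no `-`. -/
theorem GoodTableau.f_stable (h : GoodTableau n s T) (hn : 2 ≤ n) (h1 : 1 ≤ i) (hin : i ≤ n)
    (hf : (tableauCrystal n).f i T = some T') : GoodTableau n s T' := by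
  rcases (tableau_f_iff hn h1 hin).1 hf with ⟨H, H', hH, hs, rfl, he⟩ |
    ⟨l, lo, x, hi, r, y, e, hxy, rfl, hp, he⟩
  · obtain ⟨L, half⟩ := T
    simp only at hH he ⊢
    subst hH
    have hHc := h.half H rfl
    obtain ⟨lo, mid, hi, rfl⟩ := hHc.exists_split_down hn h1 hin (by simp [hs])
    rw [HalfColumn.spinF_eq hn h1 hin hHc] at hs
    cases hs
    obtain ⟨hm, hH'⟩ := hHc.f_step hn h1 hin
    refine h.replace_half hH' (HalfColumn.signOK_iff_of_step hn h1 hin hHc hH' hm).1 ?_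
    intro c hc hg
    exact hg.half_f hn h1 hin
      (h.strict (by simp [Tableau.allCols, List.mem_of_getLast? hc])) hHc
  · obtain ⟨L, half⟩ := T
    simp only at e hp ⊢
    subst e
    have hC := h.cols (lo ++ x :: hi) (by simp)
    rw [wordEps_append] at he
    rw [wordPhi_append, wordPhi_append] at hp
    have hlo : wordEps (columnWord n i lo) = 0 := by omega
    have hhi : wordPhi (columnWord n i hi) = 0 := by omega
    have hD := hC.f_replace hn h1 hin hxy hlo hhi
    refine h.replace_column hD (length_replace ..)
      (fun hl hs => hC.signOK_replace hD hn h1 hin (Or.inl hxy) hl hs) ?_ ?_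
    · intro c hc hg
      exact hg.f_right (h.strict (by simp [Tableau.allCols, List.mem_of_getLast? hc])) hC hn h1 hin
        hxy hlo hhi
    · intro c hc hg
      cases r with
      | nil =>
        cases half with
        | none => simp at hc
        | some H =>
          simp only [Option.toList_some, List.nil_append, List.head?_cons, Option.mem_def,
            Option.some.injEq] at hc
          subst hc
          have hHc := h.half H rfl
          refine hg.f_left_half hC hHc.toStrict hn h1 hin hxy hlo hhi (hHc.ext_cover hn h1 hin) ?_
          grind [wordPhi, halfWord, Option.toList_some, wordPhi_spinWord, bitLow_bitDown_spinF, colsWord_nil]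
      | cons C r =>
        simp only [List.cons_append, List.head?_cons, Option.mem_def, Option.some.injEq] at hc
        subst hc
        refine hg.f_left hC (h.cols C (by simp)).toStrict hn h1 hin hxy hlo hhi ?_
        grind [colsWord_cons, wordPhi_append]

theorem GoodTableau.e_stable (h : GoodTableau n s T) (hn : 2 ≤ n) (h1 : 1 ≤ i) (hin : i ≤ n)
    (hf : (tableauCrystal n).e i T = some T') : GoodTableau n s T' := by
  rcases (tableau_e_iff hn h1 hin fun H hH => (h.half H hH).not_both_spin hn h1 hin).1 hf with
    ⟨H, H', hH, hs, rfl, he⟩ | ⟨l, lo, x, hi, r, y, e, hxy, rfl, hp, he⟩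
  · obtain ⟨L, half⟩ := T
    simp only at hH he ⊢
    subst hH
    have hHc := h.half H rfl
    obtain ⟨lo, mid, hi, rfl⟩ := hHc.exists_split_up hn h1 hin (by simp [hs])
    rw [HalfColumn.spinE_eq hn h1 hin hHc] at hs
    cases hs
    obtain ⟨hm, hH'⟩ := hHc.e_step hn h1 hin
    refine h.replace_half hH' (HalfColumn.signOK_iff_of_step hn h1 hin hH' hHc hm).2 ?_
    intro c hc hg
    obtain ⟨w, hw⟩ := colsWord_getLast (n := n) (i := i) hc
    rw [hw, wordEps_append] at he
    exact hg.half_e hn h1 hin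
      (h.strict (by simp [Tableau.allCols, List.mem_of_getLast? hc])) hHc (by omega)
  · obtain ⟨L, half⟩ := T
    simp only at e hp ⊢
    subst e
    have hC := h.cols (lo ++ x :: hi) (by simp)
    rw [wordEps_append] at he
    rw [wordPhi_append, wordPhi_append] at hp
    have hlo : wordEps (columnWord n i lo) = 0 := by omega
    have hhi : wordPhi (columnWord n i hi) = 0 := by omega
    have hD := hC.e_replace hn h1 hin hxy hlo hhi
    refine h.replace_column hD (length_replace ..)
      (fun hl hs => hC.signOK_replace hD hn h1 hin (Or.inr hxy) hl hs) ?_ ?_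
    · intro c hc hg
      obtain ⟨w, hw⟩ := colsWord_getLast (n := n) (i := i) hc
      rw [hw, wordEps_append] at he
      exact hg.e_right (h.strict (by simp [Tableau.allCols, List.mem_of_getLast? hc])) hC hn h1 hin
        hxy hlo hhi (by omega)
    · intro c hc hg
      have hc' : StrictColumn n c := by
        refine h.strict ?_
        grind [List.mem_of_head?, Tableau.allCols]
      exact hg.e_left hC hc' hn h1 hin hxy hlo hhi

/-- The words before and behind the changed factor are not affected, so the same splitting that
locates the `-` in `T` locates the `+` in `T'`. -/
theorem GoodTableau.f_e (h : GoodTableau n s T) (hn : 2 ≤ n) (h1 : 1 ≤ i) (hin : i ≤ n)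
    (hf : (tableauCrystal n).e i T = some T') : (tableauCrystal n).f i T' = some T := by
  rw [tableau_f_iff hn h1 hin]
  rcases (tableau_e_iff hn h1 hin fun H hH => (h.half H hH).not_both_spin hn h1 hin).1 hf with
    ⟨H, H', hH, hs, rfl, he⟩ | ⟨l, lo, x, hi, r, y, e, hxy, rfl, hp, he⟩
  · left
    have hHc := h.half H hH
    obtain ⟨lo, mid, hi, rfl⟩ := hHc.exists_split_up hn h1 hin (by simp [hs])
    rw [HalfColumn.spinE_eq hn h1 hin hHc] at hs
    cases hs
    obtain ⟨hm, hH'⟩ := hHc.e_step hn h1 hin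
    exact ⟨_, _, rfl, HalfColumn.spinF_eq hn h1 hin hH', by rw [← hH], he⟩
  · right
    refine ⟨l, lo, y, hi, r, x, rfl, ?_, by rw [← e], hp, he⟩
    grind [letter_e_eq_some, letter_f_eq_some]

end

end

section

/-! ### The set `T(λ)` -/

theorem heights_pairwise (n : ℕ) (m : ℕ → ℕ) : (heights n m).Pairwise (· ≤ ·) := by
  unfold heights
  have h1 : ((List.range' 1 (n - 2)).flatMap fun i => List.replicate (m i) i).Pairwise (· ≤ ·) := by
    rw [List.pairwise_flatMap]
    refine ⟨fun a _ => List.pairwise_replicate.2 (Or.inr le_rfl), ?_⟩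
    refine (List.pairwise_lt_range' (s := 1) (n := n - 2)).imp fun {a b} hab => ?_
    intro x hx y hy
    rw [List.eq_of_mem_replicate hx, List.eq_of_mem_replicate hy]; omega
  grind

theorem heights_mem {n : ℕ} (hn : 2 ≤ n) {m : ℕ → ℕ} {h : ℕ} (hh : h ∈ heights n m) :
    1 ≤ h ∧ h ≤ n := by
  grind [heights]

theorem isChain_iff_getElem? {α : Type} {R : α → α → Prop} {l : List α} :
    l.IsChain R ↔ ∀ k a b, l[k]? = some a → l[k + 1]? = some b → R a b := by
  rw [List.isChain_iff_getElem]
  constructor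
  · grind
  · intro h k hk
    exact h k _ _ (List.getElem?_eq_getElem _) (List.getElem?_eq_getElem _)

section

variable {n i : ℕ} {m : ℕ → ℕ} {s : Prop} {T T' : Tableau}

theorem allCols_length_le (hn : 2 ≤ n) (hs : T.cols.map List.length = heights n m)
    (hh : ∀ H ∈ T.half, H.length = n) {k : ℕ} {C C' : List Letter} (hC : T.allCols[k]? = some C)
    (hC' : T.allCols[k + 1]? = some C') : C.length ≤ C'.length := by
  have hp : (T.allCols.map List.length).Pairwise (· ≤ ·) := by
    rw [Tableau.allCols, List.map_append, hs, List.pairwise_append]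
    refine ⟨heights_pairwise n m, ?_, ?_⟩
    · cases T.half <;> simp
    · intro a ha b hb
      simp only [List.mem_map, Option.mem_toList] at hb
      obtain ⟨H, hH, rfl⟩ := hb
      rw [hh H hH]; exact (heights_mem hn ha).2
  grind [List.getElem?_eq_some_iff, List.pairwise_iff_getElem, List.getElem?_eq_getElem,
      Option.some.injEq]

/-- From here on the rows of the entries are forgotten: membership in `T(λ)` consists of the shape
and of conditions on counting functions and signs. -/
theorem isTableau_iff (hn : 2 ≤ n) : IsTableau n m T ↔
    T.cols.map List.length = heights n m ∧ (T.half.isSome ↔ HasSpin n m) ∧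
      GoodTableau n (IsPlus n m) T := by
  constructor
  · intro h
    have hlen : ∀ C ∈ T.cols, C.length ≤ n := fun C hC =>
      (heights_mem hn (h.shape ▸ List.mem_map_of_mem hC)).2
    have hspin : T.half.isSome ↔ HasSpin n m := by
      by_cases hs : HasSpin n m
      · obtain ⟨C, hC, -⟩ := h.half_some hs; simp [hC, hs]
      · simp [h.half_none hs, hs]
    have hhl : ∀ H ∈ T.half, H.length = n := by
      intro H hH
      obtain ⟨C, hC, hl⟩ := h.half_some (hspin.1 (by rw [Option.mem_def.1 hH]; rfl))
      simp_all
    have hmem : ∀ C ∈ T.cols, C ∈ T.allCols := fun C hC => by simp [Tableau.allCols, hC]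
    have hmem' : ∀ H ∈ T.half, H ∈ T.allCols := fun H hH => by
      rw [Tableau.allCols, List.mem_append, Option.mem_toList]; exact Or.inr hH
    have hstrict : ∀ C ∈ T.allCols, StrictColumn n C := fun C hC => ⟨h.valid C hC, h.columns C hC⟩
    refine ⟨h.shape, hspin, fun C hC => ?_, fun H hH => ?_, h.sign, ?_⟩
    · exact ⟨h.valid C (hmem C hC), h.columns C (hmem C hC), hlen C hC,
        ((hstrict C (hmem C hC)).oneCC_iff (by omega) (hlen C hC)).1 (h.oneCC C (hmem C hC))⟩
    · exact HalfColumn.of_not_both (hstrict H (hmem' H hH)) (hhl H hH) hn (h.half_column H hH)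
    · rw [isChain_iff_getElem?]
      intro k a b ha hb
      rw [goodPair_iff (hstrict a (List.mem_of_getElem? ha)) (hstrict b (List.mem_of_getElem? hb))
        (allCols_length_le hn h.shape hhl ha hb) (by omega)]
      exact ⟨h.rows k a b ha hb, h.twoCC k a b ha hb⟩
  · rintro ⟨hs, hspin, h⟩
    have hhl : ∀ H ∈ T.half, H.length = n := fun H hH => (h.half H hH).length_eq
    have hgood : ∀ C ∈ T.allCols, GoodColumn n C := by
      intro C hC
      rw [Tableau.allCols, List.mem_append, Option.mem_toList] at hC
      rcases hC with hC | hC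
      · exact h.cols C hC
      · exact (h.half C hC).toGoodColumn
    have hpair : ∀ k C C', T.allCols[k]? = some C → T.allCols[k + 1]? = some C' →
        RowWeak n C C' ∧ TwoCC1 n C C' ∧ TwoCC2 C C' ∧ TwoCC3 n C C' := by
      intro k a b ha hb
      rw [← goodPair_iff (hgood a (List.mem_of_getElem? ha)).toStrict
        (hgood b (List.mem_of_getElem? hb)).toStrict
        (allCols_length_le hn hs hhl ha hb) (by omega)]
      exact isChain_iff_getElem?.1 h.chain k a b ha hb
    refine ⟨hs, fun h0 => ?_, fun h0 => ?_, fun C hC => (hgood C hC).valid,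
      fun k C C' h1 h2 => (hpair k C C' h1 h2).1, fun C hC => (hgood C hC).strict, h.sign,
      fun C hC => (h.half C hC).not_both hn, fun C hC => ?_,
      fun k C C' h1 h2 => (hpair k C C' h1 h2).2⟩
    · simp_all
    · grind [Option.isSome_iff_exists]
    · exact ((hgood C hC).toStrict.oneCC_iff (by omega) (hgood C hC).length_le).2 (hgood C hC).cc

theorem tableau_f_shape (hn : 2 ≤ n) (h1 : 1 ≤ i) (hi : i ≤ n)
    (h : (tableauCrystal n).f i T = some T') :
    T'.cols.map List.length = T.cols.map List.length ∧ (T'.half.isSome ↔ T.half.isSome) := by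
  grind [tableau_f_iff]

theorem IsTableau.f_stable (h : IsTableau n m T) (hn : 2 ≤ n) (h1 : 1 ≤ i) (hi : i ≤ n)
    (hf : (tableauCrystal n).f i T = some T') : IsTableau n m T' := by
  rw [isTableau_iff hn] at h ⊢
  obtain ⟨e1, e2⟩ := tableau_f_shape hn h1 hi hf
  exact ⟨e1.trans h.1, e2.trans h.2.1, h.2.2.f_stable hn h1 hi hf⟩

theorem IsTableau.e_stable (h : IsTableau n m T) (hn : 2 ≤ n) (h1 : 1 ≤ i) (hi : i ≤ n)
    (hf : (tableauCrystal n).e i T = some T') : IsTableau n m T' := by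
  rw [isTableau_iff hn] at h ⊢
  obtain ⟨e1, e2⟩ := tableau_f_shape hn h1 hi (h.2.2.f_e hn h1 hi hf)
  exact ⟨e1.symm.trans h.1, e2.symm.trans h.2.1, h.2.2.e_stable hn h1 hi hf⟩

theorem tableauRealization_isStable (hn : 2 ≤ n) :
    (tableauCrystal n).IsStable n (tableauRealization n m) := by
  rintro T hT i h1 hi T' (h | h)
  · exact IsTableau.e_stable hT hn h1 hi h
  · exact IsTableau.f_stable hT hn h1 hi h

/-! ### The highest weight tableau -/

open Classical in
/-- The column of height `h` of the highest weight tableau. -/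
noncomputable def highCol (n : ℕ) (s : Prop) (h : ℕ) : List Letter :=
  (List.range h).map fun a => if a = 0 ∧ h = n ∧ ¬ s then .bar n else .pos (h - a)

open Classical in
/-- The highest weight tableau. -/
noncomputable def highTableau (n : ℕ) (m : ℕ → ℕ) : Tableau where
  cols := (heights n m).map (highCol n (IsPlus n m))
  half := if HasSpin n m then some (highCol n (IsPlus n m) n) else none

variable {h : ℕ}

@[simp] theorem highCol_length : (highCol n s h).length = h := by simp [highCol]

theorem highCol_getElem? {p : ℕ} (hp : p < h) [Decidable (p = 0 ∧ h = n ∧ ¬ s)] :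
    (highCol n s h)[p]? = some (if p = 0 ∧ h = n ∧ ¬ s then Letter.bar n else .pos (h - p)) := by
  grind [highCol, List.getElem?_range]

theorem highCol_strict (hh : h ≤ n) : StrictColumn n (highCol n s h) := by
  classical
  constructor
  · grind [List.mem_iff_getElem?, List.getElem?_eq_some_iff, highCol_length, highCol_getElem?,
      Option.some.injEq, Letter.Valid]
  · intro p x y hx hy
    grind [List.getElem?_eq_some_iff, highCol_length, highCol_getElem?, Option.some.injEq,
        Letter.Lt, Letter.rank_pos, Letter.rank_bar]

theorem highCol_counts (hh : h ≤ n) {a : ℕ} (ha : a < n) :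
    lowCount (highCol n s h) a = min a h ∧ barCount (highCol n s h) a = 0 := by
  classical
  have hs := highCol_strict (s := s) hh
  constructor
  · have e : highCol n s h = (List.range h).map fun a =>
        if a = 0 ∧ h = n ∧ ¬ s then Letter.bar n else .pos (h - a) := by
      unfold highCol; congr
    have : lowCount (highCol n s h) a = (List.range h).countP fun p => decide (h - p ≤ a) := by
      rw [e, lowCount, List.countP_map]
      refine List.countP_congr fun p hp => ?_
      rw [List.mem_range] at hp
      simp only [Function.comp]
      split_ifs with h1
      · simp; omega
      · simp
    rw [this, List.countP_eq_length_filter]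
    have : (List.range h).filter (fun p => decide (h - p ≤ a)) =
        List.range' (h - a) (min a h) := by
      rw [List.range_eq_range']
      have : List.range' 0 h = List.range' 0 (h - a) ++ List.range' (h - a) (min a h) := by
        have := List.range'_append_1 (s := 0) (m := h - a) (n := min a h)
        rw [Nat.zero_add] at this
        rw [this]; congr 1; omega
      rw [this, List.filter_append, List.filter_eq_nil_iff.2, List.filter_eq_self.2, List.nil_append]
      · intro p hp; simp at hp ⊢; omega
      · intro p hp; simp at hp ⊢; omega
    rw [this]; simp
  grind [barCount_eq_zero, List.mem_iff_getElem?, List.getElem?_eq_some_iff, highCol_length,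
      highCol_getElem?]

theorem highCol_signOK (hh : h ≤ n) (hn : 1 ≤ n) : SignOK n s (highCol n s h) := by
  classical
  intro p
  grind [List.getElem?_eq_some_iff, highCol_length, highCol_getElem?]

theorem highCol_good (hh : h ≤ n) : GoodColumn n (highCol n s h) :=
  ⟨(highCol_strict hh).valid, (highCol_strict hh).strict, by simpa using hh, fun a ha => by
    grind [highCol_counts]⟩

theorem highCol_half : HalfColumn n (highCol n s n) :=
  ⟨highCol_good le_rfl, by simp, fun a ha => by grind [highCol_counts, le_rfl]⟩

theorem highCol_pair {h' : ℕ} (hh : h ≤ h') (hh' : h' ≤ n) (hn : 1 ≤ n) :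
    GoodPair n (highCol n s h) (highCol n s h') := by
  have e : ∀ a < n, lowCount (highCol n s h) a = min a h ∧ barCount (highCol n s h) a = 0 :=
    fun a ha => highCol_counts (by omega) ha
  have e' : ∀ a < n, lowCount (highCol n s h') a = min a h' ∧ barCount (highCol n s h') a = 0 :=
    fun a ha => highCol_counts hh' ha
  refine ⟨fun a b hab hb => ?_, fun a b hab hb => ?_, fun a ha => ?_,
    Or.inl ⟨s, highCol_signOK (by omega) hn, highCol_signOK hh' hn⟩⟩
  · have := e a (by omega); have := e b hb; have := e' a (by omega)
    omega
  · have := e a (by omega); have := e' b hb; have := e' a (by omega)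
    rw [highCol_length, highCol_length]
    omega
  grind [highCol_length]

theorem highTableau_isTableau (hn : 2 ≤ n) : IsTableau n m (highTableau n m) := by
  classical
  rw [isTableau_iff hn]
  have hall : (highTableau n m).allCols =
      (heights n m ++ if HasSpin n m then [n] else []).map (highCol n (IsPlus n m)) := by
    grind [Tableau.allCols, highTableau]
  have hle : ∀ h ∈ heights n m ++ (if HasSpin n m then [n] else []), h ≤ n := by
    intro h hh
    rw [List.mem_append] at hh
    rcases hh with hh | hh
    · exact (heights_mem hn hh).2
    simp_all
  refine ⟨?_, ?_, ?_, ?_, ?_, ?_⟩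
  · simp only [highTableau, List.map_map]
    conv_rhs => rw [← List.map_id (heights n m)]
    exact List.map_congr_left fun h _ => highCol_length
  · grind [highTableau]
  · grind [highTableau, highCol_good, heights_mem]
  · grind [highTableau, highCol_half]
  · grind [highCol_signOK]
  · rw [hall, List.isChain_map]
    have hp : (heights n m ++ (if HasSpin n m then [n] else [])).Pairwise (· ≤ ·) := by
      rw [List.pairwise_append]
      refine ⟨heights_pairwise n m, by split_ifs <;> simp, fun a ha b hb => ?_⟩
      split_ifs at hb <;> simp at hb
      subst hb; exact (heights_mem hn ha).2
    grind [heights, HasSpin, IsChain, isChain_iff_getElem?, highCol_pair, List.mem_of_getElem?]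

end

end

section

/-! ### Uniqueness of the highest weight tableau -/

section

variable {n i : ℕ} {s : Prop} {C : List Letter}

theorem StrictColumn.eps_low (h : StrictColumn n C) (h1 : 1 ≤ i) (hi : i + 1 < n)
    (he : wordEps (columnWord n i C) = 0) : (Letter.pos (i + 1) ∈ C → Letter.pos i ∈ C) ∧
      (Letter.bar i ∈ C → Letter.bar (i + 1) ∉ C → Letter.pos i ∈ C) := by
  rw [(h.columnWord_eps_phi (by omega) h1 (by omega)).1] at he
  grind [lowIdx, bitLow, bitBar, bitUp, upLetter_of_lt, bitDown, downLetter_of_lt, eps4,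
      List.count_pos_iff]

theorem StrictColumn.eps_high (h : StrictColumn n C) (hn : 2 ≤ n) (hi : n - 1 ≤ i) (hin : i ≤ n)
    (he : wordEps (columnWord n i C) = 0) : (bitUp n i C = 1 → Letter.pos (n - 1) ∈ C) ∧
      (Letter.bar (n - 1) ∈ C → bitDown n i C = 0 → Letter.pos (n - 1) ∈ C) := by
  rw [(h.columnWord_eps_phi (by omega) (by omega) (by omega)).1] at he
  grind [lowIdx, bitLow, bitBar, eps4, List.count_pos_iff]

/-- Passing between the colours `n - 1` and `n` exchanges `upLetter` and `downLetter`. Hence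
whatever the sign of the column is, one of the two colours shows the desired parity. -/
theorem StrictColumn.exists_bits (h : StrictColumn n C) (hn : 2 ≤ n) :
    (∃ i, n - 1 ≤ i ∧ i ≤ n ∧ bitDown n i C = 0) ∧
    (lowCount C (n - 1) + barCount C (n - 1) < C.length →
      ∃ i, n - 1 ≤ i ∧ i ≤ n ∧ bitUp n i C = 1) := by
  obtain ⟨s, hs⟩ := h.exists_signOK (by omega)
  have key : ∀ z < 2, ∃ i, n - 1 ≤ i ∧ i ≤ n ∧ SignBits C.length (lowCount C (n - 1))
      (barCount C (n - 1)) (bitUp n i C) (bitDown n i C) z := by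
    intro z hz
    -- A prescribed `z` together with the sign of the column selects the colour.
    by_cases hzs : (z = 0 ↔ s)
    · refine ⟨n - 1, le_rfl, by omega, h.signBits hn le_rfl (by omega) hz ?_⟩
      grind
    · refine ⟨n, by omega, le_rfl, h.signBits hn (by omega) le_rfl hz ?_⟩
      grind
  constructor
  · obtain ⟨i, hi, hi', hb⟩ := key (barCount C (n - 1) % 2) (by omega)
    grind [SignBits]
  · intro hM
    obtain ⟨i, hi, hi', hb⟩ := key ((C.length - lowCount C (n - 1) - 1) % 2) (by omega)
    grind [SignBits]

/-- With every unbarred letter, a column contains all smaller ones. -/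
def LowClosed (n : ℕ) (C : List Letter) : Prop :=
  ∀ i, 1 ≤ i → i + 1 < n → Letter.pos (i + 1) ∈ C → Letter.pos i ∈ C

theorem LowClosed.lowCount_of_mem (hc : LowClosed n C) (h : StrictColumn n C) {b : ℕ} (h1 : 1 ≤ b)
    (hb : b < n) (hm : Letter.pos b ∈ C) : lowCount C b = b := by
  induction b with
  | zero => omega
  | succ b ih =>
    rw [h.lowCount_step h1 hb, if_pos hm]
    rcases Nat.eq_zero_or_pos b with rfl | hb0
    · simp [h.lowCount_zero]
    · rw [Nat.add_sub_cancel, ih hb0 (by omega) (hc b hb0 hb hm)]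

theorem LowClosed.lowCount_eq (hc : LowClosed n C) (h : StrictColumn n C) {a : ℕ} (ha : a < n) :
    lowCount C a = a ∨ ∀ j, a ≤ j → j < n → lowCount C j = lowCount C a := by
  by_cases hm : ∃ j, a ≤ j ∧ 1 ≤ j ∧ j < n ∧ Letter.pos j ∈ C
  · obtain ⟨j, h1, h2, h3, h4⟩ := hm
    have e := hc.lowCount_of_mem h h2 h3 h4
    have := h.lowCount_lip h1 h3
    have := h.lowCount_lip (Nat.zero_le a) ha
    have := h.lowCount_zero
    left; omega
  · right
    intro j hj hjn
    induction j, hj using Nat.le_induction with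
    | base => rfl
    | succ j hj ih =>
      rw [h.lowCount_step (by omega) hjn, if_neg fun hm' => hm ⟨j + 1, by omega, by omega, hjn, hm'⟩,
        Nat.add_sub_cancel, ih (by omega), Nat.add_zero]

/-- Closedness under smaller letters and `hM` give `lowCount C a = min a C.length`. Since there are
no barred letters below `n`, this determines every row, except that in height `n` the sign decides
between `n` and `n̄` in the bottom row. -/
theorem GoodColumn.eq_highCol (h : GoodColumn n C) (hn : 2 ≤ n) (hc : LowClosed n C)
    (hb : barCount C (n - 1) = 0) (hs : C.length = n → SignOK n s C)
    (hM : C.length ≤ lowCount C (n - 1) ∨ Letter.pos (n - 1) ∈ C) :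
    C = highCol n s C.length := by
  classical
  have hst := h.toStrict
  have hlow : ∀ a < n, lowCount C a = min a C.length := by
    intro a ha
    have h1 := lowCount_le_length C a
    have h2 := hst.lowCount_lip (Nat.zero_le a) ha
    have h3 := hst.lowCount_zero
    rcases hM with hM | hM
    · rcases hc.lowCount_eq hst ha with e | e
      · omega
      · have := e (n - 1) (by omega) (by omega); omega
    · have e := hc.lowCount_of_mem hst (by omega) (by omega) hM
      have := hst.lowCount_lip (show a ≤ n - 1 by omega) (by omega)
      omega
  refine List.ext_getElem? fun p => ?_
  by_cases hp : p < C.length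
  · rw [highCol_getElem? hp]
    have hl := h.length_le
    by_cases hpn : C.length - p < n
    · obtain ⟨j, hj, e⟩ := hst.exists_pos hpn hp (by rw [hlow _ hpn]; omega)
      rw [e, if_neg (by omega)]
      have h1 := hst.getElem?_pos (by omega) e
      rw [hlow j (by omega)] at h1
      congr 2; omega
    · obtain rfl : p = 0 := by omega
      have hL : C.length = n := by omega
      have h1 := hs hL 0
      have h0 := hlow (n - 1) (by omega)
      rcases hst.exists_index_n (p := 0) (by omega) (by omega) with e | e
      · rw [e, if_neg]
        · simp [hL]
        · simpa using fun _ => h1.1 e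
      · rw [e, if_pos]
        simpa [hL] using h1.2 e
  simp_all

/-- The only column of highest weight. -/
theorem GoodColumn.eq_highCol_of_eps (h : GoodColumn n C) (hn : 2 ≤ n)
    (hs : C.length = n → SignOK n s C)
    (he : ∀ i, 1 ≤ i → i ≤ n → wordEps (columnWord n i C) = 0) : C = highCol n s C.length := by
  have hst := h.toStrict
  have hc : LowClosed n C := fun i h1 h2 =>
    (hst.eps_low h1 h2 (he i h1 (by omega))).1
  -- If `b` occurs, all `b` letters up to `b` occur by closedness, and (1CC) leaves no room for
  -- `b̄`.
  have hno : ∀ b, 1 ≤ b → b < n → Letter.pos b ∈ C → Letter.bar b ∉ C := by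
    intro b h1 h2 h3 h4
    have e1 := hc.lowCount_of_mem hst h1 h2 h3
    have e2 := h.cc b h2
    rw [hst.barCount_step h1 h2, if_pos h4] at e2
    omega
  -- Descending induction on `b`. If no barred letter with a larger index below `n` occurs, only `b`
  -- itself can cancel the `-` of `b̄`, against `hno`. For `b = n - 1` a colour with `bitDown = 0`
  -- is used.
  have hbar : ∀ k b, n - b ≤ k → 1 ≤ b → b < n → Letter.bar b ∉ C := by
    intro k
    induction k with
    | zero => omega
    | succ k ih =>
      intro b hk h1 h2 h4
      by_cases hb : b + 1 < n
      · exact hno b h1 h2 ((hst.eps_low h1 hb (he b h1 (by omega))).2 h4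
          (ih (b + 1) (by omega) (by omega) hb)) h4
      · obtain ⟨i, hi, hi', hd⟩ := (hst.exists_bits hn).1
        obtain rfl : b = n - 1 := by omega
        exact hno _ h1 h2 ((hst.eps_high hn hi hi' (he i (by omega) hi')).2 h4 hd) h4
  have hb : barCount C (n - 1) = 0 := barCount_eq_zero fun j hj => by
    by_contra hlt
    exact hbar n j (by omega) (hst.valid _ hj).1 (by omega) hj
  refine h.eq_highCol hn hc hb hs ?_
  by_cases hM : lowCount C (n - 1) + barCount C (n - 1) < C.length
  · obtain ⟨i, hi, hi', hu⟩ := (hst.exists_bits hn).2 hM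
    exact Or.inr ((hst.eps_high hn hi hi' (he i (by omega) hi')).1 hu)
  · left; omega

/-- In a half-column `ẽ_i = 0` means that `upLetter` forces `j`. Starting with the colour for which
the letter of rank `n` is `upLetter`, this yields `n - 1`, and then all smaller letters. -/
theorem HalfColumn.eq_highCol_of_spinE (h : HalfColumn n C) (hn : 2 ≤ n) (hs : SignOK n s C)
    (he : ∀ i, 1 ≤ i → i ≤ n → spinE n i C = none) : C = highCol n s n := by
  have hst := h.toStrict
  have hx : ∀ i, 1 ≤ i → i ≤ n → bitUp n i C = 1 → bitLow n i C = 1 := by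
    intro i h1 hi hu
    by_contra hl
    have hb := h.bits hn h1 hi
    have hm := h.bit_mem hn h1 hi
    have := (h.spinE_isSome hn h1 hi).2 ⟨hm.2.2.1.1 hu, hm.2.1.1 (by omega)⟩
    simp_all
  have hc : LowClosed n C := by
    intro i h1 hi hm
    have e : lowIdx n i = i := by unfold lowIdx; rw [if_pos (by omega)]
    have hmm := h.bit_mem hn h1 (show i ≤ n by omega)
    grind [upLetter_of_lt]
  have hcov := h.cover (n - 1) (by omega)
  have hl := h.length_eq
  obtain ⟨i, hi, hi', hu⟩ := (hst.exists_bits hn).2 (by omega)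
  have hm := (h.bit_mem hn (show 1 ≤ i by omega) hi').1.1 (hx i (by omega) hi' hu)
  have e : lowIdx n i = n - 1 := by grind [lowIdx]
  rw [e] at hm
  have e1 := hc.lowCount_of_mem hst (by omega) (by omega) hm
  have := h.toGoodColumn.eq_highCol hn hc (by omega) (fun _ => hs) (Or.inr hm)
  rwa [hl] at this

/-- The colours for which the columns of height at least `h` of the highest weight tableau do not
contribute a `+`. -/
def Blocked (n : ℕ) (s : Prop) (h i : ℕ) : Prop :=
  (1 ≤ i ∧ i + 1 < n ∧ i < h) ∨ (h = n ∧ n - 1 ≤ i ∧ i ≤ n ∧ (i < n ↔ s))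

/-- For a blocked colour the highest weight column contains `j` and shows `upLetter`, but no barred
partner: its word has the shape `+ -` and cancels completely. -/
theorem Blocked.bits {h h' : ℕ} (hb : Blocked n s h i) (hh : h ≤ h') (hh' : h' ≤ n) (hn : 2 ≤ n) :
    bitLow n i (highCol n s h') = 1 ∧ bitUp n i (highCol n s h') = 1 ∧
      bitDown n i (highCol n s h') = 0 ∧ bitBar n i (highCol n s h') = 0 := by
  have hst := highCol_strict (s := s) hh'
  have e : ∀ a < n, lowCount (highCol n s h') a = min a h' ∧ barCount (highCol n s h') a = 0 :=
    fun a ha => highCol_counts hh' ha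
  rcases hb with ⟨h1, h2, h3⟩ | ⟨h1, h2, h3, h4⟩
  · have el : lowIdx n i = i := by unfold lowIdx; rw [if_pos (by omega)]
    have hx := hst.increments hn h1 (show i ≤ n by omega)
    obtain ⟨_, _, _, _, x1, x2, x3, x4⟩ := hx
    grind [extLow, extBar]
  · have el : lowIdx n i = n - 1 := by unfold lowIdx; split_ifs <;> omega
    have hx := hst.increments hn (show 1 ≤ i by omega) h3
    obtain ⟨_, _, _, _, x1, _, _, x4⟩ := hx
    rw [el] at x1 x4
    simp only [extLow, extBar, if_pos (show n - 1 < n by omega),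
      if_pos (show n - 1 - 1 < n by omega)] at x1 x4
    have hb := hst.signBits hn h2 h3 (z := 0) (by omega)
      (by rw [show ((0 : ℕ) = 0 ↔ i < n) = s by simp [h4]]; exact highCol_signOK hh' (by omega))
    grind [highCol_length, SignBits]

theorem Blocked.index {h : ℕ} (hb : Blocked n s h i) (hn : 2 ≤ n) : 1 ≤ i ∧ i ≤ n := by
  rcases hb with ⟨h1, h2, h3⟩ | ⟨h1, h2, h3, h4⟩ <;> omega

theorem wordPhi_append_eq_zero {u v : List Sign} (hu : wordPhi u = 0) (hv : wordPhi v = 0) :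
    wordPhi (u ++ v) = 0 := by rw [wordPhi_append]; omega

/-- Purpose: the columns further right offer no `+` of a blocked colour, so the next column to the
left must itself have `ε_i = 0` for such a colour. -/
theorem Blocked.wordPhi {h : ℕ} (hb : Blocked n s h i) (hn : 2 ≤ n) {hs : List ℕ}
    (hle : ∀ h' ∈ hs, h ≤ h' ∧ h' ≤ n) (hh : h ≤ n) {H : Option (List Letter)}
    (hH : ∀ C ∈ H, C = highCol n s n) :
    wordPhi (halfWord n i H ++ colsWord n i (hs.map (highCol n s))) = 0 := by
  have hi := hb.index hn
  refine wordPhi_append_eq_zero ?_ ?_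
  · cases H with
    | none => rfl
    | some C =>
      rw [hH C rfl]
      have hx := hb.bits hh le_rfl hn
      have hc := highCol_half (n := n) (s := s)
      rw [show halfWord n i (some (highCol n s n)) = spinWord n i (highCol n s n) by
        simp [halfWord], wordPhi_spinWord, if_neg]
      intro hsome
      have := ((hc.bit_mem hn hi.1 hi.2).2.2.2).2 ((hc.spinF_isSome hn hi.1 hi.2).1 hsome).2
      omega
  · induction hs with
    | nil => rfl
    | cons h' hs ih =>
      rw [List.map_cons, colsWord_cons]
      refine wordPhi_append_eq_zero (ih fun x hx => hle x (by simp [hx])) ?_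
      have hx := hb.bits (hle h' (by simp)).1 (hle h' (by simp)).2 hn
      rw [((highCol_strict (hle h' (by simp)).2).columnWord_eps_phi hn hi.1 hi.2).2, hx.1, hx.2.1,
        hx.2.2.1, hx.2.2.2]
      rfl

/-- A column of highest weight relative to the column of the highest weight tableau on its right. -/
theorem GoodColumn.eq_highCol_of_pair {h : ℕ} (hC : GoodColumn n C) (hn : 2 ≤ n)
    (hs : C.length = n → SignOK n s C) (hl : C.length ≤ h) (hh : h ≤ n)
    (hp : GoodPair n C (highCol n s h))
    (he : ∀ i, Blocked n s h i → wordEps (columnWord n i C) = 0) : C = highCol n s C.length := by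
  have hst := hC.toStrict
  have e : ∀ a < n, lowCount (highCol n s h) a = min a h ∧ barCount (highCol n s h) a = 0 :=
    fun a ha => highCol_counts hh ha
  by_cases hhn : h = n
  · subst hhn
    have hb : barCount C (h - 1) = 0 := by
      have := hp.left (h - 1) (h - 1) le_rfl (by omega)
      grind
    have hr := hp.right (h - 1) (h - 1) le_rfl (by omega)
    rw [highCol_length] at hr
    have e1 := e (h - 1) (by omega)
    have hc : LowClosed h C := fun i h1 h2 =>
      (hst.eps_low h1 h2 (he i (Or.inl ⟨h1, h2, by omega⟩))).1
    refine hC.eq_highCol hn hc hb hs ?_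
    by_cases hM : lowCount C (h - 1) < C.length
    · right
      -- A column shorter than `n` has no prescribed sign; it inherits the sign of its neighbour
      -- because the strict alternative of `sign` fails at `n - 1`.
      have hsC : SignOK h s C := by
        rcases hp.sign with ⟨t, ht1, ht2⟩ | hlt
        · have := (highCol_strict (s := s) le_rfl).signOK_unique ht2
            (highCol_signOK le_rfl (by omega)) (by rw [highCol_length]; omega)
          rwa [← propext this]
        · have := hlt (h - 1) (by omega); omega
      -- The blocked one of the two highest colours. The only letter of rank `n` of `C` stands in
      -- the bottom row, and for this colour it is `upLetter`.
      obtain ⟨i, hi, hi', his⟩ : ∃ i, h - 1 ≤ i ∧ i ≤ h ∧ (i < h ↔ s) := by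
        by_cases s
        · exact ⟨h - 1, le_rfl, by omega, by simp [*]; omega⟩
        · exact ⟨h, by omega, le_rfl, by simp [*]⟩
      have hb' := hst.signBits hn hi hi' (z := 0) (by omega)
        (by rw [show ((0 : ℕ) = 0 ↔ i < h) = s by simp [his]]; exact hsC)
      refine (hst.eps_high hn hi hi' (he i (Or.inr ⟨rfl, hi, hi', his⟩))).1 ?_
      grind [SignBits]
    · left; omega
  -- For `h < n` this inequality at `a = b = h` says that all entries of `C` are unbarred and at
  -- most `h`.
  · have hr := hp.right h h le_rfl (by omega)
    rw [highCol_length] at hr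
    have e1 := e h (by omega)
    have h2 := lowCount_mono C (show h ≤ n - 1 by omega)
    have h3 := lowCount_add_barCount_le C (n - 1)
    refine hC.eq_highCol hn (fun i hi1 hi2 hm => ?_) (by omega) hs (Or.inl (by omega))
    by_cases hih : i < h
    · exact (hst.eps_low hi1 hi2 (he i (Or.inl ⟨hi1, hi2, hih⟩))).1 hm
    · exfalso
      have h4 := hst.lowCount_step (a := i + 1) (by omega) hi2
      rw [if_pos hm, Nat.add_sub_cancel] at h4
      have h5 := lowCount_mono C (show h ≤ i by omega)
      grind [lowCount_le_length]

theorem wordEps_eq_zero_of_append {u v : List Sign} (h : wordEps (u ++ v) = 0) :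
    wordEps u = 0 ∧ (wordPhi u = 0 → wordEps v = 0) := by
  rw [wordEps_append] at h
  omega

/-- A tableau of highest weight is determined by its shape. -/
theorem GoodTableau.eq_highCol (hn : 2 ≤ n) {H : Option (List Letter)} {L : List (List Letter)}
    (h : GoodTableau n s ⟨L, H⟩) (hl : (L.map List.length).Pairwise (· ≤ ·))
    (he : ∀ i, 1 ≤ i → i ≤ n → wordEps (halfWord n i H ++ colsWord n i L) = 0) :
    (∀ C ∈ H, C = highCol n s n) ∧ L = (L.map List.length).map (highCol n s) := by
  induction L with
  | nil =>
    refine ⟨fun C hC => ?_, rfl⟩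
    have hC' := h.half C hC
    refine hC'.eq_highCol_of_spinE hn (h.sign C (by simpa [Tableau.allCols] using hC)
      hC'.length_eq) fun i h1 hi => ?_
    have := (wordEps_eq_zero_of_append (he i h1 hi)).1
    cases hC
    cases hE : spinE n i C with
    | none => rfl
    | some D =>
      exfalso
      simp [halfWord, spinWord, hE] at this
  | cons C L ih =>
    have hall : (⟨C :: L, H⟩ : Tableau).allCols = C :: (⟨L, H⟩ : Tableau).allCols := rfl
    have hch := h.chain
    rw [hall, List.isChain_cons] at hch
    have hg : GoodTableau n s ⟨L, H⟩ := ⟨fun D hD => h.cols D (by simp [hD]), h.half,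
      fun D hD => h.sign D (by rw [hall]; simp [hD]), hch.2⟩
    rw [List.map_cons, List.pairwise_cons] at hl
    simp only [colsWord_cons, ← List.append_assoc] at he
    obtain ⟨ih1, ih2⟩ := ih hg hl.2 fun i h1 hi => (wordEps_eq_zero_of_append (he i h1 hi)).1
    refine ⟨ih1, ?_⟩
    rw [List.map_cons, List.map_cons, ← ih2]
    congr 1
    have hC := h.cols C (by simp)
    have hsC := h.sign C (by simp [Tableau.allCols])
    have hword : ∀ k ≤ n, (∀ h' ∈ L.map List.length, k ≤ h') → ∀ i, Blocked n s k i →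
        wordEps (columnWord n i C) = 0 := by
      intro k hk hL i hb
      refine (wordEps_eq_zero_of_append
        (he i (hb.index hn).1 (hb.index hn).2)).2 ?_
      rw [ih2]
      refine hb.wordPhi hn (fun h' hh => ⟨hL h' hh, ?_⟩) hk ih1
      obtain ⟨D, hD, rfl⟩ := List.mem_map.1 hh
      exact (h.cols D (by simp [hD])).length_le
    cases L with
    | nil =>
      cases H with
      | none =>
        refine hC.eq_highCol_of_eps hn hsC fun i h1 hi => ?_
        exact he i h1 hi
      | some D =>
        have hp := hch.1 D (by simp [Tableau.allCols])
        rw [ih1 D rfl] at hp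
        exact hC.eq_highCol_of_pair hn hsC hC.length_le le_rfl hp
          (hword n le_rfl (by simp))
    | cons D L =>
      have hp := hch.1 D (by simp [Tableau.allCols])
      have hD : D = highCol n s D.length := by
        simp only [List.map_cons, List.cons.injEq] at ih2; exact ih2.1
      have hDl := (h.cols D (by simp)).length_le
      rw [hD] at hp
      refine hC.eq_highCol_of_pair hn hsC (hl.1 _ (by simp)) hDl hp (hword _ hDl ?_)
      grind [le_rfl, List.pairwise_cons]

end

section

variable {n i : ℕ} {m : ℕ → ℕ} {T T' : Tableau}

theorem IsTableau.eq_highTableau (hn : 2 ≤ n) (h : IsTableau n m T)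
    (he : ∀ i, 1 ≤ i → i ≤ n → wordEps (tableauWord n i T) = 0) : T = highTableau n m := by
  classical
  rw [isTableau_iff hn] at h
  obtain ⟨h1, h2, h3⟩ := h
  obtain ⟨L, H⟩ := T
  simp only at h1 h2
  obtain ⟨e1, e2⟩ := GoodTableau.eq_highCol hn h3 (h1 ▸ heights_pairwise n m) he
  rw [h1] at e2
  unfold highTableau
  rw [e2]
  congr 1
  cases H with
  | none => simp_all
  | some C => simp_all

/-- The sum of the ranks of all entries. -/
def rankSum (n : ℕ) (T : Tableau) : ℕ := (T.allCols.flatten.map (Letter.rank n)).sum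

theorem letter_e_rank (hn : 2 ≤ n) (h1 : 1 ≤ i) (hi : i ≤ n) {x y : Letter}
    (h : x.e n i = some y) : y.rank n < x.rank n := by
  grind [letter_e_eq_some, upLetter, downLetter, lowIdx, Letter.rank_pos, Letter.rank_bar]

theorem IsTableau.rankSum_lt (hn : 2 ≤ n) (hT : IsTableau n m T) (h1 : 1 ≤ i) (hi : i ≤ n)
    (he : (tableauCrystal n).e i T = some T') : rankSum n T' < rankSum n T := by
  have hg := ((isTableau_iff hn).1 hT).2.2
  rcases (tableau_e_iff hn h1 hi fun H hH => (hg.half H hH).not_both_spin hn h1 hi).1 he with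
    ⟨H, H', hH, hs, rfl, -⟩ | ⟨l, lo, x, hi', r, y, e, hxy, rfl, -⟩
  · have hh := hg.half H hH
    obtain ⟨lo, mid, hi', rfl⟩ := hh.exists_split_up hn h1 hi (by rw [hs]; rfl)
    rw [HalfColumn.spinE_eq hn h1 hi hh] at hs
    cases hs
    have r1 := letter_e_rank hn h1 hi ((letter_e_eq_some hn h1 hi).2 (Or.inl ⟨rfl, rfl⟩))
    have r2 := letter_e_rank hn h1 hi ((letter_e_eq_some hn h1 hi).2 (Or.inr ⟨rfl, rfl⟩))
    grind [rankSum, Tableau.allCols, Option.toList_some, List.flatten_append, List.flatten_cons,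
        List.flatten_nil]
  · have r1 := letter_e_rank hn h1 hi hxy
    simp only [rankSum, Tableau.allCols, e, List.flatten_append,
      List.flatten_cons, List.map_append, List.map_cons, List.sum_append, List.sum_cons]
    omega

/-- Every tableau is obtained from the highest weight tableau by the operators `f̃_i`. -/
theorem IsTableau.reachable (hn : 2 ≤ n) (hT : IsTableau n m T) :
    Relation.ReflTransGen (fun T₁ T₂ => IsTableau n m T₁ ∧ ∃ i, 1 ≤ i ∧ i ≤ n ∧
      (tableauCrystal n).f i T₁ = some T₂) (highTableau n m) T := by
  induction hk : rankSum n T using Nat.strong_induction_on generalizing T with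
  | _ k ih =>
    by_cases he : ∀ i, 1 ≤ i → i ≤ n → wordEps (tableauWord n i T) = 0
    · rw [hT.eq_highTableau hn he]
    · push Not at he
      obtain ⟨i, h1, hi, hne⟩ := he
      have hs : (rightmostMinus (tableauSigns n i T)).isSome := by
        rw [rightmostMinus_isSome, tableauSigns_map_fst]; exact hne
      obtain ⟨x, hx⟩ := Option.isSome_iff_exists.1 hs
      have hE : (tableauCrystal n).e i T =
          some (applyAt (Letter.e n i) (spinE n i) T x) := by
        simp [tableauCrystal, hx]
      have hT' := hT.e_stable hn h1 hi hE
      have hlt := hT.rankSum_lt hn h1 hi hE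
      have hF := ((isTableau_iff hn).1 hT).2.2.f_e hn h1 hi hE
      grind

end

end

section

/-! ### Adjacent columns of proper Young walls -/

/-- The column `c` may stand immediately to the left of the column `d` in a proper Young wall. -/
def Adj (c d : Column) : Prop :=
  c.full < d.full ∨ (c.full = d.full ∧ d.half ≠ none ∧ (c.half = none ∨ c.half = d.half))

theorem Column.Has.of_adj {c d : Column} (h : Adj c d) {r : ℕ} {s : Side} (hr : c.Has r s) :
    d.Has r s := by
  rcases h with h | ⟨h1, h2, h3⟩
  · rcases hr with hr | ⟨hr, -⟩
    · exact Or.inl (by omega)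
    · exact Or.inl (by omega)
  · rcases hr with hr | ⟨hr, hs⟩
    · exact Or.inl (by omega)
    · refine Or.inr ⟨by omega, ?_⟩
      simp_all

/-- All global conditions reduce to neighbours: heights weakly decrease to the left, strictly so on
the left of a full column, hence full columns have distinct heights. The ground row is inherited
from the ground columns far on the left. -/
theorem isProper_iff {n : ℕ} {L : Level1} {Y : Wall} : IsProper n L Y ↔
    (∀ k s, (Y k).half = some s → IsHalfRow n L (Y k).full) ∧ (∃ N, ∀ k, N ≤ k → Y k = ground) ∧
      ∀ k, Adj (Y (k + 1)) (Y k) := by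
  constructor
  · intro h
    refine ⟨h.pattern, h.finite, fun k => ?_⟩
    have hle : (Y (k + 1)).full ≤ (Y k).full := by
      by_contra hlt
      have h1 := h.no_free_space k (Y k).full .front (Or.inl (by omega))
      have h2 := h.no_free_space k (Y k).full .back (Or.inl (by omega))
      rcases h1 with h1 | ⟨-, h1⟩ <;> rcases h2 with h2 | ⟨-, h2⟩
      · omega
      · omega
      · omega
      simp_all
    rcases hle.lt_or_eq with hlt | heq
    · exact Or.inl hlt
    · refine Or.inr ⟨heq, fun hd => ?_, ?_⟩
      · cases hc : (Y (k + 1)).half with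
        | none => exact absurd (h.proper _ _ hc hd heq) (by omega)
        | some s =>
          rcases h.no_free_space k _ s (Or.inr ⟨rfl, hc⟩) with h1 | ⟨-, h1⟩
          · omega
          simp_all
      · cases hc : (Y (k + 1)).half with
        | none => exact Or.inl rfl
        | some s =>
          rcases h.no_free_space k _ s (Or.inr ⟨rfl, hc⟩) with h1 | ⟨-, h1⟩
          · omega
          · exact Or.inr h1.symm
  · rintro ⟨h1, ⟨N, h2⟩, h3⟩
    have hle : ∀ k l, k ≤ l → (Y l).full ≤ (Y k).full := by
      intro k l hkl
      induction l, hkl using Nat.le_induction with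
      | base => exact le_rfl
      | succ l _ ih => exact le_trans (by rcases h3 l with h | ⟨h, -⟩ <;> omega) ih
    have hlt : ∀ k l, k < l → (Y k).half = none → (Y l).full < (Y k).full := by
      intro k l hkl hk
      refine lt_of_le_of_lt (hle (k + 1) l hkl) ?_
      rcases h3 k with h | ⟨-, h, -⟩
      · exact h
      · exact absurd hk h
    refine ⟨⟨h1, fun k => ?_, fun k r s hr => hr.of_adj (h3 k), ⟨N, h2⟩⟩, fun k l hk hl hkl => ?_⟩
    · by_cases hk : N ≤ k
      · rw [h2 k hk]; exact Or.inr ⟨rfl, rfl⟩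
      · have hind : ∀ j, j ≤ N → (Y (N - j)).Has 0 .front := by
          intro j
          induction j with
          | zero => intro _; rw [Nat.sub_zero, h2 N le_rfl]; exact Or.inr ⟨rfl, rfl⟩
          | succ j ih =>
            intro hj
            have := ih (by omega)
            rw [show N - j = N - (j + 1) + 1 by omega] at this
            exact this.of_adj (h3 _)
        have := hind (N - k) (by omega)
        rwa [show N - (N - k) = k by omega] at this
    · rcases lt_trichotomy k l with h | h | h
      · have := hlt k l h hk; omega
      · exact h
      grind

@[simp] theorem setColumn_self (Y : Wall) (k : ℕ) (c : Column) : setColumn Y k c k = c := by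
  simp [setColumn]

theorem setColumn_of_ne (Y : Wall) {k l : ℕ} (c : Column) (h : l ≠ k) :
    setColumn Y k c l = Y l := by
  simp [setColumn, h]

/-- The column `c` fits in position `k` of the wall `Y`. -/
def Fits (Y : Wall) (k : ℕ) (c : Column) : Prop :=
  Adj (Y (k + 1)) c ∧ ∀ j, k = j + 1 → Adj c (Y j)

theorem isProper_setColumn {n : ℕ} {L : Level1} {Y : Wall} (h : IsProper n L Y) {k : ℕ} {c : Column}
    (hc : ∀ s, c.half = some s → IsHalfRow n L c.full) :
    IsProper n L (setColumn Y k c) ↔ Fits Y k c := by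
  have h0 := isProper_iff.1 h
  rw [isProper_iff]
  constructor
  · rintro ⟨-, -, h3⟩
    constructor
    · have := h3 k
      grind [setColumn_self, setColumn_of_ne]
    · rintro j rfl
      have := h3 j
      grind [setColumn_self, setColumn_of_ne]
  · rintro ⟨h1, h2⟩
    refine ⟨fun l s hs => ?_, ?_, fun l => ?_⟩
    · by_cases hl : l = k
      · subst hl; rw [setColumn_self] at hs ⊢; exact hc s hs
      · rw [setColumn_of_ne _ _ hl] at hs ⊢; exact h0.1 l s hs
    · obtain ⟨N, hN⟩ := h0.2.1
      refine ⟨max N (k + 1), fun l hl => ?_⟩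
      rw [setColumn_of_ne _ _ (by omega), hN l (by omega)]
    grind [setColumn_self, setColumn_of_ne]

/-! ### Columns representing letters -/

section

variable {n : ℕ} {L : Level1} {k r R i : ℕ} {x y : Letter}

theorem phase_add (n : ℕ) (L : Level1) (r d : ℕ) :
    phase n L (r + d) = (phase n L r + d) % (2 * n - 4) := by
  cases L <;> simp only [phase, Nat.mod_add_mod] <;> congr 1 <;> omega

theorem phase_lt (hn : 4 ≤ n) : phase n L r < 2 * n - 4 := by
  cases L <;> exact Nat.mod_lt _ (by omega)

/-- The row of the top block of the column representing a letter, counted from the row of the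
letter `1`. -/
def Letter.row (n : ℕ) : Letter → ℕ
  | .pos a => if a = n then n - 2 else a - 1
  | .bar a => if a = 1 then 2 * n - 4 else 2 * n - 2 - a

/-- The colour of the half-thickness block on top of the column representing a letter. -/
def Letter.top (n : ℕ) : Letter → Option ℕ
  | .pos a => if a = n then some (n - 1) else if a = 1 then some 0 else none
  | .bar a => if a = n then some n else if a = 1 then some 1 else none

/-- The side of the block of colour `c` in row `r`. -/
def sideOf (n : ℕ) (L : Level1) (k r c : ℕ) : Side :=
  if color n L k r .front = c then .front else .back

/-- The column representing a letter; `R` is the row of the blocks `n-1` and `n`. -/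
def colOf (n : ℕ) (L : Level1) (k R : ℕ) (x : Letter) : Column :=
  ⟨R + x.row n - (n - 2), (x.top n).map (sideOf n L k (R + x.row n - (n - 2)))⟩

theorem phase_row (hn : 4 ≤ n) (hR : phase n L R = n - 2) {q : ℕ} (hq : n - 2 ≤ R + q) :
    phase n L (R + q - (n - 2)) = q % (2 * n - 4) := by
  have h1 := phase_add n L (R + q - (n - 2)) (n - 2)
  rw [show R + q - (n - 2) + (n - 2) = R + q by omega, phase_add, hR] at h1
  have h2 := phase_lt (L := L) (r := R + q - (n - 2)) hn
  have h3 : (phase n L (R + q - (n - 2))) ≡ q [MOD 2 * n - 4] := by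
    refine Nat.ModEq.add_right_cancel' (n - 2) ?_
    rw [Nat.ModEq, ← h1, add_comm]
  rw [← h3, Nat.mod_eq_of_lt h2]

theorem color_unit (hn : 4 ≤ n) {q : ℕ} (h : phase n L r = q) (h0 : 0 < q) (h1 : q ≠ n - 2)
    (s : Side) : color n L k r s = if q < n - 2 then q + 1 else 2 * n - 3 - q := by grind [color]

/-- One side `s` describes columns `k` and `k + 1` simultaneously, because the front colours
alternate. All comparisons of half-thickness blocks of neighbouring columns rest on this and on
`color_mid`. -/
theorem color_zero (hn : 4 ≤ n) (h : phase n L r = 0) (k : ℕ) : ∃ s : Side,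
    (∀ t, color n L k r t = if t = s then 1 else 0) ∧
      ∀ t, color n L (k + 1) r t = if t = s then 0 else 1 := by
  unfold color
  simp only [h, if_true]
  have hk : (k + 1) % 2 = 0 ↔ ¬ k % 2 = 0 := by omega
  simp only [hk]
  by_cases h1 : k % 2 = 0 <;> by_cases h2 : L = .L1
  · exact ⟨.back, by rintro (_ | _) <;> simp [h1, h2], by rintro (_ | _) <;> simp [h1, h2]⟩
  · exact ⟨.front, by simp_all, by simp_all⟩
  · exact ⟨.front, by simp_all, by simp_all⟩
  · exact ⟨.back, by rintro (_ | _) <;> simp [h1, h2], by rintro (_ | _) <;> simp [h1, h2]⟩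

theorem color_mid (hn : 4 ≤ n) (h : phase n L r = n - 2) (k : ℕ) : ∃ s : Side,
    (∀ t, color n L k r t = if t = s then n - 1 else n) ∧
      ∀ t, color n L (k + 1) r t = if t = s then n else n - 1 := by
  unfold color
  simp only [h, if_true, if_neg (show ¬ n - 2 = 0 by omega)]
  have hk : (k + 1) % 2 = 0 ↔ ¬ k % 2 = 0 := by omega
  simp only [hk]
  by_cases h1 : k % 2 = 0 <;> by_cases h2 : L = .Lpred
  · exact ⟨.back, by rintro (_ | _) <;> simp [h1, h2], by rintro (_ | _) <;> simp [h1, h2]⟩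
  · exact ⟨.front, by simp_all, by simp_all⟩
  · exact ⟨.front, by simp_all, by simp_all⟩
  · exact ⟨.back, by rintro (_ | _) <;> simp [h1, h2], by rintro (_ | _) <;> simp [h1, h2]⟩

/-- The letter can stand on a column with middle row `R`. -/
def Letter.Above0 (n R : ℕ) (x : Letter) : Prop := n - 2 ≤ R ∨ n ≤ x.rank n

/-- The letters, arranged according to the top of the columns representing them. -/
theorem Letter.Valid.cases (hn : 4 ≤ n) (hx : x.Valid n) {P : Letter → Prop}
    (h1 : P (.pos 1)) (h2 : ∀ a, 2 ≤ a → a ≤ n - 2 → P (.pos a)) (h3 : P (.pos (n - 1)))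
    (h4 : P (.pos n)) (h5 : P (.bar n)) (h6 : ∀ a, 3 ≤ a → a ≤ n - 1 → P (.bar a))
    (h7 : P (.bar 2)) (h8 : P (.bar 1)) : P x := by
  cases x with
  | pos a =>
    obtain ⟨ha, ha'⟩ := hx
    grind
  | bar a =>
    obtain ⟨ha, ha'⟩ := hx
    grind

end

end

/-! ### Adding and removing blocks on columns representing letters -/

section

section

variable {n : ℕ} {L : Level1} {k r R i : ℕ} {x y : Letter}

@[simp] theorem Side.opp_opp (s : Side) : s.opp.opp = s := by cases s <;> rfl

theorem Side.opp_ne (s : Side) : s.opp ≠ s := by cases s <;> simp [Side.opp]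

theorem sides_zero (hn : 4 ≤ n) (h : phase n L r = 0) (k : ℕ) : ∃ s : Side,
    color n L k r s = 1 ∧ color n L k r s.opp = 0 ∧ sideOf n L k r 1 = s ∧
      sideOf n L k r 0 = s.opp ∧ sideOf n L (k + 1) r 1 = s.opp ∧ sideOf n L (k + 1) r 0 = s := by
  obtain ⟨s, h1, h2⟩ := color_zero hn h k
  refine ⟨s, ?_⟩
  unfold sideOf
  cases s <;> simp [h1, h2, Side.opp]

theorem sides_mid (hn : 4 ≤ n) (h : phase n L r = n - 2) (k : ℕ) : ∃ s : Side,
    color n L k r s = n - 1 ∧ color n L k r s.opp = n ∧ sideOf n L k r (n - 1) = s ∧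
      sideOf n L k r n = s.opp ∧ sideOf n L (k + 1) r (n - 1) = s.opp ∧
      sideOf n L (k + 1) r n = s := by
  obtain ⟨s, h1, h2⟩ := color_mid hn h k
  refine ⟨s, ?_⟩
  have e1 : n - 1 ≠ n := by omega
  have e2 : n ≠ n - 1 := by omega
  unfold sideOf
  cases s <;> grind [Side.opp]

theorem colOf_pos_one (hn : 4 ≤ n) :
    colOf n L k R (.pos 1) = ⟨R - (n - 2), some (sideOf n L k (R - (n - 2)) 0)⟩ := by
  grind [colOf, Letter.row, Letter.top]

theorem colOf_pos {a : ℕ} (h2 : 2 ≤ a) (ha : a ≤ n - 1) :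
    colOf n L k R (.pos a) = ⟨R + (a - 1) - (n - 2), none⟩ := by
  grind [colOf, Letter.row, Letter.top]

theorem colOf_pos_n : colOf n L k R (.pos n) = ⟨R, some (sideOf n L k R (n - 1))⟩ := by
  simp [colOf, Letter.row, Letter.top]

theorem colOf_bar_n (hn : 4 ≤ n) : colOf n L k R (.bar n) = ⟨R, some (sideOf n L k R n)⟩ := by
  grind [colOf, Letter.row, Letter.top]

theorem colOf_bar {a : ℕ} (h2 : 2 ≤ a) (ha : a ≤ n - 1) :
    colOf n L k R (.bar a) = ⟨R + (n - a), none⟩ := by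
  grind [colOf, Letter.row, Letter.top]

theorem colOf_bar_one (hn : 4 ≤ n) :
    colOf n L k R (.bar 1) = ⟨R + (n - 2), some (sideOf n L k (R + (n - 2)) 1)⟩ := by
  grind [colOf, Letter.row, Letter.top]

theorem phase_low (hn : 4 ≤ n) (hR : phase n L R = n - 2) {q : ℕ} (hq : n - 2 ≤ R + q)
    (hq' : q < 2 * n - 4) : phase n L (R + q - (n - 2)) = q := by
  rw [phase_row hn hR hq, Nat.mod_eq_of_lt hq']

theorem phase_high (hn : 4 ≤ n) (hR : phase n L R = n - 2) {q : ℕ} (hq : q < n - 2) :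
    phase n L (R + q) = n - 2 + q := by
  rw [phase_add, hR, Nat.mod_eq_of_lt (by omega)]

theorem phase_top (hn : 4 ≤ n) (hR : phase n L R = n - 2) : phase n L (R + (n - 2)) = 0 := by
  rw [phase_add, hR, show n - 2 + (n - 2) = 2 * n - 4 by omega, Nat.mod_self]

theorem addBlock_half (s : Side) : addBlock n L k i ⟨r, some s⟩ =
    if color n L k r s.opp = i then some ⟨r + 1, none⟩ else none := rfl

theorem removeBlock_half (s : Side) : removeBlock n L k i ⟨r, some s⟩ =
    if color n L k r s = i then some ⟨r, none⟩ else none := rfl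

theorem addBlock_unit (hn : 4 ≤ n) {q : ℕ} (h : phase n L r = q) (h0 : 0 < q) (h1 : q ≠ n - 2)
    {c : ℕ} (hc : (q < n - 2 ∧ c = q + 1) ∨ (n - 2 ≤ q ∧ c + q + 3 = 2 * n)) :
    addBlock n L k i ⟨r, none⟩ =
      if c = i then some ⟨r + 1, none⟩ else none := by grind [IsHalfRow, addBlock, color_unit]

theorem removeBlock_unit (hn : 4 ≤ n) {q : ℕ} (h : phase n L r = q) (h0 : 0 < q)
    (h1 : q ≠ n - 2) {c : ℕ} (hc : (q < n - 2 ∧ c = q + 1) ∨ (n - 2 ≤ q ∧ c + q + 3 = 2 * n)) :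
    removeBlock n L k i ⟨r + 1, none⟩ =
      if c = i then some ⟨r, none⟩ else none := by
  grind [IsHalfRow, removeBlock, Nat.add_sub_cancel, color_unit]

/-- `addBlock` tests the front side first; since the two colours differ the order is irrelevant, and
the formula may start with either side. -/
theorem addBlock_halfRow (h : IsHalfRow n L r) (s : Side)
    (hne : color n L k r s.opp ≠ color n L k r s) : addBlock n L k i ⟨r, none⟩ =
      if color n L k r s = i then some ⟨r, some s⟩
      else if color n L k r s.opp = i then some ⟨r, some s.opp⟩ else none := by
  simp only [addBlock, if_pos h]
  cases s
  · rfl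
  grind [Side.opp, color]

theorem removeBlock_halfRow (h : IsHalfRow n L r) (s : Side)
    (hne : color n L k r s.opp ≠ color n L k r s) : removeBlock n L k i ⟨r + 1, none⟩ =
      if color n L k r s = i then some ⟨r, some s.opp⟩
      else if color n L k r s.opp = i then some ⟨r, some s⟩ else none := by
  simp only [removeBlock, Nat.add_sub_cancel, if_neg (Nat.succ_ne_zero r), if_pos h]
  cases s
  · rfl
  grind [Side.opp, color]

/-- One goes through the rows of the pattern. The restriction `1 ≤ i` excludes the `0`-blocks, which
would lead from `2̄` to a letter `1` one `δ` higher, or from `1̄` to a letter `2`. -/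
theorem addBlock_colOf (hn : 4 ≤ n) (hR : phase n L R = n - 2) (hx : x.Valid n)
    (hA : x.Above0 n R) (h1 : 1 ≤ i) (hi : i ≤ n) :
    addBlock n L k i (colOf n L k R x) = (x.f n i).map (colOf n L k R) := by
  unfold Letter.Above0 at hA
  revert hA
  refine Letter.Valid.cases (P := fun x => (n - 2 ≤ R ∨ n ≤ x.rank n) →
    addBlock n L k i (colOf n L k R x) = (x.f n i).map (colOf n L k R)) hn hx ?_ ?_ ?_ ?_ ?_ ?_ ?_ ?_
  · intro hA
    have hA : n - 2 ≤ R := by simp only [Letter.rank_pos] at hA; omega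
    obtain ⟨s, e1, e2, e3, e4, -⟩ := sides_zero hn
      (phase_low (q := 0) hn hR (by omega) (by omega)) k
    grind [colOf_pos_one, addBlock_half, Side.opp_opp, Letter.f, colOf_pos, le_rfl]
  · intro a h2 ha hA
    have hA : n - 2 ≤ R := by simp only [Letter.rank_pos] at hA; omega
    have hp := phase_low (q := a - 1) hn hR (by omega) (by omega)
    rw [colOf_pos h2 (by omega), addBlock_unit hn hp (by omega) (by omega) (c := a) (by omega)]
    grind [Letter.f, colOf_pos]
  · intro hA
    have hA : n - 2 ≤ R := by simp only [Letter.rank_pos] at hA; omega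
    obtain ⟨s, e1, e2, e3, e4, -⟩ := sides_mid hn hR k
    rw [colOf_pos (by omega) le_rfl, show R + (n - 1 - 1) - (n - 2) = R by omega,
      addBlock_halfRow (Or.inr hR) s (by omega), e1, e2]
    grind [Letter.f, colOf_pos_n, colOf_bar_n]
  · intro hA
    obtain ⟨s, e1, e2, e3, e4, -⟩ := sides_mid hn hR k
    grind [colOf_pos_n, addBlock_half, Letter.f, colOf_bar, le_rfl]
  · intro hA
    obtain ⟨s, e1, e2, e3, e4, -⟩ := sides_mid hn hR k
    grind [colOf_bar_n, addBlock_half, Side.opp_opp, Letter.f, colOf_bar, le_rfl]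
  · intro a h2 ha hA
    have hp := phase_high (q := n - a) hn hR (by omega)
    rw [colOf_bar (by omega) (by omega),
      addBlock_unit hn hp (by omega) (by omega) (c := a - 1) (by omega)]
    grind [Letter.f, colOf_bar]
  · intro hA
    have hp := phase_top hn hR
    obtain ⟨s, e1, e2, e3, e4, -⟩ := sides_zero hn hp k
    rw [colOf_bar le_rfl (by omega), addBlock_halfRow (Or.inl hp) s (by omega), e1, e2]
    grind [Letter.f, colOf_bar_one]
  · intro hA
    have hp := phase_top hn hR
    obtain ⟨s, e1, e2, e3, e4, -⟩ := sides_zero hn hp k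
    grind [colOf_bar_one, addBlock_half, Letter.f]

theorem removeBlock_colOf (hn : 4 ≤ n) (hR : phase n L R = n - 2) (hx : x.Valid n)
    (hA : x.Above0 n R) (h1 : 1 ≤ i) (hi : i ≤ n) :
    removeBlock n L k i (colOf n L k R x) = (x.e n i).map (colOf n L k R) := by
  unfold Letter.Above0 at hA
  revert hA
  refine Letter.Valid.cases (P := fun x => (n - 2 ≤ R ∨ n ≤ x.rank n) →
    removeBlock n L k i (colOf n L k R x) = (x.e n i).map (colOf n L k R))
    hn hx ?_ ?_ ?_ ?_ ?_ ?_ ?_ ?_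
  · intro hA
    have hA : n - 2 ≤ R := by simp only [Letter.rank_pos] at hA; omega
    obtain ⟨s, e1, e2, e3, e4, -⟩ := sides_zero hn
      (phase_low (q := 0) hn hR (by omega) (by omega)) k
    grind [colOf_pos_one, removeBlock_half, Letter.e]
  · intro a h2 ha hA
    have hA : n - 2 ≤ R := by grind [Letter.rank_pos]
    have hp := phase_low (q := a - 2) hn hR (by omega) (by omega)
    rw [colOf_pos h2 (by omega), show R + (a - 1) - (n - 2) = R + (a - 2) - (n - 2) + 1 by omega]
    by_cases ha2 : a = 2
    · subst ha2
      obtain ⟨s, e1, e2, e3, e4, -⟩ := sides_zero hn hp k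
      rw [removeBlock_halfRow (Or.inl hp) s (by omega), e1, e2]
      grind [Letter.e, colOf_pos_one]
    · rw [removeBlock_unit hn hp (by omega) (by omega) (c := a - 1) (by omega)]
      grind [Letter.e, colOf_pos]
  · intro hA
    have hA : n - 2 ≤ R := by simp only [Letter.rank_pos] at hA; omega
    have hp := phase_low (q := n - 3) hn hR (by omega) (by omega)
    rw [colOf_pos (by omega) le_rfl,
      show R + (n - 1 - 1) - (n - 2) = R + (n - 3) - (n - 2) + 1 by omega,
      removeBlock_unit hn hp (by omega) (by omega) (c := n - 2) (by omega)]
    grind [Letter.e, colOf_pos]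
  · intro hA
    obtain ⟨s, e1, e2, e3, e4, -⟩ := sides_mid hn hR k
    grind [colOf_pos_n, removeBlock_half, Letter.e, colOf_pos, le_rfl]
  · intro hA
    obtain ⟨s, e1, e2, e3, e4, -⟩ := sides_mid hn hR k
    grind [colOf_bar_n, removeBlock_half, Letter.e, colOf_pos, le_rfl]
  · intro a h2 ha hA
    by_cases ha' : a = n - 1
    · subst ha'
      obtain ⟨s, e1, e2, e3, e4, -⟩ := sides_mid hn hR k
      rw [colOf_bar (by omega) (by omega), show R + (n - (n - 1)) = R + 1 by omega,
        removeBlock_halfRow (Or.inr hR) s (by omega), e1, e2]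
      grind [Letter.e, colOf_bar_n, colOf_pos_n]
    · have hp := phase_high (q := n - a - 1) hn hR (by omega)
      rw [colOf_bar (by omega) (by omega), show R + (n - a) = R + (n - a - 1) + 1 by omega,
        removeBlock_unit hn hp (by omega) (by omega) (c := a) (by omega)]
      grind [Letter.e, colOf_bar]
  · intro hA
    have hp := phase_high (q := n - 3) hn hR (by omega)
    rw [colOf_bar le_rfl (by omega), show R + (n - 2) = R + (n - 3) + 1 by omega,
      removeBlock_unit hn hp (by omega) (by omega) (c := 2) (by omega)]
    grind [Letter.e, colOf_bar]
  · intro hA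
    have hp := phase_top hn hR
    obtain ⟨s, e1, e2, e3, e4, -⟩ := sides_zero hn hp k
    grind [colOf_bar_one, removeBlock_half, Letter.e, colOf_bar, le_rfl]

end

end

/-! ### Reading letters off columns, and adjacency of columns -/

section

section

variable {n : ℕ} {L : Level1} {k r R R' i : ℕ} {x y x' w : Letter}

theorem isHalfRow_colOf (hn : 4 ≤ n) (hR : phase n L R = n - 2) (hx : x.Valid n)
    (hA : x.Above0 n R) (s : Side) (hs : (colOf n L k R x).half = some s) :
    IsHalfRow n L (colOf n L k R x).full := by
  unfold Letter.Above0 at hA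
  revert hA hs
  refine Letter.Valid.cases (P := fun x => (n - 2 ≤ R ∨ n ≤ x.rank n) →
    (colOf n L k R x).half = some s → IsHalfRow n L (colOf n L k R x).full)
    hn hx ?_ ?_ ?_ ?_ ?_ ?_ ?_ ?_
  · intro hA _
    simp only [Letter.rank_pos] at hA
    rw [colOf_pos_one hn]
    exact Or.inl (phase_low (q := 0) hn hR (by omega) (by omega))
  · grind [colOf_pos]
  · grind [colOf_pos, le_rfl]
  · intro _ _; rw [colOf_pos_n]; exact Or.inr hR
  · intro _ _; rw [colOf_bar_n hn]; exact Or.inr hR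
  · grind [colOf_bar]
  · grind [colOf_bar, le_rfl]
  · intro _ _; rw [colOf_bar_one hn]; exact Or.inl (phase_top hn hR)

theorem letterOf_colOf (hn : 4 ≤ n) (hR : phase n L R = n - 2) (hx : x.Valid n)
    (hA : x.Above0 n R) : letterOf n L k (colOf n L k R x) = x := by
  unfold Letter.Above0 at hA
  revert hA
  refine Letter.Valid.cases (P := fun x => (n - 2 ≤ R ∨ n ≤ x.rank n) →
    letterOf n L k (colOf n L k R x) = x) hn hx ?_ ?_ ?_ ?_ ?_ ?_ ?_ ?_
  · intro hA
    simp only [Letter.rank_pos] at hA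
    have hp := phase_low (q := 0) hn hR (by omega) (by omega)
    rw [Nat.add_zero] at hp
    obtain ⟨s, e1, e2, e3, e4, -⟩ := sides_zero hn hp k
    grind [colOf_pos_one, letterOf]
  · intro a h2 ha hA
    simp only [Letter.rank_pos] at hA
    have hp := phase_low (q := a - 2) hn hR (by omega) (by omega)
    grind [colOf_pos, letterOf, color_unit]
  · intro hA
    simp only [Letter.rank_pos] at hA
    have hp := phase_low (q := n - 3) hn hR (by omega) (by omega)
    grind [colOf_pos, le_rfl, letterOf, color_unit]
  · intro hA
    obtain ⟨s, e1, e2, e3, e4, -⟩ := sides_mid hn hR k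
    grind [colOf_pos_n, letterOf]
  · intro hA
    obtain ⟨s, e1, e2, e3, e4, -⟩ := sides_mid hn hR k
    grind [colOf_bar_n, letterOf]
  · intro a h2 ha hA
    have hp := phase_high (q := n - a - 1) hn hR (by omega)
    grind [colOf_bar, letterOf, color_unit]
  · intro hA
    have hp := phase_high (q := n - 3) hn hR (by omega)
    grind [colOf_bar, le_rfl, letterOf, color_unit]
  · intro hA
    have hp := phase_top hn hR
    obtain ⟨s, e1, e2, e3, e4, -⟩ := sides_zero hn hp k
    grind [colOf_bar_one, letterOf]

/-! ### Letters on adjacent columns -/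

theorem not_above_self (x : Letter) : ¬ x.Above n x := by grind [Letter.Above, Letter.Lt]

/-- The order of two letters in terms of the tops of the columns representing them. -/
theorem row_top_cases (hn : 4 ≤ n) (hx : x.Valid n) (hx' : x'.Valid n) :
    (x'.row n < x.row n ∧ x.Above n x') ∨ (x.row n < x'.row n ∧ ¬ x.Above n x') ∨
    (x.row n = x'.row n ∧ x.top n = none ∧ ¬ x.Above n x') ∨
    (x.row n = x'.row n ∧ x.top n ≠ none ∧ x'.top n = none ∧ x.Above n x') ∨
    x = x' ∨
    (x.row n = n - 2 ∧ x'.row n = n - 2 ∧ ((x.top n = some n ∧ x'.top n = some (n - 1)) ∨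
      (x.top n = some (n - 1) ∧ x'.top n = some n)) ∧ x.Above n x') := by
  rcases x with a | a <;> rcases x' with b | b <;>
    simp only [Letter.row, Letter.top, Letter.Above, Letter.Lt, Letter.rank_pos, Letter.rank_bar,
      Letter.Valid, Letter.pos.injEq, Letter.bar.injEq, reduceCtorEq, false_and, and_false,
      or_false, false_or] at * <;> split_ifs <;>
    simp only [reduceCtorEq, ne_eq, not_true_eq_false, not_false_eq_true, true_and, false_and,
      and_false, or_false, false_or, and_true, or_true, true_or, Option.some.injEq] <;> omega

/-- Different heights are compared by `Letter.row`. Equal letters with a half-thickness top stand on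
opposite sides in neighbouring columns, so they do not fit; `n` and `n̄` stand on the same side and
do fit, in agreement with the exception in column strictness. -/
theorem adj_colOf (hn : 4 ≤ n) (hR : phase n L R = n - 2) (hx : x.Valid n) (hx' : x'.Valid n)
    (hA : x.Above0 n R) (hA' : x'.Above0 n R) :
    Adj (colOf n L (k + 1) R x') (colOf n L k R x) ↔ x.Above n x' := by
  have hrow : ∀ z : Letter, z.Valid n → z.Above0 n R → n - 2 ≤ R + z.row n := by
    intro z hz hz'
    rcases z with a | a <;> grind [Letter.Above0, Letter.row, Letter.rank_pos, Letter.rank_bar,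
        Letter.Valid]
  have h1 := hrow x hx hA
  have h2 := hrow x' hx' hA'
  unfold Adj colOf
  rcases row_top_cases hn hx hx' with ⟨h, hab⟩ | ⟨h, hab⟩ | ⟨h, ht, hab⟩ | ⟨h, ht, ht', hab⟩ | rfl |
    ⟨h, h', ht, hab⟩
  · grind
  · grind
  · simp_all
  · simp_all
  · simp only [not_above_self, iff_false, lt_irrefl, false_or, true_and]
    rintro ⟨ht, hs⟩
    have : x = .pos 1 ∨ x.rank n = n ∨ x = .bar 1 := by
      rcases x with a | a <;> simp only [Letter.top] at ht <;> split_ifs at ht <;> simp_all <;> omega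
    rcases this with rfl | e | rfl
    · have hp := phase_low (q := 0) hn hR (by grind [Letter.row])
        (by omega)
      obtain ⟨s, -, -, -, e4, -, e6⟩ := sides_zero hn hp k
      simp [Letter.row, Letter.top, show ¬ 1 = n by omega] at hs e4 e6
      rw [e4, e6] at hs
      exact s.opp_ne hs.symm
    · obtain ⟨s, -, -, e3, e4, e5, e6⟩ := sides_mid hn hR k
      have e2 : R + (2 * n - 2 - n) - (n - 2) = R := by omega
      rcases x with a | a
      · obtain rfl : a = n := by simpa using e
        simp [Letter.row, Letter.top, e3, e5, s.opp_ne] at hs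
      · have h3 : 1 ≤ a ∧ a ≤ n := hx
        obtain rfl : a = n := by simp at e; omega
        simp [Letter.row, Letter.top, show ¬ a = 1 by omega, e2, e4, e6, s.opp_ne.symm] at hs
    · have hp := phase_top hn hR
      obtain ⟨s, -, -, e3, -, e5, -⟩ := sides_zero hn hp k
      have e2 : R + (2 * n - 4) - (n - 2) = R + (n - 2) := by omega
      simp [Letter.row, Letter.top, show ¬ 1 = n by omega, e2, e3, e5, s.opp_ne] at hs
  · simp only [hab, iff_true, h, h', lt_irrefl, false_or, true_and, Nat.add_sub_cancel]
    obtain ⟨s, -, -, e3, e4, e5, e6⟩ := sides_mid hn hR k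
    grind

theorem row_le (hn : 4 ≤ n) (hx : x.Valid n) : x.row n ≤ 2 * n - 4 ∧
    (x.row n = 0 → x = .pos 1) ∧ (x.row n = 2 * n - 4 → x.top n = none ∨ x = .bar 1) := by
  rcases x with a | a <;> simp only [Letter.Valid, Letter.row, Letter.top] at * <;> split_ifs <;>
    simp <;> omega

/-- A difference of one `δ` leaves enough room. Heights can tie only if `x` is the letter `1`; then
`x'` is `2̄`, which has a full top, or `1̄`, whose block is on the same side as that of `x`. -/
theorem adj_colOf_jump (hn : 4 ≤ n) (hR : phase n L R' = n - 2) (hx : x.Valid n)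
    (hx' : x'.Valid n) :
    Adj (colOf n L (k + 1) R' x') (colOf n L k (R' + (2 * n - 4)) x) := by
  obtain ⟨h1, h2, -⟩ := row_le hn hx
  obtain ⟨h1', -, h3'⟩ := row_le hn hx'
  by_cases hlt : R' + x'.row n - (n - 2) < R' + (2 * n - 4) + x.row n - (n - 2)
  · exact Or.inl hlt
  · obtain rfl := h2 (by omega)
    rw [colOf_pos_one hn, show R' + (2 * n - 4) - (n - 2) = R' + (n - 2) by omega]
    have hr : R' + x'.row n - (n - 2) = R' + (n - 2) := by omega
    have hp := phase_top hn hR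
    obtain ⟨s, -, -, -, e4, e5, -⟩ := sides_zero hn hp k
    refine Or.inr ⟨hr, by simp, ?_⟩
    grind [colOf, colOf_bar_one]

/-- Since `ẽ_i` lowers the rank by one, a collision needs `x'` to have rank at least that of `w`.
Inspection of the letters shows that `x'` then carries a `+` of the same colour. -/
theorem above_e_iff (hn : 4 ≤ n) (h1 : 1 ≤ i) (hi : i ≤ n) (hx' : x'.Valid n)
    (he : x.e n i = some w) (h : x.Above n x') :
    w.Above n x' ↔ ¬ ((x'.f n i).isSome ∧ x.rank n ≤ x'.rank n + 1) := by
  rw [letter_f_isSome (by omega) h1 hi]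
  rcases (letter_e_eq_some (by omega) h1 hi).1 he with ⟨rfl, rfl⟩ | ⟨rfl, rfl⟩ <;>
    rcases x' with b | b <;>
    simp only [Letter.Above, Letter.Lt, upLetter, downLetter, lowIdx, Letter.Valid] at * <;>
    split_ifs at * <;>
    grind [Letter.rank_pos, Letter.rank_bar, Letter.pos.injEq, Letter.bar.injEq, reduceCtorEq,
        not_false_eq_true]

theorem above_f_iff (hn : 4 ≤ n) (h1 : 1 ≤ i) (hi : i ≤ n) (hx : x.Valid n)
    (hf : x'.f n i = some y) (h : x.Above n x') :
    x.Above n y ↔ ¬ ((x.e n i).isSome ∧ x.rank n ≤ x'.rank n + 1) := by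
  rw [letter_e_isSome (by omega) h1 hi]
  rcases (letter_f_eq_some (by omega) h1 hi).1 hf with ⟨rfl, rfl⟩ | ⟨rfl, rfl⟩ <;>
    rcases x with b | b <;>
    simp only [Letter.Above, Letter.Lt, upLetter, downLetter, lowIdx, Letter.Valid] at * <;>
    split_ifs at * <;>
    grind [Letter.rank_pos, Letter.rank_bar, Letter.pos.injEq, Letter.bar.injEq, reduceCtorEq,
        not_false_eq_true]

end

end

section

/-! ### Walls given by a list of letters -/

/-- The column representing a letter with middle row `c.1`, if the letter is visible. -/
def cellCol (n : ℕ) (L : Level1) (k : ℕ) (c : ℕ × Letter) : Column :=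
  if n - 2 ≤ c.1 ∨ n ≤ c.2.rank n then colOf n L k c.1 c.2 else ground

/-- The wall given by a list of letters and the middle rows of their blocks. -/
def wallOf (n : ℕ) (L : Level1) (cs : List (ℕ × Letter)) : Wall := fun k =>
  (cs[k]?).elim ground (cellCol n L k)

/-- The relation between consecutive letters of a wall: in a block of columns, from one block to the
next, or in the columns of the half-column. -/
def CellStep (n : ℕ) (c c' : ℕ × Letter) : Prop :=
  (c'.1 = c.1 ∧ n - 2 ≤ c.1 ∧ c.2.Above n c'.2 ∧ ¬ (c.2 = .bar 1 ∧ c'.2 = .pos 1)) ∨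
  (c.1 = c'.1 + (2 * n - 4) ∧ ¬ c.2.Above n c'.2 ∧ (c'.1 = 0 → n ≤ c'.2.rank n)) ∨
  (c.1 = 0 ∧ c'.1 = 0 ∧ ((n < c.2.rank n ∧ n ≤ c'.2.rank n ∧ c'.2.rank n < c.2.rank n) ∨
    (c.2.rank n ≤ n ∧ c'.2.rank n < n)))

/-- Lists of letters giving reduced proper Young walls. -/
structure GoodCells (n : ℕ) (L : Level1) (cs : List (ℕ × Letter)) : Prop where
  valid : ∀ c ∈ cs, c.2.Valid n ∧ phase n L c.1 = n - 2 ∧ (c.1 = 0 ∨ n - 2 ≤ c.1)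
  step : ∀ k c c', cs[k]? = some c → cs[k + 1]? = some c' → CellStep n c c'
  anchor : ∀ k x, cs[k]? = some (0, x) → x.rank n = n → colOf n L k 0 x = ground
  first : ∀ x, cs[0]? = some (0, x) → n ≤ x.rank n
  last : (∃ k x, cs.length = k + 1 ∧ cs[k]? = some (0, x) ∧ x.rank n ≤ n) ∨
    (phase n L 0 = 0 ∧ color n L cs.length 0 .back = 0 ∧
      ∀ k c, cs.length = k + 1 → cs[k]? = some c → c.1 = n - 2)

section

variable {n : ℕ} {L : Level1} {k r R R' i : ℕ} {x y x' w : Letter} {cs : List (ℕ × Letter)}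

theorem wallOf_of_none (h : cs[k]? = none) : wallOf n L cs k = ground := by simp [wallOf, h]

theorem wallOf_of_some (h : cs[k]? = some (R, x)) (hA : x.Above0 n R) :
    wallOf n L cs k = colOf n L k R x := by grind [Letter.Above0, wallOf, Option.elim, cellCol]

theorem getElem?_of_succ {α : Type} {l : List α} {a : α} (h : l[k + 1]? = some a) :
    ∃ b, l[k]? = some b := by grind

/-- In the columns of a half-column only letters of rank greater than `n` are visible as added
blocks. Smaller letters lie below the ground row, and letters of rank `n` are the ground block
itself by `anchor`. -/
theorem GoodCells.ground_self (h : GoodCells n L cs) (hn : 4 ≤ n) (hk : cs[k]? = some (0, x))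
    (hx : x.rank n ≤ n) : wallOf n L cs k = ground := by
  rcases hx.lt_or_eq with hlt | heq
  · grind [wallOf, Option.elim, cellCol]
  · rw [wallOf_of_some hk (Or.inr heq.ge), h.anchor k x hk heq]

theorem GoodCells.ground_succ (h : GoodCells n L cs) (hn : 4 ≤ n) (hk : cs[k]? = some (0, x))
    (hx : x.rank n ≤ n) : wallOf n L cs (k + 1) = ground := by
  cases hk' : cs[k + 1]? with
  | none => exact wallOf_of_none hk'
  | some c =>
    obtain ⟨R', x'⟩ := c
    rcases h.step k _ _ hk hk' with ⟨-, h2, -⟩ | ⟨h2, -⟩ | ⟨-, h2, h3⟩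
    · simp only at h2; omega
    · simp only at h2; omega
    · simp only at h2 h3
      subst h2
      exact h.ground_self hn hk' (by omega)

/-- The cells which determine their column. -/
theorem GoodCells.cases (h : GoodCells n L cs) (hn : 4 ≤ n) (k : ℕ) :
    (∃ R x, cs[k]? = some (R, x) ∧ (R = 0 → n < x.rank n) ∧ x.Above0 n R) ∨
      (wallOf n L cs k = ground ∧ wallOf n L cs (k + 1) = ground ∧
        ∀ R x, cs[k]? = some (R, x) → R = 0 ∧ x.rank n ≤ n) := by
  cases hk : cs[k]? with
  | none =>
    grind [wallOf_of_none, List.getElem?_eq_none_iff]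
  | some c =>
    obtain ⟨R, x⟩ := c
    have hR := (h.valid _ (List.mem_of_getElem? hk)).2.2
    simp only at hR
    by_cases hv : R = 0 → n < x.rank n
    · refine Or.inl ⟨R, x, rfl, hv, ?_⟩
      rcases hR with hR | hR
      · exact Or.inr (hv hR).le
      · exact Or.inl hR
    · push Not at hv
      obtain ⟨rfl, hv⟩ := hv
      refine Or.inr ⟨h.ground_self hn hk hv, h.ground_succ hn hk hv, ?_⟩
      simp_all

/-- Stated for an arbitrary `w` in place of `x`, so that it also covers the column after a removal.
Only a left neighbour in the same block can obstruct; from one block to the next, and at the end of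
the list, adjacency is automatic. -/
theorem GoodCells.adj_left (h : GoodCells n L cs) (hn : 4 ≤ n) (hk : cs[k]? = some (R, x))
    (hx : R = 0 → n < x.rank n) (hw : w.Valid n) (hA : w.Above0 n R) :
    Adj (wallOf n L cs (k + 1)) (colOf n L k R w) ↔
      ∀ x', cs[k + 1]? = some (R, x') → w.Above n x' := by
  obtain ⟨hv, hR, hR0⟩ := h.valid _ (List.mem_of_getElem? hk)
  simp only at hv hR hR0
  cases hk' : cs[k + 1]? with
  | none =>
    simp only [reduceCtorEq, false_implies, implies_true, iff_true]
    have hl : cs.length = k + 1 := by grind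
    rw [wallOf_of_none hk']
    rcases h.last with ⟨j, z, h1, h2, h3⟩ | ⟨h0, h1, h2⟩
    · grind
    · obtain rfl := h2 k _ hl hk
      obtain ⟨h3, h4, -⟩ := row_le hn hw
      -- Any letter but `1` rises above the ground row. The letter `1` has its `0`-block on the
      -- front by the colour condition in `last`, like the ground block of the neighbour.
      by_cases hrow : w.row n = 0
      · obtain rfl := h4 hrow
        obtain ⟨s, -, -, -, e4, -⟩ := sides_zero hn h0 k
        obtain ⟨s', e1', e2', -, -⟩ := sides_zero hn h0 (k + 1)
        obtain ⟨t, t1, t2⟩ := color_zero hn h0 k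
        rw [colOf_pos_one hn, Nat.sub_self]
        refine Or.inr ⟨rfl, by simp, Or.inr ?_⟩
        grind [ground, sideOf]
      · left; simp only [ground, colOf]; omega
  | some c =>
    obtain ⟨R', x'⟩ := c
    obtain ⟨hv', hR', -⟩ := h.valid _ (List.mem_of_getElem? hk')
    simp only at hv' hR'
    rcases h.step k _ _ hk hk' with ⟨h1, h2, h3, h4⟩ | ⟨h1, h2, h3⟩ | ⟨h1, h2, h3⟩ <;>
      simp only at h1 h2 h3
    · subst h1
      rw [wallOf_of_some hk' (Or.inl h2), adj_colOf hn hR hw hv' hA (Or.inl h2)]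
      simp
    · subst h1
      have hA' : x'.Above0 n R' := by
        rcases (h.valid _ (List.mem_of_getElem? hk')).2.2 with h0 | h0
        · exact Or.inr (h3 h0)
        · exact Or.inl h0
      rw [wallOf_of_some hk' hA']
      grind [adj_colOf_jump, Option.some.injEq, Prod.mk.injEq]
    · subst h1; subst h2
      have := hx rfl
      have hA' : x'.Above0 n 0 := Or.inr (by omega)
      rw [wallOf_of_some hk' hA', adj_colOf hn hR hw hv' hA hA']
      simp

theorem GoodCells.adj_right (h : GoodCells n L cs) (hn : 4 ≤ n) {z : Letter}
    (hk : cs[k]? = some (R, z)) (hk' : cs[k + 1]? = some (R', x')) (hA : x'.Above0 n R')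
    (hy : y.Valid n) (hA' : y.Above0 n R') :
    Adj (colOf n L (k + 1) R' y) (wallOf n L cs k) ↔ (R = R' → z.Above n y) := by
  obtain ⟨hv, hR, -⟩ := h.valid _ (List.mem_of_getElem? hk)
  obtain ⟨hv', hR', hR0⟩ := h.valid _ (List.mem_of_getElem? hk')
  simp only at hv hR hv' hR' hR0
  rcases h.step k _ _ hk hk' with ⟨h1, h2, h3, h4⟩ | ⟨h1, h2, h3⟩ | ⟨h1, h2, h3⟩ <;>
      simp only at h1 h2 h3
  · subst h1
    rw [wallOf_of_some hk (Or.inl h2), adj_colOf hn hR hv hy (Or.inl h2) hA']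
    simp
  · subst h1
    rw [wallOf_of_some hk (Or.inl (by omega))]
    grind [adj_colOf_jump]
  · subst h1; subst h2
    have hz : z.Above0 n 0 := by grind [Letter.Above0]
    rw [wallOf_of_some hk hz, adj_colOf hn hR hv hy hz hA']
    simp

theorem phase_zero (hn : 4 ≤ n) (L : Level1) : IsHalfRow n L 0 := by
  have : (n - 2) % (2 * n - 4) = n - 2 := Nat.mod_eq_of_lt (by omega)
  cases L <;> simp [IsHalfRow, phase, this]

theorem CellStep.above {R : ℕ} {x x' : Letter} (hn : 4 ≤ n) (h : CellStep n (R, x) (R, x'))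
    (hx : R = 0 → n < x.rank n) : x.Above n x' := by
  rcases h with ⟨-, -, h, -⟩ | ⟨h, -⟩ | ⟨h, -, h'⟩
  · exact h
  · simp only at h; omega
  · simp only at h h'
    have := hx h
    exact Or.inl (by unfold Letter.Lt; omega)

theorem GoodCells.isProper (h : GoodCells n L cs) (hn : 4 ≤ n) : IsProper n L (wallOf n L cs) := by
  rw [isProper_iff]
  refine ⟨fun k s hs => ?_, ⟨cs.length, fun k hk => wallOf_of_none (List.getElem?_eq_none hk)⟩,
    fun k => ?_⟩
  · rcases h.cases hn k with ⟨R, x, hk, hx, hA⟩ | ⟨h1, h2, -⟩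
    · have hv := h.valid _ (List.mem_of_getElem? hk)
      rw [wallOf_of_some hk hA] at hs ⊢
      grind [isHalfRow_colOf]
    · rw [h1]; exact phase_zero hn L
  · rcases h.cases hn k with ⟨R, x, hk, hx, hA⟩ | ⟨h1, h2, -⟩
    · have hv := h.valid _ (List.mem_of_getElem? hk)
      rw [wallOf_of_some hk hA, h.adj_left hn hk hx hv.1 hA]
      exact fun x' hk' => (h.step k _ _ hk hk').above hn hx
    · rw [h1, h2]; exact Or.inr ⟨rfl, by simp [ground], Or.inr rfl⟩

theorem color_congr {r' : ℕ} (h : phase n L r = phase n L r') (s : Side) :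
    color n L k r s = color n L k r' s := by unfold color; rw [h]

/-- Removing a `δ` inside a block makes a column too low for its left neighbour, apart from `1̄`
next to `1`, which `CellStep` excludes. At the end of a block it brings `x` to the level of the next
block, where it would have to fit next to `x'`; this too is excluded by `CellStep`. -/
theorem GoodCells.isReduced (h : GoodCells n L cs) (hn : 4 ≤ n) :
    IsReduced n L (wallOf n L cs) := by
  refine ⟨h.isProper hn, fun k hK hp => ?_⟩
  have hadj := (isProper_iff.1 hp).2.2 k
  rw [setColumn_self, setColumn_of_ne _ _ (by omega)] at hadj
  rcases h.cases hn k with ⟨R, x, hk, hx, hA⟩ | ⟨h1, h2, -⟩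
  swap
  · grind [ground]
  obtain ⟨hv, hR, hR0⟩ := h.valid _ (List.mem_of_getElem? hk)
  simp only at hv hR hR0
  rw [wallOf_of_some hk hA] at hK hadj
  obtain ⟨hr1, hr2, hr3⟩ := row_le hn hv
  have hfull : (colOf n L k R x).full = R + x.row n - (n - 2) := rfl
  rw [hfull] at hK hadj
  cases hk' : cs[k + 1]? with
  | none =>
    have hl : cs.length = k + 1 := by grind
    rw [wallOf_of_none hk'] at hadj
    rcases h.last with ⟨j, z, h1, h2, h3⟩ | ⟨h0, h1, h2⟩
    · grind
    · obtain rfl := h2 k _ hl hk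
      rcases hadj with hadj | ⟨-, hadj, hs⟩
      · simp_all
      · rcases hr3 (by omega) with e | rfl
        · grind [colOf]
        -- Without its `δ` the column of `1̄` would be a single `1`-block on the back of the ground
        -- row, next to a ground block on the front.
        · obtain ⟨t, t1, t2⟩ := color_zero hn h0 k
          rw [hl, t2] at h1
          rw [colOf_bar_one hn] at hs
          have e : phase n L (n - 2 + (n - 2)) = phase n L 0 := by rw [phase_top hn hR, h0]
          simp only [ground, sideOf, color_congr e, t1] at hs
          cases t <;> simp_all
  | some c =>
    obtain ⟨R', x'⟩ := c
    obtain ⟨hv', hR', hR0'⟩ := h.valid _ (List.mem_of_getElem? hk')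
    simp only at hv' hR' hR0'
    rcases h.step k _ _ hk hk' with ⟨h1, h2, h3, h4⟩ | ⟨h1, h2, h3⟩ | ⟨h1, h2, h3⟩ <;>
      simp only at h1 h2 h3
    · subst h1
      obtain ⟨hr1', hr2', hr3'⟩ := row_le hn hv'
      rw [wallOf_of_some hk' (Or.inl h2)] at hadj
      rcases hadj with hadj | ⟨hadj, hhalf, -⟩
      · simp only [colOf] at hadj; omega
      grind [colOf]
    · subst h1
      have hA' : x'.Above0 n R' := by
        rcases hR0' with h0 | h0
        · exact Or.inr (h3 h0)
        · exact Or.inl h0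
      by_cases hB : x.Above0 n R'
      · have hrow : n - 2 ≤ R' + x.row n := by omega
        have e : (⟨R' + (2 * n - 4) + x.row n - (n - 2) - (2 * n - 4),
            (colOf n L k (R' + (2 * n - 4)) x).half⟩ : Column) = colOf n L k R' x := by
          have e1 : R' + (2 * n - 4) + x.row n - (n - 2) = R' + x.row n - (n - 2) + (2 * n - 4) := by
            omega
          have e2 : phase n L (R' + x.row n - (n - 2) + (2 * n - 4)) =
              phase n L (R' + x.row n - (n - 2)) := by
            rw [phase_add, Nat.add_mod_right, Nat.mod_eq_of_lt (phase_lt hn)]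
          simp only [colOf, e1, Nat.add_sub_cancel]
          congr 2
          grind [sideOf, color_congr]
        rw [e, wallOf_of_some hk' hA', adj_colOf hn hR' hv hv' hB hA'] at hadj
        exact h2 hadj
      -- Here the middle row of the next block is the ground row and `x` is unbarred and smaller
      -- than `n`. Only `x = n - 1` is high enough to lose a `δ`, and it would leave an empty
      -- column.
      · simp only [Letter.Above0, not_or, not_le] at hB
        rcases x with a | a
        · simp only [Letter.rank_pos, Letter.Valid] at hB hv
          simp only [Letter.row, show ¬ a = n by omega, if_false] at hK hadj
          obtain rfl : a = n - 1 := by omega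
          rcases hadj with hadj | ⟨-, hadj, -⟩
          · simp only at hadj; omega
          · rw [colOf_pos (by omega) le_rfl] at hadj; exact hadj rfl
        grind [Letter.rank_bar, Letter.Valid]
    · omega

theorem adj_removeBlock {c c' d : Column} (h : removeBlock n L k i c = some c') (hd : Adj c d) :
    Adj c' d := by
  obtain ⟨f, _ | s⟩ := c
  · have : c'.full + 1 = f := by grind [removeBlock]
    rcases hd with hd | ⟨hd, -⟩ <;> simp only at hd <;> exact Or.inl (by omega)
  · unfold removeBlock at h
    simp only at h
    split_ifs at h; cases h
    rcases hd with hd | ⟨hd, h2, -⟩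
    · exact Or.inl hd
    · exact Or.inr ⟨hd, h2, Or.inl rfl⟩

theorem adj_addBlock {c c' d : Column} (h : addBlock n L k i c = some c') (hd : Adj d c) :
    Adj d c' := by
  obtain ⟨f, _ | s⟩ := c
  · have hlt : d.full < f := by
      rcases hd with hd | ⟨-, h2, -⟩
      · exact hd
      · exact absurd rfl h2
    have : f ≤ c'.full := by grind [addBlock]
    exact Or.inl (by omega)
  · unfold addBlock at h
    simp only at h
    split_ifs at h; cases h
    rcases hd with hd | ⟨hd, h2, -⟩ <;> simp only at hd <;> exact Or.inl (by simp only; omega)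

end

end

/-! ### Removable and admissible columns, and the signature of a wall -/

section

section

variable {n : ℕ} {L : Level1} {k r R R' i : ℕ} {x y x' w : Letter} {cs : List (ℕ × Letter)}
  {Y Y' : Wall}

theorem removeAt_eq_some : removeAt n L i Y k = some Y' ↔ ∃ c, removeBlock n L k i (Y k) = some c ∧
    IsProper n L (setColumn Y k c) ∧ Y' = setColumn Y k c := by
  grind [removeAt, Option.bind_eq_some_iff, exists_congr]

theorem addAt_eq_some : addAt n L i Y k = some Y' ↔ ∃ c, addBlock n L k i (Y k) = some c ∧
    IsProper n L (setColumn Y k c) ∧ Y' = setColumn Y k c := by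
  grind [addAt, Option.bind_eq_some_iff, exists_congr]

theorem letter_f_rank (hn : 2 ≤ n) (h1 : 1 ≤ i) (hi : i ≤ n) (h : x.f n i = some y) :
    y.rank n = x.rank n + 1 ∧ y.Valid n := by
  grind [letter_f_eq_some, upLetter, downLetter, lowIdx, Letter.rank_pos, Letter.rank_bar,
      Letter.Valid]

theorem letter_e_rank_add (hn : 2 ≤ n) (h1 : 1 ≤ i) (hi : i ≤ n) (h : x.e n i = some w) :
    x.rank n = w.rank n + 1 ∧ w.Valid n := by
  grind [letter_e_eq_some, upLetter, downLetter, lowIdx, Letter.rank_pos, Letter.rank_bar,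
      Letter.Valid]

/-- The letter `x'` on the column to the left of `x` is about to be raised to a position which `x`
does not allow. -/
def Jam (n i : ℕ) (x x' : Letter) : Prop :=
  (x.e n i).isSome ∧ (x'.f n i).isSome ∧ x.rank n ≤ x'.rank n + 1

/-- Removing a block never harms the fit to the column on the right; the left neighbour obstructs
exactly in a jam. A ground block cannot be removed, since a ground column or an added block to its
left needs it. -/
theorem GoodCells.removeAt_iff (h : GoodCells n L cs) (hn : 4 ≤ n) (h1 : 1 ≤ i) (hi : i ≤ n) :
    removeAt n L i (wallOf n L cs) k = some Y' ↔ ∃ R x w, cs[k]? = some (R, x) ∧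
      (R = 0 → n < x.rank n) ∧ x.e n i = some w ∧ Y' = setColumn (wallOf n L cs) k (colOf n L k R w) ∧
      ∀ x', cs[k + 1]? = some (R, x') → ¬ Jam n i x x' := by
  have hprop := h.isProper hn
  rw [removeAt_eq_some]
  constructor
  · rintro ⟨c, hc, hp, rfl⟩
    have hadj := (isProper_iff.1 hp).2.2 k
    rw [setColumn_self, setColumn_of_ne _ _ (by omega)] at hadj
    rcases h.cases hn k with ⟨R, x, hk, hx, hA⟩ | ⟨e1, -, -⟩
    · obtain ⟨hv, hR, hR0⟩ := h.valid _ (List.mem_of_getElem? hk)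
      simp only at hv hR hR0
      rw [wallOf_of_some hk hA, removeBlock_colOf hn hR hv hA h1 hi, Option.map_eq_some_iff] at hc
      obtain ⟨w, hw, rfl⟩ := hc
      obtain ⟨r1, r2⟩ := letter_e_rank_add (by omega) h1 hi hw
      have hwA : w.Above0 n R := by
        unfold Letter.Above0
        omega
      refine ⟨R, x, w, hk, hx, hw, rfl, fun x' hk' hj => ?_⟩
      rw [h.adj_left hn hk hx r2 hwA] at hadj
      have hv' := (h.valid _ (List.mem_of_getElem? hk')).1
      exact (above_e_iff hn h1 hi hv' hw ((h.step k _ _ hk hk').above hn hx)).1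
        (hadj x' hk') hj.2
    · rw [e1, ground, removeBlock_half] at hc
      split_ifs at hc
      cases hc
      rcases hadj with hadj | ⟨-, hadj, -⟩
      · simp at hadj
      simp_all
  · rintro ⟨R, x, w, hk, hx, hw, rfl, hj⟩
    obtain ⟨hv, hR, hR0⟩ := h.valid _ (List.mem_of_getElem? hk)
    simp only at hv hR hR0
    obtain ⟨r1, r2⟩ := letter_e_rank_add (by omega) h1 hi hw
    have hA : x.Above0 n R := by unfold Letter.Above0; omega
    have hwA : w.Above0 n R := by unfold Letter.Above0; omega
    have hc : removeBlock n L k i (wallOf n L cs k) = some (colOf n L k R w) := by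
      rw [wallOf_of_some hk hA, removeBlock_colOf hn hR hv hA h1 hi, hw]; rfl
    refine ⟨_, hc, ?_, rfl⟩
    rw [isProper_setColumn hprop (isHalfRow_colOf hn hR r2 hwA)]
    refine ⟨?_, ?_⟩
    · rw [h.adj_left hn hk hx r2 hwA]
      intro x' hk'
      have hv' := (h.valid _ (List.mem_of_getElem? hk')).1
      rw [above_e_iff hn h1 hi hv' hw ((h.step k _ _ hk hk').above hn hx)]
      exact fun hj' => hj x' hk' ⟨by rw [hw]; rfl, hj'⟩
    grind [adj_removeBlock, isProper_iff]

theorem GoodCells.addAt_iff (h : GoodCells n L cs) (hn : 4 ≤ n) (h1 : 1 ≤ i) (hi : i ≤ n) :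
    addAt n L i (wallOf n L cs) k = some Y' ↔ ∃ R x' y, cs[k]? = some (R, x') ∧
      (R = 0 → n ≤ x'.rank n) ∧ x'.f n i = some y ∧
      Y' = setColumn (wallOf n L cs) k (colOf n L k R y) ∧
      ∀ j x, k = j + 1 → cs[j]? = some (R, x) → ¬ Jam n i x x' := by
  have hprop := h.isProper hn
  rw [addAt_eq_some]
  constructor
  · rintro ⟨c, hc, hp, rfl⟩
    by_cases hvis : ∃ R x', cs[k]? = some (R, x') ∧ (R = 0 → n ≤ x'.rank n)
    · obtain ⟨R, x', hk, hx⟩ := hvis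
      obtain ⟨hv, hR, hR0⟩ := h.valid _ (List.mem_of_getElem? hk)
      simp only at hv hR hR0
      have hA : x'.Above0 n R := by unfold Letter.Above0; omega
      rw [wallOf_of_some hk hA, addBlock_colOf hn hR hv hA h1 hi, Option.map_eq_some_iff] at hc
      obtain ⟨y, hy, rfl⟩ := hc
      obtain ⟨r1, r2⟩ := letter_f_rank (by omega) h1 hi hy
      have hyA : y.Above0 n R := by unfold Letter.Above0; omega
      refine ⟨R, x', y, hk, hx, hy, rfl, ?_⟩
      rintro j x rfl hj hjam
      have hadj := (isProper_iff.1 hp).2.2 j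
      rw [setColumn_self, setColumn_of_ne _ _ (by omega), h.adj_right hn hj hk hA r2 hyA] at hadj
      have hab : x.Above n x' := by
        rcases h.step j _ _ hj hk with ⟨-, -, h, -⟩ | ⟨h, -⟩ | ⟨h, -, h'⟩
        · exact h
        · simp only at h; omega
        · simp only at h h'
          have := hx h
          exact Or.inl (by unfold Letter.Lt; omega)
      exact (above_f_iff hn h1 hi (h.valid _ (List.mem_of_getElem? hj)).1 hy hab).1 (hadj rfl)
        ⟨hjam.1, hjam.2.2⟩
    -- Otherwise column `k` is a ground column and the new block is its back block. This needs a
    -- column on its right that is not a ground column, which occurs only just behind the last full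
    -- block, and there the free slot has colour `0`.
    · exfalso
      push Not at hvis
      have hY : wallOf n L cs k = ground := by
        rcases h.cases hn k with ⟨R, x, hk, hx, hA⟩ | ⟨e1, -, -⟩
        · grind
        · exact e1
      rw [hY, ground, addBlock_half] at hc
      split_ifs at hc with hcol
      cases hc
      have hj : ∀ j, k = j + 1 → wallOf n L cs j ≠ ground := by
        rintro j rfl hj
        have hadj := (isProper_iff.1 hp).2.2 j
        rw [setColumn_self, setColumn_of_ne _ _ (by omega), hj] at hadj
        rcases hadj with hadj | ⟨hadj, -⟩ <;> simp [ground] at hadj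
      cases hk : cs[k]? with
      | some c =>
        obtain ⟨R, x⟩ := c
        obtain ⟨rfl, hx⟩ := hvis R x hk
        cases k with
        | zero => exact absurd (h.first x hk) (by omega)
        | succ j =>
          obtain ⟨⟨R', z⟩, hz⟩ := getElem?_of_succ hk
          rcases h.step j _ _ hz hk with ⟨e1, e2, -⟩ | ⟨-, -, e3⟩ | ⟨e1, -, e3⟩
          · omega
          · grind
          · simp only at e1 e3
            subst e1
            exact hj j rfl (h.ground_self hn hz (by omega))
      | none =>
        rw [List.getElem?_eq_none_iff] at hk
        have hl : cs.length = k := by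
          by_contra hne
          obtain ⟨j, rfl⟩ : ∃ j, k = j + 1 := ⟨k - 1, by omega⟩
          exact hj j rfl (wallOf_of_none (List.getElem?_eq_none (by omega)))
        rcases h.last with ⟨j, z, e1, e2, e3⟩ | ⟨-, e1, -⟩
        · exact hj j (by omega) (h.ground_self hn e2 e3)
        grind [Side.opp]
  · rintro ⟨R, x', y, hk, hx, hy, rfl, hj⟩
    obtain ⟨hv, hR, hR0⟩ := h.valid _ (List.mem_of_getElem? hk)
    simp only at hv hR hR0
    obtain ⟨r1, r2⟩ := letter_f_rank (by omega) h1 hi hy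
    have hA : x'.Above0 n R := by unfold Letter.Above0; omega
    have hyA : y.Above0 n R := by unfold Letter.Above0; omega
    have hc : addBlock n L k i (wallOf n L cs k) = some (colOf n L k R y) := by
      rw [wallOf_of_some hk hA, addBlock_colOf hn hR hv hA h1 hi, hy]; rfl
    refine ⟨_, hc, ?_, rfl⟩
    rw [isProper_setColumn hprop (isHalfRow_colOf hn hR r2 hyA)]
    refine ⟨adj_addBlock hc ((isProper_iff.1 hprop).2.2 k), ?_⟩
    rintro j rfl
    obtain ⟨⟨R', z⟩, hz⟩ := getElem?_of_succ hk
    rw [h.adj_right hn hz hk hA r2 hyA]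
    rintro rfl
    have hab : z.Above n x' := by
      rcases h.step j _ _ hz hk with ⟨-, -, h, -⟩ | ⟨h, -⟩ | ⟨h, -, h'⟩
      · exact h
      · simp only at h; omega
      · simp only at h h'
        have := hx h
        exact Or.inl (by unfold Letter.Lt; omega)
    rw [above_f_iff hn h1 hi (h.valid _ (List.mem_of_getElem? hz)).1 hy hab]
    exact fun hj' => hj j z rfl hz ⟨hj'.1, by rw [hy]; rfl, hj'.2⟩

/-! ### Signatures of walls -/

/-- The signs of a letter, disregarding the neighbouring columns. -/
def cellSigns (n i : ℕ) (k : ℕ) (c : ℕ × Letter) : List (Sign × ℕ) :=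
  (if (c.1 = 0 → n < c.2.rank n) ∧ (c.2.e n i).isSome then [(Sign.minus, k)] else []) ++
    (if (c.1 = 0 → n ≤ c.2.rank n) ∧ (c.2.f n i).isSome then [(Sign.plus, k)] else [])

/-- The signs of all letters, from left to right. -/
def cellsWord (n i : ℕ) (cs : List (ℕ × Letter)) (k : ℕ) : List (Sign × ℕ) :=
  (cs.zipIdx k).reverse.flatMap fun c => cellSigns n i c.2 c.1

theorem cellsWord_append (cs ds : List (ℕ × Letter)) (k : ℕ) : cellsWord n i (cs ++ ds) k =
    cellsWord n i ds (k + cs.length) ++ cellsWord n i cs k := by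
  simp [cellsWord, List.zipIdx_append]

theorem cellsWord_singleton (c : ℕ × Letter) (k : ℕ) :
    cellsWord n i [c] k = cellSigns n i k c := by
  simp [cellsWord]

/-- Column `k` and its left neighbour block each other. -/
def Jammed (n i : ℕ) (cs : List (ℕ × Letter)) (k : ℕ) : Prop :=
  ∃ R x x', cs[k]? = some (R, x) ∧ cs[k + 1]? = some (R, x') ∧ (R = 0 → n < x.rank n) ∧ Jam n i x x'

theorem not_e_f (hn : 2 ≤ n) (h1 : 1 ≤ i) (hi : i ≤ n) (he : (x.e n i).isSome)
    (hf : (x.f n i).isSome) : False := by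
  grind [letter_e_isSome, letter_f_isSome, upLetter, downLetter, lowIdx, Letter.pos.injEq,
      Letter.bar.injEq, reduceCtorEq]

-- In a jam of columns `k` and `k + 1`, the `-` of column `k` and the `+` of column `k + 1` are
-- missing from the wall, although both are present in the word of letters. All other signs agree.
open Classical in
theorem GoodCells.columnSigns_eq (h : GoodCells n L cs) (hn : 4 ≤ n) (h1 : 1 ≤ i) (hi : i ≤ n)
    {c : ℕ × Letter} (hk : cs[k]? = some c) : columnSigns n L i (wallOf n L cs) k =
      if Jammed n i cs k ∨ (∃ j, k = j + 1 ∧ Jammed n i cs j) then [] else cellSigns n i k c := by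
  obtain ⟨R, x⟩ := c
  have hm : (removeAt n L i (wallOf n L cs) k).isSome ↔
      ((R = 0 → n < x.rank n) ∧ (x.e n i).isSome) ∧ ¬ Jammed n i cs k := by
    rw [Option.isSome_iff_exists]
    simp only [h.removeAt_iff hn h1 hi]
    constructor
    · rintro ⟨Y', R', x', w, hk', hx, hw, -, hj⟩
      rw [hk] at hk'; cases hk'
      refine ⟨⟨hx, by rw [hw]; rfl⟩, ?_⟩
      rintro ⟨R', z, z', e1, e2, -, e3⟩
      simp_all
    · rintro ⟨⟨hx, he⟩, hj⟩
      obtain ⟨w, hw⟩ := Option.isSome_iff_exists.1 he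
      exact ⟨_, R, x, w, hk, hx, hw, rfl, fun x' e2 e3 => hj ⟨R, x, x', hk, e2, hx, e3⟩⟩
  have hp : (addAt n L i (wallOf n L cs) k).isSome ↔
      ((R = 0 → n ≤ x.rank n) ∧ (x.f n i).isSome) ∧ ¬ ∃ j, k = j + 1 ∧ Jammed n i cs j := by
    rw [Option.isSome_iff_exists]
    simp only [h.addAt_iff hn h1 hi]
    constructor
    · rintro ⟨Y', R', x', w, hk', hx, hw, -, hj⟩
      rw [hk] at hk'; cases hk'
      refine ⟨⟨hx, by rw [hw]; rfl⟩, ?_⟩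
      rintro ⟨j, rfl, R', z, z', e1, e2, -, e3⟩
      simp_all
    · rintro ⟨⟨hx, he⟩, hj⟩
      obtain ⟨w, hw⟩ := Option.isSome_iff_exists.1 he
      refine ⟨_, R, x, w, hk, hx, hw, rfl, ?_⟩
      rintro j z rfl e2 e3
      refine hj ⟨j, rfl, R, z, x, e2, hk, fun hR => ?_, e3⟩
      rcases h.step j _ _ e2 hk with ⟨_, h', -⟩ | ⟨h', -⟩ | ⟨-, -, h'⟩
      · simp only at h'; omega
      · simp only at h'; omega
      grind
  unfold columnSigns cellSigns
  simp only [hm, hp]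
  by_cases hj : Jammed n i cs k
  · have hne : ¬ (x.f n i).isSome := by
      obtain ⟨R', z, z', e1, -, -, e3⟩ := hj
      rw [hk] at e1; cases e1
      exact fun hf => not_e_f (by omega) h1 hi e3.1 hf
    simp [hj, hne]
  · by_cases hj' : ∃ j, k = j + 1 ∧ Jammed n i cs j
    · have hne : ¬ (x.e n i).isSome := by
        obtain ⟨j, rfl, R', z, z', -, e1, -, e3⟩ := hj'
        rw [hk] at e1; cases e1
        exact fun he => not_e_f (by omega) h1 hi he e3.2.1
      simp only [hj', hne]; simp
    simp_all

theorem GoodCells.columnSigns_of_none (h : GoodCells n L cs) (hn : 4 ≤ n) (h1 : 1 ≤ i) (hi : i ≤ n)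
    (hk : cs[k]? = none) : columnSigns n L i (wallOf n L cs) k = [] := by
  have hm : ¬ (removeAt n L i (wallOf n L cs) k).isSome := by
    rw [Option.isSome_iff_exists]
    simp only [h.removeAt_iff hn h1 hi]
    simp_all
  have hp : ¬ (addAt n L i (wallOf n L cs) k).isSome := by
    rw [Option.isSome_iff_exists]
    simp only [h.addAt_iff hn h1 hi]
    simp_all
  simp [columnSigns, hm, hp]

theorem range_reverse_flatMap_congr {α : Type} {g : ℕ → List α} {N M : ℕ} (h : N ≤ M)
    (hg : ∀ k, N ≤ k → g k = []) :
    (List.range M).reverse.flatMap g = (List.range N).reverse.flatMap g := by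
  induction M, h using Nat.le_induction with
  | base => rfl
  | succ M hM ih => simp [List.range_succ, ih, hg M hM]

/-- `width` counts only up to the last column with added blocks, the list of cells may go on; beyond
either bound no column has a sign, so both ranges give the same word. -/
theorem GoodCells.wallSigns_eq (h : GoodCells n L cs) (hn : 4 ≤ n) (h1 : 1 ≤ i) (hi : i ≤ n) :
    wallSigns n L i (wallOf n L cs) =
      (List.range cs.length).reverse.flatMap (columnSigns n L i (wallOf n L cs)) := by
  have hw : ∀ k, width (wallOf n L cs) ≤ k → wallOf n L cs k = ground := by
    have : width (wallOf n L cs) ∈ {N | ∀ k, N ≤ k → wallOf n L cs k = ground} :=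
      Nat.sInf_mem ⟨cs.length, fun k hk => wallOf_of_none (List.getElem?_eq_none hk)⟩
    exact this
  have hz : ∀ k, width (wallOf n L cs) + 1 ≤ k → columnSigns n L i (wallOf n L cs) k = [] := by
    intro k hk
    cases hck : cs[k]? with
    | none => exact h.columnSigns_of_none hn h1 hi hck
    | some c =>
      have hprop := h.isProper hn
      have hm : ¬ (removeAt n L i (wallOf n L cs) k).isSome := by
        rw [Option.isSome_iff_exists]
        simp only [removeAt_eq_some, hw k (by omega), ground, removeBlock_half]
        rintro ⟨Y', c, hc, hp, -⟩
        split_ifs at hc; cases hc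
        have hadj := (isProper_iff.1 hp).2.2 k
        rw [setColumn_self] at hadj
        rcases hadj with hadj | ⟨-, hadj, -⟩
        · simp at hadj
        simp_all
      have hp : ¬ (addAt n L i (wallOf n L cs) k).isSome := by
        rw [Option.isSome_iff_exists]
        simp only [addAt_eq_some, hw k (by omega), ground, addBlock_half]
        rintro ⟨Y', c, hc, hp, -⟩
        split_ifs at hc; cases hc
        obtain ⟨j, rfl⟩ : ∃ j, k = j + 1 := ⟨k - 1, by omega⟩
        have hadj := (isProper_iff.1 hp).2.2 j
        rw [setColumn_self, setColumn_of_ne _ _ (by omega), hw j (by omega)] at hadj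
        rcases hadj with hadj | ⟨hadj, -⟩ <;> simp [ground] at hadj
      simp [columnSigns, hm, hp]
  unfold wallSigns
  rcases le_total (width (wallOf n L cs) + 1) cs.length with hle | hle
  · rw [range_reverse_flatMap_congr hle hz]
  · exact range_reverse_flatMap_congr hle fun k hk =>
      h.columnSigns_of_none hn h1 hi (List.getElem?_eq_none hk)

/-- The signature of a wall is the signature of the word of its letters. -/
theorem GoodCells.wordEquiv (h : GoodCells n L cs) (hn : 4 ≤ n) (h1 : 1 ≤ i) (hi : i ≤ n) :
    WordEquiv (cellsWord n i cs 0) (wallSigns n L i (wallOf n L cs)) := by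
  classical
  rw [h.wallSigns_eq hn h1 hi]
  -- Induction over the `N` right-most columns. If column `N - 1` is jammed with column `N`, its `-`
  -- is still waiting for a partner and is carried in front; the `+` of column `N` then cancels it.
  have key : ∀ N ≤ cs.length, WordEquiv (cellsWord n i (cs.take N) 0)
      ((if ∃ j, N = j + 1 ∧ Jammed n i cs j then [(Sign.minus, N - 1)] else []) ++
        (List.range N).reverse.flatMap (columnSigns n L i (wallOf n L cs))) := by
    intro N
    induction N with
    | zero => grind [cellsWord, WordEquiv.refl]
    | succ N ih =>
      intro hN
      have hk : cs[N]? = some cs[N] := List.getElem?_eq_getElem (by omega)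
      have e : cs.take (N + 1) = cs.take N ++ [cs[N]] := by simp_all
      have ih := ih (by omega)
      have hl : (cs.take N).length = N := by grind
      rw [e, cellsWord_append, hl, Nat.zero_add, cellsWord_singleton]
      rw [List.range_succ, List.reverse_append, List.reverse_singleton, List.singleton_append,
        List.flatMap_cons, h.columnSigns_eq hn h1 hi hk]
      have hj1 : (∃ j, N + 1 = j + 1 ∧ Jammed n i cs j) ↔ Jammed n i cs N :=
        ⟨fun ⟨j, e, hj⟩ => by cases e; exact hj, fun hj => ⟨N, rfl, hj⟩⟩
      simp only [hj1, Nat.add_sub_cancel]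
      refine ((WordEquiv.refl _).append ih).trans ?_
      by_cases hj' : ∃ j, N = j + 1 ∧ Jammed n i cs j
      · have hjN : ¬ Jammed n i cs N := by
          rintro ⟨R, x, x', f1, f2, f3, f4⟩
          obtain ⟨j, rfl, R', z, z', g1, g2, g3, g4⟩ := hj'
          rw [f1] at g2; cases g2
          exact not_e_f (by omega) h1 hi f4.1 g4.2.1
        rw [if_pos hj', if_pos (Or.inr hj'), if_neg hjN]
        obtain ⟨j, rfl, R', z, z', g1, g2, g3, g4⟩ := hj'
        rw [hk] at g2
        have hs : cellSigns n i (j + 1) (R', z') = [(Sign.plus, j + 1)] := by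
          have hne : ¬ (z'.e n i).isSome := fun he => not_e_f (by omega) h1 hi he g4.2.1
          have hvis : R' = 0 → n ≤ z'.rank n := by
            intro hR
            have := g3 hR
            have := g4.2.2
            omega
          simp only [cellSigns, hne, g4.2.1, hvis]
          simp
          exact hvis
        grind [Option.some.inj, wordEquiv_cancel]
      · rw [if_neg hj', List.nil_append]
        by_cases hjN : Jammed n i cs N
        · rw [if_pos hjN, if_pos (Or.inl hjN), List.nil_append]
          obtain ⟨R, x, x', f1, f2, f3, f4⟩ := hjN
          rw [hk] at f1
          have hne : ¬ (x.f n i).isSome := fun hf => not_e_f (by omega) h1 hi f4.1 hf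
          have hs : cellSigns n i N (R, x) = [(Sign.minus, N)] := by
            simp only [cellSigns, hne, f4.1]
            simp
            exact f3
          rw [Option.some.inj f1, hs]
          exact WordEquiv.refl _
        grind [WordEquiv.refl]
  have := key cs.length le_rfl
  rw [List.take_length, if_neg, List.nil_append] at this
  · exact this
  · rintro ⟨j, hj, R, x, x', -, f2, -⟩
    simp_all

end

end

section

/-! ### The wall of a tableau -/

/-- The letters of a list of columns with the middle rows of their blocks, `R` being that of the
last one. -/
def colsCells (n R : ℕ) : List (List Letter) → List (ℕ × Letter)
  | [] => []
  | C :: M => C.map (R + M.length * (2 * n - 4), ·) ++ colsCells n R M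

/-- The letters of a tableau with the middle rows of their blocks. -/
def tableauCells (n : ℕ) (T : Tableau) : List (ℕ × Letter) :=
  colsCells n (if T.half.isSome then 0 else n - 2) T.allCols

/-- The wall of a tableau. -/
def tableauWall (n : ℕ) (L : Level1) (T : Tableau) : Wall := wallOf n L (tableauCells n T)

section

variable {n R : ℕ} {m : ℕ → ℕ} {T : Tableau} {M : List (List Letter)} {H C D : List Letter}

theorem colsCells_append (M M' : List (List Letter)) : colsCells n R (M ++ M') =
    colsCells n (R + M'.length * (2 * n - 4)) M ++ colsCells n R M' := by
  induction M with
  | nil => rfl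
  | cons C M ih =>
    grind [colsCells, List.length_append, List.append_assoc]

theorem colsCells_length : (colsCells n R M).length = (M.map List.length).sum := by
  induction M with
  | nil => rfl
  | cons C M ih => simp [colsCells, ih]

theorem mem_colsCells {c : ℕ × Letter} (hc : c ∈ colsCells n R M) :
    ∃ C ∈ M, c.2 ∈ C ∧ ∃ j, c.1 = R + j * (2 * n - 4) := by
  induction M with
  | nil => simp [colsCells] at hc
  | cons C M ih =>
    rcases List.mem_append.1 hc with h | h
    · obtain ⟨x, hx, rfl⟩ := List.mem_map.1 h
      exact ⟨C, by simp, hx, _, rfl⟩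
    simp_all

theorem HalfColumn.bottom_rank (h : HalfColumn n H) {x : Letter} (hx : H[0]? = some x) :
    n ≤ x.rank n := by
  have hv := h.valid _ (List.mem_of_getElem? hx)
  have hl := h.length_eq
  cases x with
  | pos a =>
    simp only [Letter.Valid, Letter.rank_pos] at *
    by_contra hlt
    have := h.toStrict.getElem?_pos (by omega) hx
    have := h.cc a (by omega)
    omega
  | bar a => grind [Letter.Valid, Letter.rank_bar]

theorem HalfColumn.top_rank (h : HalfColumn n H) {x : Letter} {p : ℕ} (hp : n = p + 1)
    (hx : H[p]? = some x) : x.rank n ≤ n := by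
  have hv := h.valid _ (List.mem_of_getElem? hx)
  cases x with
  | pos a => grind [Letter.Valid, Letter.rank_pos]
  | bar a =>
    simp only [Letter.Valid, Letter.rank_bar] at *
    by_contra hlt
    have := h.toStrict.getElem?_bar (by omega) hx
    have := h.cc a (by omega)
    omega

theorem HalfColumn.rank_lt (h : HalfColumn n H) {x y : Letter} {p : ℕ} (hx : H[p]? = some x)
    (hy : H[p + 1]? = some y) : y.rank n < x.rank n := by
  have hl := h.length_eq
  have hc := h.cover (n - 1) (by grind)
  refine (Letter.Above.weakAbove (h.strict p x y hx hy)).resolve_right fun e => ?_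
  have := h.toStrict.index_n hx e.1
  have := h.toStrict.index_n hy e.2
  omega

/-- A half-column has exactly one letter of rank `n`, so a barred letter of larger rank cannot be
followed immediately by an unbarred letter smaller than `n`. -/
theorem HalfColumn.cellStep (h : HalfColumn n H) {x y : Letter} {p : ℕ} (hx : H[p]? = some x)
    (hy : H[p + 1]? = some y) : CellStep n (0, x) (0, y) := by
  have hvx := h.valid _ (List.mem_of_getElem? hx)
  have hvy := h.valid _ (List.mem_of_getElem? hy)
  have hl := h.length_eq
  have hc := h.cover (n - 1) (by grind)
  refine Or.inr (Or.inr ⟨rfl, rfl, ?_⟩)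
  have hlt := h.rank_lt hx hy
  by_cases hx' : x.rank n ≤ n
  · right; simp only; omega
  · left
    refine ⟨by simpa using hx', ?_, hlt⟩
    by_contra hy'
    cases x with
    | pos a => grind [Letter.Valid, Letter.rank_pos]
    | bar a =>
      cases y with
      | bar b => grind [Letter.Valid, Letter.rank_bar]
      | pos b =>
        simp only [Letter.Valid, Letter.rank_bar, Letter.rank_pos] at *
        have := h.toStrict.getElem?_bar (by omega) hx
        have := h.toStrict.getElem?_pos (by omega) hy
        have := lowCount_mono H (show b ≤ n - 1 by omega)
        have := barCount_mono H (show a ≤ n - 1 by omega)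
        omega

/-- The exclusion of `1̄` directly below `1` is (1CC) at `a = 1`. In the wall such a pair would be a
removable `δ`. -/
theorem GoodColumn.cellStep (h : GoodColumn n C) (hn : 2 ≤ n) (hR : n - 2 ≤ R) {x y : Letter} {p : ℕ}
    (hx : C[p]? = some x) (hy : C[p + 1]? = some y) : CellStep n (R, x) (R, y) := by
  refine Or.inl ⟨rfl, hR, h.strict p x y hx hy, ?_⟩
  rintro ⟨e1, e2⟩
  simp only at e1 e2
  subst e1 e2
  have := h.cc 1 (by omega)
  rw [h.toStrict.lowCount_step le_rfl (by omega), h.toStrict.barCount_step le_rfl (by omega),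
    if_pos (List.mem_of_getElem? hx), if_pos (List.mem_of_getElem? hy)] at this
  omega

/-- In rank, the top of `C` is at most the bottom of `C`, which is at most the bottom of `D`. The
exceptional pairs `n`, `n̄` are excluded since `mid` would force `C` to have height one, and then
row weakness makes the two letters equal. This is what makes the wall reduced between blocks. -/
theorem GoodPair.not_above (h : GoodPair n C D) (hC : StrictColumn n C) (hD : StrictColumn n D)
    (hn : 1 ≤ n) {x y : Letter} (hx : x ∈ C.getLast?) (hy : y ∈ D.head?) : ¬ x.Above n y := by
  obtain ⟨C, rfl⟩ := List.getLast?_eq_some_iff.1 hx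
  obtain ⟨D, rfl⟩ := List.head?_eq_some_iff.1 hy
  obtain ⟨z, hz⟩ : ∃ z, (C ++ [x])[0]? = some z := ⟨_, List.getElem?_eq_getElem (by simp)⟩
  have hle := h.rowWeak hC hD hn 0 z y hz rfl
  have hlast : (C ++ [x])[C.length]? = some x := by simp
  have hzx : x.rank n ≤ z.rank n := by
    cases C with
    | nil => cases hz; rfl
    | cons a C =>
      cases hz
      rcases (hC.split_above rfl).1 z (by simp) with h | h <;> omega
  have hle' : z.rank n ≤ y.rank n := by
    rcases hle with rfl | h
    · rfl
    · exact le_of_lt h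
  have key : x.rank n = n → y.rank n = n → x = y := fun e1 e2 => by
    have a1 := hC.index_n hlast e1
    have a2 := hC.index_n hz (by omega)
    have a3 := hD.index_n (p := 0) rfl e2
    have := h.mid (n - 1) (by omega)
    simp only [List.length_append, List.length_singleton] at *
    obtain rfl := List.length_eq_zero_iff.1 (show C.length = 0 by omega)
    cases hz
    exact hle.resolve_right fun h => by unfold Letter.Lt at h; omega
  rintro (h | ⟨rfl, rfl⟩ | ⟨rfl, rfl⟩)
  · unfold Letter.Lt at h; omega
  · simpa using key (by simp) (by simp; omega)
  · simpa using key (by simp; omega) (by simp)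

theorem isChain_map_of {α β : Type} {r : β → β → Prop} {g : α → β} {l : List α}
    (h : ∀ (p : ℕ) (x y : α), l[p]? = some x → l[p + 1]? = some y → r (g x) (g y)) :
    (l.map g).IsChain r := by
  rw [List.isChain_map]
  exact isChain_iff_getElem?.2 h

theorem colsCells_chain (hn : 4 ≤ n) (hc : M.IsChain (GoodPair n)) (hg : ∀ C ∈ M, GoodColumn n C)
    (h0 : ∀ C ∈ M, C ≠ []) (hR : n - 2 ≤ R ∨ R = 0 ∧ ∀ H ∈ M.getLast?, HalfColumn n H) :
    (colsCells n R M).IsChain (CellStep n) := by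
  induction M with
  | nil => simp [colsCells]
  | cons C M ih =>
    have hgC := hg C (by simp)
    rw [colsCells, List.isChain_append]
    have hR' : n - 2 ≤ R ∨ R = 0 ∧ ∀ H ∈ M.getLast?, HalfColumn n H := by grind
    refine ⟨isChain_map_of fun p x y hx hy => ?_, ih hc.of_cons (fun C h => hg C (by simp [h]))
      (fun C h => h0 C (by simp [h])) hR', ?_⟩
    · by_cases hb : n - 2 ≤ R + M.length * (2 * n - 4)
      · exact hgC.cellStep (by omega) hb hx hy
      · cases M with
        | cons D M => grind [List.length_cons, Nat.add_mul]
        | nil =>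
          simp only [List.length_nil, Nat.zero_mul, Nat.add_zero] at hb ⊢
          obtain ⟨rfl, h⟩ := hR.resolve_left hb
          exact (h C (by simp)).cellStep hx hy
    · intro a ha b hb
      cases M with
      | nil => simp [colsCells] at hb
      | cons D M =>
        have hD0 := h0 D (by simp)
        obtain ⟨d, D, rfl⟩ := List.exists_cons_of_ne_nil hD0
        have hgD := hg (d :: D) (by simp)
        rw [List.getLast?_map] at ha
        obtain ⟨x, hx, rfl⟩ := Option.mem_map.1 ha
        simp only [colsCells, List.map_cons, List.cons_append, List.head?_cons,
          Option.mem_some_iff] at hb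
        subst hb
        refine Or.inr (Or.inl ⟨?_, ((List.isChain_cons_cons.1 hc).1).not_above hgC.toStrict
          hgD.toStrict (by omega) hx rfl, fun h => ?_⟩)
        · grind
        · simp only at h
          obtain ⟨h1, h2⟩ := hR.resolve_left (by omega)
          have : M = [] := by grind [Nat.mul_eq_zero, List.length_eq_zero_iff]
          subst this
          exact (h2 (d :: D) (by simp)).bottom_rank rfl

theorem IsTableau.nonempty (hT : IsTableau n m T) (hn : 2 ≤ n) : ∀ C ∈ T.allCols, C ≠ [] := by
  intro C hC e
  subst e
  obtain ⟨h1, h2, h3⟩ := (isTableau_iff hn).1 hT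
  rcases List.mem_append.1 hC with h | h
  · have := heights_mem (m := m) hn (h := 0) (by grind)
    omega
  · have := (h3.half [] (by simpa using h)).length_eq
    simp at this; omega

theorem phase_levelOne_spin (hs : HasSpin n m) (hn : 4 ≤ n) (j : ℕ) :
    phase n (levelOne n m) (j * (2 * n - 4)) = n - 2 := by
  have : (j * (2 * n - 4) + (n - 2)) % (2 * n - 4) = n - 2 := by
    rw [Nat.add_comm, Nat.add_mul_mod_self_right, Nat.mod_eq_of_lt (by omega)]
  grind [levelOne, phase]

theorem phase_levelOne (hs : ¬ HasSpin n m) (r : ℕ) :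
    phase n (levelOne n m) r = r % (2 * n - 4) := by grind [levelOne, phase]

/-- The choice between `Λ_{n-1}` and `Λ_n` by the parity of the total height lets the ground colours
of the last `n` columns alternate just as `SignOK` prescribes for `n` and `n̄`. -/
theorem levelOne_color_spin (hs : HasSpin n m) (hn : 4 ≤ n) (p : ℕ) :
    color n (levelOne n m) ((heights n m).sum + p) 0 .front =
      (by classical exact if (Even p ↔ IsPlus n m) then n - 1 else n) := by
  classical
  have h := phase_levelOne_spin hs hn 0
  grind [color, heights, Even, levelOne]

theorem levelOne_color (hs : ¬ HasSpin n m) (hn : 4 ≤ n) (p : ℕ) :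
    color n (levelOne n m) ((heights n m).sum + p) 0 .back = if p % 2 = 0 then 0 else 1 := by
  grind [phase_levelOne, Nat.zero_mod, color, heights, Even, levelOne]

/-- Steps inside a column come from strictness or from the structure of half-columns, steps between
columns from `GoodPair.not_above`. `anchor` is the agreement of the sign condition with the ground
colours; `first` and `last` hold because a half-column begins with rank at least `n` and ends with
rank at most `n`. -/
theorem IsTableau.goodCells (hT : IsTableau n m T) (hn : 4 ≤ n) :
    GoodCells n (levelOne n m) (tableauCells n T) := by
  have h0 := hT.nonempty (by omega)
  obtain ⟨h1, h2, h3⟩ := (isTableau_iff (by omega)).1 hT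
  have hgood : ∀ C ∈ T.allCols, GoodColumn n C := fun C hC => by
    rcases List.mem_append.1 hC with h | h
    · exact h3.cols C h
    · exact (h3.half C (by simpa using h)).toGoodColumn
  have hchain := h3.chain
  have hsign := h3.sign
  obtain ⟨cols, half⟩ := T
  cases half with
  | none =>
    have hs : ¬ HasSpin n m := fun h => by simpa using h2.2 h
    have e : tableauCells n ⟨cols, none⟩ = colsCells n (n - 2) cols := by
      simp [tableauCells, Tableau.allCols]
    simp only [Tableau.allCols, Option.toList_none, List.append_nil] at *
    have hmid : ∀ j, phase n (levelOne n m) (n - 2 + j * (2 * n - 4)) = n - 2 := fun j => by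
      rw [phase_levelOne hs, Nat.add_mul_mod_self_right, Nat.mod_eq_of_lt (by omega)]
    rw [e]
    have hne : ∀ k x, (colsCells n (n - 2) cols)[k]? ≠ some (0, x) := fun k x h => by
      obtain ⟨C, -, -, j, hj⟩ := mem_colsCells (List.mem_of_getElem? h)
      simp only at hj; omega
    refine ⟨fun c hc => ?_, isChain_iff_getElem?.1 (colsCells_chain hn hchain hgood h0 (by simp)),
      fun k x h => (hne k x h).elim, fun x h => (hne 0 x h).elim, Or.inr ⟨?_, ?_, ?_⟩⟩
    · obtain ⟨C, hC, hx, j, hj⟩ := mem_colsCells hc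
      exact ⟨(hgood C hC).valid _ hx, by rw [hj, hmid], Or.inr (by omega)⟩
    · rw [phase_levelOne hs, Nat.zero_mod]
    · rw [colsCells_length, h1]
      exact levelOne_color hs hn 0
    · intro k c hk hc
      rcases List.eq_nil_or_concat cols with rfl | ⟨M, C, rfl⟩
      · simp [colsCells] at hk
      grind [colsCells_append, List.getElem?_append_right, colsCells,
          List.length_nil, List.mem_of_getElem?,
          List.length_pos_iff, List.length_append, List.length_map, List.length_singleton]
  | some H =>
    have hs : HasSpin n m := h2.1 rfl
    have hH := h3.half H rfl
    have e : tableauCells n ⟨cols, some H⟩ = colsCells n (2 * n - 4) cols ++ H.map (0, ·) := by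
      simp [tableauCells, Tableau.allCols, colsCells_append, colsCells]
    have e' : tableauCells n ⟨cols, some H⟩ = colsCells n 0 (cols ++ [H]) := by
      simp [tableauCells, Tableau.allCols]
    simp only [Tableau.allCols, Option.toList_some] at *
    have hlen : (colsCells n (2 * n - 4) cols).length = (heights n m).sum := by
      rw [colsCells_length, h1]
    have hzero : ∀ k x, (tableauCells n ⟨cols, some H⟩)[k]? = some (0, x) →
        ∃ p, k = (heights n m).sum + p ∧ H[p]? = some x := fun k x h => by
      rw [e] at h
      by_cases hk : k < (colsCells n (2 * n - 4) cols).length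
      · rw [List.getElem?_append_left hk] at h
        obtain ⟨C, -, -, j, hj⟩ := mem_colsCells (List.mem_of_getElem? h)
        simp only at hj; omega
      grind
    refine ⟨fun c hc => ?_, ?_, fun k x h hx => ?_, fun x h => ?_, Or.inl ?_⟩
    · rw [e'] at hc
      obtain ⟨C, hC, hx, j, hj⟩ := mem_colsCells hc
      refine ⟨(hgood C hC).valid _ hx, by rw [hj, Nat.zero_add, phase_levelOne_spin hs hn], ?_⟩
      rcases j with _ | j
      · left; simpa using hj
      grind
    · grind [isChain_iff_getElem?, colsCells_chain]
    · obtain ⟨p, rfl, hp⟩ := hzero k x h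
      have hc := levelOne_color_spin hs hn p
      have hS := hsign H (by simp) hH.length_eq p
      have hv := hH.valid _ (List.mem_of_getElem? hp)
      obtain rfl | rfl : x = .pos n ∨ x = .bar n := by
        cases x <;> simp_all <;> omega
      · rw [colOf_pos_n, sideOf, hc, if_pos (hS.1 hp), if_pos rfl]; rfl
      · have : ¬ (Even p ↔ IsPlus n m) := by grind
        rw [colOf_bar_n hn, sideOf, hc, if_neg this, if_pos rfl]; rfl
    · obtain ⟨p, hp, h⟩ := hzero 0 x h
      obtain rfl : p = 0 := by omega
      exact hH.bottom_rank h
    · obtain ⟨x, hx⟩ : ∃ x, H[n - 1]? = some x :=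
        ⟨_, List.getElem?_eq_getElem (by rw [hH.length_eq]; omega)⟩
      refine ⟨(heights n m).sum + (n - 1), x, ?_, ?_, hH.top_rank (by omega) hx⟩
      · rw [e, List.length_append, hlen, List.length_map, hH.length_eq]; omega
      grind

end

end

section

section

variable {n R i k : ℕ} {m : ℕ → ℕ} {T : Tableau} {M : List (List Letter)} {H C D : List Letter}

/-! ### Signatures of tableaux and of their walls -/

theorem cellsWord_cons (c : ℕ × Letter) (cs : List (ℕ × Letter)) :
    cellsWord n i (c :: cs) k = cellsWord n i cs (k + 1) ++ cellSigns n i k c := by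
  simp [cellsWord]

theorem zipIdx_eq_map_shift {α : Type} (l : List α) (k : ℕ) :
    l.zipIdx k = l.zipIdx.map fun x => (x.1, k + x.2) := by
  rw [List.zipIdx_eq_map_add]

/-- The column of the wall corresponding to a box of the `c`-th column. -/
def boxIndex (M : List (List Letter)) (q : ℕ) : Option (ℕ × ℕ) → ℕ
  | some (c, p) => ((M.take c).map List.length).sum + p
  | none => q

theorem columnSignsAt_map (hR : 0 < R) (l M : List (List Letter)) (C : List Letter) (q : ℕ) :
    (columnSignsAt n i (C, l.length)).map (Prod.map id (boxIndex (l ++ M) q)) =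
      cellsWord n i (C.map (R, ·)) (l.map List.length).sum := by
  unfold columnSignsAt cellsWord
  rw [List.zipIdx_map, zipIdx_eq_map_shift C (List.sum _), List.map_map, List.map_flatMap,
    ← List.map_reverse, List.flatMap_map]
  grind [List.flatMap_congr, boxSigns, cellSigns, Prod.map, id, boxIndex]

theorem colsSigns_map (hR : 0 < R) (M l : List (List Letter)) (q : ℕ) :
    ((M.zipIdx l.length).reverse.flatMap (columnSignsAt n i)).map
        (Prod.map id (boxIndex (l ++ M) q)) =
      cellsWord n i (colsCells n R M) (l.map List.length).sum := by
  induction M generalizing l with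
  | nil => simp [colsCells, cellsWord]
  | cons C M ih =>
    have := ih (l ++ [C])
    simp only [List.append_assoc, List.singleton_append, List.length_append, List.length_singleton,
      List.map_append, List.sum_append, List.map_singleton, List.sum_singleton] at this
    rw [colsCells, cellsWord_append, List.zipIdx_cons, List.reverse_cons, List.flatMap_append,
      List.map_append, this, List.length_map, List.flatMap_singleton,
      columnSignsAt_map (R := R + M.length * (2 * n - 4)) (by omega)]

theorem cellsWord_eq_nil {cs : List (ℕ × Letter)} (h : ∀ c ∈ cs, ∀ k, cellSigns n i k c = []) :
    cellsWord n i cs k = [] := by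
  induction cs generalizing k with
  | nil => rfl
  | cons c cs ih =>
    grind [cellsWord_cons]

/-- Of the four letters with a sign only `j̄` and `downLetter` remain: `j` is hidden in the ground,
and `upLetter` has rank at most `n`, so its column has no block to remove. -/
theorem cellSigns_half (hn : 2 ≤ n) (h1 : 1 ≤ i) (hi : i ≤ n) (x : Letter) (k : ℕ) :
    cellSigns n i k (0, x) = if x = .bar (lowIdx n i) then [(.minus, k)] else
      if x = downLetter n i then [(.plus, k)] else [] := by
  grind [lowIdx_lt, rank_upLetter, rank_downLetter, lowIdx, Letter.rank_bar, Letter.rank_pos,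
      letter_e_isSome, downLetter, letter_f_isSome, cellSigns]

theorem cellsWord_half_eq_nil (hn : 2 ≤ n) (h1 : 1 ≤ i) (hi : i ≤ n)
    (hb : Letter.bar (lowIdx n i) ∉ H) (hd : downLetter n i ∉ H) :
    cellsWord n i (H.map (0, ·)) k = [] := by
  grind [cellsWord_eq_nil, cellSigns_half]

/-- The letters `x, x'` of a half-column are replaced by `y, y'`. -/
def HalfMove (n : ℕ) (H H' : List Letter) (p : ℕ) (x y : Letter) : Prop :=
  ∃ lo mid hi x' y', H = lo ++ x :: (mid ++ x' :: hi) ∧ H' = lo ++ y :: (mid ++ y' :: hi) ∧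
    p = lo.length ∧ n ≤ y.rank n ∧ x'.rank n ≤ n ∧ y'.rank n ≤ n

/-- The wall shows only the barred half of each double move of a spin crystal, but exactly one of
`j`, `j̄` and one of `upLetter`, `downLetter` occur, so the visible letters determine the sign. If
`j̄` and `downLetter` both occur, neither spin operator applies, and their signs in the wall cancel.
-/
theorem HalfColumn.spin_word (h : HalfColumn n H) (hn : 2 ≤ n) (h1 : 1 ≤ i) (hi : i ≤ n) (k : ℕ) :
    ∃ p, WordEquiv ((spinSigns n i H).map (Prod.map id fun _ => k + p))
        (cellsWord n i (H.map (0, ·)) k) ∧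
      (∀ H', spinF n i H = some H' →
        HalfMove n H H' p (downLetter n i) (.bar (lowIdx n i))) ∧
      (∀ H', spinE n i H = some H' →
        HalfMove n H H' p (.bar (lowIdx n i)) (downLetter n i)) := by
  have hj := lowIdx_lt (i := i) hn
  have hu := rank_upLetter (i := i) hn hi
  have hd := rank_downLetter (i := i) hn hi
  have hnd := h.nodup hn
  have hb : (Letter.bar (lowIdx n i)).rank n = 2 * n - lowIdx n i := Letter.rank_bar ..
  have hl : (Letter.pos (lowIdx n i)).rank n = lowIdx n i := Letter.rank_pos ..
  have hno := h.not_both_spin hn h1 hi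
  have hne : Letter.bar (lowIdx n i) ≠ downLetter n i := fun e => by rw [e] at hb; omega
  have single : ∀ {lo hi' : List Letter} {x : Letter}, H = lo ++ x :: hi' →
      (Letter.bar (lowIdx n i) ∈ H → x = .bar (lowIdx n i)) →
      (downLetter n i ∈ H → x = downLetter n i) → cellsWord n i (H.map (0, ·)) k =
        cellSigns n i (k + lo.length) (0, x) := by
    grind [List.nodup_append, List.nodup_cons, cellsWord_append,
        cellsWord_cons, cellsWord_half_eq_nil, List.length_map]
  by_cases hF : (spinF n i H).isSome
  · have hE : ¬ (spinE n i H).isSome := fun hE => hno ⟨hE, hF⟩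
    obtain ⟨m1, m2⟩ := (h.spinF_isSome hn h1 hi).1 hF
    obtain ⟨lo, mid, hi', e⟩ := h.exists_split_down hn h1 hi hF
    refine ⟨lo.length, ?_, fun H' hH' => ?_, fun H' hH' => absurd (by rw [hH']; rfl) hE⟩
    · rw [single e (fun hm => (h.not_both hn _ ⟨m1, hm⟩).elim) (fun _ => rfl),
        cellSigns_half hn h1 hi, if_neg hne.symm, if_pos rfl, spinSigns, if_neg hE, if_pos hF]
      exact WordEquiv.refl _
    · subst e
      rw [HalfColumn.spinF_eq hn h1 hi h] at hH'
      cases hH'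
      exact ⟨lo, mid, hi', _, _, rfl, rfl, rfl, by omega, by omega, by omega⟩
  by_cases hE : (spinE n i H).isSome
  · obtain ⟨m1, m2⟩ := (h.spinE_isSome hn h1 hi).1 hE
    obtain ⟨lo, mid, hi', e⟩ := h.exists_split_up hn h1 hi hE
    have hdn : downLetter n i ∉ H := fun hm => by
      have := h.bits hn h1 hi
      have := h.bit_mem hn h1 hi
      simp_all
    refine ⟨lo.length, ?_, fun H' hH' => absurd (by rw [hH']; rfl) hF, fun H' hH' => ?_⟩
    · grind [cellSigns_half, spinSigns, WordEquiv.refl]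
    · subst e
      rw [HalfColumn.spinE_eq hn h1 hi h] at hH'
      cases hH'
      exact ⟨lo, mid, hi', _, _, rfl, rfl, rfl, by omega, by omega, by omega⟩
  · refine ⟨0, ?_, fun H' hH' => absurd (by rw [hH']; rfl) hF,
      fun H' hH' => absurd (by rw [hH']; rfl) hE⟩
    rw [spinSigns, if_neg hE, if_neg hF]
    have hiff : Letter.bar (lowIdx n i) ∈ H ↔ downLetter n i ∈ H := by
      have hb1 := h.bits hn h1 hi
      obtain ⟨b1, b2, b3, b4⟩ := h.bit_mem hn h1 hi
      rw [h.spinF_isSome hn h1 hi, ← b1, ← b4] at hF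
      rw [h.spinE_isSome hn h1 hi, ← b2, ← b3] at hE
      rw [← b2, ← b4]
      omega
    by_cases hm : Letter.bar (lowIdx n i) ∈ H
    · obtain ⟨lo, r, e⟩ := List.append_of_mem hm
      have hdr : downLetter n i ∈ r := by
        have hm' := hiff.1 hm
        rw [e, List.mem_append, List.mem_cons] at hm'
        refine (hm'.resolve_left fun h5 => ?_).resolve_left hne.symm
        have := (h.toStrict.split_above e).1 _ h5
        unfold Letter.WeakAbove at this; omega
      obtain ⟨mid, hi', rfl⟩ := List.append_of_mem hdr
      have hnd' := hnd
      rw [e] at hnd'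
      have hnil : ∀ (l : List Letter) k', (∀ x ∈ l, x ≠ .bar (lowIdx n i) ∧ x ≠ downLetter n i) →
          cellsWord n i (l.map (0, ·)) k' = [] := fun l k' hl =>
        cellsWord_half_eq_nil hn h1 hi (fun h => (hl _ h).1 rfl) (fun h => (hl _ h).2 rfl)
      simp only [List.nodup_append, List.nodup_cons, List.mem_append, List.mem_cons] at hnd'
      rw [e]
      simp only [List.map_append, List.map_cons, cellsWord_append, cellsWord_cons,
        cellSigns_half hn h1 hi, if_pos rfl, if_neg hne.symm]
      rw [hnil lo, hnil mid, hnil hi']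
      -- `downLetter` stands above `j̄`, so its `+` is read immediately before the `-`.
      · exact fun st => (wordEquiv_cancel _ _ [] st).symm
      all_goals
        rintro x hx
        constructor <;> rintro rfl <;> grind
    grind [cellsWord_half_eq_nil, WordEquiv.refl]

theorem tableauCells_none (cols : List (List Letter)) :
    tableauCells n ⟨cols, none⟩ = colsCells n (n - 2) cols := by
  simp [tableauCells, Tableau.allCols]

theorem tableauCells_some (cols : List (List Letter)) (H : List Letter) :
    tableauCells n ⟨cols, some H⟩ = colsCells n (2 * n - 4) cols ++ H.map (0, ·) := by
  simp [tableauCells, Tableau.allCols, colsCells_append, colsCells]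

theorem tableauCells_eq (T : Tableau) : tableauCells n T =
    colsCells n (if T.half.isSome then 2 * n - 4 else n - 2) T.cols ++
      T.half.toList.flatMap fun H => H.map (0, ·) := by
  obtain ⟨cols, _ | H⟩ := T
  · simp [tableauCells_none]
  · simp [tableauCells_some]

/-- For the full columns the two words agree sign by sign, since all their letters are visible; only
the half-column needs a cancellation. The number `p` marks the one column of the wall that a move of
the half-column changes. -/
theorem IsTableau.tableau_word (hT : IsTableau n m T) (hn : 4 ≤ n) (h1 : 1 ≤ i) (hi : i ≤ n) :
    ∃ p, WordEquiv ((tableauSigns n i T).map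
        (Prod.map id (boxIndex T.cols ((heights n m).sum + p))))
        (wallSigns n (levelOne n m) i (tableauWall n (levelOne n m) T)) ∧
      ∀ H ∈ T.half, (∀ H', spinF n i H = some H' →
          HalfMove n H H' p (downLetter n i) (.bar (lowIdx n i))) ∧
        (∀ H', spinE n i H = some H' →
          HalfMove n H H' p (.bar (lowIdx n i)) (downLetter n i)) := by
  obtain ⟨hs, -, hg⟩ := (isTableau_iff (by omega)).1 hT
  have hw := (hT.goodCells hn).wordEquiv hn h1 hi
  have hcols : ∀ R q, 0 < R → _ := fun R q hR => colsSigns_map (n := n) (i := i) hR T.cols [] q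
  simp only [List.nil_append, List.length_nil, List.map_nil, List.sum_nil] at hcols
  obtain ⟨cols, _ | H⟩ := T
  · refine ⟨0, ?_, by simp⟩
    grind [tableauCells_none, tableauSigns_eq, Option.toList_none, tableauWall]
  · obtain ⟨p, e1, e2⟩ := (hg.half H rfl).spin_word (by omega) h1 hi (heights n m).sum
    refine ⟨p, ?_, by simpa using e2⟩
    rw [tableauCells_some] at hw
    rw [tableauSigns_eq, List.map_append, tableauWall, tableauCells_some]
    refine WordEquiv.trans ?_ hw
    rw [cellsWord_append, hcols (2 * n - 4) _ (by omega)]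
    grind [WordEquiv.append, WordEquiv.refl, colsCells_length, spinSigns, Prod.map, id, boxIndex,
        heights]

/-! ### Kashiwara operators on tableaux and on their walls -/

theorem wallOf_replace {L : Level1} (A B : List (ℕ × Letter)) (c c' : ℕ × Letter) :
    wallOf n L (A ++ c' :: B) =
      setColumn (wallOf n L (A ++ c :: B)) A.length (cellCol n L A.length c') := by
  grind [wallOf, setColumn, setColumn_of_ne, Nat.lt_or_gt_of_ne, List.getElem?_append_left,
      Nat.exists_eq_add_of_lt, List.getElem?_append_right]

theorem setColumn_eq_self {Y : Wall} {c : Column} (h : Y k = c) : setColumn Y k c = Y := by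
  grind [setColumn]

/-- Changing the letter of one box of a tableau. -/
theorem tableauWall_box {L : Level1} (hn : 4 ≤ n) (l r : List (List Letter)) (lo hi : List Letter)
    (x y : Letter) (K : Option (List Letter)) (q : ℕ) : ∃ R,
    (tableauCells n ⟨l ++ (lo ++ x :: hi) :: r, K⟩)[boxIndex (l ++ (lo ++ x :: hi) :: r) q
        (some (l.length, lo.length))]? = some (R, x) ∧
    R = (if K.isSome then 2 * n - 4 else n - 2) + r.length * (2 * n - 4) ∧
    tableauWall n L ⟨l ++ (lo ++ y :: hi) :: r, K⟩ =
      setColumn (tableauWall n L ⟨l ++ (lo ++ x :: hi) :: r, K⟩)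
        (boxIndex (l ++ (lo ++ x :: hi) :: r) q (some (l.length, lo.length)))
        (colOf n L (boxIndex (l ++ (lo ++ x :: hi) :: r) q (some (l.length, lo.length))) R y) := by
  obtain ⟨A, B, R, hR, hR', hA, e⟩ : ∃ A B R, n - 2 ≤ R ∧
      R = (if K.isSome then 2 * n - 4 else n - 2) + r.length * (2 * n - 4) ∧
      A.length = boxIndex (l ++ (lo ++ x :: hi) :: r) q (some (l.length, lo.length)) ∧
      ∀ z, tableauCells n ⟨l ++ (lo ++ z :: hi) :: r, K⟩ = A ++ (R, z) :: B := by
    obtain ⟨R₀, hR₀, e⟩ : ∃ R₀, n - 2 ≤ R₀ ∧ R₀ = if K.isSome then 2 * n - 4 else n - 2 :=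
      ⟨_, by split_ifs <;> omega, rfl⟩
    refine ⟨colsCells n (R₀ + (r.length + 1) * (2 * n - 4)) l ++
        lo.map (R₀ + r.length * (2 * n - 4), ·), hi.map (R₀ + r.length * (2 * n - 4), ·) ++
        (colsCells n R₀ r ++ K.toList.flatMap fun H => H.map (0, ·)),
      R₀ + r.length * (2 * n - 4), by omega, by rw [e], by simp [boxIndex, colsCells_length], fun z => ?_⟩
    rw [tableauCells_eq]
    simp [colsCells_append, colsCells, ← e]
  grind [tableauWall, wallOf_replace, cellCol]

/-- Changing the letters of the half-column of a tableau. -/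
theorem tableauWall_half {cols : List (List Letter)} {H H' : List Letter} {p : ℕ} {x y : Letter}
    (hn : 4 ≤ n) (hT : IsTableau n m ⟨cols, some H⟩) (hT' : IsTableau n m ⟨cols, some H'⟩)
    (h : HalfMove n H H' p x y) :
    (tableauCells n ⟨cols, some H⟩)[(heights n m).sum + p]? = some (0, x) ∧
      tableauWall n (levelOne n m) ⟨cols, some H'⟩ =
        setColumn (tableauWall n (levelOne n m) ⟨cols, some H⟩) ((heights n m).sum + p)
          (colOf n (levelOne n m) ((heights n m).sum + p) 0 y) := by
  obtain ⟨lo, mid, hi, x', y', rfl, rfl, rfl, hy, hx', hy'⟩ := h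
  have hg := hT.goodCells hn
  have hg' := hT'.goodCells hn
  have hlen : (heights n m).sum = (colsCells n (2 * n - 4) cols).length := by
    rw [colsCells_length, hT.shape]
  have e : ∀ z z', tableauCells n ⟨cols, some (lo ++ z :: (mid ++ z' :: hi))⟩ =
      (colsCells n (2 * n - 4) cols ++ lo.map (0, ·)) ++ (0, z) ::
        (mid.map (0, ·) ++ (0, z') :: hi.map (0, ·)) := fun z z' => by
    rw [tableauCells_some]; simp
  have e' : ∀ z z', tableauCells n ⟨cols, some (lo ++ z :: (mid ++ z' :: hi))⟩ =
      (colsCells n (2 * n - 4) cols ++ lo.map (0, ·) ++ (0, z) :: mid.map (0, ·)) ++ (0, z') ::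
        hi.map (0, ·) := fun z z' => by
    rw [tableauCells_some]; simp
  have hp : (heights n m).sum + lo.length =
      (colsCells n (2 * n - 4) cols ++ lo.map ((0 : ℕ), ·)).length := by simp [hlen]
  refine ⟨by rw [e, hp]; simp, ?_⟩
  have k1 : (tableauCells n ⟨cols, some (lo ++ x :: (mid ++ x' :: hi))⟩)[(colsCells n (2 * n - 4)
      cols ++ lo.map (0, ·) ++ (0, x) :: mid.map (0, ·)).length]? = some (0, x') := by
    rw [e']; simp
  have k2 : (tableauCells n ⟨cols, some (lo ++ y :: (mid ++ y' :: hi))⟩)[(colsCells n (2 * n - 4)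
      cols ++ lo.map (0, ·) ++ (0, y) :: mid.map (0, ·)).length]? = some (0, y') := by
    rw [e']; simp
  -- The second letter of the move has rank at most `n` before and after it, so its column is a
  -- ground column both times and only one column of the wall changes.
  have g1 := hg.ground_self hn k1 hx'
  have g2 := hg'.ground_self hn k2 hy'
  unfold tableauWall
  rw [← setColumn_eq_self g2, e', wallOf_replace _ _ (0, x') (0, y'), ← e' y x', e y x',
    wallOf_replace _ _ (0, x) (0, y), ← e x x', ← hp]
  grind [colsCells, heights, List.length_append, setColumn, ground, setColumn_eq_self, cellCol]

end

end

/-! ### The wall of a tableau and the Kashiwara operators -/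

section

section

variable {n i k : ℕ} {m : ℕ → ℕ} {T : Tableau}

theorem mem_wallSigns {L : Level1} {Y : Wall} {s : Sign} (h : (s, k) ∈ wallSigns n L i Y) :
    (s = .minus ∧ (removeAt n L i Y k).isSome) ∨ (s = .plus ∧ (addAt n L i Y k).isSome) := by
  obtain ⟨j, -, hj⟩ := List.mem_flatMap.1 h
  grind [columnSigns]

theorem mem_spinSigns {H : List Letter} {s : Sign} {x : Option (ℕ × ℕ)}
    (h : (s, x) ∈ spinSigns n i H) :
    x = none ∧ ((s = .minus ∧ (spinE n i H).isSome) ∨ (s = .plus ∧ (spinF n i H).isSome)) := by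
  grind [spinSigns]

theorem applyAt_box {g : Letter → Option Letter} {gs : List Letter → Option (List Letter)}
    {l r : List (List Letter)} {lo hi : List Letter} {x y : Letter} (K : Option (List Letter))
    (h : g x = some y) :
    applyAt g gs ⟨l ++ (lo ++ x :: hi) :: r, K⟩ (some (l.length, lo.length)) =
      ⟨l ++ (lo ++ y :: hi) :: r, K⟩ := by
  simp only [applyAt, modify_append_cons, h, Option.getD_some]

theorem IsTableau.wall_eps_phi (hT : IsTableau n m T) (hn : 4 ≤ n) (h1 : 1 ≤ i) (hi : i ≤ n) :
    (wallCrystal n (levelOne n m)).eps i (tableauWall n (levelOne n m) T) =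
        (tableauCrystal n).eps i T ∧
      (wallCrystal n (levelOne n m)).phi i (tableauWall n (levelOne n m) T) =
        (tableauCrystal n).phi i T := by
  obtain ⟨p, hw, -⟩ := hT.tableau_word hn h1 hi
  have hs := hw.signature_eq
  simp only [wallCrystal, tableauCrystal, countMinus, countPlus, ← hs, signature_map,
    List.countP_map]
  exact ⟨rfl, rfl⟩

/-- Equivalent words select corresponding positions. There the wall changes the column of one letter
by `f̃_i`, and this is the wall of the tableau changed at that position. -/
theorem IsTableau.wall_f (hT : IsTableau n m T) (hn : 4 ≤ n) (h1 : 1 ≤ i) (hi : i ≤ n) :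
    (wallCrystal n (levelOne n m)).f i (tableauWall n (levelOne n m) T) =
      ((tableauCrystal n).f i T).map (tableauWall n (levelOne n m)) := by
  obtain ⟨p, hw, hhalf⟩ := hT.tableau_word hn h1 hi
  have hlp : leftmostPlus (wallSigns n (levelOne n m) i (tableauWall n (levelOne n m) T)) =
      (leftmostPlus (tableauSigns n i T)).map (boxIndex T.cols ((heights n m).sum + p)) := by
    rw [← leftmostPlus_map, leftmostPlus, leftmostPlus, hw.signature_eq]
  have hfT : (tableauCrystal n).f i T =
    (leftmostPlus (tableauSigns n i T)).map (applyAt (Letter.f n i) (spinF n i) T) := rfl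
  show (leftmostPlus _).bind _ = _
  rw [hlp]
  cases hx : leftmostPlus (tableauSigns n i T) with
  | none => rw [hfT, hx]; rfl
  | some x =>
    rw [hx] at hlp hfT
    rw [hfT]
    have hT' := hT.f_stable (by omega) h1 hi hfT
    simp only [Option.map_some, Option.bind_some] at hlp ⊢
    obtain ⟨u, v, e, -⟩ := (leftmostPlus_eq_some_iff _ _).1 hlp
    have hadd := mem_wallSigns (n := n) (L := levelOne n m) (i := i)
      (Y := tableauWall n (levelOne n m) T) (s := .plus)
      (k := boxIndex T.cols ((heights n m).sum + p) x) (by rw [e]; simp)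
    simp only [reduceCtorEq, false_and, true_and, false_or, Option.isSome_iff_exists] at hadd
    obtain ⟨Y', hY'⟩ := hadd
    rw [hY']
    obtain ⟨R, a, b, hk, -, hab, rfl, -⟩ := ((hT.goodCells hn).addAt_iff hn h1 hi).1 hY'
    obtain ⟨u', v', e', -⟩ := (leftmostPlus_eq_some_iff _ _).1 hx
    congr 1
    rcases tableauSigns_split (by omega) h1 hi e' with ⟨H, v₂, hH, e₂, -⟩ |
      ⟨l, lo, z, hi', r, hc, rfl, hz, -⟩
    · obtain ⟨rfl, hs⟩ := mem_spinSigns (n := n) (i := i) (H := H) (x := x) (s := .plus)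
        (by rw [e₂]; simp)
      simp only [reduceCtorEq, false_and, true_and, false_or, Option.isSome_iff_exists] at hs
      obtain ⟨H', hs⟩ := hs
      obtain ⟨cols, half⟩ := T
      subst hH
      simp only [applyAt, Option.map_some, hs, Option.getD_some] at hT' ⊢
      obtain ⟨q1, q2⟩ := tableauWall_half hn hT hT' ((hhalf H rfl).1 H' hs)
      rw [boxIndex] at hk
      rw [hk] at q1
      cases q1
      obtain rfl : b = .bar (lowIdx n i) := by
        rw [(letter_f_eq_some (by omega) h1 hi).2 (Or.inr ⟨rfl, rfl⟩)] at hab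
        cases hab; rfl
      rw [q2]; rfl
    · obtain ⟨cols, half⟩ := T
      subst hc
      obtain ⟨R', q1, -, q2⟩ := tableauWall_box (L := levelOne n m) hn l r lo hi' z b half
        ((heights n m).sum + p)
      rw [hk] at q1
      cases q1
      rw [applyAt_box half hab, q2]; rfl

theorem IsTableau.wall_e (hT : IsTableau n m T) (hn : 4 ≤ n) (h1 : 1 ≤ i) (hi : i ≤ n) :
    (wallCrystal n (levelOne n m)).e i (tableauWall n (levelOne n m) T) =
      ((tableauCrystal n).e i T).map (tableauWall n (levelOne n m)) := by
  obtain ⟨p, hw, hhalf⟩ := hT.tableau_word hn h1 hi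
  have hlp : rightmostMinus (wallSigns n (levelOne n m) i (tableauWall n (levelOne n m) T)) =
      (rightmostMinus (tableauSigns n i T)).map (boxIndex T.cols ((heights n m).sum + p)) := by
    rw [← rightmostMinus_map, rightmostMinus, rightmostMinus, hw.signature_eq]
  have hfT : (tableauCrystal n).e i T =
    (rightmostMinus (tableauSigns n i T)).map (applyAt (Letter.e n i) (spinE n i) T) := rfl
  show (rightmostMinus _).bind _ = _
  rw [hlp]
  cases hx : rightmostMinus (tableauSigns n i T) with
  | none => rw [hfT, hx]; rfl
  | some x =>
    rw [hx] at hlp hfT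
    rw [hfT]
    have hT' := hT.e_stable (by omega) h1 hi hfT
    simp only [Option.map_some, Option.bind_some] at hlp ⊢
    obtain ⟨u, v, e, -⟩ := (rightmostMinus_eq_some_iff _ _).1 hlp
    have hadd := mem_wallSigns (n := n) (L := levelOne n m) (i := i)
      (Y := tableauWall n (levelOne n m) T) (s := .minus)
      (k := boxIndex T.cols ((heights n m).sum + p) x) (by rw [e]; simp)
    simp only [reduceCtorEq, false_and, true_and, or_false, Option.isSome_iff_exists] at hadd
    obtain ⟨Y', hY'⟩ := hadd
    rw [hY']
    obtain ⟨R, a, b, hk, -, hab, rfl, -⟩ := ((hT.goodCells hn).removeAt_iff hn h1 hi).1 hY'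
    obtain ⟨u', v', e', -⟩ := (rightmostMinus_eq_some_iff _ _).1 hx
    congr 1
    rcases tableauSigns_split (by omega) h1 hi e' with ⟨H, v₂, hH, e₂, -⟩ |
      ⟨l, lo, z, hi', r, hc, rfl, hz, -⟩
    · obtain ⟨rfl, hs⟩ := mem_spinSigns (n := n) (i := i) (H := H) (x := x) (s := .minus)
        (by rw [e₂]; simp)
      simp only [reduceCtorEq, false_and, true_and, or_false, Option.isSome_iff_exists] at hs
      obtain ⟨H', hs⟩ := hs
      obtain ⟨cols, half⟩ := T
      subst hH
      simp only [applyAt, Option.map_some, hs, Option.getD_some] at hT' ⊢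
      obtain ⟨q1, q2⟩ := tableauWall_half hn hT hT' ((hhalf H rfl).2 H' hs)
      rw [boxIndex] at hk
      rw [hk] at q1
      cases q1
      obtain rfl : b = downLetter n i := by
        rw [(letter_e_eq_some (by omega) h1 hi).2 (Or.inr ⟨rfl, rfl⟩)] at hab
        cases hab; rfl
      rw [q2]; rfl
    · obtain ⟨cols, half⟩ := T
      subst hc
      obtain ⟨R', q1, -, q2⟩ := tableauWall_box (L := levelOne n m) hn l r lo hi' z b half
        ((heights n m).sum + p)
      rw [hk] at q1
      cases q1
      rw [applyAt_box half hab, q2]; rfl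

end

end

section

section

variable {n i k : ℕ} {m : ℕ → ℕ} {T : Tableau} {H C : List Letter}

/-! ### The tableau of the wall of a tableau -/

theorem IsTableau.cols_getElem? (hT : IsTableau n m T) (hn : 4 ≤ n) {b a : ℕ} {x : Letter}
    (hC : T.cols[b]? = some C) (hx : C[a]? = some x) : ∃ R,
    (tableauCells n T)[blockStart n m b + a]? = some (R, x) ∧
      R = baseRow n m b + (n - 2) := by
  obtain ⟨hs, h2, -⟩ := (isTableau_iff (by omega)).1 hT
  obtain ⟨hb, hbC⟩ := List.getElem?_eq_some_iff.1 hC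
  obtain ⟨lo, hi, hlo, rfl⟩ := StrictColumn.exists_split hx
  obtain ⟨l, r, hl, rfl⟩ : ∃ l r, T.cols = l ++ (lo ++ x :: hi) :: r ∧ l.length = b := by
    refine ⟨T.cols.take b, T.cols.drop (b + 1), ?_, by simp; omega⟩
    rw [← hlo, ← hbC, ← List.drop_eq_getElem_cons hb, List.take_append_drop]
  obtain ⟨cols, half⟩ := T
  subst hl
  obtain ⟨R, h1, hR, -⟩ := tableauWall_box (L := .L0) hn l r lo hi x x half 0
  refine ⟨R, ?_, ?_⟩
  · rw [blockStart, ← hs, ← List.map_take]; exact h1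
  grind [HasSpin, baseRow, List.length_map, List.length_append, List.length_cons]

theorem HalfColumn.rank_pairwise (h : HalfColumn n H) (hn : 4 ≤ n) :
    H.Pairwise fun x y => y.rank n < x.rank n := by
  have : IsTrans Letter fun x y => y.rank n < x.rank n := ⟨fun _ _ _ h1 h2 => h2.trans h1⟩
  rw [← List.isChain_iff_pairwise, isChain_iff_getElem?]
  exact fun p x y => h.rank_lt

theorem HalfColumn.pos_mem_iff (h : HalfColumn n H) (hn : 4 ≤ n) {j : ℕ} (h1 : 1 ≤ j) (hj : j ≤ n) :
    Letter.pos j ∈ H ↔ Letter.bar j ∉ H := by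
  refine ⟨fun h2 h3 => h.not_both (by omega) j ⟨h2, h3⟩, fun h2 => ?_⟩
  obtain ⟨b1, b2⟩ := h.bits (i := j) (by omega) h1 hj
  obtain ⟨c1, c2, c3, c4⟩ := h.bit_mem (i := j) (by omega) h1 hj
  grind [lowIdx, upLetter, downLetter]

/-- The columns with added blocks are exactly those of letters of rank greater than `n`, and from
these the letter can be read off. -/
theorem IsTableau.half_column_wall (hT : IsTableau n m T) (hn : 4 ≤ n) (hH : T.half = some H)
    {a : ℕ} {x : Letter} (hx : H[a]? = some x) :
    (x.rank n ≤ n → tableauWall n (levelOne n m) T ((heights n m).sum + a) = ground) ∧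
    (n < x.rank n → tableauWall n (levelOne n m) T ((heights n m).sum + a) =
        colOf n (levelOne n m) ((heights n m).sum + a) 0 x ∧
      tableauWall n (levelOne n m) T ((heights n m).sum + a) ≠ ground ∧
      letterOf n (levelOne n m) ((heights n m).sum + a)
        (tableauWall n (levelOne n m) T ((heights n m).sum + a)) = x) := by
  have hg := hT.goodCells hn
  have hs := hT.shape
  obtain ⟨cols, half⟩ := T
  subst hH
  have hcell : (tableauCells n ⟨cols, some H⟩)[(heights n m).sum + a]? = some (0, x) := by
    have hlen : (colsCells n (2 * n - 4) cols).length = (heights n m).sum := by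
      rw [colsCells_length, hs]
    rw [tableauCells_some, List.getElem?_append_right (by omega), hlen, Nat.add_sub_cancel_left,
      List.getElem?_map, hx]; rfl
  refine ⟨fun h => hg.ground_self hn hcell h, fun h => ?_⟩
  have h1 := wallOf_of_some (L := levelOne n m) hcell (Or.inr h.le)
  obtain ⟨hv, hp, -⟩ := hg.valid _ (List.mem_of_getElem? hcell)
  simp only at hv hp
  have h2 := letterOf_colOf (k := (heights n m).sum + a) hn hp hv (Or.inr h.le)
  refine ⟨h1, fun h3 => ?_, by rw [tableauWall, h1, h2]⟩
  rw [tableauWall, h1] at h3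
  grind [letterOf, ground, Letter.rank_pos, Letter.rank_bar]

theorem IsTableau.isBarred_iff (hT : IsTableau n m T) (hn : 4 ≤ n) (hH : T.half = some H) {j : ℕ} :
    IsBarred n m (tableauWall n (levelOne n m) T) (levelOne n m) j ↔ Letter.bar j ∈ H := by
  obtain ⟨-, h2, h3⟩ := (isTableau_iff (by omega)).1 hT
  have hh := h3.half H hH
  have hs : HasSpin n m := h2.1 (by rw [hH]; rfl)
  have hsign := h3.sign H (by simp [Tableau.allCols, hH]) hh.length_eq
  have hlen := hh.length_eq
  constructor
  · rintro ⟨a, ha, hor⟩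
    obtain ⟨x, hx⟩ : ∃ x, H[a]? = some x := ⟨_, List.getElem?_eq_getElem (by omega)⟩
    obtain ⟨w1, w2⟩ := hT.half_column_wall hn hH hx
    rcases hor with ⟨h, h'⟩ | ⟨rfl, h, hc, hall⟩
    · grind
    -- The first column without added blocks represents a letter of rank exactly `n`: the letter
    -- before it, if any, has larger rank, and `HalfColumn.cellStep` allows no jump over the middle.
    -- The ground colour then decides between `n` and `n̄`.
    · have hr : x.rank j ≤ j := by by_contra hr; exact (w2 (by omega)).2.1 h
      have hr' : j ≤ x.rank j := by
        rcases a with _ | a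
        · exact hh.bottom_rank hx
        · obtain ⟨y, hy⟩ : ∃ y, H[a]? = some y := ⟨_, List.getElem?_eq_getElem (by omega)⟩
          have hry : j < y.rank j := by
            by_contra hr
            exact hall a (by omega) ((hT.half_column_wall hn hH hy).1 (by omega))
          rcases hh.cellStep hy hx with ⟨-, h1, -⟩ | ⟨h1, -⟩ | ⟨-, -, h1⟩ <;> simp only at h1 <;> omega
      have hv := hh.valid _ (List.mem_of_getElem? hx)
      rw [levelOne_color_spin hs hn] at hc
      obtain rfl | rfl : x = .pos j ∨ x = .bar j := by
        cases x <;> simp [Letter.Valid] at * <;> omega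
      · rw [if_pos ((hsign a).1 hx)] at hc; omega
      grind
  · intro hm
    obtain ⟨a, ha, hx⟩ := List.mem_iff_getElem.1 hm
    have hx' := List.getElem?_eq_some_iff.2 ⟨ha, hx⟩
    have hv := hh.valid _ hm
    obtain ⟨w1, w2⟩ := hT.half_column_wall hn hH hx'
    refine ⟨a, by omega, ?_⟩
    by_cases hj : j < n
    · grind [Letter.Valid, Letter.rank_bar]
    · obtain rfl : j = n := by grind [Letter.Valid]
      refine Or.inr ⟨rfl, w1 (by simp only [Letter.rank_bar]; omega), ?_, fun a' ha' => ?_⟩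
      · have := (hsign a).2 hx'
        grind [levelOne_color_spin, Nat.not_even_iff_odd]
      · have hp := List.pairwise_iff_getElem.1 (hh.rank_pairwise hn) a' a (by omega) ha ha'
        rw [hx, Letter.rank_bar] at hp
        exact ((hT.half_column_wall hn hH (List.getElem?_eq_getElem (by omega))).2 (by omega)).2.1

/-- Both lists have strictly decreasing rank and the same members, so they coincide. -/
theorem IsTableau.spinColumn_eq (hT : IsTableau n m T) (hn : 4 ≤ n) (hH : T.half = some H) :
    spinColumn n m (tableauWall n (levelOne n m) T) = H := by
  obtain ⟨-, h2, h3⟩ := (isTableau_iff (by omega)).1 hT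
  have hh := h3.half H hH
  have hr : ∀ {l : List Letter}, l.Pairwise (fun x y => y.rank n < x.rank n) → l.Nodup := fun h =>
    h.imp fun h => by rintro rfl; omega
  have hb : ∀ j, IsBarred n m (tableauWall n (levelOne n m) T) (levelOne n m) j ↔
    Letter.bar j ∈ H := fun j => hT.isBarred_iff hn hH
  have hsort : (spinColumn n m (tableauWall n (levelOne n m) T)).Pairwise
      fun x y => y.rank n < x.rank n := by
    have hlt : (List.range' 1 n).Pairwise (· < ·) := List.pairwise_lt_range'
    simp only [spinColumn, hb, List.pairwise_append, List.pairwise_map, Letter.rank_bar,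
      Letter.rank_pos, List.mem_map, List.mem_filter, List.mem_range'_1, List.mem_reverse,
      decide_eq_true_eq]
    refine ⟨?_, ?_, ?_⟩
    · refine ((hlt.filter _).imp_of_mem fun hx hy h => ?_)
      rw [List.mem_filter, List.mem_range'_1] at hx hy
      omega
    · exact (List.pairwise_reverse.2 hlt).filter _
    grind [Letter.rank_bar, Letter.rank_pos]
  refine List.Perm.eq_of_pairwise (le := fun x y => y.rank n < x.rank n)
    (fun x y _ _ h4 h5 => by omega) hsort (hh.rank_pairwise hn)
    ((List.perm_ext_iff_of_nodup (hr hsort) (hr (hh.rank_pairwise hn))).2 fun x => ?_)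
  simp only [spinColumn, hb, List.mem_append, List.mem_map, List.mem_filter, List.mem_range'_1,
    List.mem_reverse, decide_eq_true_eq]
  constructor
  · rintro (⟨j, ⟨-, h4⟩, rfl⟩ | ⟨j, ⟨h4, h5⟩, rfl⟩)
    · exact h4
    · exact (hh.pos_mem_iff hn (by omega) (by omega)).2 h5
  · intro hx
    have hv := hh.valid x hx
    cases x with
    | pos j =>
      simp only [Letter.Valid] at hv
      exact Or.inr ⟨j, ⟨by omega, (hh.pos_mem_iff hn (by omega) (by omega)).1 hx⟩, rfl⟩
    | bar j =>
      grind [Letter.Valid]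

theorem IsTableau.tableauOf_wall (hT : IsTableau n m T) (hn : 4 ≤ n) :
    tableauOf n m (tableauWall n (levelOne n m) T) = T := by
  obtain ⟨hs, h2, -⟩ := (isTableau_iff (by omega)).1 hT
  have hhalf : (tableauOf n m (tableauWall n (levelOne n m) T)).half = T.half := by
    cases hH : T.half with
    | none =>
      have : ¬ HasSpin n m := fun h => by simpa [hH] using h2.2 h
      simp [tableauOf, this]
    | some H =>
      have : HasSpin n m := h2.1 (by rw [hH]; rfl)
      simp [tableauOf, this, hT.spinColumn_eq hn hH]
  have hcols : (tableauOf n m (tableauWall n (levelOne n m) T)).cols = T.cols := by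
    refine List.ext_getElem (by simp [tableauOf, ← hs]) fun b h3 h4 => ?_
    have hC : T.cols[b]? = some T.cols[b] := List.getElem?_eq_getElem h4
    have hlen : (heights n m)[b]? = some T.cols[b].length := by rw [← hs]; simp [h4]
    simp only [tableauOf, List.getElem_map, List.getElem_range, blockColumn, hlen, Option.getD_some]
    refine List.ext_getElem (by simp) fun a h5 h6 => ?_
    simp only [List.getElem_map, List.getElem_range]
    obtain ⟨R, h7, h8⟩ := hT.cols_getElem? hn hC (List.getElem?_eq_getElem h6)
    obtain ⟨hv, hp, -⟩ := (hT.goodCells hn).valid _ (List.mem_of_getElem? h7)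
    have hA : (T.cols[b][a]).Above0 n R := Or.inl (by omega)
    rw [tableauWall, wallOf_of_some h7 hA, letterOf_colOf hn hp hv hA]
  cases h : tableauOf n m (tableauWall n (levelOne n m) T)
  simp_all

/-! ### The wall of the highest weight tableau -/

theorem exists_split_sum : ∀ {l : List ℕ} {k : ℕ}, k < l.sum →
    ∃ b a h, l[b]? = some h ∧ a < h ∧ k = (l.take b).sum + a
  | [], k, hk => by simp at hk
  | h :: l, k, hk => by
    by_cases hkh : k < h
    · exact ⟨0, k, h, rfl, hkh, by simp⟩
    · rw [List.sum_cons] at hk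
      obtain ⟨b, a, h', h1, h2, h3⟩ := exists_split_sum (l := l) (k := k - h) (by omega)
      exact ⟨b + 1, a, h', h1, h2, by simp; omega⟩

theorem blockStart_succ {b h : ℕ} (hb : (heights n m)[b]? = some h) :
    blockStart n m (b + 1) = blockStart n m b + h := by
  simp [blockStart, List.take_add_one, hb]

theorem blockStart_mono {b c : ℕ} (h : b ≤ c) : blockStart n m b ≤ blockStart n m c := by
  grind [Nat.exists_eq_add_of_le, blockStart]

theorem blockIndex_eq {b a h : ℕ} (hb : (heights n m)[b]? = some h) (ha : a < h) :
    blockIndex n m (blockStart n m b + a) = b := by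
  have hlt := (List.getElem?_eq_some_iff.1 hb).1
  obtain ⟨d, hd⟩ := Nat.exists_eq_add_of_le hlt.le
  rw [blockIndex, hd, List.range_add, List.countP_append, List.countP_eq_length.2,
    List.countP_eq_zero.2]
  · simp
  · intro c hc
    obtain ⟨e, -, rfl⟩ := List.mem_map.1 hc
    have := blockStart_mono (n := n) (m := m) (show b + 1 ≤ b + e + 1 by omega)
    grind [blockStart_succ]
  · intro c hc
    have := blockStart_mono (n := n) (m := m) (show c + 1 ≤ b from List.mem_range.1 hc)
    grind

/-- In the blocks both sides are the columns of the letters of `highCol` over the same base rows. A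
highest weight half-column has no letter of rank greater than `n`, so it leaves only ground columns.
-/
theorem highestWall_eq (hn : 4 ≤ n) :
    highestWall n m = tableauWall n (levelOne n m) (highTableau n m) := by
  classical
  have hT : IsTableau n m (highTableau n m) := highTableau_isTableau (by omega)
  funext k
  by_cases hk : k < (heights n m).sum
  · obtain ⟨b, a, h, hb, ha, rfl⟩ := exists_split_sum hk
    have hh := heights_mem (by omega) (List.mem_of_getElem? hb)
    have hbs := blockStart_succ hb
    have hbi := blockIndex_eq hb ha
    change _ < _ at hk
    obtain ⟨R, h1, h2⟩ := hT.cols_getElem? (b := b) (C := highCol n (IsPlus n m) h) hn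
      (by simp [highTableau, hb]) (highCol_getElem? ha)
    rw [tableauWall, show ((heights n m).take b).sum + a = blockStart n m b + a from rfl,
      wallOf_of_some h1 (Or.inl (by omega))]
    simp only [highestWall]
    rw [if_pos (show blockStart n m b + a < _ from hk), hbi, hbs, show blockStart n m b + h - (blockStart n m b + a) = h - a by omega]
    by_cases hja : h - a = 1
    · rw [if_pos hja, if_neg (by omega), hja, colOf_pos_one hn, h2, Nat.add_sub_cancel]; rfl
    · rw [if_neg hja]
      by_cases hjn : h - a = n
      · rw [if_pos hjn, h2]
        by_cases hp : IsPlus n m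
        · rw [if_pos hp, if_neg (by tauto), hjn, colOf_pos_n]; rfl
        · rw [if_neg hp, if_pos ⟨by omega, by omega, hp⟩, colOf_bar_n hn]; rfl
      grind [colOf_pos]
  · rw [highestWall, if_neg hk]
    obtain ⟨a, rfl⟩ := Nat.exists_eq_add_of_le (Nat.le_of_not_lt hk)
    by_cases hs : HasSpin n m
    · have hH : (highTableau n m).half = some (highCol n (IsPlus n m) n) := by
        simp [highTableau, hs]
      by_cases ha : a < n
      · refine ((hT.half_column_wall hn hH (highCol_getElem? ha)).1 ?_).symm
        grind [Letter.rank_bar, Letter.rank_pos]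
      · refine (wallOf_of_none (List.getElem?_eq_none ?_)).symm
        rw [tableauCells_eq, hH, List.length_append, colsCells_length, hT.shape]
        simp; omega
    · refine (wallOf_of_none (List.getElem?_eq_none ?_)).symm
      rw [tableauCells_eq, hT.half_none hs, List.length_append, colsCells_length, hT.shape]
      simp

end

end

section

section

variable {n i k r : ℕ} {L : Level1} {m : ℕ → ℕ} {T : Tableau} {H C : List Letter} {c : Column}

/-! ### Weights of columns -/

/-- On the classical coroots `δ` vanishes, so `α_0` restricts to `-ε_1 - ε_2`. -/
theorem cartan_zero (hn : 4 ≤ n) (h1 : 1 ≤ i) (hi : i ≤ n) :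
    affineCartan n i 0 = - epsilonCoroot n i 1 - epsilonCoroot n i 2 := by
  grind [affineCartan, epsilonCoroot, IsEdge]

theorem cartan_last (hn : 4 ≤ n) (h1 : 1 ≤ i) (hi : i ≤ n) :
    affineCartan n i n = epsilonCoroot n i (n - 1) + epsilonCoroot n i n := by
  grind [affineCartan, epsilonCoroot, IsEdge]

theorem cartan_of_lt (hn : 4 ≤ n) (h1 : 1 ≤ i) (hi : i ≤ n) {j : ℕ} (hj : 1 ≤ j) (hj' : j < n) :
    affineCartan n i j = epsilonCoroot n i j - epsilonCoroot n i (j + 1) := by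
  grind [affineCartan, epsilonCoroot, IsEdge]

theorem color_le (hn : 4 ≤ n) (s : Side) : color n L k r s ≤ n := by grind [phase_lt, color]

/-- The value on `h_i` of the sum of the simple roots of the blocks of a column. -/
def colWt (n : ℕ) (L : Level1) (k i : ℕ) (c : Column) : ℤ :=
  ∑ j ∈ Finset.range (n + 1), (columnCount n L k j c : ℤ) * affineCartan n i j

theorem sum_ite_mul {c : ℕ} (hc : c ≤ n) (a : ℕ → ℤ) :
    ∑ j ∈ Finset.range (n + 1), (if c = j then 1 else 0) * a j = a c := by simp_all

theorem colWt_half (hn : 4 ≤ n) (s : Side) : colWt n L k i ⟨r, some s⟩ =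
    colWt n L k i ⟨r, none⟩ + affineCartan n i (color n L k r s) := by
  rw [← sum_ite_mul (color_le hn s) (affineCartan n i), colWt, colWt, ← Finset.sum_add_distrib]
  refine Finset.sum_congr rfl fun j _ => ?_
  simp only [columnCount]
  push_cast
  ring

theorem colWt_succ (hn : 4 ≤ n) : colWt n L k i ⟨r + 1, none⟩ = colWt n L k i ⟨r, none⟩ +
    (affineCartan n i (color n L k r .front) +
      if IsHalfRow n L r then affineCartan n i (color n L k r .back) else 0) := by
  rw [← sum_ite_mul (color_le hn .front) (affineCartan n i),
    ← sum_ite_mul (color_le hn .back) (affineCartan n i), colWt, colWt]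
  by_cases h : IsHalfRow n L r
  · rw [if_pos h, ← Finset.sum_add_distrib, ← Finset.sum_add_distrib]
    refine Finset.sum_congr rfl fun j _ => ?_
    simp only [columnCount, Finset.sum_range_succ, rowCount, if_pos h]
    push_cast
    ring
  · rw [if_neg h, add_zero, ← Finset.sum_add_distrib]
    refine Finset.sum_congr rfl fun j _ => ?_
    simp only [columnCount, Finset.sum_range_succ, rowCount, if_neg h]
    push_cast
    ring

/-- The weight of the letter represented by a column with complete rows only, the row above them
having a given phase. -/
def phaseWt (n i q : ℕ) : ℤ :=
  if q = 0 then - epsilonCoroot n i 2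
  else if q ≤ n - 2 then epsilonCoroot n i (q + 1) else - epsilonCoroot n i (2 * n - 2 - q)

theorem letterWt_half (hn : 4 ≤ n) (h1 : 1 ≤ i) (hi : i ≤ n) (h : IsHalfRow n L r) (s : Side) :
    affineCartan n i (color n L k r s) + (letterOf n L k ⟨r, some s⟩).wt n i =
      phaseWt n i (phase n L r) := by
  have c0 := cartan_zero hn h1 hi
  have c1 := cartan_of_lt hn h1 hi (j := 1) le_rfl (by omega)
  have c2 := cartan_of_lt hn h1 hi (j := n - 1) (by omega) (by omega)
  have c3 := cartan_last hn h1 hi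
  rw [show n - 1 + 1 = n by omega] at c2
  rcases h with h | h
  · obtain ⟨t, ht, -⟩ := color_zero hn h k
    grind [letterOf, phaseWt, Letter.wt]
  · obtain ⟨t, ht, -⟩ := color_mid hn h k
    grind [letterOf, phaseWt, le_refl, Letter.wt]

theorem letterWt_succ (hn : 4 ≤ n) (h1 : 1 ≤ i) (hi : i ≤ n) :
    (affineCartan n i (color n L k r .front) +
      if IsHalfRow n L r then affineCartan n i (color n L k r .back) else 0) +
      (letterOf n L k ⟨r + 1, none⟩).wt n i = phaseWt n i (phase n L r) ∧
    (letterOf n L k ⟨r + 1, none⟩).wt n i = phaseWt n i (phase n L (r + 1)) := by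
  have c0 := cartan_zero hn h1 hi
  have c1 := cartan_of_lt hn h1 hi (j := 1) le_rfl (by omega)
  have c2 := cartan_of_lt hn h1 hi (j := n - 1) (by omega) (by omega)
  have c3 := cartan_last hn h1 hi
  rw [show n - 1 + 1 = n by omega] at c2
  have hlt := phase_lt (L := L) (r := r) hn
  rw [phase_add]
  simp only [letterOf, Nat.add_sub_cancel]
  by_cases h0 : phase n L r = 0
  · obtain ⟨t, ht, -⟩ := color_zero hn h0 k
    simp only [IsHalfRow, h0, true_or, if_true, ht, phaseWt, Letter.wt, Nat.zero_add,
      Nat.mod_eq_of_lt (show 1 < 2 * n - 4 by omega), if_pos (show 1 ≤ n - 2 by omega), one_ne_zero,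
      if_false, and_true]
    cases t <;> simp [c0, c1] <;> ring
  by_cases hmid : phase n L r = n - 2
  · obtain ⟨t, ht, -⟩ := color_mid hn hmid k
    simp only [IsHalfRow, hmid, or_true, if_true, ht, phaseWt, Letter.wt, lt_irrefl, le_refl,
      Nat.mod_eq_of_lt (show n - 2 + 1 < 2 * n - 4 by omega), if_neg (show ¬ n - 2 = 0 by omega),
      if_neg (show ¬ n - 2 + 1 ≤ n - 2 by omega), if_false, Nat.succ_ne_zero]
    rw [show 2 * n - 2 - (n - 2 + 1) = n - 1 by omega, show n - 2 + 1 = n - 1 by omega]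
    cases t <;> simp [c2, c3]
  have hh : ¬ IsHalfRow n L r := by unfold IsHalfRow; tauto
  simp only [hh, if_false, h0, hmid, color_unit hn rfl (Nat.pos_of_ne_zero h0) hmid, phaseWt,
    add_zero]
  by_cases hl : phase n L r < n - 2
  · have c := cartan_of_lt hn h1 hi (j := phase n L r + 1) (by omega) (by omega)
    simp only [if_pos hl, Letter.wt, if_pos hl.le, c,
      Nat.mod_eq_of_lt (show phase n L r + 1 < 2 * n - 4 by omega),
      if_pos (show phase n L r + 1 ≤ n - 2 by omega), Nat.succ_ne_zero, if_false]
    simp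
  · have c := cartan_of_lt hn h1 hi (j := 2 * n - 3 - phase n L r) (by omega) (by omega)
    rw [show 2 * n - 3 - phase n L r + 1 = 2 * n - 2 - phase n L r by omega] at c
    simp only [if_neg hl, Letter.wt, if_neg (show ¬ phase n L r ≤ n - 2 by omega), c]
    refine ⟨by ring, ?_⟩
    by_cases hw : phase n L r + 1 = 2 * n - 4
    · grind [Nat.mod_self, phase]
    · rw [Nat.mod_eq_of_lt (by omega), if_neg (by omega), if_neg (by omega)]
      congr 2; omega

/-- A block of colour `c` lowers the weight of the represented letter by `α_c`, so the sum is
unchanged by adding blocks and depends only on the phase of the ground row. -/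
theorem colWt_add_letterWt (hn : 4 ≤ n) (h1 : 1 ≤ i) (hi : i ≤ n)
    (hs : ∀ s, c.half = some s → IsHalfRow n L c.full) (h0 : c.half = none → 1 ≤ c.full) :
    colWt n L k i c + (letterOf n L k c).wt n i = phaseWt n i (phase n L 0) := by
  have base : ∀ r, colWt n L k i ⟨r, none⟩ + phaseWt n i (phase n L r) =
      phaseWt n i (phase n L 0) := by
    intro r
    induction r with
    | zero => simp [colWt, columnCount]
    | succ r ih =>
      obtain ⟨e1, e2⟩ := letterWt_succ (L := L) (k := k) (r := r) hn h1 hi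
      rw [colWt_succ hn, ← ih, ← e1, ← e2]; ring
  obtain ⟨r, _ | s⟩ := c
  · obtain ⟨r, rfl⟩ := Nat.exists_eq_add_of_le' (h0 rfl)
    rw [(letterWt_succ hn h1 hi).2, base]
  grind [colWt_half, add_assoc, letterWt_half]

/-! ### Weights of walls -/

theorem addedBlocks_eq {Y : Wall} {N : ℕ} (hY : ∀ k, N ≤ k → Y k = ground) (j : ℕ) :
    addedBlocks n L Y j = ∑ k ∈ Finset.range N,
      ((columnCount n L k j (Y k) : ℤ) - (columnCount n L k j ground : ℤ)) := by
  have hw : width Y ≤ N := Nat.sInf_le hY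
  have hw' : ∀ k, width Y ≤ k → Y k = ground :=
    Nat.sInf_mem (s := {N | ∀ k, N ≤ k → Y k = ground}) ⟨N, hY⟩
  refine Finset.sum_subset (Finset.range_mono hw) fun k _ hk => ?_
  simp_all

/-- The weight of the letter represented by a column of the ground-state wall. -/
def groundWt (n : ℕ) (L : Level1) (i k : ℕ) : ℤ := (letterOf n L k ground).wt n i

theorem groundWt_succ (hn : 4 ≤ n) : groundWt n L i (k + 1) = - groundWt n L i k := by
  rcases phase_zero (n := n) (L := L) hn with h | h
  · obtain ⟨s, e1, e2⟩ := color_zero hn h k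
    grind [groundWt, letterOf, ground, Letter.wt]
  · obtain ⟨s, e1, e2⟩ := color_mid hn h k
    grind [groundWt, letterOf, ground, Letter.wt]

theorem sum_groundWt (hn : 4 ≤ n) (N : ℕ) :
    2 * ∑ k ∈ Finset.range N, groundWt n L i k = groundWt n L i 0 - groundWt n L i N := by
  induction N with
  | zero => simp
  | succ N ih => rw [Finset.sum_range_succ, mul_add, ih, groundWt_succ hn]; ring

theorem sum_range_of_getElem? {α : Type} {F : α → ℤ} : ∀ {A : List α} {G : ℕ → ℤ},
    (∀ k x, A[k]? = some x → G k = F x) → ∑ k ∈ Finset.range A.length, G k = (A.map F).sum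
  | [], G, _ => by simp
  | x :: A, G, h => by
    rw [List.length_cons, Finset.sum_range_succ', h 0 x rfl,
      sum_range_of_getElem? (A := A) (G := fun k => G (k + 1)) fun k y hy => h (k + 1) y hy]
    simp [add_comm]

/-- By `colWt_add_letterWt`, each column contributes the weight of its letter minus that of the
ground letter. The ground weights alternate in sign, so twice their sum telescopes to the two
boundary terms; the factor `2` avoids halves. -/
theorem wall_wt (hn : 4 ≤ n) (h1 : 1 ≤ i) (hi : i ≤ n) {Y : Wall} (hp : IsProper n L Y)
    {A : List Letter} (hA : ∀ k x, A[k]? = some x → letterOf n L k (Y k) = x)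
    (hY : ∀ k, A.length ≤ k → Y k = ground) :
    2 * (wallCrystal n L).wt Y i = (if L.index n = i then 2 else 0) +
      2 * (A.map (Letter.wt n i)).sum - groundWt n L i 0 + groundWt n L i A.length := by
  have hcol : ∀ {Y : Wall}, IsYoungWall n L Y → ∀ k, colWt n L k i (Y k) +
      (letterOf n L k (Y k)).wt n i = phaseWt n i (phase n L 0) := fun hY k =>
    colWt_add_letterWt hn h1 hi (hY.pattern k) fun h => by
      rcases hY.contains_ground k with h' | ⟨-, h'⟩
      · exact h'
      simp_all
  have hg : ∀ k, colWt n L k i ground + groundWt n L i k = phaseWt n i (phase n L 0) := fun k =>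
    colWt_add_letterWt hn h1 hi (fun s h => phase_zero hn L) (by simp [ground])
  have hsum : ∑ j ∈ Finset.range (n + 1), addedBlocks n L Y j * affineCartan n i j =
      ∑ k ∈ Finset.range A.length, (groundWt n L i k - (letterOf n L k (Y k)).wt n i) := by
    simp only [addedBlocks_eq hY, Finset.sum_mul]
    rw [Finset.sum_comm]
    refine Finset.sum_congr rfl fun k _ => ?_
    have e1 := hcol hp.toIsYoungWall k
    have e2 := hg k
    simp only [sub_mul, Finset.sum_sub_distrib]
    grind [colWt]
  have e3 := sum_groundWt (L := L) (i := i) hn A.length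
  have e4 := sum_range_of_getElem? (A := A) (F := Letter.wt n i)
    (G := fun k => (letterOf n L k (Y k)).wt n i) fun k x hx => by rw [hA k x hx]
  simp only [wallCrystal]
  rw [hsum, Finset.sum_sub_distrib, e4]
  split_ifs <;> linarith

theorem sum_epsilonCoroot (hn : 4 ≤ n) (h1 : 1 ≤ i) (hi : i ≤ n) :
    ∑ a ∈ Finset.range (n - 1), epsilonCoroot n i (1 + a) = if n - 1 ≤ i then 1 else 0 := by
  have key : ∀ c, ∑ a ∈ Finset.range (n - 1), (if 1 + a = c + 1 then (1 : ℤ) else 0) =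
      if c < n - 1 then 1 else 0 := fun c => by
    rw [Finset.sum_congr rfl fun a _ => if_congr (show 1 + a = c + 1 ↔ c = a by omega) rfl rfl,
      Finset.sum_ite_eq]
    simp_all
  by_cases hin : i < n
  · have e : ∀ a, epsilonCoroot n i (1 + a) =
        (if 1 + a = i - 1 + 1 then 1 else 0) - if 1 + a = i + 1 then 1 else 0 := fun a => by
      grind [epsilonCoroot]
    simp only [e, Finset.sum_sub_distrib, key]
    split_ifs <;> omega
  · have e : ∀ a ∈ Finset.range (n - 1), epsilonCoroot n i (1 + a) =
        if 1 + a = n - 2 + 1 then 1 else 0 := fun a ha => by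
      grind [epsilonCoroot]
    rw [Finset.sum_congr rfl e, key]
    split_ifs <;> omega

/-- Here `2Λ = (ε_1 + … + ε_{n-1}) ± ε_n`, and the ground letter `n` or `n̄` of column `0` carries
the last term. -/
theorem index_levelOne_spin (hs : HasSpin n m) (hn : 4 ≤ n) (h1 : 1 ≤ i) (hi : i ≤ n) :
    (if (levelOne n m).index n = i then (2 : ℤ) else 0) =
      (if n - 1 ≤ i then 1 else 0) + groundWt n (levelOne n m) i 0 := by
  have h := phase_levelOne_spin hs hn 0
  rw [Nat.zero_mul] at h
  have hL : levelOne n m = .Ln ∨ levelOne n m = .Lpred := by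
    unfold levelOne; split_ifs <;> simp
  grind [groundWt, letterOf, ground, color, Nat.zero_mod, Level1.index, reduceCtorEq, not_true,
      not_false_iff, not_false_eq_true, Letter.wt, epsilonCoroot]

/-- The ground letter just behind the blocks is `1̄`. For `Λ_0` the total height is even and the two
ground weights agree; for `Λ_1` it is odd and their difference is `2 ε_1`. -/
theorem index_levelOne (hs : ¬ HasSpin n m) (hn : 4 ≤ n) (h1 : 1 ≤ i) (hi : i ≤ n) :
    (if (levelOne n m).index n = i then (2 : ℤ) else 0) =
      groundWt n (levelOne n m) i 0 - groundWt n (levelOne n m) i (heights n m).sum := by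
  have h := phase_levelOne hs 0
  rw [Nat.zero_mod] at h
  have hc := levelOne_color hs hn 0
  obtain ⟨s, e1, -⟩ := color_zero hn h (heights n m).sum
  rw [Nat.add_zero, e1] at hc
  have hs' : s = .front := by cases s <;> simp_all
  have hS : groundWt n (levelOne n m) i (heights n m).sum = - epsilonCoroot n i 1 := by
    simp [groundWt, letterOf, ground, h, e1, hs', Letter.wt]
  rw [hS]
  have hL : levelOne n m = .L0 ∨ levelOne n m = .L1 := by grind [levelOne]
  rcases hL with e | e <;> rw [e] at h ⊢ <;>
    simp only [groundWt, letterOf, ground, h, if_true, color, Nat.zero_mod, Level1.index,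
      reduceCtorEq, ne_eq, not_true, not_false_iff, iff_true, iff_false, not_false_eq_true,
      if_false, Letter.wt, epsilonCoroot, one_ne_zero] <;>
    split_ifs <;> omega

end

end

/-! ### Weights of the walls of tableaux, and the description of `Y(λ)` -/

section

section

variable {n i k : ℕ} {m : ℕ → ℕ} {T : Tableau} {H lo hi : List Letter} {x : Letter}

theorem HalfColumn.perm (h : HalfColumn n H) (hn : 4 ≤ n) :
    H.Perm ((List.range' 1 n).map fun j => if Letter.bar j ∈ H then .bar j else .pos j) := by
  refine (List.perm_ext_iff_of_nodup (h.nodup (by omega))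
    ((List.nodup_range' (s := 1)).map fun a b hab => ?_)).2 fun x => ?_
  · grind
  · simp only [List.mem_map, List.mem_range'_1]
    constructor
    · intro hx
      have hv := h.valid x hx
      cases x with
      | pos j =>
        exact ⟨j, ⟨hv.1, by have := hv.2; omega⟩, if_neg ((h.pos_mem_iff hn hv.1 hv.2).1 hx)⟩
      | bar j => exact ⟨j, ⟨hv.1, by have := hv.2; omega⟩, if_pos hx⟩
    · rintro ⟨j, ⟨h1, h2⟩, rfl⟩
      split_ifs with hj
      · exact hj
      · exact (h.pos_mem_iff hn h1 (by omega)).2 hj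

/-- Reversing the signs of the barred letters below the letter `x` of rank `n` leaves `ε_1 + … +
ε_{n-1}` and the weight of `x`. -/
theorem HalfColumn.sum_wt (h : HalfColumn n (lo ++ x :: hi)) (hn : 4 ≤ n) (h1 : 1 ≤ i) (hi' : i ≤ n)
    (hx : x.rank n = n) : ((lo ++ x :: hi).map (Letter.wt n i)).sum =
      2 * (lo.map (Letter.wt n i)).sum + (if n - 1 ≤ i then 1 else 0) + x.wt n i := by
  -- The weight after the bar is dropped from every letter of rank greater than `n`; its sum does
  -- not depend on which indices are barred.
  let F : Letter → ℤ := fun y => if n < y.rank n then - y.wt n i else y.wt n i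
  have hF : (lo.map F).sum = - (lo.map (Letter.wt n i)).sum ∧ F x = x.wt n i ∧
      (hi.map F).sum = (hi.map (Letter.wt n i)).sum := by
    have hp := h.rank_pairwise hn
    rw [List.pairwise_append, List.pairwise_cons] at hp
    refine ⟨?_, if_neg (by omega), ?_⟩
    · have neg : ∀ l : List Letter, (l.map fun y => - y.wt n i).sum =
          - (l.map (Letter.wt n i)).sum := fun l => by
        induction l with
        | nil => rfl
        | cons a l ih => simp only [List.map_cons, List.sum_cons, ih]; ring
      rw [← neg]
      refine congrArg List.sum (List.map_congr_left fun y hy => if_pos ?_)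
      have := hp.2.2 y hy x (by simp)
      omega
    · congr 1
      refine List.map_congr_left fun y hy => if_neg ?_
      have := hp.2.1.1 y hy
      omega
  have hsum : ((lo ++ x :: hi).map F).sum = (if n - 1 ≤ i then 1 else 0) + x.wt n i := by
    rw [((h.perm hn).map F).sum_eq, List.map_map, show n = n - 1 + 1 by omega, List.range'_concat,
      ← show n = n - 1 + 1 by omega, List.map_append, List.sum_append, ← sum_epsilonCoroot hn h1 hi',
      List.range'_eq_map_range, List.map_map]
    congr 1
    · refine congrArg List.sum (List.map_congr_left fun a ha => ?_)
      rw [List.mem_range] at ha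
      simp only [Function.comp, F]
      split_ifs with h2 h3 h3 <;> simp only [Letter.rank_bar, Letter.rank_pos] at h3 <;>
        first | omega | simp [Letter.wt]
    · rw [show 1 + 1 * (n - 1) = n by omega]
      have hv := h.valid x (by simp)
      obtain rfl | rfl : x = .pos n ∨ x = .bar n := by
        cases x <;> simp [Letter.Valid] at * <;> omega
      · have := (h.pos_mem_iff hn (by omega) le_rfl).1 (by simp)
        simp only [List.map_singleton, List.sum_singleton, Function.comp, if_neg this]
        exact hF.2.1
      · have : Letter.bar n ∈ lo ++ Letter.bar n :: hi := by simp
        simp only [List.map_singleton, List.sum_singleton, Function.comp, if_pos this]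
        exact hF.2.1
  grind

theorem colsCells_map_snd {R : ℕ} (M : List (List Letter)) :
    (colsCells n R M).map Prod.snd = M.flatten := by
  induction M with
  | nil => rfl
  | cons C M ih => simp [colsCells, ih, Function.comp_def]

theorem sum_flatten_wt (M : List (List Letter)) : (M.flatten.map (Letter.wt n i)).sum =
    (M.map fun C => (C.map (Letter.wt n i)).sum).sum := by
  induction M with
  | nil => rfl
  | cons C M ih => simp_all

theorem IsTableau.letterOf_flatten (hT : IsTableau n m T) (hn : 4 ≤ n)
    (hx : T.cols.flatten[k]? = some x) :
    letterOf n (levelOne n m) k (tableauWall n (levelOne n m) T k) = x := by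
  obtain ⟨R, hR⟩ : ∃ R, R = if T.half.isSome then 2 * n - 4 else n - 2 := ⟨_, rfl⟩
  rw [← colsCells_map_snd (n := n) (R := R), List.getElem?_map, Option.map_eq_some_iff] at hx
  obtain ⟨⟨R', y⟩, hc, rfl⟩ := hx
  have hR' : n - 2 ≤ R' := by
    obtain ⟨-, -, -, j, hj⟩ := mem_colsCells (List.mem_of_getElem? hc)
    grind
  have hcell : (tableauCells n T)[k]? = some (R', y) := by
    grind [tableauCells_eq, List.getElem?_append_left, List.getElem?_eq_some_iff]
  obtain ⟨hv, hp, -⟩ := (hT.goodCells hn).valid _ (List.mem_of_getElem? hcell)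
  rw [tableauWall, wallOf_of_some hcell (Or.inl hR'), letterOf_colOf hn hp hv (Or.inl hR')]

theorem IsTableau.wall_wt (hT : IsTableau n m T) (hn : 4 ≤ n) (h1 : 1 ≤ i) (hi : i ≤ n) :
    (wallCrystal n (levelOne n m)).wt (tableauWall n (levelOne n m) T) i =
      (tableauCrystal n).wt T i := by
  obtain ⟨hs, h2, h3⟩ := (isTableau_iff (by omega)).1 hT
  have hg := hT.goodCells hn
  have hfl : T.cols.flatten.length = (heights n m).sum := by simp_all
  have hlet := fun k x => hT.letterOf_flatten (k := k) (x := x) hn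
  have hflat := sum_flatten_wt (n := n) (i := i) T.cols
  have htw : (tableauCrystal n).wt T i = (T.cols.map fun C => (C.map (Letter.wt n i)).sum).sum +
    (T.half.toList.map fun C => (C.map (Letter.wt n i)).sum / 2).sum := rfl
  have hout : ∀ k, (tableauCells n T).length ≤ k → tableauWall n (levelOne n m) T k = ground :=
    fun k hk => wallOf_of_none (List.getElem?_eq_none hk)
  rw [tableauCells_eq, List.length_append, colsCells_length, hs] at hout
  cases hH : T.half with
  | none =>
    have hsp : ¬ HasSpin n m := fun h => by simpa [hH] using h2.2 h
    have := CrystalD.wall_wt hn h1 hi (hg.isProper hn) hlet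
      (fun k hk => hout k (by simp [hH]; omega))
    grind [index_levelOne, Option.toList_none, tableauWall]
  | some H =>
    have hh := h3.half H hH
    have hsp : HasSpin n m := h2.1 (by rw [hH]; rfl)
    obtain ⟨x, hxH, hx⟩ : ∃ x ∈ H, x.rank n = n := by
      have := hh.pos_mem_iff hn (j := n) (by omega) le_rfl
      by_cases h : Letter.bar n ∈ H
      · exact ⟨_, h, by simp only [Letter.rank_bar]; omega⟩
      · exact ⟨_, this.2 h, rfl⟩
    obtain ⟨lo, hi', rfl⟩ := List.append_of_mem hxH
    have hpw := hh.rank_pairwise hn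
    have hlo : ∀ y ∈ lo, n < y.rank n := fun y hy => by
      have := (List.pairwise_append.1 hpw).2.2 y hy x (by simp); omega
    have hhi : ∀ y ∈ hi', y.rank n < n := fun y hy => by
      have := (List.pairwise_cons.1 (List.pairwise_append.1 hpw).2.1).1 y hy; omega
    -- The list stops before the letter `x` of rank `n`: all later columns are ground columns, and
    -- the first of them represents `x`. This supplies the boundary term in `CrystalD.wall_wt`.
    have hA : ∀ k y, (T.cols.flatten ++ lo)[k]? = some y →
        letterOf n (levelOne n m) k (tableauWall n (levelOne n m) T k) = y := fun k y hy => by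
      by_cases hk : k < T.cols.flatten.length
      · rw [List.getElem?_append_left hk] at hy
        exact hlet k y hy
      · rw [List.getElem?_append_right (by omega), hfl] at hy
        obtain ⟨a, rfl⟩ := Nat.exists_eq_add_of_le (show (heights n m).sum ≤ k by omega)
        rw [Nat.add_sub_cancel_left] at hy
        refine ((hT.half_column_wall hn hH (a := a) (x := y) ?_).2
          (hlo y (List.mem_of_getElem? hy))).2.2
        rw [List.getElem?_append_left (List.getElem?_eq_some_iff.1 hy).1, hy]
    have hY : ∀ k, (T.cols.flatten ++ lo).length ≤ k →
        tableauWall n (levelOne n m) T k = ground := fun k hk => by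
      rw [List.length_append, hfl] at hk
      obtain ⟨a, rfl⟩ := Nat.exists_eq_add_of_le (show (heights n m).sum ≤ k by omega)
      by_cases ha : a < (lo ++ x :: hi').length
      · refine (hT.half_column_wall hn hH (List.getElem?_eq_getElem ha)).1 ?_
        have hm : (lo ++ x :: hi')[a] ∈ x :: hi' := by
          rw [List.getElem_append_right (by omega)]; exact List.getElem_mem _
        rcases List.mem_cons.1 hm with h | h
        · rw [h]; omega
        · exact (hhi _ h).le
      · refine hout _ ?_
        simp only [hH, Option.toList_some, List.flatMap_singleton, List.length_map]
        omega
    have hgr : groundWt n (levelOne n m) i (T.cols.flatten ++ lo).length = x.wt n i := by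
      have hcell : (tableauCells n T)[(T.cols.flatten ++ lo).length]? = some (0, x) := by
        rw [tableauCells_eq, List.getElem?_append_right (by
          rw [colsCells_length, hs, List.length_append, hfl]; omega), colsCells_length, hs,
          List.length_append, hfl, Nat.add_sub_cancel_left, hH]
        simp
      have hv := hg.valid _ (List.mem_of_getElem? hcell)
      rw [groundWt, ← hg.anchor _ x hcell hx, letterOf_colOf hn hv.2.1 hv.1 (Or.inr hx.ge)]
    have := CrystalD.wall_wt hn h1 hi (hg.isProper hn) hA hY
    rw [index_levelOne_spin hsp hn h1 hi, hgr, List.map_append, List.sum_append, hflat] at this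
    have hsum := hh.sum_wt hn h1 hi hx
    grind [Option.toList_some, List.map_singleton, tableauWall]

/-! ### The isomorphism -/

/-- The image of `T(λ)` contains `H_λ` and is closed under all operators, since these are carried
along from tableaux, so it contains the connected component. Conversely, a chain of `f̃_i` from the
highest weight tableau becomes a path of reduced proper walls. -/
theorem wallRealization_eq (hn : 4 ≤ n) :
    wallRealization n m = tableauWall n (levelOne n m) '' tableauRealization n m := by
  have hred : ∀ T, IsTableau n m T → IsReduced n (levelOne n m) (tableauWall n (levelOne n m) T) :=
    fun T hT => (hT.goodCells hn).isReduced hn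
  have hhigh : IsTableau n m (highTableau n m) := highTableau_isTableau (by omega)
  ext Y
  constructor
  · rintro ⟨-, hY⟩
    induction hY with
    | refl => exact ⟨_, hhigh, (highestWall_eq hn).symm⟩
    | tail _ hstep ih =>
      obtain ⟨T, hT, rfl⟩ := ih
      obtain ⟨-, i, h1, hi, h | h⟩ := hstep
      · rw [IsTableau.wall_e hT hn h1 hi, Option.map_eq_some_iff] at h
        obtain ⟨T', h, rfl⟩ := h
        exact ⟨T', IsTableau.e_stable hT (by omega) h1 hi h, rfl⟩
      · rw [IsTableau.wall_f hT hn h1 hi, Option.map_eq_some_iff] at h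
        obtain ⟨T', h, rfl⟩ := h
        exact ⟨T', IsTableau.f_stable hT (by omega) h1 hi h, rfl⟩
  · rintro ⟨T, hT, rfl⟩
    refine ⟨highestWall_eq hn ▸ hred _ hhigh, ?_⟩
    rw [highestWall_eq hn]
    refine (IsTableau.reachable (by omega) hT).lift _ fun T₁ T₂ h => ?_
    obtain ⟨hT₁, i, h1, hi, h⟩ := h
    exact ⟨hred _ (IsTableau.f_stable hT₁ (by omega) h1 hi h), i, h1, hi,
      Or.inr (by rw [hT₁.wall_f hn h1 hi, h]; rfl)⟩

end

end

end CrystalD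

/-- For `n ≥ 4` and the dominant integral weight `λ = m 1 • λ_1 + … + m n • λ_n` of `D_n`, the map
`Y ↦ T_Y` is an isomorphism of `U_q(D_n)`-crystals from `Y(λ)` onto `T(λ)`. -/
theorem mainTheorem2 (n : ℕ) (hn : 4 ≤ n) (m : ℕ → ℕ) :
    CrystalD.IsCrystalIso n
      (CrystalD.wallCrystal n (CrystalD.levelOne n m)) (CrystalD.wallRealization n m)
      (CrystalD.tableauCrystal n) (CrystalD.tableauRealization n m)
      (CrystalD.tableauOf n m) := by
  have hst := CrystalD.tableauRealization_isStable (m := m) (show 2 ≤ n by omega)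
  have hinv : ∀ T ∈ CrystalD.tableauRealization n m,
      CrystalD.tableauOf n m (CrystalD.tableauWall n (CrystalD.levelOne n m) T) = T :=
    fun T hT => CrystalD.IsTableau.tableauOf_wall hT hn
  -- Every wall in question is now the wall of some tableau `T` in `T(λ)`, and `hinv` recovers `T`;
  -- each remaining claim is the corresponding property of `tableauWall` read backwards.
  rw [CrystalD.wallRealization_eq hn]
  refine ⟨?_, hst, ⟨?_, ?_, ?_⟩, ?_⟩
  · rintro _ ⟨T, hT, rfl⟩ i h1 hi b' h
    rw [CrystalD.IsTableau.wall_e hT hn h1 hi, CrystalD.IsTableau.wall_f hT hn h1 hi,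
      Option.map_eq_some_iff, Option.map_eq_some_iff] at h
    rcases h with ⟨T', h, rfl⟩ | ⟨T', h, rfl⟩
    · exact ⟨T', hst T hT i h1 hi T' (Or.inl h), rfl⟩
    · exact ⟨T', hst T hT i h1 hi T' (Or.inr h), rfl⟩
  · rintro _ ⟨T, hT, rfl⟩
    rwa [hinv T hT]
  · rintro _ ⟨T, hT, rfl⟩ _ ⟨T', hT', rfl⟩ h
    rw [hinv T hT, hinv T' hT'] at h
    rw [h]
  · exact fun T hT => ⟨_, ⟨T, hT, rfl⟩, hinv T hT⟩
  · rintro _ ⟨T, hT, rfl⟩ i h1 hi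
    rw [hinv T hT]
    obtain ⟨h2, h3⟩ := CrystalD.IsTableau.wall_eps_phi hT hn h1 hi
    refine ⟨(CrystalD.IsTableau.wall_wt hT hn h1 hi).symm, h2.symm, h3.symm, ?_, ?_⟩
    · rw [CrystalD.IsTableau.wall_e hT hn h1 hi]
      cases h : (CrystalD.tableauCrystal n).e i T with
      | none => rfl
      | some T' => simp [hinv T' (hst T hT i h1 hi T' (Or.inl h))]
    · rw [CrystalD.IsTableau.wall_f hT hn h1 hi]
      cases h : (CrystalD.tableauCrystal n).f i T with
      | none => rfl
      | some T' => simp [hinv T' (hst T hT i h1 hi T' (Or.inr h))]
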